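/- Let $\mathcal H$ be a separable infinite-dimensional Hilbert space, let $U(\mathcal H)$ carry the compact-open topology and $PU(\mathcal H)=U(\mathcal H)/U(1)$ the quotient topology. Let $(X,Y)$ be a CW pair and $P\to X$ a principal $PU(\mathcal H)$-bundle. **Twisted vectorial bundles.** For an open set $U$, an object of $\mathcal{HF}(U)$ is a pair $(E,h)$ of a $\mathbb Z_2$-graded Hermitian vector bundle $E\to U$ of finite rank and a Hermitian map $h:E\to E$ of degree $1$. A homomorphism $(E,h)\to(E',h')$ is a class of degree-$0$ maps $\phi$ with $\phi h=h'\phi$, where $\phi\fallingdotseq\phi'$ if every $x\in U$ has a neighbourhood $V$ and a $\mu>0$ such that $\phi=\phi'$ on $\bigoplus_{\lambda<\mu}\ker(h_y^2-\lambda)$ for all $y\in V$. For $f:T\to X$, an $f^*P$-twisted vectorial bundle on $T$ consists of an open cover $\{U_\alpha\}$, sections $s_\alpha$ of $f^*P|_{U_\alpha}$, continuous $g_{\alpha\beta}:U_{\alpha\beta}\to U(\mathcal H)$ with $s_\beta=s_\alpha[g_{\alpha\beta}]$, objects $(E_\alpha,h_\alpha)$ of $\mathcal{HF}(U_\alpha)$,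 and homomorphisms $\phi_{\alpha\beta}:(E_\beta,h_\beta)\to(E_\alpha,h_\alpha)$ on $U_{\alpha\beta}$, such that the classes $\Phi_{\alpha\beta}=[(g_{\alpha\beta},\phi_{\alpha\beta})]$, taken modulo $(g,\phi)\sim(g\zeta,\phi\zeta)$ for continuous $U(1)$-valued $\zeta$, satisfy $\Phi_{\alpha\beta}\Phi_{\beta\alpha}=1$ and $\Phi_{\alpha\beta}\Phi_{\beta\gamma}=\Phi_{\alpha\gamma}$. Isomorphisms are the invertible families $\Psi_{\alpha\alpha'}=[(k_{\alpha\alpha'},\psi_{\alpha\alpha'})]$ of such classes compatible with the transition maps. The support is the closure of the set of points where some $h_\alpha$ is not invertible. **The groups.** For $S\subset T$, let $KF_{f^*P}(T,S)$ be the set of homotopy classes of $f^*P$-twisted vectorial bundles on $T$ whose support is disjoint from $S$, homotopies being objects over $(T\times I,S\times I)$, $I=[0,1]$, whose restrictions to the two ends are isomorphic to the given objects. Pull-back makes it functorial for maps of pairs over $X$. Put $$KF_P^{-n}(X,Y)=KF_{P\times I^n}(X\times I^n,\;Y\times I^n\cup X\times\partial I^n),\qquad KF_P^{-n}(X)=KF_P^{-n}(X,\emptyset),\qquad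 n\ge 0 .$$ **Proposition.** The direct sum of twisted vectorial bundles (formed on representatives with the same cover, sections and lifts) makes each $KF_{f^*P}(T,S)$ an abelian group, and pull-backs are homomorphisms. For every $n\ge 0$: (a) the sequence $KF_P^{-n}(X,Y)\to KF_P^{-n}(X)\to KF_{P|_Y}^{-n}(Y)$, with maps induced by the inclusions $(X,\emptyset)\to(X,Y)$ and $Y\to X$, is exact. Moreover, let $\mathcal X=X\times I^n\times\{0\}\cup(Y\times I^n\cup X\times\partial I^n)\times I$, $\;\mathcal R=Y\times I^n\times\{1\}\cup X\times\partial I^n\times I$ and $\mathcal R'=X\times I^n\times\{0\}\cup\mathcal R$, all groups on $\mathcal X$ being twisted by the pull-back of $P$. Then the maps $$e: KF(\mathcal X,\mathcal R')\to KF_{P|_Y}^{-n-1}(Y),\qquad p^*: KF_P^{-n}(X,Y)\to KF(\mathcal X,\mathcal R),$$ induced by the inclusion $Y\times I^{n+1}\to\mathcal X$ and by the projection $\mathcal X\to X\times I^n$, are isomorphisms. Let $$\delta_{-n-1}=(p^*)^{-1}\circ i^*\circ e^{-1}: KF_{P|_Y}^{-n-1}(Y)\to KF_P^{-n}(X,Y),$$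 where $i^*:KF(\mathcal X,\mathcal R')\to KF(\mathcal X,\mathcal R)$ is induced by the inclusion of pairs. Then $\delta_{-n-1}$ is a homomorphism and the following sequences are exact: (b) $KF_{P|_Y}^{-n-1}(Y)\xrightarrow{\ \delta_{-n-1}\ }KF_P^{-n}(X,Y)\to KF_P^{-n}(X)$; (c) $KF_P^{-n-1}(X)\to KF_{P|_Y}^{-n-1}(Y)\xrightarrow{\ \delta_{-n-1}\ }KF_P^{-n}(X,Y)$. -/

import Mathlib

open Set Filter Topology

universe u v w

noncomputable section

namespace TwistedKF

/-! ### The groups `U(H)` and `PU(H)` -/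

section Groups

variable (H : Type w) [NormedAddCommGroup H] [InnerProductSpace ℂ H]

/-- `H` has infinite dimension. -/
class InfiniteDimensional : Prop where
  not_finiteDimensional : ¬ FiniteDimensional ℂ H

theorem InfiniteDimensional.nontrivial [InfiniteDimensional H] : Nontrivial H := by
  by_contra h
  rw [not_nontrivial_iff_subsingleton] at h
  exact InfiniteDimensional.not_finiteDimensional (H := H) inferInstance

/-- The unitary group `U(H)`. -/
def UGroup : Type w := H ≃ₗᵢ[ℂ] H

instance : Group (UGroup H) := inferInstanceAs (Group (H ≃ₗᵢ[ℂ] H))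

variable {H} in
/-- A unitary operator as a continuous map `H → H`. -/
def UGroup.toMap (u : UGroup H) : C(H, H) :=
  ⟨fun ξ => (show H ≃ₗᵢ[ℂ] H from u) ξ, (show H ≃ₗᵢ[ℂ] H from u).continuous⟩

/-- `U(H)` carries the compact-open topology. -/
instance : TopologicalSpace (UGroup H) :=
  TopologicalSpace.induced UGroup.toMap inferInstance

/-- The scalar operators `U(1) ⊆ U(H)`. -/
def scalars : Subgroup (UGroup H) where
  carrier := {u | ∃ z : Circle, ∀ ξ, u.toMap ξ = (z : ℂ) • ξ}
  one_mem' := ⟨1, fun ξ => by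
    rw [Circle.coe_one, one_smul]; rfl⟩
  mul_mem' := by
    rintro a b ⟨z, hz⟩ ⟨z', hz'⟩
    refine ⟨z * z', fun ξ => ?_⟩
    have : (a * b).toMap ξ = a.toMap (b.toMap ξ) := rfl
    rw [this, hz', hz, smul_smul, Circle.coe_mul]
  inv_mem' := by
    rintro a ⟨z, hz⟩
    refine ⟨z⁻¹, fun ξ => ?_⟩
    have h1 : a⁻¹.toMap (a.toMap (((z⁻¹ : Circle) : ℂ) • ξ)) = ((z⁻¹ : Circle) : ℂ) • ξ :=
      (show H ≃ₗᵢ[ℂ] H from a).symm_apply_apply _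
    rw [hz, smul_smul, ← Circle.coe_mul, mul_inv_cancel, Circle.coe_one, one_smul] at h1
    exact h1

instance : (scalars H).Normal where
  conj_mem := by
    rintro a ⟨z, hz⟩ g
    refine ⟨z, fun ξ => ?_⟩
    have : (g * a * g⁻¹).toMap ξ = g.toMap (a.toMap (g⁻¹.toMap ξ)) := rfl
    rw [this, hz]
    have h2 : g.toMap ((z : ℂ) • g⁻¹.toMap ξ) = (z : ℂ) • g.toMap (g⁻¹.toMap ξ) :=
      (show H ≃ₗᵢ[ℂ] H from g).map_smul _ _
    rw [h2]
    congr 1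
    exact (show H ≃ₗᵢ[ℂ] H from g).apply_symm_apply _

/-- `PU(H) = U(H)/U(1)`, with the quotient topology. -/
abbrev PUGroup : Type w := UGroup H ⧸ scalars H

end Groups

/-- `π : P → X` is a principal `G`-bundle; the right action of `G` on `P` is written as an action
of the opposite group, so that `p · g` is `MulOpposite.op g • p`. -/
structure IsPrincipalBundle (G : Type w) [Group G] [TopologicalSpace G] {X : Type u}
    [TopologicalSpace X] {P : Type v} [TopologicalSpace P] [MulAction Gᵐᵒᵖ P] (π : P → X) :
    Prop where
  continuous_proj : Continuous π
  continuous_act : Continuous fun q : P × G => MulOpposite.op q.2 • q.1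
  proj_act : ∀ (p : P) (g : G), π (MulOpposite.op g • p) = π p
  locally_trivial : ∀ x : X, ∃ V : Set X, IsOpen V ∧ x ∈ V ∧ ∃ e : (V × G) ≃ₜ (π ⁻¹' V),
    (∀ q, π (e q).1 = q.1) ∧
      ∀ (y : V) (g g' : G), (e (y, g * g')).1 = MulOpposite.op g' • (e (y, g)).1

/-! ### Hermitian vector bundles and the category `HF` -/

section HF

variable {T : Type u} [TopologicalSpace T]

/-- A Hermitian vector bundle of finite rank over the open subset `U` of `T`, given by its fibres
and an atlas of local orthonormal frames `(frame j κ)_{κ : K j}` over open sets `base j` covering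
`U`, with continuous transition matrices.  The rank may vary from one component to another.
(`fiber x` and the frames have no meaning at points outside `U`.) -/
structure HermBundle (U : Set T) where
  fiber : T → Type
  [instNormed : ∀ x, NormedAddCommGroup (fiber x)]
  [instInner : ∀ x, InnerProductSpace ℂ (fiber x)]
  J : Type u
  K : J → Type
  [instFintype : ∀ j, Fintype (K j)]
  base : J → Set T
  isOpen_base : ∀ j, IsOpen (base j)
  iUnion_base : ⋃ j, base j = U
  frame : ∀ j, K j → ∀ x, fiber x
  orthonormal : ∀ j, ∀ x ∈ base j, Orthonormal ℂ fun κ => frame j κ x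
  span : ∀ j, ∀ x ∈ base j, Submodule.span ℂ (range fun κ => frame j κ x) = ⊤
  transition : ∀ i j κ κ',
    ContinuousOn (fun x => inner ℂ (frame i κ x) (frame j κ' x)) (base i ∩ base j)

attribute [instance] HermBundle.instNormed HermBundle.instInner HermBundle.instFintype

/-- A fibrewise linear map is continuous over `V`: its matrix entries with respect to the local
frames are continuous functions. -/
def HermBundle.ContOn {U U' : Set T} (E : HermBundle U) (E' : HermBundle U') (V : Set T)
    (φ : ∀ x, E.fiber x →ₗ[ℂ] E'.fiber x) : Prop :=
  ∀ i κ j κ', ContinuousOn (fun x => inner ℂ (E'.frame j κ' x) (φ x (E.frame i κ x)))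
    (V ∩ E.base i ∩ E'.base j)

/-- An object `(E, h)` of `HF(U)`.  The `ℤ/2`-grading `E = E⁰ ⊕ E¹` is given by the orthogonal
involution `gr`, equal to `1` on `E⁰` and to `-1` on `E¹`; so a map has degree `0` when it commutes
with the involutions and degree `1` when it anticommutes with them. -/
structure HFObj (U : Set T) extends HermBundle U where
  gr : ∀ x, fiber x →ₗ[ℂ] fiber x
  gr_cont : toHermBundle.ContOn toHermBundle U gr
  gr_gr : ∀ x ∈ U, ∀ ξ, gr x (gr x ξ) = ξ
  gr_symm : ∀ x ∈ U, ∀ ξ η, inner ℂ (gr x ξ) η = inner ℂ ξ (gr x η)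
  h : ∀ x, fiber x →ₗ[ℂ] fiber x
  h_cont : toHermBundle.ContOn toHermBundle U h
  h_symm : ∀ x ∈ U, ∀ ξ η, inner ℂ (h x ξ) η = inner ℂ ξ (h x η)
  h_odd : ∀ x ∈ U, ∀ ξ, h x (gr x ξ) = - gr x (h x ξ)

/-- `(E, h)_{< μ}`: the sum of the eigenspaces of `h²` with eigenvalue `< μ`. -/
def lowSpace {E : Type} [NormedAddCommGroup E] [InnerProductSpace ℂ E] (h : E →ₗ[ℂ] E) (μ : ℝ) :
    Submodule ℂ E :=
  ⨆ (l : ℝ) (_ : l < μ), LinearMap.ker (h ∘ₗ h - (l : ℂ) • LinearMap.id)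

variable {U U' : Set T}

/-- `φ : (E, h) → (E', h')` is, over `V`, a continuous map of degree `0` with `φ h = h' φ`. -/
structure HFObj.IsHom (A : HFObj U) (B : HFObj U') (V : Set T)
    (φ : ∀ x, A.fiber x →ₗ[ℂ] B.fiber x) : Prop where
  cont : A.ContOn B.toHermBundle V φ
  even : ∀ x ∈ V, ∀ ξ, φ x (A.gr x ξ) = B.gr x (φ x ξ)
  comm : ∀ x ∈ V, ∀ ξ, φ x (A.h x ξ) = B.h x (φ x ξ)

/-- The relation `φ ≑ φ'` over `V`. -/
def HFObj.Eqv (A : HFObj U) (B : HFObj U') (V : Set T)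
    (φ φ' : ∀ x, A.fiber x →ₗ[ℂ] B.fiber x) : Prop :=
  ∀ x ∈ V, ∃ μ : ℝ, 0 < μ ∧ ∀ᶠ y in 𝓝[V] x, ∀ ξ ∈ lowSpace (A.h y) μ, φ y ξ = φ' y ξ

end HF

/-! ### Twisted vectorial bundles -/

section Twisted

variable (H : Type w) [NormedAddCommGroup H] [InnerProductSpace ℂ H]
variable {X : Type u} [TopologicalSpace X] {P : Type v} [TopologicalSpace P]
  [MulAction (PUGroup H)ᵐᵒᵖ P]

/-- The twisting part `(U_α, s_α, g_{αβ})` of an `f^*P`-twisted vectorial bundle over a space `T`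
with a map `f : T → X`: an open cover, local sections `s_α` of `f^*P`, written as continuous maps
`s_α : U_α → P` with `π ∘ s_α = f`, and continuous lifts `g_{αβ} : U_α ∩ U_β → U(H)` of the
transition functions, `s_β = s_α · [g_{αβ}]`. -/
structure Twist (π : P → X) {T : Type u} [TopologicalSpace T] (f : C(T, X)) where
  ι : Type u
  U : ι → Set T
  isOpen_U : ∀ a, IsOpen (U a)
  iUnion_U : ⋃ a, U a = univ
  s : ι → T → P
  s_cont : ∀ a, ContinuousOn (s a) (U a)
  proj_s : ∀ a, ∀ t ∈ U a, π (s a t) = f t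
  g : ι → ι → T → UGroup H
  g_cont : ∀ a b, ContinuousOn (g a b) (U a ∩ U b)
  g_lift : ∀ a b, ∀ t ∈ U a ∩ U b, MulOpposite.op (g a b t : PUGroup H) • s a t = s b t

variable {H}

section Pairs

variable {T : Type u} [TopologicalSpace T]

/-- Equality in `HF_P(V)` of the classes of the pairs `(g, φ)` and `(g', φ')`: there is a continuous
`ζ : V → U(1)` with `g' = g ζ` and `φ' ≑ φ ζ`. -/
def PairEqv {U U' : Set T} (A : HFObj U) (B : HFObj U') (V : Set T)
    (g : T → UGroup H) (φ : ∀ x, A.fiber x →ₗ[ℂ] B.fiber x)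
    (g' : T → UGroup H) (φ' : ∀ x, A.fiber x →ₗ[ℂ] B.fiber x) : Prop :=
  ∃ ζ : T → Circle, ContinuousOn ζ V ∧
    (∀ x ∈ V, ∀ ξ : H, (g' x).toMap ξ = (ζ x : ℂ) • (g x).toMap ξ) ∧
    A.Eqv B V φ' fun x => (ζ x : ℂ) • φ x

end Pairs

/-- The vectorial part `((E_α, h_α), φ_{αβ})` of a twisted vectorial bundle with twisting part `τ`.
The maps `Φ_{αβ}` of `HF_P(U_{αβ})` are the classes of the pairs `(g_{αβ}, φ_{αβ})`. -/
structure Vectorial {π : P → X} {T : Type u} [TopologicalSpace T] {f : C(T, X)}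
    (τ : Twist H π f) where
  E : ∀ a, HFObj (τ.U a)
  φ : ∀ a b x, (E b).fiber x →ₗ[ℂ] (E a).fiber x
  φ_hom : ∀ a b, (E b).IsHom (E a) (τ.U a ∩ τ.U b) (φ a b)
  φ_inv : ∀ a b, PairEqv (E a) (E a) (τ.U a ∩ τ.U b)
    (fun x => τ.g a b x * τ.g b a x) (fun x => φ a b x ∘ₗ φ b a x) 1 (fun _ => LinearMap.id)
  φ_comp : ∀ a b c, PairEqv (E c) (E a) (τ.U a ∩ τ.U b ∩ τ.U c)
    (fun x => τ.g a b x * τ.g b c x) (fun x => φ a b x ∘ₗ φ b c x) (τ.g a c) (φ a c)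

variable (H) in
/-- An object of `KF_{f^*P}(T)`: a vectorial bundle over `T` twisted by `f^*P`. -/
structure TVB (π : P → X) {T : Type u} [TopologicalSpace T] (f : C(T, X)) where
  twist : Twist H π f
  vect : Vectorial twist

section Constructions

variable {π : P → X} {T T' : Type u} [TopologicalSpace T] [TopologicalSpace T']
  {f : C(T, X)} {f' : C(T', X)}

/-- The support: the closure of the set of points where some `h_α` is not invertible. -/
def Vectorial.supp {τ : Twist H π f} (A : Vectorial τ) : Set T :=
  closure {t | ∃ a, t ∈ τ.U a ∧ ¬ Function.Bijective ((A.E a).h t)}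

/-- The support of a twisted vectorial bundle. -/
def TVB.supp (A : TVB H π f) : Set T := A.vect.supp

/-- A morphism `A → B` of twisted vectorial bundles: maps
`Ψ_{αα'} = [(k_{αα'}, ψ_{αα'})] : A_{α'} → B_α` in `HF_P(U_α ∩ U'_{α'})`, compatible with the
transition maps of `A` and of `B`. -/
structure TVB.IsMorphism (A B : TVB H π f)
    (k : B.twist.ι → A.twist.ι → T → UGroup H)
    (ψ : ∀ b a x, ((A.vect.E a).fiber x) →ₗ[ℂ] ((B.vect.E b).fiber x)) : Prop where
  k_cont : ∀ b a, ContinuousOn (k b a) (B.twist.U b ∩ A.twist.U a)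
  k_lift : ∀ b a, ∀ t ∈ B.twist.U b ∩ A.twist.U a,
    MulOpposite.op (k b a t : PUGroup H) • B.twist.s b t = A.twist.s a t
  ψ_hom : ∀ b a, (A.vect.E a).IsHom (B.vect.E b) (B.twist.U b ∩ A.twist.U a) (ψ b a)
  comp_source : ∀ b a a', PairEqv (A.vect.E a') (B.vect.E b)
    (B.twist.U b ∩ A.twist.U a ∩ A.twist.U a')
    (fun x => k b a x * A.twist.g a a' x) (fun x => ψ b a x ∘ₗ A.vect.φ a a' x)
    (k b a') (ψ b a')
  comp_target : ∀ b b' a, PairEqv (A.vect.E a) (B.vect.E b)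
    (B.twist.U b ∩ B.twist.U b' ∩ A.twist.U a)
    (fun x => B.twist.g b b' x * k b' a x) (fun x => B.vect.φ b b' x ∘ₗ ψ b' a x)
    (k b a) (ψ b a)

/-- `(k', ψ')` after `(k, ψ)` is the identity morphism `(Φ_{αβ})` of `A`. -/
def TVB.IsLeftInverse (A B : TVB H π f)
    (k : B.twist.ι → A.twist.ι → T → UGroup H)
    (ψ : ∀ b a x, ((A.vect.E a).fiber x) →ₗ[ℂ] ((B.vect.E b).fiber x))
    (k' : A.twist.ι → B.twist.ι → T → UGroup H)
    (ψ' : ∀ a b x, ((B.vect.E b).fiber x) →ₗ[ℂ] ((A.vect.E a).fiber x)) : Prop :=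
  ∀ a b a', PairEqv (A.vect.E a') (A.vect.E a)
    (A.twist.U a ∩ B.twist.U b ∩ A.twist.U a')
    (fun x => k' a b x * k b a' x) (fun x => ψ' a b x ∘ₗ ψ b a' x)
    (A.twist.g a a') (A.vect.φ a a')

/-- Isomorphism of twisted vectorial bundles. -/
def TVB.Iso (A B : TVB H π f) : Prop :=
  ∃ k ψ k' ψ', A.IsMorphism B k ψ ∧ B.IsMorphism A k' ψ' ∧
    A.IsLeftInverse B k ψ k' ψ' ∧ B.IsLeftInverse A k' ψ' k ψ

/-! #### Pull-backs -/

/-- Pull-back of a Hermitian vector bundle. -/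
def HermBundle.pull (q : C(T', T)) {U : Set T} (E : HermBundle U) : HermBundle (q ⁻¹' U) where
  fiber t := E.fiber (q t)
  J := E.J
  K := E.K
  base j := q ⁻¹' E.base j
  isOpen_base j := (E.isOpen_base _).preimage q.continuous
  iUnion_base := by
    rw [← preimage_iUnion, E.iUnion_base]
  frame j κ t := E.frame j κ (q t)
  orthonormal j t ht := E.orthonormal j (q t) ht
  span j t ht := E.span j (q t) ht
  transition i j κ κ' :=
    (E.transition i j κ κ').comp q.continuous.continuousOn fun _ ht => ht

theorem HermBundle.ContOn.pull (q : C(T', T)) {U U' V : Set T} {E : HermBundle U}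
    {E' : HermBundle U'} {φ : ∀ x, E.fiber x →ₗ[ℂ] E'.fiber x} (hφ : E.ContOn E' V φ) :
    (E.pull q).ContOn (E'.pull q) (q ⁻¹' V) fun t => φ (q t) := by
  intro i κ j κ'
  exact (hφ i κ j κ').comp q.continuous.continuousOn fun _ ht => ht

/-- Pull-back of an object of `HF`. -/
def HFObj.pull (q : C(T', T)) {U : Set T} (A : HFObj U) : HFObj (q ⁻¹' U) where
  toHermBundle := A.toHermBundle.pull q
  gr t := A.gr (q t)
  gr_cont := A.gr_cont.pull q
  gr_gr t ht := A.gr_gr (q t) ht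
  gr_symm t ht := A.gr_symm (q t) ht
  h t := A.h (q t)
  h_cont := A.h_cont.pull q
  h_symm t ht := A.h_symm (q t) ht
  h_odd t ht := A.h_odd (q t) ht

theorem HFObj.IsHom.pull (q : C(T', T)) {U U' V : Set T} {A : HFObj U} {B : HFObj U'}
    {φ : ∀ x, A.fiber x →ₗ[ℂ] B.fiber x} (hφ : A.IsHom B V φ) :
    (A.pull q).IsHom (B.pull q) (q ⁻¹' V) fun t => φ (q t) where
  cont := hφ.cont.pull q
  even t ht := hφ.even (q t) ht
  comm t ht := hφ.comm (q t) ht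

theorem HFObj.Eqv.pull (q : C(T', T)) {U U' V : Set T} {A : HFObj U} {B : HFObj U'}
    {φ φ' : ∀ x, A.fiber x →ₗ[ℂ] B.fiber x} (hφ : A.Eqv B V φ φ') :
    (A.pull q).Eqv (B.pull q) (q ⁻¹' V) (fun t => φ (q t)) fun t => φ' (q t) := by
  intro t ht
  obtain ⟨μ, hμ, h⟩ := hφ (q t) ht
  exact ⟨μ, hμ, (q.continuous.continuousWithinAt.tendsto_nhdsWithin fun _ hx => hx).eventually h⟩

theorem PairEqv.pull (q : C(T', T)) {U U' V : Set T} {A : HFObj U} {B : HFObj U'}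
    {g g' : T → UGroup H} {φ φ' : ∀ x, A.fiber x →ₗ[ℂ] B.fiber x}
    (hφ : PairEqv A B V g φ g' φ') :
    PairEqv (A.pull q) (B.pull q) (q ⁻¹' V) (fun t => g (q t)) (fun t => φ (q t))
      (fun t => g' (q t)) fun t => φ' (q t) := by
  obtain ⟨ζ, hc, hg, he⟩ := hφ
  exact ⟨fun t => ζ (q t), hc.comp q.continuous.continuousOn fun _ ht => ht,
    fun t ht => hg (q t) ht, he.pull q⟩

/-- Pull-back of the twisting part along `q : T' → T` over `X`. -/
def Twist.pull (q : C(T', T)) (hq : ∀ t, f' t = f (q t)) (τ : Twist H π f) :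
    Twist H π f' where
  ι := τ.ι
  U a := q ⁻¹' τ.U a
  isOpen_U a := (τ.isOpen_U a).preimage q.continuous
  iUnion_U := by rw [← preimage_iUnion, τ.iUnion_U, preimage_univ]
  s a t := τ.s a (q t)
  s_cont a := (τ.s_cont a).comp q.continuous.continuousOn fun _ ht => ht
  proj_s a t ht := (τ.proj_s a (q t) ht).trans (hq t).symm
  g a b t := τ.g a b (q t)
  g_cont a b := (τ.g_cont a b).comp q.continuous.continuousOn fun _ ht => ht
  g_lift a b t ht := τ.g_lift a b (q t) ht

/-- Pull-back of the vectorial part. -/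
def Vectorial.pull (q : C(T', T)) (hq : ∀ t, f' t = f (q t)) {τ : Twist H π f}
    (A : Vectorial τ) : Vectorial (τ.pull q hq) where
  E a := (A.E a).pull q
  φ a b t := A.φ a b (q t)
  φ_hom a b := (A.φ_hom a b).pull q
  φ_inv a b := (A.φ_inv a b).pull q
  φ_comp a b c := (A.φ_comp a b c).pull q

/-- Pull-back of twisted vectorial bundles along `q : T' → T` over `X`. -/
def TVB.pull (q : C(T', T)) (hq : ∀ t, f' t = f (q t)) (A : TVB H π f) : TVB H π f' where
  twist := A.twist.pull q hq
  vect := A.vect.pull q hq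

theorem TVB.supp_pull (q : C(T', T)) (hq : ∀ t, f' t = f (q t)) (A : TVB H π f) :
    (A.pull q hq).supp ⊆ q ⁻¹' A.supp :=
  closure_minimal (fun _ ht => subset_closure ht) (isClosed_closure.preimage q.continuous)

theorem TVB.Iso.pull (q : C(T', T)) (hq : ∀ t, f' t = f (q t)) {A B : TVB H π f}
    (h : A.Iso B) : (A.pull q hq).Iso (B.pull q hq) := by
  have key : ∀ {A B : TVB H π f} {k : B.twist.ι → A.twist.ι → T → UGroup H}
      {ψ : ∀ b a x, ((A.vect.E a).fiber x) →ₗ[ℂ] ((B.vect.E b).fiber x)},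
      A.IsMorphism B k ψ → (A.pull q hq).IsMorphism (B.pull q hq)
        (fun b a t => k b a (q t)) (fun b a t => ψ b a (q t)) := by
    intro A B k ψ h
    exact
      { k_cont := fun b a => (h.k_cont b a).comp q.continuous.continuousOn fun _ ht => ht
        k_lift := fun b a t ht => h.k_lift b a (q t) ht
        ψ_hom := fun b a => (h.ψ_hom b a).pull q
        comp_source := fun b a a' => (h.comp_source b a a').pull q
        comp_target := fun b b' a => (h.comp_target b b' a).pull q }
  obtain ⟨k, ψ, k', ψ', h1, h2, h3, h4⟩ := h
  exact ⟨_, _, _, _, key h1, key h2, fun a b a' => (h3 a b a').pull q,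
    fun a b a' => (h4 a b a').pull q⟩

end Constructions

/-! ### The groups `KF` -/

section KF

variable {π : P → X} {T T' : Type u} [TopologicalSpace T] [TopologicalSpace T']
  {f : C(T, X)} {f' : C(T', X)}

variable (H π f) in
/-- The objects of `KF_{f^*P}(T, S)`: those whose support does not meet `S`. -/
def RelTVB (S : Set T) : Type _ := {A : TVB H π f // Disjoint A.supp S}

/-- Pull-back of relative objects along a map of pairs over `X`. -/
def RelTVB.pull (q : C(T', T)) (hq : ∀ t, f' t = f (q t)) {S : Set T} {S' : Set T'}
    (hS : MapsTo q S' S) (A : RelTVB H π f S) : RelTVB H π f' S' :=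
  ⟨A.1.pull q hq, disjoint_left.2 fun _ ht hts =>
    disjoint_left.1 A.2 (TVB.supp_pull q hq A.1 ht) (hS hts)⟩

/-- The inclusion `T → T × I` at the time `i`. -/
def slice (T : Type u) [TopologicalSpace T] (i : unitInterval) : C(T, T × unitInterval) :=
  ⟨fun t => (t, i), by fun_prop⟩

/-- `A₀` and `A₁` are joined by an object over `(T × I, S × I)`. -/
def RelTVB.Homotopic {S : Set T} (A₀ A₁ : RelTVB H π f S) : Prop :=
  ∃ B : RelTVB H π (f.comp ContinuousMap.fst : C(T × unitInterval, X)) (S ×ˢ univ),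
    (B.1.pull (f' := f) (slice T 0) fun _ => rfl).Iso A₀.1 ∧
    (B.1.pull (f' := f) (slice T 1) fun _ => rfl).Iso A₁.1

variable (H π f) in
/-- `KF_{f^*P}(T, S)`: the homotopy classes of objects (the quotient by the equivalence relation
generated by homotopy). -/
def KF (S : Set T) : Type _ := Quot (RelTVB.Homotopic (H := H) (π := π) (f := f) (S := S))

/-- The homotopy class of an object. -/
def KF.mk {S : Set T} (A : RelTVB H π f S) : KF H π f S := Quot.mk _ A

/-- The map `q^* : KF_{f^*P}(T, S) → KF_{f'^*P}(T', S')` induced by a map of pairs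
`q : (T', S') → (T, S)` over `X`. -/
def KF.pull (q : C(T', T)) (hq : ∀ t, f' t = f (q t)) {S : Set T} {S' : Set T'}
    (hS : MapsTo q S' S) : KF H π f S → KF H π f' S' :=
  Quot.map (RelTVB.pull q hq hS) (by
    rintro A₀ A₁ ⟨B, h0, h1⟩
    refine ⟨RelTVB.pull (f := f.comp ContinuousMap.fst) (f' := f'.comp ContinuousMap.fst)
      (S := S ×ˢ univ) (S' := S' ×ˢ univ) (q.prodMap (ContinuousMap.id unitInterval)) (fun t => hq t.1)
      (fun t ht => ⟨hS ht.1, trivial⟩) B, ?_, ?_⟩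
    · exact h0.pull q hq
    · exact h1.pull q hq)

/-! #### Direct sums -/

/-- The direct sum of two linear maps between orthogonal direct sums. -/
def sumMap {E E' F F' : Type} [NormedAddCommGroup E] [InnerProductSpace ℂ E]
    [NormedAddCommGroup E'] [InnerProductSpace ℂ E'] [NormedAddCommGroup F]
    [InnerProductSpace ℂ F] [NormedAddCommGroup F'] [InnerProductSpace ℂ F']
    (φ : E →ₗ[ℂ] F) (φ' : E' →ₗ[ℂ] F') : WithLp 2 (E × E') →ₗ[ℂ] WithLp 2 (F × F') :=
  (WithLp.linearEquiv 2 ℂ (F × F')).symm.toLinearMap ∘ₗ (φ.prodMap φ') ∘ₗ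
    (WithLp.linearEquiv 2 ℂ (E × E')).toLinearMap

theorem sumMap_apply {E E' F F' : Type} [NormedAddCommGroup E] [InnerProductSpace ℂ E]
    [NormedAddCommGroup E'] [InnerProductSpace ℂ E'] [NormedAddCommGroup F]
    [InnerProductSpace ℂ F] [NormedAddCommGroup F'] [InnerProductSpace ℂ F']
    (φ : E →ₗ[ℂ] F) (φ' : E' →ₗ[ℂ] F') (ξ : WithLp 2 (E × E')) :
    sumMap φ φ' ξ = WithLp.toLp 2 (φ ξ.fst, φ' ξ.snd) := rfl

/-- Direct sum of Hermitian vector bundles. -/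
def HermBundle.sum {U : Set T} (E E' : HermBundle U) : HermBundle U where
  fiber x := WithLp 2 (E.fiber x × E'.fiber x)
  J := E.J × E'.J
  K j := E.K j.1 ⊕ E'.K j.2
  base j := E.base j.1 ∩ E'.base j.2
  isOpen_base j := (E.isOpen_base j.1).inter (E'.isOpen_base j.2)
  iUnion_base := by
    ext x
    have h : x ∈ U ↔ ∃ j, x ∈ E.base j := by
      rw [← mem_iUnion, E.iUnion_base]
    have h' : x ∈ U ↔ ∃ j, x ∈ E'.base j := by
      rw [← mem_iUnion, E'.iUnion_base]
    simp only [mem_iUnion, mem_inter_iff, Prod.exists]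
    constructor
    · rintro ⟨i, j, hi, -⟩
      exact h.2 ⟨i, hi⟩
    · intro hx
      obtain ⟨i, hi⟩ := h.1 hx
      obtain ⟨j, hj⟩ := h'.1 hx
      exact ⟨i, j, hi, hj⟩
  frame j κ x := Sum.elim (fun κ => WithLp.toLp 2 (E.frame j.1 κ x, 0))
    (fun κ => WithLp.toLp 2 (0, E'.frame j.2 κ x)) κ
  orthonormal j x hx := by
    classical
    have h1 := orthonormal_iff_ite.1 (E.orthonormal j.1 x hx.1)
    have h2 := orthonormal_iff_ite.1 (E'.orthonormal j.2 x hx.2)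
    rw [orthonormal_iff_ite]
    rintro (κ | κ) (κ' | κ')
    · simp [WithLp.prod_inner_apply, h1]
    · simp [WithLp.prod_inner_apply]
    · simp [WithLp.prod_inner_apply]
    · simp [WithLp.prod_inner_apply, h2]
  span j x hx := by
    rw [eq_top_iff]
    rintro ξ -
    set S := Submodule.span ℂ (range fun κ : E.K j.1 ⊕ E'.K j.2 =>
      (Sum.elim (fun κ => WithLp.toLp 2 (E.frame j.1 κ x, 0))
        (fun κ => WithLp.toLp 2 (0, E'.frame j.2 κ x)) κ :
          WithLp 2 (E.fiber x × E'.fiber x))) with hS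
    have h1 : (⊤ : Submodule ℂ (E.fiber x)) ≤ S.comap
        ((WithLp.linearEquiv 2 ℂ (E.fiber x × E'.fiber x)).symm.toLinearMap ∘ₗ
          LinearMap.inl ℂ _ _) := by
      rw [← E.span j.1 x hx.1, Submodule.span_le]
      rintro _ ⟨κ, rfl⟩
      exact Submodule.subset_span ⟨Sum.inl κ, rfl⟩
    have h2 : (⊤ : Submodule ℂ (E'.fiber x)) ≤ S.comap
        ((WithLp.linearEquiv 2 ℂ (E.fiber x × E'.fiber x)).symm.toLinearMap ∘ₗ
          LinearMap.inr ℂ _ _) := by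
      rw [← E'.span j.2 x hx.2, Submodule.span_le]
      rintro _ ⟨κ, rfl⟩
      exact Submodule.subset_span ⟨Sum.inr κ, rfl⟩
    have h3 : ξ = WithLp.toLp 2 (ξ.fst, 0) + WithLp.toLp 2 (0, ξ.snd) := by
      rw [← WithLp.toLp_add, Prod.mk_add_mk, add_zero, zero_add]
      rfl
    rw [h3]
    exact S.add_mem (h1 (x := ξ.fst) trivial) (h2 (x := ξ.snd) trivial)
  transition i j κ κ' := by
    rcases κ with κ | κ <;> rcases κ' with κ' | κ'
    · simp only [Sum.elim_inl, WithLp.prod_inner_apply, inner_zero_left, add_zero]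
      exact (E.transition i.1 j.1 κ κ').mono fun x hx => ⟨hx.1.1, hx.2.1⟩
    · simp only [Sum.elim_inl, Sum.elim_inr, WithLp.prod_inner_apply, inner_zero_left,
        inner_zero_right, add_zero]
      exact continuousOn_const
    · simp only [Sum.elim_inl, Sum.elim_inr, WithLp.prod_inner_apply, inner_zero_left,
        inner_zero_right, add_zero]
      exact continuousOn_const
    · simp only [Sum.elim_inr, WithLp.prod_inner_apply, inner_zero_left, zero_add]
      exact (E'.transition i.2 j.2 κ κ').mono fun x hx => ⟨hx.1.2, hx.2.2⟩

theorem HermBundle.ContOn.sum {U V W : Set T} {E E' : HermBundle U} {F F' : HermBundle V}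
    {φ : ∀ x, E.fiber x →ₗ[ℂ] F.fiber x} {φ' : ∀ x, E'.fiber x →ₗ[ℂ] F'.fiber x}
    (hφ : E.ContOn F W φ) (hφ' : E'.ContOn F' W φ') :
    (E.sum E').ContOn (F.sum F') W fun x => sumMap (φ x) (φ' x) := by
  rintro i κ j κ'
  rcases κ with κ | κ <;> rcases κ' with κ' | κ'
  · refine ((hφ i.1 κ j.1 κ').mono (t := W ∩ (E.sum E').base i ∩ (F.sum F').base j)
      fun x hx => ⟨⟨hx.1.1, hx.1.2.1⟩, hx.2.1⟩).congr fun x _ => ?_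
    change inner ℂ (F.frame j.1 κ' x) (φ x (E.frame i.1 κ x)) + inner ℂ 0 (φ' x 0) = _
    rw [inner_zero_left, add_zero]
  · refine (continuousOn_const (c := (0 : ℂ))).congr fun x _ => ?_
    change inner ℂ 0 (φ x (E.frame i.1 κ x)) + inner ℂ (F'.frame j.2 κ' x) (φ' x 0) = 0
    rw [map_zero, inner_zero_right, inner_zero_left, add_zero]
  · refine (continuousOn_const (c := (0 : ℂ))).congr fun x _ => ?_
    change inner ℂ (F.frame j.1 κ' x) (φ x 0) + inner ℂ 0 (φ' x (E'.frame i.2 κ x)) = 0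
    rw [map_zero, inner_zero_right, inner_zero_left, add_zero]
  · refine ((hφ' i.2 κ j.2 κ').mono (t := W ∩ (E.sum E').base i ∩ (F.sum F').base j)
      fun x hx => ⟨⟨hx.1.1, hx.1.2.2⟩, hx.2.2⟩).congr fun x _ => ?_
    change inner ℂ 0 (φ x 0) + inner ℂ (F'.frame j.2 κ' x) (φ' x (E'.frame i.2 κ x)) = _
    rw [inner_zero_left, zero_add]

/-- Direct sum of objects of `HF`. -/
def HFObj.sum {U : Set T} (A A' : HFObj U) : HFObj U where
  toHermBundle := A.toHermBundle.sum A'.toHermBundle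
  gr x := sumMap (A.gr x) (A'.gr x)
  gr_cont := A.gr_cont.sum A'.gr_cont
  gr_gr x hx ξ := congrArg (WithLp.toLp 2)
    (Prod.ext (A.gr_gr x hx ξ.fst) (A'.gr_gr x hx ξ.snd))
  gr_symm x hx ξ η := congrArg₂ (· + ·) (A.gr_symm x hx ξ.fst η.fst)
    (A'.gr_symm x hx ξ.snd η.snd)
  h x := sumMap (A.h x) (A'.h x)
  h_cont := A.h_cont.sum A'.h_cont
  h_symm x hx ξ η := congrArg₂ (· + ·) (A.h_symm x hx ξ.fst η.fst)
    (A'.h_symm x hx ξ.snd η.snd)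
  h_odd x hx ξ := congrArg (WithLp.toLp 2)
    (Prod.ext (A.h_odd x hx ξ.fst) (A'.h_odd x hx ξ.snd))

theorem HFObj.IsHom.sum {U V W : Set T} {A A' : HFObj U} {B B' : HFObj V}
    {φ : ∀ x, A.fiber x →ₗ[ℂ] B.fiber x} {φ' : ∀ x, A'.fiber x →ₗ[ℂ] B'.fiber x}
    (hφ : A.IsHom B W φ) (hφ' : A'.IsHom B' W φ') :
    (A.sum A').IsHom (B.sum B') W fun x => sumMap (φ x) (φ' x) where
  cont := hφ.cont.sum hφ'.cont
  even x hx ξ := congrArg (WithLp.toLp 2)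
    (Prod.ext (hφ.even x hx ξ.fst) (hφ'.even x hx ξ.snd))
  comm x hx ξ := congrArg (WithLp.toLp 2)
    (Prod.ext (hφ.comm x hx ξ.fst) (hφ'.comm x hx ξ.snd))

theorem lowSpace_sum {E E' : Type} [NormedAddCommGroup E] [InnerProductSpace ℂ E]
    [NormedAddCommGroup E'] [InnerProductSpace ℂ E'] (h : E →ₗ[ℂ] E) (h' : E' →ₗ[ℂ] E')
    {μ ν ν' : ℝ} (hν : μ ≤ ν) (hν' : μ ≤ ν') {ξ : WithLp 2 (E × E')}
    (hξ : ξ ∈ lowSpace (sumMap h h') μ) : ξ.fst ∈ lowSpace h ν ∧ ξ.snd ∈ lowSpace h' ν' := by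
  have key : lowSpace (sumMap h h') μ ≤ ((lowSpace h ν).prod (lowSpace h' ν')).comap
      (WithLp.linearEquiv 2 ℂ (E × E')).toLinearMap := by
    refine iSup₂_le fun l hl η hη => ?_
    rw [LinearMap.mem_ker] at hη
    have hη' := congrArg (WithLp.linearEquiv 2 ℂ (E × E')) hη
    refine ⟨?_, ?_⟩
    · refine le_iSup₂ (f := fun (l : ℝ) (_ : l < ν) =>
        LinearMap.ker (h ∘ₗ h - (l : ℂ) • LinearMap.id)) l (hl.trans_le hν) ?_
      exact congrArg Prod.fst hη'
    · refine le_iSup₂ (f := fun (l : ℝ) (_ : l < ν') =>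
        LinearMap.ker (h' ∘ₗ h' - (l : ℂ) • LinearMap.id)) l (hl.trans_le hν') ?_
      exact congrArg Prod.snd hη'
  exact key hξ

theorem PairEqv.sum [InfiniteDimensional H] {U V W : Set T} {A A' : HFObj U} {B B' : HFObj V}
    {g g' : T → UGroup H} {φ ψ : ∀ x, A.fiber x →ₗ[ℂ] B.fiber x}
    {φ' ψ' : ∀ x, A'.fiber x →ₗ[ℂ] B'.fiber x}
    (h : PairEqv A B W g φ g' ψ) (h' : PairEqv A' B' W g φ' g' ψ') :
    PairEqv (A.sum A') (B.sum B') W g (fun x => sumMap (φ x) (φ' x)) g'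
      (fun x => sumMap (ψ x) (ψ' x)) := by
  obtain ⟨ζ, hc, hg, he⟩ := h
  obtain ⟨ζ', -, hg', he'⟩ := h'
  have hζ : ∀ x ∈ W, ζ' x = ζ x := by
    intro x hx
    have := InfiniteDimensional.nontrivial H
    obtain ⟨ξ, hξ⟩ := exists_ne (0 : H)
    have h1 := (hg' x hx ξ).symm.trans (hg x hx ξ)
    have h2 : (g x).toMap ξ ≠ 0 := fun h0 =>
      hξ ((show H ≃ₗᵢ[ℂ] H from g x).map_eq_zero_iff.1 h0)
    exact Circle.ext (smul_left_injective ℂ h2 h1)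
  refine ⟨ζ, hc, hg, fun x hx => ?_⟩
  obtain ⟨μ, hμ, hev⟩ := he x hx
  obtain ⟨μ', hμ', hev'⟩ := he' x hx
  refine ⟨min μ μ', lt_min hμ hμ', ?_⟩
  filter_upwards [hev, hev', self_mem_nhdsWithin] with y h1 h2 hy ξ hξ
  obtain ⟨m1, m2⟩ := lowSpace_sum (A.h y) (A'.h y) (min_le_left μ μ') (min_le_right μ μ') hξ
  have e1 := h1 _ m1
  have e2 := h2 _ m2
  rw [hζ y hy] at e2
  exact congrArg (WithLp.toLp 2) (Prod.ext e1 e2)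

theorem sumMap_comp {E E' F F' G G' : Type} [NormedAddCommGroup E] [InnerProductSpace ℂ E]
    [NormedAddCommGroup E'] [InnerProductSpace ℂ E'] [NormedAddCommGroup F]
    [InnerProductSpace ℂ F] [NormedAddCommGroup F'] [InnerProductSpace ℂ F']
    [NormedAddCommGroup G] [InnerProductSpace ℂ G] [NormedAddCommGroup G']
    [InnerProductSpace ℂ G'] (ψ : F →ₗ[ℂ] G) (ψ' : F' →ₗ[ℂ] G') (φ : E →ₗ[ℂ] F)
    (φ' : E' →ₗ[ℂ] F') : sumMap ψ ψ' ∘ₗ sumMap φ φ' = sumMap (ψ ∘ₗ φ) (ψ' ∘ₗ φ') := rfl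

theorem sumMap_id {E E' : Type} [NormedAddCommGroup E] [InnerProductSpace ℂ E]
    [NormedAddCommGroup E'] [InnerProductSpace ℂ E'] :
    sumMap (LinearMap.id : E →ₗ[ℂ] E) (LinearMap.id : E' →ₗ[ℂ] E') = LinearMap.id := rfl

/-- Direct sum of two twisted vectorial bundles with the same twisting part. -/
def Vectorial.sum [InfiniteDimensional H] {τ : Twist H π f} (A B : Vectorial τ) :
    Vectorial τ where
  E a := (A.E a).sum (B.E a)
  φ a b x := sumMap (A.φ a b x) (B.φ a b x)
  φ_hom a b := (A.φ_hom a b).sum (B.φ_hom a b)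
  φ_inv a b := by
    have h := (A.φ_inv a b).sum (B.φ_inv a b)
    simp only [← sumMap_comp, sumMap_id] at h
    exact h
  φ_comp a b c := by
    have h := (A.φ_comp a b c).sum (B.φ_comp a b c)
    simp only [← sumMap_comp] at h
    exact h

theorem Vectorial.supp_sum [InfiniteDimensional H] {τ : Twist H π f} (A B : Vectorial τ) :
    (A.sum B).supp ⊆ A.supp ∪ B.supp := by
  refine closure_minimal ?_ (isClosed_closure.union isClosed_closure)
  rintro t ⟨a, ha, hb⟩
  by_contra hcon
  have h1 : Function.Bijective ((A.E a).h t) := by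
    by_contra hn
    exact hcon (Or.inl (subset_closure ⟨a, ha, hn⟩))
  have h2 : Function.Bijective ((B.E a).h t) := by
    by_contra hn
    exact hcon (Or.inr (subset_closure ⟨a, ha, hn⟩))
  refine hb ?_
  exact ((WithLp.linearEquiv 2 ℂ _).symm.bijective.comp (h1.prodMap h2)).comp
    (WithLp.linearEquiv 2 ℂ _).bijective

/-- Direct sum of two relative objects with the same twisting part. -/
def RelTVB.sum [InfiniteDimensional H] {S : Set T} (τ : Twist H π f) (A B : Vectorial τ)
    (hA : Disjoint A.supp S) (hB : Disjoint B.supp S) : RelTVB H π f S :=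
  ⟨⟨τ, A.sum B⟩, (disjoint_union_left.2 ⟨hA, hB⟩).mono_left (A.supp_sum B)⟩

/-- `z` is a direct sum of `x` and `y`: for some representatives `A` of `x` and `B` of `y` with the
same twisting part, `A ⊕ B` represents `z`. -/
def KF.IsDirectSum [InfiniteDimensional H] {S : Set T} (x y z : KF H π f S) : Prop :=
  ∃ (τ : Twist H π f) (A B : Vectorial τ) (hA : Disjoint A.supp S) (hB : Disjoint B.supp S),
    x = KF.mk ⟨⟨τ, A⟩, hA⟩ ∧ y = KF.mk ⟨⟨τ, B⟩, hB⟩ ∧ z = KF.mk (RelTVB.sum τ A B hA hB)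

end KF

/-! ### The groups `KF^{-n}` and the maps between them -/

section Cohomology

variable {π : P → X}

/-- `I^n`. -/
abbrev Cb (n : ℕ) : Type := Fin n → unitInterval

variable (H π) in
/-- `KF^{-n}_{f^*P}(T, S) = KF_{f^*P × I^n}(T × I^n, S × I^n ∪ T × ∂I^n)`. -/
abbrev KFn (n : ℕ) {T : Type u} [TopologicalSpace T] (f : C(T, X)) (S : Set T) : Type _ :=
  KF H π (f.comp ContinuousMap.fst : C(T × Cb n, X))
    (S ×ˢ univ ∪ univ ×ˢ Cube.boundary (Fin n))

/-- The inclusion `Y → X`, over which `P` restricts to `P|_Y`. -/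
def incl (Y : Set X) : C(Y, X) := ⟨Subtype.val, continuous_subtype_val⟩

variable (H π) in
/-- `KF_P^{-n}(X, Y) → KF_P^{-n}(X)`, induced by `(X, ∅) → (X, Y)`. -/
def forget (n : ℕ) (Y : Set X) :
    KFn H π n (ContinuousMap.id X) Y → KFn H π n (ContinuousMap.id X) ∅ :=
  KF.pull (ContinuousMap.id _) (fun _ => rfl) fun t ht => by
    rcases ht with ht | ht
    · exact ht.1.elim
    · exact Or.inr ht

variable (H π) in
/-- `KF_P^{-n}(X) → KF_{P|Y}^{-n}(Y)`, induced by `Y → X`. -/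
def restrictTo (n : ℕ) (Y : Set X) :
    KFn H π n (ContinuousMap.id X) ∅ → KFn H π n (incl Y) ∅ :=
  KF.pull ((incl Y).prodMap (ContinuousMap.id (Cb n))) (fun _ => rfl) fun t ht => by
    rcases ht with ht | ht
    · exact ht.1.elim
    · exact Or.inr ⟨trivial, ht.2⟩

/-- The space `X × I^n × {0} ∪ (Y × I^n ∪ X × ∂I^n) × I`. -/
abbrev Hat (n : ℕ) (Y : Set X) : Type u :=
  {q : (X × Cb n) × unitInterval // q.2 = 0 ∨ q.1.1 ∈ Y ∨ q.1.2 ∈ Cube.boundary (Fin n)}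

/-- The projection `Hat n Y → X × I^n`. -/
def hatFst (n : ℕ) (Y : Set X) : C(Hat n Y, X × Cb n) :=
  ⟨fun q => q.1.1, by fun_prop⟩

/-- The projection `Hat n Y → X`. -/
def hatProj (n : ℕ) (Y : Set X) : C(Hat n Y, X) := ContinuousMap.fst.comp (hatFst n Y)

/-- The subspace `Y × I^n × {1} ∪ X × ∂I^n × I` of `Hat n Y`. -/
def hatSmall (n : ℕ) (Y : Set X) : Set (Hat n Y) :=
  {q | (q.1.1.1 ∈ Y ∧ q.1.2 = 1) ∨ q.1.1.2 ∈ Cube.boundary (Fin n)}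

/-- The subspace `X × I^n × {0} ∪ Y × I^n × {1} ∪ X × ∂I^n × I` of `Hat n Y`. -/
def hatLarge (n : ℕ) (Y : Set X) : Set (Hat n Y) :=
  {q | q.1.2 = 0} ∪ hatSmall n Y

/-- The inclusion `Y × I^{n+1} → Hat n Y`, with `I^{n+1} = I^n × I`. -/
def hatIncl (n : ℕ) (Y : Set X) : C(Y × Cb (n + 1), Hat n Y) :=
  ⟨fun t => ⟨((t.1.1, fun i => t.2 i.castSucc), t.2 (Fin.last n)), Or.inr (Or.inl t.1.2)⟩,
    by fun_prop⟩

variable (H π) in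
/-- The excision map `KF(Hat, hatLarge) → KF_{P|Y}^{-n-1}(Y)`. -/
def excision (n : ℕ) (Y : Set X) :
    KF H π (hatProj n Y) (hatLarge n Y) → KFn H π (n + 1) (incl Y) ∅ :=
  KF.pull (hatIncl n Y) (fun _ => rfl) fun t ht => by
    rcases ht with ht | ⟨-, i, hi⟩
    · exact ht.1.elim
    · induction i using Fin.lastCases with
      | last => exact hi.imp id fun h => Or.inl ⟨t.1.2, h⟩
      | cast i => exact Or.inr (Or.inr ⟨i, hi⟩)

variable (H π) in
/-- The map `KF(Hat, hatLarge) → KF(Hat, hatSmall)` induced by the inclusion. -/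
def hatForget (n : ℕ) (Y : Set X) :
    KF H π (hatProj n Y) (hatLarge n Y) → KF H π (hatProj n Y) (hatSmall n Y) :=
  KF.pull (ContinuousMap.id _) (fun _ => rfl) fun _ ht => Or.inr ht

variable (H π) in
/-- The map `KF_P^{-n}(X, Y) → KF(Hat, hatSmall)` induced by the projection. -/
def hatPull (n : ℕ) (Y : Set X) :
    KFn H π n (ContinuousMap.id X) Y → KF H π (hatProj n Y) (hatSmall n Y) :=
  KF.pull (hatFst n Y) (fun _ => rfl) fun t ht => by
    rcases ht with ht | ht
    · exact Or.inl ⟨ht.1, trivial⟩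
    · exact Or.inr ⟨trivial, ht⟩

end Cohomology

end Twisted

end TwistedKF

end

open TwistedKF

set_option linter.unusedSectionVars false
set_option linter.unusedVariables false

noncomputable section

namespace TwistedKF

/-! ### The unitary group and the projective unitary group -/

section Unitary

variable {H : Type w} [NormedAddCommGroup H] [InnerProductSpace ℂ H]

/-! The group law. A map to `PU(H)` lifts locally to `U(H)`, so two twisting parts always have a
common refinement (`Twist.exists_common_ref`). Refining does not change the isomorphism class of an
object, hence classes can be represented over one twisting part and added there. Where `h` is
invertible, `h²` has no small eigenvalues and any two homomorphisms are `≑`-equal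
(`HFObj.eqv_of_bijective`); so objects with empty support are neutral, and all of them represent the
same class. The inverse of `(E, h)` is `(E, -h)` with the opposite grading: on the sum of the two,
the block map with rows `(h, t)` and `(t, -h)` has square `h² + t²`. At `t = 0` it is the direct
sum, for `t > 0` it is invertible, and its support never exceeds that of `E` (`KF.exists_add_neg`).

Vanishing and cylinders. Objects over two open sets, isomorphic on the overlap, can be glued
(`GlueData.exists_glue`). Consequently homotopies can be concatenated, homotopy is an equivalence
relation, and a class is zero exactly when a representative is homotopic to an object with empty
support (`KF.mk_eq_zero_iff`). If an object `A` on `T` is null-homotopic over a subspace `D`, gluing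
the null-homotopy to `A` gives an object on `T × {0} ∪ D × I` that is `A` on the base and has no
support on the top of `D × I` (`exists_cylinder_of_homotopic`). Pulling it back along a map from `T`
to this cylinder that is homotopic to the inclusion of the base changes `A`, within its class, to an
object with smaller support. Exactness in (a) and (b) and injectivity of `e` are instances of this
principle.

The bundle. For (a) the map to the cylinder comes from a retraction of `X × I` onto `X × {0} ∪ Y ×
I`. Such a retraction moves points of `X`, so it does not respect the twisting by `P` by itself. It
is therefore constructed equivariantly on `P × I`, one cell after the other, using that a principal
bundle has a section over a cube (`IsPrincipalBundle.liftsOn_cube`,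
`IsPrincipalBundle.exists_equivariant_retraction`). This covers the retraction by a bundle map, and
objects are pulled back along bundle maps (`TVB.bpull`). Combined with the central projection of
`I^n × I` onto its bottom and sides, it gives a covered retraction of `X × I^n × I` onto `Hat n Y`,
which makes `p^*` bijective.

The remaining points need no motion in `X`. Injectivity of `e` follows from the cylinder principle
with a rescaling of the cubes; surjectivity, by compressing an object into the middle of the cube
and extending it by zero. In (b), a null-homotopy over `X × I^n` is attached below the bottom of
`Hat n Y`. In (c), a null-homotopy over `Hat n Y`, restricted to the bottom, is an object on `X ×
I^{n+1}`, and turning a square about its corner identifies its restriction to `Y`.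

The CW structure is used for two things only: the existence of one twisting part on `X`, whose
pull-backs carry the zero objects, and the covered retraction. -/

theorem UGroup.toMap_mul (a b : UGroup H) (ξ : H) : (a * b).toMap ξ = a.toMap (b.toMap ξ) := rfl

theorem UGroup.toMap_inv_toMap (a : UGroup H) (ξ : H) : a⁻¹.toMap (a.toMap ξ) = ξ :=
  (show H ≃ₗᵢ[ℂ] H from a).symm_apply_apply _

theorem UGroup.toMap_toMap_inv (a : UGroup H) (ξ : H) : a.toMap (a⁻¹.toMap ξ) = ξ :=
  (show H ≃ₗᵢ[ℂ] H from a).apply_symm_apply _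

theorem UGroup.toMap_smul (a : UGroup H) (z : ℂ) (ξ : H) : a.toMap (z • ξ) = z • a.toMap ξ :=
  (show H ≃ₗᵢ[ℂ] H from a).map_smul _ _

theorem UGroup.toMap_sub (a : UGroup H) (ξ η : H) : a.toMap (ξ - η) = a.toMap ξ - a.toMap η :=
  (show H ≃ₗᵢ[ℂ] H from a).map_sub _ _

theorem UGroup.norm_toMap (a : UGroup H) (ξ : H) : ‖a.toMap ξ‖ = ‖ξ‖ :=
  (show H ≃ₗᵢ[ℂ] H from a).norm_map _

theorem UGroup.ext_toMap {a b : UGroup H} (h : ∀ ξ, a.toMap ξ = b.toMap ξ) : a = b :=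
  LinearIsometryEquiv.ext (e := (show H ≃ₗᵢ[ℂ] H from a)) (e' := (show H ≃ₗᵢ[ℂ] H from b)) h

/-- Unitary operators are equicontinuous: `‖aη - uξ‖ ≤ ‖η - ξ‖ + ‖aξ - uξ‖`, so continuity in `a`
for fixed `ξ` gives joint continuity. -/
theorem UGroup.continuous_eval : Continuous fun q : UGroup H × H => q.1.toMap q.2 := by
  rw [continuous_iff_continuousAt]
  rintro ⟨u, ξ⟩
  have h1 : Continuous fun a : UGroup H => a.toMap ξ :=
    (ContinuousEvalConst.continuous_eval_const ξ).comp continuous_induced_dom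
  have h2 : Tendsto (fun q : UGroup H × H => ‖q.2 - ξ‖ + ‖q.1.toMap ξ - u.toMap ξ‖)
      (𝓝 (u, ξ)) (𝓝 0) := by
    have : Continuous fun q : UGroup H × H => ‖q.2 - ξ‖ + ‖q.1.toMap ξ - u.toMap ξ‖ := by
      have := h1.comp (continuous_fst (X := UGroup H) (Y := H))
      simp only [Function.comp_def] at this
      fun_prop
    simpa using this.tendsto (u, ξ)
  refine tendsto_iff_norm_sub_tendsto_zero.2 (squeeze_zero (fun _ => norm_nonneg _) ?_ h2)
  rintro ⟨a, η⟩
  have h3 : a.toMap η - u.toMap ξ = a.toMap (η - ξ) + (a.toMap ξ - u.toMap ξ) := by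
    rw [a.toMap_sub]; abel
  calc ‖a.toMap η - u.toMap ξ‖ ≤ ‖a.toMap (η - ξ)‖ + ‖a.toMap ξ - u.toMap ξ‖ := by
        rw [h3]; exact norm_add_le _ _
    _ = _ := by rw [a.norm_toMap]

/-- By the same estimate the compact-open topology on `U(H)` is no finer than the strong operator
topology, so continuity into `U(H)` can be tested on vectors. -/
theorem UGroup.continuous_of_pointwise {T : Type*} [TopologicalSpace T] {f : T → UGroup H}
    (hf : ∀ ξ, Continuous fun t => (f t).toMap ξ) : Continuous f := by
  refine continuous_induced_rng.2 (ContinuousMap.continuous_of_continuous_uncurry _ ?_)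
  rw [continuous_iff_continuousAt]
  rintro ⟨s, ξ⟩
  have h2 : Tendsto (fun q : T × H => ‖q.2 - ξ‖ + ‖(f q.1).toMap ξ - (f s).toMap ξ‖)
      (𝓝 (s, ξ)) (𝓝 0) := by
    have : Continuous fun q : T × H => ‖q.2 - ξ‖ + ‖(f q.1).toMap ξ - (f s).toMap ξ‖ := by
      have := (hf ξ).comp (continuous_fst (X := T) (Y := H))
      simp only [Function.comp_def] at this
      fun_prop
    simpa using this.tendsto (s, ξ)
  refine tendsto_iff_norm_sub_tendsto_zero.2 (squeeze_zero (fun _ => norm_nonneg _) ?_ h2)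
  rintro ⟨t, η⟩
  have h3 : (f t).toMap η - (f s).toMap ξ
      = (f t).toMap (η - ξ) + ((f t).toMap ξ - (f s).toMap ξ) := by
    rw [(f t).toMap_sub]; abel
  calc ‖(f t).toMap η - (f s).toMap ξ‖
      ≤ ‖(f t).toMap (η - ξ)‖ + ‖(f t).toMap ξ - (f s).toMap ξ‖ := by
        rw [h3]; exact norm_add_le _ _
    _ = _ := by rw [(f t).norm_toMap]

/-- Inversion is continuous because `‖a⁻¹ξ - u⁻¹ξ‖ = ‖ξ - a u⁻¹ξ‖`, which tends to `0` as `a → u`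
strongly. -/
instance : IsTopologicalGroup (UGroup H) where
  continuous_mul := UGroup.continuous_of_pointwise fun ξ => by
    have h1 : Continuous fun q : UGroup H × UGroup H => q.2.toMap ξ :=
      UGroup.continuous_eval.comp (continuous_snd.prodMk continuous_const)
    exact UGroup.continuous_eval.comp (continuous_fst.prodMk h1)
  continuous_inv := UGroup.continuous_of_pointwise fun ξ => by
    rw [continuous_iff_continuousAt]
    intro u
    have h1 : Continuous fun a : UGroup H => ‖ξ - a.toMap (u⁻¹.toMap ξ)‖ := by
      have : Continuous fun a : UGroup H => a.toMap (u⁻¹.toMap ξ) :=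
        UGroup.continuous_eval.comp (continuous_id.prodMk continuous_const)
      fun_prop
    have h2 := h1.tendsto u
    rw [u.toMap_toMap_inv, sub_self, norm_zero] at h2
    refine tendsto_iff_norm_sub_tendsto_zero.2 (h2.congr fun a => ?_)
    rw [← a.norm_toMap (a⁻¹.toMap ξ - u⁻¹.toMap ξ), a.toMap_sub, a.toMap_toMap_inv]

theorem PUGroup.mk_eq_iff {a b : UGroup H} :
    (a : PUGroup H) = b ↔ ∃ z : Circle, ∀ ξ, b.toMap ξ = (z : ℂ) • a.toMap ξ := by
  rw [QuotientGroup.eq]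
  constructor
  · rintro ⟨z, hz⟩
    refine ⟨z, fun ξ => ?_⟩
    have h1 := congrArg a.toMap (hz ξ)
    rwa [UGroup.toMap_mul, UGroup.toMap_toMap_inv, a.toMap_smul] at h1
  · rintro ⟨z, hz⟩
    refine ⟨z, fun ξ => ?_⟩
    rw [UGroup.toMap_mul, hz, UGroup.toMap_smul, UGroup.toMap_inv_toMap]

open Classical in
/-- The scalar by which two unitary operators with the same class in `PU(H)` differ. -/
def UGroup.ratio (a b : UGroup H) : Circle :=
  if h : ∃ z : Circle, ∀ ξ, b.toMap ξ = (z : ℂ) • a.toMap ξ then h.choose else 1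

theorem UGroup.ratio_spec {a b : UGroup H} (h : (a : PUGroup H) = b) (ξ : H) :
    b.toMap ξ = (UGroup.ratio a b : ℂ) • a.toMap ξ := by
  have h' := PUGroup.mk_eq_iff.1 h
  rw [UGroup.ratio, dif_pos h']
  exact h'.choose_spec ξ

/-- The scalar is recovered from one nonzero vector: it equals `⟨gξ, g'ξ⟩ / ⟨ξ, ξ⟩`. -/
theorem UGroup.continuousOn_ratio [InfiniteDimensional H] {T : Type*} [TopologicalSpace T]
    {V : Set T} {g g' : T → UGroup H} (hg : ContinuousOn g V) (hg' : ContinuousOn g' V)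
    (h : ∀ x ∈ V, (g x : PUGroup H) = g' x) :
    ContinuousOn (fun x => UGroup.ratio (g x) (g' x)) V := by
  have := InfiniteDimensional.nontrivial H
  obtain ⟨ξ, hξ⟩ := exists_ne (0 : H)
  refine (show IsInducing ((↑) : Circle → ℂ) from ⟨rfl⟩).continuousOn_iff.2 ?_
  have h1 : ∀ {f : T → UGroup H}, ContinuousOn f V → ContinuousOn (fun x => (f x).toMap ξ) V :=
    fun hf => UGroup.continuous_eval.comp_continuousOn (hf.prodMk continuousOn_const)
  have h2 : ContinuousOn (fun x => inner ℂ ((g x).toMap ξ) ((g' x).toMap ξ) /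
      inner ℂ ξ ξ) V := ((h1 hg).inner (h1 hg')).div_const _
  refine h2.congr fun x hx => ?_
  have hne : (inner ℂ ξ ξ : ℂ) ≠ 0 := inner_self_ne_zero.2 hξ
  have h3 : (inner ℂ ((g x).toMap ξ) ((g x).toMap ξ) : ℂ) = inner ℂ ξ ξ :=
    (show H ≃ₗᵢ[ℂ] H from g x).inner_map_map ξ ξ
  change (UGroup.ratio (g x) (g' x) : ℂ) = inner ℂ ((g x).toMap ξ) ((g' x).toMap ξ) / inner ℂ ξ ξ
  rw [UGroup.ratio_spec (h x hx) ξ, inner_smul_right, h3, mul_div_cancel_right₀ _ hne]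

/-- The phase of a complex number, as a point of the circle (`1` at the origin). -/
def phase (z : ℂ) : Circle :=
  ⟨if z = 0 then 1 else z / (‖z‖ : ℂ), by
    refine mem_sphere_zero_iff_norm.2 ?_
    split_ifs with h
    · exact norm_one
    · simp [norm_ne_zero_iff.2 h]⟩

theorem coe_phase {z : ℂ} (h : z ≠ 0) : (phase z : ℂ) = z / (‖z‖ : ℂ) :=
  if_neg h

theorem phase_mul {z : ℂ} (h : z ≠ 0) (a : Circle) : phase ((a : ℂ) * z) = a * phase z := by
  have ha : (a : ℂ) ≠ 0 := a.coe_ne_zero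
  refine Circle.ext ?_
  rw [coe_phase (mul_ne_zero ha h), Circle.coe_mul, coe_phase h, norm_mul, Circle.norm_coe,
    one_mul, mul_div_assoc]

theorem continuousOn_phase : ContinuousOn phase {z : ℂ | z ≠ 0} := by
  refine (show IsInducing ((↑) : Circle → ℂ) from ⟨rfl⟩).continuousOn_iff.2 ?_
  have : ContinuousOn (fun z : ℂ => z / (‖z‖ : ℂ)) {z : ℂ | z ≠ 0} :=
    continuousOn_id.div (Complex.continuous_ofReal.comp continuous_norm).continuousOn
      fun z hz => by simpa using hz
  exact this.congr fun z hz => coe_phase hz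

/-- Scalar multiples of unitary operators. -/
def UGroup.scale (z : Circle) (a : UGroup H) : UGroup H :=
  (show UGroup H from
    ({ LinearEquiv.smulOfNeZero ℂ H (z : ℂ) z.coe_ne_zero with
        norm_map' := fun ξ => by
          change ‖(z : ℂ) • ξ‖ = ‖ξ‖
          rw [norm_smul, Circle.norm_coe, one_mul] } : H ≃ₗᵢ[ℂ] H)) * a

theorem UGroup.scale_toMap (z : Circle) (a : UGroup H) (ξ : H) :
    (UGroup.scale z a).toMap ξ = (z : ℂ) • a.toMap ξ := rfl

/-- A continuous map to `PU(H)` lifts locally to `U(H)`. -/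
theorem PUGroup.exists_lift [InfiniteDimensional H] {T : Type*} [TopologicalSpace T] {V : Set T}
    {γ : T → PUGroup H} (hγ : ContinuousOn γ V) {t₀ : T} (ht₀ : t₀ ∈ V) :
    ∃ W, IsOpen W ∧ t₀ ∈ W ∧ ∃ g : T → UGroup H, ContinuousOn g (W ∩ V) ∧
      ∀ t ∈ W ∩ V, (g t : PUGroup H) = γ t := by
  have := InfiniteDimensional.nontrivial H
  obtain ⟨ξ, hξ⟩ := exists_ne (0 : H)
  obtain ⟨u₀, hu₀⟩ := QuotientGroup.mk_surjective (γ t₀)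
  set c : UGroup H → ℂ := fun u => inner ℂ (u₀.toMap ξ) (u.toMap ξ) with hc
  have hcont : Continuous c := Continuous.inner continuous_const
    (UGroup.continuous_eval.comp (continuous_id.prodMk continuous_const))
  -- Dividing `u` by the phase of `⟨u₀ξ, uξ⟩` gives a representative that depends only on the class
  -- of `u`. On the open set `N` where the inner product is nonzero it is continuous, so it descends
  -- to a local section of `U(H) → PU(H)`.
  set ν : UGroup H → UGroup H := fun u => UGroup.scale (phase (c u))⁻¹ u with hν
  set N : Set (UGroup H) := {u | c u ≠ 0} with hN
  have hNo : IsOpen N := isOpen_ne_fun hcont continuous_const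
  have hu₀N : u₀ ∈ N := by
    have h3 : (inner ℂ (u₀.toMap ξ) (u₀.toMap ξ) : ℂ) = inner ℂ ξ ξ :=
      (show H ≃ₗᵢ[ℂ] H from u₀).inner_map_map ξ ξ
    change c u₀ ≠ 0
    rw [hc]
    simp only
    rw [h3]
    exact inner_self_ne_zero.2 hξ
  have hνc : ContinuousOn ν N := by
    have h1 : ContinuousOn (fun u => (phase (c u))⁻¹) N :=
      (continuousOn_phase.comp hcont.continuousOn fun u hu => hu).inv
    rw [continuousOn_iff_continuous_domRestrict]
    refine UGroup.continuous_of_pointwise fun η => ?_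
    have h2 : Continuous fun u : N => (((phase (c u))⁻¹ : Circle) : ℂ) :=
      continuous_subtype_val.comp (continuousOn_iff_continuous_domRestrict.1 h1)
    have h3 : Continuous fun u : N => (u : UGroup H).toMap η :=
      UGroup.continuous_eval.comp (continuous_subtype_val.prodMk continuous_const)
    exact h2.smul h3
  have hclass : ∀ u, (ν u : PUGroup H) = u := fun u =>
    (PUGroup.mk_eq_iff.2 ⟨_, fun η => UGroup.scale_toMap _ u η⟩).symm
  have hinv : ∀ u ∈ N, ∀ v : UGroup H, (u : PUGroup H) = v → ν v = ν u := by
    intro u hu v huv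
    obtain ⟨z, hz⟩ := PUGroup.mk_eq_iff.1 huv
    have h1 : c v = (z : ℂ) * c u := by
      simp only [hc, hz, inner_smul_right]
    refine UGroup.ext_toMap fun η => ?_
    rw [hν]
    simp only
    rw [UGroup.scale_toMap, UGroup.scale_toMap, hz, h1, phase_mul hu, smul_smul, ← Circle.coe_mul]
    rw [show (z * phase (c u))⁻¹ * z = (phase (c u))⁻¹ by rw [mul_inv, mul_right_comm, inv_mul_cancel, one_mul]]
  set σ : PUGroup H → UGroup H := fun p => ν (Quotient.out p) with hσ
  have hσu : ∀ u ∈ N, σ u = ν u := fun u hu => hinv u hu _ (QuotientGroup.out_eq' _).symm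
  have hσc : ∀ u ∈ N, ContinuousAt σ (u : PUGroup H) := by
    intro u hu
    have h1 : Tendsto (σ ∘ fun v : UGroup H => (v : PUGroup H)) (𝓝 u) (𝓝 (σ u)) := by
      rw [hσu u hu]
      refine (hνc.continuousAt (hNo.mem_nhds hu)).tendsto.congr' ?_
      filter_upwards [hNo.mem_nhds hu] with v hv using (hσu v hv).symm
    -- The quotient map is open, so it carries the neighbourhood filter of `u` onto that of its
    -- class, and continuity may be checked upstairs.
    have h2 := (QuotientGroup.isOpenQuotientMap_mk (N := scalars H)).map_nhds_eq u
    rw [ContinuousAt, ← h2]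
    exact tendsto_map'_iff.2 h1
  set O : Set (PUGroup H) := (fun u : UGroup H => (u : PUGroup H)) '' N
  have hO : IsOpen O := QuotientGroup.isOpenQuotientMap_mk.isOpenMap _ hNo
  obtain ⟨W, hW, hWV⟩ := (continuousOn_iff'.1 hγ) O hO
  refine ⟨W, hW, (hWV.subset ⟨⟨u₀, hu₀N, hu₀⟩, ht₀⟩).1, fun t => σ (γ t), ?_, ?_⟩
  · intro t ht
    obtain ⟨u, hu, hut⟩ := (hWV.symm.subset ht).1
    have h1 := hσc u hu
    simp only at hut
    rw [hut] at h1
    exact h1.comp_continuousWithinAt ((hγ t ht.2).mono inter_subset_right)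
  · intro t ht
    rw [hσ]
    simp only
    rw [hclass]
    exact QuotientGroup.out_eq' _

end Unitary

/-! ### Principal bundles -/

section Principal

variable {G : Type w} [Group G] [TopologicalSpace G] {X : Type u}
  [TopologicalSpace X] {P : Type v} [TopologicalSpace P] [MulAction Gᵐᵒᵖ P] {π : P → X}

theorem IsPrincipalBundle.exists_act (hπ : IsPrincipalBundle G π) {p p' : P} (h : π p = π p') :
    ∃ g : G, MulOpposite.op g • p = p' := by
  obtain ⟨V, -, hx, e, he, hact⟩ := hπ.locally_trivial (π p)
  set a := e.symm ⟨p, hx⟩ with ha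
  set b := e.symm ⟨p', show π p' ∈ V from h ▸ hx⟩ with hb
  have ha' : (e a).1 = p := by rw [ha, e.apply_symm_apply]
  have hb' : (e b).1 = p' := by rw [hb, e.apply_symm_apply]
  have hab : a.1 = b.1 := Subtype.ext (by rw [← he a, ← he b, ha', hb', h])
  refine ⟨a.2⁻¹ * b.2, ?_⟩
  have := hact a.1 a.2 (a.2⁻¹ * b.2)
  rw [mul_inv_cancel_left] at this
  rw [← ha', ← this, hab, hb']

theorem IsPrincipalBundle.act_injective (hπ : IsPrincipalBundle G π) {p : P} {g g' : G}
    (h : MulOpposite.op g • p = MulOpposite.op g' • p) : g = g' := by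
  obtain ⟨V, -, hx, e, he, hact⟩ := hπ.locally_trivial (π p)
  set a := e.symm ⟨p, hx⟩ with ha
  have ha' : (e a).1 = p := by rw [ha, e.apply_symm_apply]
  have h1 := hact a.1 a.2 g
  have h2 := hact a.1 a.2 g'
  rw [Prod.mk.eta, ha'] at h1 h2
  have h3 := e.injective (Subtype.ext (h1.trans (h.trans h2.symm)))
  exact mul_left_cancel (Prod.ext_iff.1 h3).2

open Classical in
variable (G) in
/-- The group element carrying `p` to `p'`. -/
def transl (p p' : P) : G :=
  if h : ∃ g : G, MulOpposite.op g • p = p' then h.choose else 1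

theorem IsPrincipalBundle.transl_act (hπ : IsPrincipalBundle G π) {p p' : P} (h : π p = π p') :
    MulOpposite.op (transl G p p') • p = p' := by
  have h' := hπ.exists_act h
  rw [transl, dif_pos h']
  exact h'.choose_spec

theorem IsPrincipalBundle.transl_eq (hπ : IsPrincipalBundle G π) {p p' : P} {g : G}
    (h : MulOpposite.op g • p = p') : transl G p p' = g :=
  hπ.act_injective ((hπ.transl_act (h ▸ (hπ.proj_act p g).symm)).trans h.symm)

/-- In a local trivialisation the element carrying `(x, a)` to `(x, b)` is `a⁻¹ b`. -/
theorem IsPrincipalBundle.continuousOn_transl [IsTopologicalGroup G] (hπ : IsPrincipalBundle G π) :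
    ContinuousOn (fun q : P × P => transl G q.1 q.2) {q | π q.1 = π q.2} := by
  rintro ⟨p, p'⟩ hpp
  obtain ⟨V, hV, hx, e, he, hact⟩ := hπ.locally_trivial (π p)
  set S : Set (P × P) := {q | π q.1 = π q.2 ∧ π q.1 ∈ V} with hS
  have hmem : S ∈ 𝓝[{q : P × P | π q.1 = π q.2}] (p, p') := by
    refine mem_nhdsWithin.2 ⟨(fun q : P × P => π q.1) ⁻¹' V,
      hV.preimage (hπ.continuous_proj.comp continuous_fst), hx, fun q hq => ⟨hq.2, hq.1⟩⟩
  refine ContinuousWithinAt.mono_of_mem_nhdsWithin (t := S) ?_ hmem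
  have key : ContinuousOn (fun q : P × P => transl G q.1 q.2) S := by
    rw [continuousOn_iff_continuous_domRestrict]
    have h1 : Continuous fun q : S => (e.symm ⟨q.1.1, q.2.2⟩).2 :=
      continuous_snd.comp (e.symm.continuous.comp
        ((continuous_fst.comp continuous_subtype_val).subtype_mk _))
    have h2 : Continuous fun q : S => (e.symm ⟨q.1.2, show π q.1.2 ∈ V from q.2.1 ▸ q.2.2⟩).2 :=
      continuous_snd.comp (e.symm.continuous.comp
        ((continuous_snd.comp continuous_subtype_val).subtype_mk _))
    refine (h1.inv.mul h2).congr ?_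
    rintro ⟨⟨r, r'⟩, hr, hrV⟩
    refine (hπ.transl_eq ?_).symm
    set a := e.symm ⟨r, hrV⟩ with ha
    set b := e.symm ⟨r', show π r' ∈ V from hr ▸ hrV⟩ with hb
    have ha' : (e a).1 = r := by rw [ha, e.apply_symm_apply]
    have hb' : (e b).1 = r' := by rw [hb, e.apply_symm_apply]
    have hab : a.1 = b.1 := Subtype.ext (by rw [← he a, ← he b, ha', hb']; exact hr)
    have := hact a.1 a.2 (a.2⁻¹ * b.2)
    rw [mul_inv_cancel_left] at this
    change MulOpposite.op (a.2⁻¹ * b.2) • r = r'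
    rw [← ha', ← this, hab, hb']
  exact key _ ⟨hpp, hx⟩

end Principal

/-! ### Low eigenspaces -/

section LowSpace

variable {E F : Type} [NormedAddCommGroup E] [InnerProductSpace ℂ E] [NormedAddCommGroup F]
  [InnerProductSpace ℂ F]

theorem lowSpace_le {h : E →ₗ[ℂ] E} {μ : ℝ} {S : Submodule ℂ E}
    (hS : ∀ l : ℝ, l < μ → ∀ ξ, h (h ξ) = (l : ℂ) • ξ → ξ ∈ S) : lowSpace h μ ≤ S :=
  iSup₂_le fun l hl ξ hξ => hS l hl ξ (by
    rw [LinearMap.mem_ker] at hξ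
    exact sub_eq_zero.1 hξ)

theorem mem_lowSpace {h : E →ₗ[ℂ] E} {μ l : ℝ} (hl : l < μ) {ξ : E}
    (hξ : h (h ξ) = (l : ℂ) • ξ) : ξ ∈ lowSpace h μ :=
  Submodule.mem_iSup_of_mem l (Submodule.mem_iSup_of_mem hl
    (LinearMap.mem_ker.2 (sub_eq_zero.2 hξ)))

theorem lowSpace_mono (h : E →ₗ[ℂ] E) {μ ν : ℝ} (hμ : μ ≤ ν) : lowSpace h μ ≤ lowSpace h ν :=
  lowSpace_le fun _ hl _ hξ => mem_lowSpace (hl.trans_le hμ) hξ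

/-- An intertwiner maps eigenvectors of `h²` to eigenvectors of `h'²` with the same eigenvalue. This
is what makes `≑` compatible with composition on the right. -/
theorem map_mem_lowSpace {h : E →ₗ[ℂ] E} {h' : F →ₗ[ℂ] F} {φ : E →ₗ[ℂ] F}
    (hφ : ∀ ξ, φ (h ξ) = h' (φ ξ)) {μ : ℝ} {ξ : E} (hξ : ξ ∈ lowSpace h μ) :
    φ ξ ∈ lowSpace h' μ := by
  have : lowSpace h μ ≤ (lowSpace h' μ).comap φ := lowSpace_le fun l hl η hη =>
    mem_lowSpace hl (by rw [← hφ, ← hφ, hη, map_smul])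
  exact this hξ

theorem mem_lowSpace_of_map_eq_zero {h : E →ₗ[ℂ] E} {μ : ℝ} (hμ : 0 < μ) {ξ : E} (hξ : h ξ = 0) :
    ξ ∈ lowSpace h μ :=
  mem_lowSpace hμ (by rw [hξ, map_zero, Complex.ofReal_zero, zero_smul])

end LowSpace

/-! ### The calculus of the relations `≑` and `PairEqv` -/

section Calculus

variable {T : Type u} [TopologicalSpace T] {U U' U'' : Set T} {A : HFObj U} {B : HFObj U'}
  {C : HFObj U''} {V : Set T}

theorem HFObj.Eqv.of_eqOn {φ φ' : ∀ x, A.fiber x →ₗ[ℂ] B.fiber x} (h : ∀ x ∈ V, φ x = φ' x) :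
    A.Eqv B V φ φ' := fun _ _ =>
  ⟨1, one_pos, by filter_upwards [self_mem_nhdsWithin] with y hy ξ _ using by rw [h y hy]⟩

theorem HFObj.Eqv.symm {φ φ' : ∀ x, A.fiber x →ₗ[ℂ] B.fiber x} (h : A.Eqv B V φ φ') :
    A.Eqv B V φ' φ := fun x hx => by
  obtain ⟨μ, hμ, hev⟩ := h x hx
  exact ⟨μ, hμ, hev.mono fun y hy ξ hξ => (hy ξ hξ).symm⟩

theorem HFObj.Eqv.trans {φ φ' φ'' : ∀ x, A.fiber x →ₗ[ℂ] B.fiber x} (h : A.Eqv B V φ φ')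
    (h' : A.Eqv B V φ' φ'') : A.Eqv B V φ φ'' := fun x hx => by
  obtain ⟨μ, hμ, hev⟩ := h x hx
  obtain ⟨ν, hν, hev'⟩ := h' x hx
  refine ⟨min μ ν, lt_min hμ hν, ?_⟩
  filter_upwards [hev, hev'] with y h1 h2 ξ hξ
  exact (h1 ξ (lowSpace_mono _ (min_le_left _ _) hξ)).trans
    (h2 ξ (lowSpace_mono _ (min_le_right _ _) hξ))

theorem HFObj.Eqv.mono {W : Set T} (hW : W ⊆ V) {φ φ' : ∀ x, A.fiber x →ₗ[ℂ] B.fiber x}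
    (h : A.Eqv B V φ φ') : A.Eqv B W φ φ' := fun x hx => by
  obtain ⟨μ, hμ, hev⟩ := h x (hW hx)
  exact ⟨μ, hμ, hev.filter_mono (nhdsWithin_mono x hW)⟩

theorem HFObj.Eqv.comp_left {φ φ' : ∀ x, A.fiber x →ₗ[ℂ] B.fiber x} (h : A.Eqv B V φ φ')
    (χ : ∀ x, B.fiber x →ₗ[ℂ] C.fiber x) :
    A.Eqv C V (fun x => χ x ∘ₗ φ x) fun x => χ x ∘ₗ φ' x := fun x hx => by
  obtain ⟨μ, hμ, hev⟩ := h x hx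
  exact ⟨μ, hμ, hev.mono fun y hy ξ hξ => congrArg (χ y) (hy ξ hξ)⟩

theorem HFObj.Eqv.comp_right {φ φ' : ∀ x, B.fiber x →ₗ[ℂ] C.fiber x} (h : B.Eqv C V φ φ')
    {χ : ∀ x, A.fiber x →ₗ[ℂ] B.fiber x} (hχ : ∀ x ∈ V, ∀ ξ, χ x (A.h x ξ) = B.h x (χ x ξ)) :
    A.Eqv C V (fun x => φ x ∘ₗ χ x) fun x => φ' x ∘ₗ χ x := fun x hx => by
  obtain ⟨μ, hμ, hev⟩ := h x hx
  refine ⟨μ, hμ, ?_⟩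
  filter_upwards [hev, self_mem_nhdsWithin] with y hy hyV ξ hξ
  exact hy _ (map_mem_lowSpace (hχ y hyV) hξ)

theorem HFObj.Eqv.smul {φ φ' : ∀ x, A.fiber x →ₗ[ℂ] B.fiber x} (h : A.Eqv B V φ φ')
    (z : T → ℂ) : A.Eqv B V (fun x => z x • φ x) fun x => z x • φ' x := fun x hx => by
  obtain ⟨μ, hμ, hev⟩ := h x hx
  exact ⟨μ, hμ, hev.mono fun y hy ξ hξ => congrArg (z y • ·) (hy ξ hξ)⟩

variable {H : Type w} [NormedAddCommGroup H] [InnerProductSpace ℂ H]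

theorem PairEqv.of_eqOn {g g' : T → UGroup H} {φ φ' : ∀ x, A.fiber x →ₗ[ℂ] B.fiber x}
    (hg : ∀ x ∈ V, g x = g' x) (h : ∀ x ∈ V, φ x = φ' x) : PairEqv A B V g φ g' φ' :=
  ⟨fun _ => 1, continuousOn_const, fun x hx ξ => by rw [hg x hx, Circle.coe_one, one_smul],
    HFObj.Eqv.of_eqOn fun x hx => by rw [h x hx, Circle.coe_one, one_smul]⟩

theorem PairEqv.symm {g g' : T → UGroup H} {φ φ' : ∀ x, A.fiber x →ₗ[ℂ] B.fiber x}
    (h : PairEqv A B V g φ g' φ') : PairEqv A B V g' φ' g φ := by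
  obtain ⟨ζ, hζ, hg, he⟩ := h
  refine ⟨fun x => (ζ x)⁻¹, hζ.inv, fun x hx ξ => ?_, ?_⟩
  · rw [hg x hx, smul_smul, ← Circle.coe_mul, inv_mul_cancel, Circle.coe_one, one_smul]
  · refine HFObj.Eqv.trans (.of_eqOn fun x _ => ?_)
      (he.symm.smul fun x => (((ζ x)⁻¹ : Circle) : ℂ))
    rw [smul_smul, ← Circle.coe_mul, inv_mul_cancel, Circle.coe_one, one_smul]

theorem PairEqv.trans {g g' g'' : T → UGroup H} {φ φ' φ'' : ∀ x, A.fiber x →ₗ[ℂ] B.fiber x}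
    (h : PairEqv A B V g φ g' φ') (h' : PairEqv A B V g' φ' g'' φ'') :
    PairEqv A B V g φ g'' φ'' := by
  obtain ⟨ζ, hζ, hg, he⟩ := h
  obtain ⟨ζ', hζ', hg', he'⟩ := h'
  refine ⟨fun x => ζ' x * ζ x, hζ'.mul hζ, fun x hx ξ => ?_, ?_⟩
  · rw [hg' x hx, hg x hx, smul_smul, Circle.coe_mul]
  · refine he'.trans ((he.smul fun x => (ζ' x : ℂ)).trans (.of_eqOn fun x _ => ?_))
    rw [smul_smul, Circle.coe_mul]

theorem PairEqv.mono {W : Set T} (hW : W ⊆ V) {g g' : T → UGroup H}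
    {φ φ' : ∀ x, A.fiber x →ₗ[ℂ] B.fiber x} (h : PairEqv A B V g φ g' φ') :
    PairEqv A B W g φ g' φ' := by
  obtain ⟨ζ, hζ, hg, he⟩ := h
  exact ⟨ζ, hζ.mono hW, fun x hx => hg x (hW hx), he.mono hW⟩

theorem PairEqv.comp_left {g g' : T → UGroup H} {φ φ' : ∀ x, A.fiber x →ₗ[ℂ] B.fiber x}
    (h : PairEqv A B V g φ g' φ') (k : T → UGroup H) (χ : ∀ x, B.fiber x →ₗ[ℂ] C.fiber x) :
    PairEqv A C V (fun x => k x * g x) (fun x => χ x ∘ₗ φ x) (fun x => k x * g' x)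
      fun x => χ x ∘ₗ φ' x := by
  obtain ⟨ζ, hζ, hg, he⟩ := h
  refine ⟨ζ, hζ, fun x hx ξ => ?_, (he.comp_left χ).trans (.of_eqOn fun x _ => ?_)⟩
  · rw [UGroup.toMap_mul, hg x hx, UGroup.toMap_smul, UGroup.toMap_mul]
  · rw [LinearMap.comp_smul]

theorem PairEqv.comp_right {g g' : T → UGroup H} {φ φ' : ∀ x, B.fiber x →ₗ[ℂ] C.fiber x}
    (h : PairEqv B C V g φ g' φ') (k : T → UGroup H) {χ : ∀ x, A.fiber x →ₗ[ℂ] B.fiber x}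
    (hχ : ∀ x ∈ V, ∀ ξ, χ x (A.h x ξ) = B.h x (χ x ξ)) :
    PairEqv A C V (fun x => g x * k x) (fun x => φ x ∘ₗ χ x) (fun x => g' x * k x)
      fun x => φ' x ∘ₗ χ x := by
  obtain ⟨ζ, hζ, hg, he⟩ := h
  exact ⟨ζ, hζ, fun x hx ξ => hg x hx _, he.comp_right hχ⟩

theorem PairEqv.comp {g g' k k' : T → UGroup H} {φ φ' : ∀ x, A.fiber x →ₗ[ℂ] B.fiber x}
    {χ χ' : ∀ x, B.fiber x →ₗ[ℂ] C.fiber x} (hχ : PairEqv B C V k χ k' χ')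
    (hφ : PairEqv A B V g φ g' φ') (hc : ∀ x ∈ V, ∀ ξ, φ' x (A.h x ξ) = B.h x (φ' x ξ)) :
    PairEqv A C V (fun x => k x * g x) (fun x => χ x ∘ₗ φ x) (fun x => k' x * g' x)
      fun x => χ' x ∘ₗ φ' x :=
  (hφ.comp_left k χ).trans (hχ.comp_right g' hc)

/-- When the two lifts have the same class in `PU(H)` the function `ζ` is forced to be
`UGroup.ratio`, so only the relation `≑` between the corrected maps remains to be checked. -/
theorem PairEqv.of_class [InfiniteDimensional H] {g g' : T → UGroup H} (hg : ContinuousOn g V)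
    (hg' : ContinuousOn g' V) (h : ∀ x ∈ V, (g x : PUGroup H) = g' x)
    {φ φ' : ∀ x, A.fiber x →ₗ[ℂ] B.fiber x}
    (he : A.Eqv B V φ' fun x => (UGroup.ratio (g x) (g' x) : ℂ) • φ x) :
    PairEqv A B V g φ g' φ' :=
  ⟨_, UGroup.continuousOn_ratio hg hg' h, fun x hx ξ => UGroup.ratio_spec (h x hx) ξ, he⟩

end Calculus

/-! ### Homomorphisms -/

section Hom

variable {T : Type u} [TopologicalSpace T] {U U' U'' : Set T} {A : HFObj U} {B : HFObj U'}
  {C : HFObj U''} {V : Set T}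

theorem HermBundle.exists_base {U : Set T} (E : HermBundle U) {x : T} (hx : x ∈ U) :
    ∃ j, x ∈ E.base j := by
  rwa [← E.iUnion_base, mem_iUnion] at hx

theorem HermBundle.isOpen {U : Set T} (E : HermBundle U) : IsOpen U := by
  rw [← E.iUnion_base]
  exact isOpen_iUnion E.isOpen_base

theorem HermBundle.base_subset {U : Set T} (E : HermBundle U) (j : E.J) : E.base j ⊆ U := by
  conv_rhs => rw [← E.iUnion_base]
  exact subset_iUnion _ j

/-- The orthonormal basis of a fibre given by a local frame. -/
def HermBundle.basis {U : Set T} (E : HermBundle U) (j : E.J) {x : T} (hx : x ∈ E.base j) :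
    OrthonormalBasis (E.K j) ℂ (E.fiber x) :=
  OrthonormalBasis.mk (E.orthonormal j x hx) (E.span j x hx).ge

theorem HermBundle.basis_apply {U : Set T} (E : HermBundle U) (j : E.J) {x : T}
    (hx : x ∈ E.base j) (κ : E.K j) : E.basis j hx κ = E.frame j κ x := by
  simp [HermBundle.basis]

theorem HermBundle.finiteDimensional {U : Set T} (E : HermBundle U) {x : T} (hx : x ∈ U) :
    FiniteDimensional ℂ (E.fiber x) := by
  obtain ⟨j, hj⟩ := E.exists_base hx
  exact (E.basis j hj).toBasis.finiteDimensional_of_finite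

theorem HermBundle.ContOn.mono {W : Set T} (hW : W ⊆ V) {E : HermBundle U} {E' : HermBundle U'}
    {φ : ∀ x, E.fiber x →ₗ[ℂ] E'.fiber x} (hφ : E.ContOn E' V φ) : E.ContOn E' W φ :=
  fun i κ j κ' => (hφ i κ j κ').mono
    (inter_subset_inter_left _ (inter_subset_inter_left _ hW))

/-- Near a point, a frame of the middle bundle expresses the matrix of the composite as a product of
matrices with continuous entries. -/
theorem HermBundle.ContOn.comp {E : HermBundle U} {E' : HermBundle U'} {E'' : HermBundle U''}
    (hV : V ⊆ U') {φ : ∀ x, E.fiber x →ₗ[ℂ] E'.fiber x} {χ : ∀ x, E'.fiber x →ₗ[ℂ] E''.fiber x}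
    (hχ : E'.ContOn E'' V χ) (hφ : E.ContOn E' V φ) :
    E.ContOn E'' V fun x => χ x ∘ₗ φ x := by
  intro i κ j κ' x hx
  obtain ⟨l, hl⟩ := E'.exists_base (hV hx.1.1)
  have hmem : V ∩ E.base i ∩ E''.base j ∩ E'.base l ∈ 𝓝[V ∩ E.base i ∩ E''.base j] x :=
    inter_mem_nhdsWithin _ ((E'.isOpen_base l).mem_nhds hl)
  refine ContinuousWithinAt.mono_of_mem_nhdsWithin ?_ hmem
  have h1 : ContinuousOn (fun x => ∑ m, inner ℂ (E'.frame l m x) (φ x (E.frame i κ x)) *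
      inner ℂ (E''.frame j κ' x) (χ x (E'.frame l m x)))
      (V ∩ E.base i ∩ E''.base j ∩ E'.base l) := by
    refine continuousOn_finsetSum _ fun m _ => ContinuousOn.mul ?_ ?_
    · exact (hφ i κ l m).mono fun y hy => ⟨hy.1.1, hy.2⟩
    · exact (hχ l m j κ').mono fun y hy => ⟨⟨hy.1.1.1, hy.2⟩, hy.1.2⟩
  refine (h1.congr fun y hy => ?_) x ⟨hx, hl⟩
  have h2 := (E'.basis l hy.2).sum_repr (φ y (E.frame i κ y))
  conv_lhs => rw [LinearMap.comp_apply, ← h2, map_sum, inner_sum]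
  refine Finset.sum_congr rfl fun m _ => ?_
  rw [map_smul, inner_smul_right, OrthonormalBasis.repr_apply_apply, E'.basis_apply]

theorem HermBundle.ContOn.smul {E : HermBundle U} {E' : HermBundle U'}
    {φ : ∀ x, E.fiber x →ₗ[ℂ] E'.fiber x} (hφ : E.ContOn E' V φ) {z : T → ℂ}
    (hz : ContinuousOn z V) : E.ContOn E' V fun x => z x • φ x := by
  intro i κ j κ'
  refine ((hz.mono fun y hy => hy.1.1).mul (hφ i κ j κ')).congr fun y _ => ?_
  rw [LinearMap.smul_apply, inner_smul_right]
  rfl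

theorem HermBundle.ContOn.id (E : HermBundle U) : E.ContOn E V fun _ => LinearMap.id :=
  fun i κ j κ' => (E.transition j i κ' κ).mono fun _ hy => ⟨hy.2, hy.1.2⟩

theorem HermBundle.ContOn.zero (E : HermBundle U) (E' : HermBundle U') :
    E.ContOn E' V fun _ => 0 := fun i κ j κ' => by
  simp only [LinearMap.zero_apply, inner_zero_right]
  exact continuousOn_const

theorem HFObj.IsHom.mono {W : Set T} (hW : W ⊆ V) {φ : ∀ x, A.fiber x →ₗ[ℂ] B.fiber x}
    (hφ : A.IsHom B V φ) : A.IsHom B W φ :=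
  ⟨hφ.cont.mono hW, fun x hx => hφ.even x (hW hx), fun x hx => hφ.comm x (hW hx)⟩

theorem HFObj.IsHom.comp (hV : V ⊆ U') {φ : ∀ x, A.fiber x →ₗ[ℂ] B.fiber x}
    {χ : ∀ x, B.fiber x →ₗ[ℂ] C.fiber x} (hχ : B.IsHom C V χ) (hφ : A.IsHom B V φ) :
    A.IsHom C V fun x => χ x ∘ₗ φ x where
  cont := hχ.cont.comp hV hφ.cont
  even x hx ξ := by
    rw [LinearMap.comp_apply, LinearMap.comp_apply, hφ.even x hx, hχ.even x hx]
  comm x hx ξ := by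
    rw [LinearMap.comp_apply, LinearMap.comp_apply, hφ.comm x hx, hχ.comm x hx]

theorem HFObj.IsHom.smul {φ : ∀ x, A.fiber x →ₗ[ℂ] B.fiber x} (hφ : A.IsHom B V φ) {z : T → ℂ}
    (hz : ContinuousOn z V) : A.IsHom B V fun x => z x • φ x where
  cont := hφ.cont.smul hz
  even x hx ξ := by
    rw [LinearMap.smul_apply, LinearMap.smul_apply, hφ.even x hx, map_smul]
  comm x hx ξ := by
    rw [LinearMap.smul_apply, LinearMap.smul_apply, hφ.comm x hx, map_smul]

theorem HFObj.IsHom.id (A : HFObj U) : A.IsHom A V fun _ => LinearMap.id :=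
  ⟨.id _, fun _ _ _ => rfl, fun _ _ _ => rfl⟩

theorem HFObj.IsHom.zero (A : HFObj U) (B : HFObj U') : A.IsHom B V fun _ => 0 :=
  ⟨.zero _ _, fun _ _ _ => by simp, fun _ _ _ => by simp⟩

/-! ### Invertibility of `h` -/

theorem HFObj.bijective_h_iff (A : HFObj U) {x : T} (hx : x ∈ U) :
    Function.Bijective (A.h x) ↔ ∀ ξ, A.h x ξ = 0 → ξ = 0 := by
  have := A.finiteDimensional hx
  have h1 : Function.Injective (A.h x) ↔ Function.Surjective (A.h x) :=
    LinearMap.injective_iff_surjective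
  have h2 : Function.Injective (A.h x) ↔ ∀ ξ, A.h x ξ = 0 → ξ = 0 :=
    injective_iff_map_eq_zero _
  rw [← h2]
  exact ⟨fun h => h.1, fun h => ⟨h, h1.1 h⟩⟩

/-- Near a point where `h` is invertible, `h²` has no eigenvalue close to zero. -/
theorem HFObj.eventually_lowSpace_eq_bot (A : HFObj U) {x : T} (hx : x ∈ U)
    (hb : Function.Bijective (A.h x)) :
    ∃ μ : ℝ, 0 < μ ∧ ∀ᶠ y in 𝓝 x, lowSpace (A.h y) μ = ⊥ := by
  classical
  obtain ⟨j, hj⟩ := A.exists_base hx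
  set M : T → Matrix (A.K j) (A.K j) ℂ := fun y =>
    Matrix.of fun κ' κ => inner ℂ (A.frame j κ' y) (A.h y (A.frame j κ y)) with hM
  have hMc : ContinuousOn M (A.base j) := by
    refine continuousOn_pi.2 fun κ' => continuousOn_pi.2 fun κ => ?_
    exact (A.h_cont j κ j κ').mono fun y hy => ⟨⟨A.base_subset j hy, hy⟩, hy⟩
  have hMat : ∀ y (hy : y ∈ A.base j), LinearMap.toMatrix (A.basis j hy).toBasis
      (A.basis j hy).toBasis (A.h y) = M y := by
    intro y hy
    ext κ' κ
    change _ = inner ℂ (A.frame j κ' y) (A.h y (A.frame j κ y))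
    rw [LinearMap.toMatrix_apply, OrthonormalBasis.coe_toBasis,
      OrthonormalBasis.coe_toBasis_repr_apply, OrthonormalBasis.repr_apply_apply, A.basis_apply,
      A.basis_apply]
  -- `D (y, l) = det (h_y² - l)` is continuous and nonzero at `(x, 0)`, hence nonzero for `y` near
  -- `x` and `|l| < μ`; such `l` are not eigenvalues.
  set D : T × ℝ → ℂ := fun q => (M q.1 * M q.1 - (q.2 : ℂ) • (1 : Matrix (A.K j) (A.K j) ℂ)).det
    with hD
  have hDet : ∀ y (hy : y ∈ A.base j) (l : ℝ), D (y, l) =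
      LinearMap.det (A.h y ∘ₗ A.h y - (l : ℂ) • LinearMap.id) := by
    intro y hy l
    rw [← LinearMap.det_toMatrix (A.basis j hy).toBasis, map_sub, map_smul,
      LinearMap.toMatrix_comp _ (A.basis j hy).toBasis, hMat, LinearMap.toMatrix_id]
  have hDc : ContinuousAt D (x, 0) := by
    have h1 : ContinuousAt (fun q : T × ℝ => M q.1) (x, 0) :=
      ContinuousAt.comp (g := M) (f := (Prod.fst : T × ℝ → T))
        (hMc.continuousAt ((A.isOpen_base j).mem_nhds hj)) continuousAt_fst
    have h2 : ContinuousAt (fun q : T × ℝ => M q.1 * M q.1 -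
        (q.2 : ℂ) • (1 : Matrix (A.K j) (A.K j) ℂ)) (x, 0) := by
      have h3 : ContinuousAt (fun q : T × ℝ => (q.2 : ℂ)) (x, 0) :=
        (Complex.continuous_ofReal.comp continuous_snd).continuousAt
      have h4 : ContinuousAt (fun q : T × ℝ => M q.1 * M q.1) (x, 0) :=
        (Continuous.matrix_mul continuous_id continuous_id).continuousAt.comp h1
      exact h4.sub (h3.smul continuousAt_const)
    exact (Continuous.matrix_det continuous_id).continuousAt.comp h2
  have hD0 : D (x, 0) ≠ 0 := by
    have := A.finiteDimensional hx
    rw [hDet x hj, Complex.ofReal_zero, zero_smul, sub_zero]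
    have h1 : IsUnit (A.h x ∘ₗ A.h x) :=
      (Module.End.isUnit_iff _).2 (hb.comp hb)
    exact ((LinearMap.isUnit_iff_isUnit_det _).1 h1).ne_zero
  have hev : ∀ᶠ q in 𝓝 (x, (0 : ℝ)), D q ≠ 0 := hDc.eventually_ne hD0
  rw [nhds_prod_eq, Filter.eventually_prod_iff] at hev
  obtain ⟨p, hp, q, hq, hpq⟩ := hev
  obtain ⟨μ, hμ, hball⟩ := Metric.eventually_nhds_iff.1 hq
  refine ⟨μ, hμ, ?_⟩
  filter_upwards [hp, (A.isOpen_base j).mem_nhds hj] with y hy hyj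
  have hyU := A.base_subset j hyj
  have := A.finiteDimensional hyU
  rw [eq_bot_iff]
  refine lowSpace_le fun l hl ξ hξ => ?_
  rw [Submodule.mem_bot]
  by_contra hne
  -- Since `h` is self-adjoint, `l ‖ξ‖² = ‖hξ‖²`. Thus the one-sided bound `l < μ` defining the low
  -- space already places `l` in the ball of radius `μ`.
  have h0 : 0 ≤ l := by
    have h1 : (inner ℂ (A.h y ξ) (A.h y ξ) : ℂ) = (l : ℂ) * inner ℂ ξ ξ := by
      rw [← A.h_symm y hyU, hξ, inner_smul_left, Complex.conj_ofReal]
    rw [inner_self_eq_norm_sq_to_K, inner_self_eq_norm_sq_to_K] at h1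
    have h2 : ‖A.h y ξ‖ ^ 2 = l * ‖ξ‖ ^ 2 := Complex.ofReal_injective (by push_cast; exact h1)
    by_contra hneg
    have h3 : 0 < ‖ξ‖ ^ 2 := by positivity
    nlinarith [sq_nonneg ‖A.h y ξ‖]
  have hne' := hpq hy (hball (y := l) (by rw [Real.dist_eq, sub_zero, abs_of_nonneg h0]; exact hl))
  rw [hDet y hyj] at hne'
  have h1 : IsUnit (A.h y ∘ₗ A.h y - (l : ℂ) • LinearMap.id) :=
    (LinearMap.isUnit_iff_isUnit_det _).2 (isUnit_iff_ne_zero.2 hne')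
  have h2 := ((Module.End.isUnit_iff _).1 h1).1
  refine hne (h2 ?_)
  rw [map_zero, LinearMap.sub_apply, LinearMap.comp_apply, hξ]
  exact sub_self _

/-- Over the locus where `h` is invertible the low spaces vanish for small `μ`, so the relation `≑`
imposes nothing there. -/
theorem HFObj.eqv_of_bijective (A : HFObj U) (hV : V ⊆ U)
    (hb : ∀ x ∈ V, Function.Bijective (A.h x)) (φ φ' : ∀ x, A.fiber x →ₗ[ℂ] B.fiber x) :
    A.Eqv B V φ φ' := fun x hx => by
  obtain ⟨μ, hμ, hev⟩ := A.eventually_lowSpace_eq_bot (hV hx) (hb x hx)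
  refine ⟨μ, hμ, (hev.filter_mono nhdsWithin_le_nhds).mono fun y hy ξ hξ => ?_⟩
  rw [hy, Submodule.mem_bot] at hξ
  rw [hξ, map_zero, map_zero]

theorem HFObj.eventually_bijective (A : HFObj U) {x : T} (hx : x ∈ U)
    (hb : Function.Bijective (A.h x)) : ∀ᶠ y in 𝓝 x, Function.Bijective (A.h y) := by
  obtain ⟨μ, hμ, hev⟩ := A.eventually_lowSpace_eq_bot hx hb
  filter_upwards [hev, A.isOpen.mem_nhds hx] with y hy hyU
  refine (A.bijective_h_iff hyU).2 fun ξ hξ => ?_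
  rw [← Submodule.mem_bot ℂ, ← hy]
  exact mem_lowSpace_of_map_eq_zero hμ hξ

/-- If `χ φ ≑ z` with `z` a nowhere vanishing function, `h` is invertible in the source
when it is in the target. -/
theorem HFObj.bijective_of_eqv {χ : ∀ x, B.fiber x →ₗ[ℂ] A.fiber x}
    {φ : ∀ x, A.fiber x →ₗ[ℂ] B.fiber x} {ζ : T → Circle}
    (hφ : ∀ x ∈ V, ∀ ξ, φ x (A.h x ξ) = B.h x (φ x ξ))
    (he : A.Eqv A V (fun _ => LinearMap.id) fun x => (ζ x : ℂ) • (χ x ∘ₗ φ x)) {x : T} (hx : x ∈ V)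
    (hxU : x ∈ U) (hb : Function.Bijective (B.h x)) : Function.Bijective (A.h x) := by
  refine (A.bijective_h_iff hxU).2 fun ξ hξ => ?_
  obtain ⟨μ, hμ, hev⟩ := he x hx
  have h1 := hev.self_of_nhdsWithin hx ξ (mem_lowSpace_of_map_eq_zero hμ hξ)
  have h2 : φ x ξ = 0 := hb.1 (by rw [← hφ x hx, hξ, map_zero, map_zero])
  rw [LinearMap.smul_apply, LinearMap.comp_apply, h2, map_zero, smul_zero] at h1
  exact h1

end Hom

/-! ### Local pull-backs of objects of `HF` -/

section PullOn

variable {T T' : Type u} [TopologicalSpace T] [TopologicalSpace T']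

/-- Pull-back of a Hermitian vector bundle to an open set on which the map is continuous. -/
def HermBundle.pullOn (q : T' → T) {U : Set T} {W : Set T'} (hW : IsOpen W)
    (hq : ContinuousOn q W) (hWU : MapsTo q W U) (E : HermBundle U) : HermBundle W where
  fiber t := E.fiber (q t)
  J := E.J
  K := E.K
  base j := W ∩ q ⁻¹' E.base j
  isOpen_base j := hq.isOpen_inter_preimage hW (E.isOpen_base j)
  iUnion_base := by
    rw [← inter_iUnion, ← preimage_iUnion, E.iUnion_base]
    exact inter_eq_left.2 hWU
  frame j κ t := E.frame j κ (q t)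
  orthonormal j t ht := E.orthonormal j (q t) ht.2
  span j t ht := E.span j (q t) ht.2
  transition i j κ κ' :=
    (E.transition i j κ κ').comp (hq.mono fun _ ht => ht.1.1) fun _ ht => ⟨ht.1.2, ht.2.2⟩

theorem HermBundle.ContOn.pullOn {q : T' → T} {U U' V : Set T} {W W' V' : Set T'} {hW : IsOpen W}
    {hq : ContinuousOn q W} {hWU : MapsTo q W U} {hW' : IsOpen W'} {hq' : ContinuousOn q W'}
    {hWU' : MapsTo q W' U'} (hV : MapsTo q V' V) {E : HermBundle U} {E' : HermBundle U'}
    {φ : ∀ x, E.fiber x →ₗ[ℂ] E'.fiber x} (hφ : E.ContOn E' V φ) :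
    (E.pullOn q hW hq hWU).ContOn (E'.pullOn q hW' hq' hWU') V' fun t => φ (q t) := by
  intro i κ j κ'
  exact (hφ i κ j κ').comp (hq.mono fun _ ht => ht.1.2.1)
    fun _ ht => ⟨⟨hV ht.1.1, ht.1.2.2⟩, ht.2.2⟩

/-- Pull-back of an object of `HF` to an open set on which the map is continuous. -/
def HFObj.pullOn (q : T' → T) {U : Set T} {W : Set T'} (hW : IsOpen W)
    (hq : ContinuousOn q W) (hWU : MapsTo q W U) (A : HFObj U) : HFObj W where
  toHermBundle := A.toHermBundle.pullOn q hW hq hWU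
  gr t := A.gr (q t)
  gr_cont := A.gr_cont.pullOn hWU
  gr_gr t ht := A.gr_gr (q t) (hWU ht)
  gr_symm t ht := A.gr_symm (q t) (hWU ht)
  h t := A.h (q t)
  h_cont := A.h_cont.pullOn hWU
  h_symm t ht := A.h_symm (q t) (hWU ht)
  h_odd t ht := A.h_odd (q t) (hWU ht)

theorem HFObj.IsHom.pullOn {q : T' → T} {U U' V : Set T} {W W' V' : Set T'} {hW : IsOpen W}
    {hq : ContinuousOn q W} {hWU : MapsTo q W U} {hW' : IsOpen W'} {hq' : ContinuousOn q W'}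
    {hWU' : MapsTo q W' U'} (hV : MapsTo q V' V) {A : HFObj U} {B : HFObj U'}
    {φ : ∀ x, A.fiber x →ₗ[ℂ] B.fiber x} (hφ : A.IsHom B V φ) :
    (A.pullOn q hW hq hWU).IsHom (B.pullOn q hW' hq' hWU') V' fun t => φ (q t) where
  cont := HermBundle.ContOn.pullOn (hW := hW) (hq := hq) (hWU := hWU) (hW' := hW') (hq' := hq')
    (hWU' := hWU') hV hφ.cont
  even t ht := hφ.even (q t) (hV ht)
  comm t ht := hφ.comm (q t) (hV ht)

theorem HFObj.Eqv.pullOn {q : T' → T} {U U' V : Set T} {W W' V' : Set T'} {hW : IsOpen W}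
    {hq : ContinuousOn q W} {hWU : MapsTo q W U} {hW' : IsOpen W'} {hq' : ContinuousOn q W'}
    {hWU' : MapsTo q W' U'} (hqV : ContinuousOn q V') (hV : MapsTo q V' V) {A : HFObj U}
    {B : HFObj U'} {φ φ' : ∀ x, A.fiber x →ₗ[ℂ] B.fiber x} (hφ : A.Eqv B V φ φ') :
    (A.pullOn q hW hq hWU).Eqv (B.pullOn q hW' hq' hWU') V' (fun t => φ (q t))
      fun t => φ' (q t) := by
  intro t ht
  obtain ⟨μ, hμ, h⟩ := hφ (q t) (hV ht)
  exact ⟨μ, hμ, ((hqV t ht).tendsto_nhdsWithin hV).eventually h⟩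

theorem PairEqv.pullOn {H : Type w} [NormedAddCommGroup H] [InnerProductSpace ℂ H]
    {q : T' → T} {U U' V : Set T} {W W' V' : Set T'} {hW : IsOpen W}
    {hq : ContinuousOn q W} {hWU : MapsTo q W U} {hW' : IsOpen W'} {hq' : ContinuousOn q W'}
    {hWU' : MapsTo q W' U'} (hqV : ContinuousOn q V') (hV : MapsTo q V' V) {A : HFObj U}
    {B : HFObj U'} {g g' : T → UGroup H} {φ φ' : ∀ x, A.fiber x →ₗ[ℂ] B.fiber x}
    (hφ : PairEqv A B V g φ g' φ') :
    PairEqv (A.pullOn q hW hq hWU) (B.pullOn q hW' hq' hWU') V' (fun t => g (q t))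
      (fun t => φ (q t)) (fun t => g' (q t)) fun t => φ' (q t) := by
  obtain ⟨ζ, hc, hg, he⟩ := hφ
  exact ⟨fun t => ζ (q t), hc.comp hqV hV, fun t ht => hg (q t) (hV ht), he.pullOn hqV hV⟩

/-- Restriction of an object of `HF` to a smaller open set. -/
def HFObj.restr {U W : Set T} (hW : IsOpen W) (hWU : W ⊆ U) (A : HFObj U) : HFObj W :=
  A.pullOn id hW continuousOn_id hWU

/-- The zero bundle. -/
def HFObj.zero {U : Set T} (hU : IsOpen U) : HFObj U where
  fiber _ := EuclideanSpace ℂ (Fin 0)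
  J := PUnit
  K _ := Empty
  base _ := U
  isOpen_base _ := hU
  iUnion_base := iUnion_const U
  frame _ κ := κ.elim
  orthonormal _ _ _ := ⟨fun κ => κ.elim, fun κ => κ.elim⟩
  span _ _ _ := Subsingleton.elim _ _
  transition _ _ κ := κ.elim
  gr _ := LinearMap.id
  gr_cont _ κ := κ.elim
  gr_gr _ _ _ := rfl
  gr_symm _ _ _ _ := rfl
  h _ := 0
  h_cont _ κ := κ.elim
  h_symm _ _ ξ η := by simp
  h_odd _ _ _ := Subsingleton.elim _ _

instance {U : Set T} (hU : IsOpen U) (x : T) : Subsingleton ((HFObj.zero hU).fiber x) :=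
  inferInstanceAs (Subsingleton (EuclideanSpace ℂ (Fin 0)))

end PullOn

/-! ### Lifts of transition functions -/

section Lift

variable {H : Type w} [NormedAddCommGroup H] [InnerProductSpace ℂ H]
variable {X : Type u} [TopologicalSpace X] {P : Type v} [TopologicalSpace P]
  [MulAction (PUGroup H)ᵐᵒᵖ P] {T : Type u} [TopologicalSpace T]

/-- `g` is over `V` a continuous lift of the transition function from `s` to `s'`. -/
structure IsLift (V : Set T) (s s' : T → P) (g : T → UGroup H) : Prop where
  cont : ContinuousOn g V
  act : ∀ t ∈ V, MulOpposite.op (g t : PUGroup H) • s t = s' t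

variable {V W : Set T} {s s' s'' : T → P} {g g' : T → UGroup H}

theorem IsLift.mono (h : IsLift V s s' g) (hW : W ⊆ V) : IsLift W s s' g :=
  ⟨h.cont.mono hW, fun t ht => h.act t (hW ht)⟩

theorem IsLift.mul (h : IsLift V s s' g) (h' : IsLift V s' s'' g') :
    IsLift V s s'' fun t => g t * g' t :=
  ⟨h.cont.mul h'.cont, fun t ht => by
    rw [← h'.act t ht, ← h.act t ht, smul_smul, ← MulOpposite.op_mul]
    rfl⟩

theorem IsLift.inv (h : IsLift V s s' g) : IsLift V s' s fun t => (g t)⁻¹ :=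
  ⟨h.cont.inv, fun t ht => by
    rw [← h.act t ht, smul_smul, ← MulOpposite.op_mul, ← QuotientGroup.mk_mul, mul_inv_cancel]
    exact one_smul _ _⟩

theorem IsLift.one (V : Set T) (s : T → P) : IsLift V s s fun _ => (1 : UGroup H) :=
  ⟨continuousOn_const, fun _ _ => one_smul _ _⟩

theorem IsLift.mk_eq {π : P → X} (hπ : IsPrincipalBundle (PUGroup H) π) (h : IsLift V s s' g)
    (h' : IsLift V s s' g') {t : T} (ht : t ∈ V) : (g t : PUGroup H) = g' t :=
  hπ.act_injective ((h.act t ht).trans (h'.act t ht).symm)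

/-- The action on `P` is free, so two lifts between the same sections agree in `PU(H)` and differ by
a continuous scalar. -/
theorem IsLift.pairEqv [InfiniteDimensional H] {π : P → X}
    (hπ : IsPrincipalBundle (PUGroup H) π) (h : IsLift V s s' g)
    (h' : IsLift V s s' g') {U U' : Set T} {A : HFObj U} {B : HFObj U'}
    {φ φ' : ∀ x, A.fiber x →ₗ[ℂ] B.fiber x}
    (he : A.Eqv B V φ' fun x => (UGroup.ratio (g x) (g' x) : ℂ) • φ x) :
    PairEqv A B V g φ g' φ' :=
  .of_class h.cont h'.cont (fun _ hx => h.mk_eq hπ h' hx) he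

variable {π : P → X} {f : C(T, X)}

theorem Twist.isLift (τ : Twist H π f) (a b : τ.ι) :
    IsLift (τ.U a ∩ τ.U b) (τ.s a) (τ.s b) (τ.g a b) :=
  ⟨τ.g_cont a b, τ.g_lift a b⟩

theorem Twist.exists_mem (τ : Twist H π f) (t : T) : ∃ a, t ∈ τ.U a := by
  rw [← mem_iUnion, τ.iUnion_U]
  trivial

/-- The cocycle relation says `Φ_{aa} Φ_{aa} = Φ_{aa}` and the inverse relation says `Φ_{aa} Φ_{aa}
= 1`. -/
theorem Vectorial.φ_self {τ : Twist H π f} (A : Vectorial τ) (a : τ.ι) :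
    PairEqv (A.E a) (A.E a) (τ.U a) (τ.g a a) (A.φ a a) 1 fun _ => LinearMap.id :=
  ((A.φ_comp a a a).symm.mono (by simp)).trans ((A.φ_inv a a).mono (by simp))

/-- The zero object with a given twisting part. -/
def Vectorial.zero [InfiniteDimensional H] (hπ : IsPrincipalBundle (PUGroup H) π)
    (τ : Twist H π f) : Vectorial τ where
  E a := HFObj.zero (τ.isOpen_U a)
  φ _ _ _ := LinearMap.id
  φ_hom a b := ⟨fun _ κ => κ.elim, fun _ _ _ => rfl, fun _ _ _ => rfl⟩
  φ_inv a b := ((τ.isLift a b).mul ((τ.isLift b a).mono fun _ ht => ⟨ht.2, ht.1⟩)).pairEqv hπ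
    (.one _ _) (.of_eqOn fun x _ => LinearMap.ext fun ξ => Subsingleton.elim (α := (HFObj.zero (τ.isOpen_U a)).fiber x) _ _)
  φ_comp a b c := (((τ.isLift a b).mono fun _ ht => ht.1).mul
    ((τ.isLift b c).mono fun _ ht => ⟨ht.1.2, ht.2⟩)).pairEqv hπ
    ((τ.isLift a c).mono fun _ ht => ⟨ht.1.1, ht.2⟩)
    (.of_eqOn fun x _ => LinearMap.ext fun ξ => Subsingleton.elim (α := (HFObj.zero (τ.isOpen_U a)).fiber x) _ _)

/-! ### The support -/

theorem Vectorial.bijective_h_iff {τ : Twist H π f} (A : Vectorial τ) {a b : τ.ι} {t : T}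
    (ha : t ∈ τ.U a) (hb : t ∈ τ.U b) :
    Function.Bijective ((A.E a).h t) ↔ Function.Bijective ((A.E b).h t) := by
  have key : ∀ {a b : τ.ι}, t ∈ τ.U a → t ∈ τ.U b →
      Function.Bijective ((A.E b).h t) → Function.Bijective ((A.E a).h t) := by
    intro a b ha hb h
    obtain ⟨ζ, -, -, he⟩ := A.φ_inv a b
    exact HFObj.bijective_of_eqv (V := τ.U a ∩ τ.U b)
      (fun x hx => (A.φ_hom b a).comm x ⟨hx.2, hx.1⟩) he ⟨ha, hb⟩ ha h
  exact ⟨key hb ha, key ha hb⟩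

/-- Invertibility of `h` is an open condition and does not depend on the chart, so the closure in
the definition of the support adds no points. -/
theorem Vectorial.notMem_supp_iff {τ : Twist H π f} (A : Vectorial τ) {a : τ.ι} {t : T}
    (ha : t ∈ τ.U a) : t ∉ A.supp ↔ Function.Bijective ((A.E a).h t) := by
  constructor
  · intro h
    by_contra hn
    exact h (subset_closure ⟨a, ha, hn⟩)
  · intro h hmem
    have hev := (A.E a).eventually_bijective ha h
    obtain ⟨y, ⟨hy, hya⟩, b, hb, hnb⟩ := mem_closure_iff_nhds.1 hmem _
      (hev.and ((τ.isOpen_U a).mem_nhds ha))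
    exact hnb ((A.bijective_h_iff hya hb).1 hy)

theorem TVB.notMem_supp_iff (A : TVB H π f) {a : A.twist.ι} {t : T} (ha : t ∈ A.twist.U a) :
    t ∉ A.supp ↔ Function.Bijective ((A.vect.E a).h t) :=
  A.vect.notMem_supp_iff ha

theorem TVB.supp_pull_eq {T' : Type u} [TopologicalSpace T'] {f' : C(T', X)} (q : C(T', T))
    (hq : ∀ t, f' t = f (q t)) (A : TVB H π f) : (A.pull q hq).supp = q ⁻¹' A.supp := by
  ext t
  obtain ⟨a, ha⟩ := A.twist.exists_mem (q t)
  exact not_iff_not.1 (((A.pull q hq).notMem_supp_iff (a := a) ha).trans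
    (A.notMem_supp_iff ha).symm)

theorem Vectorial.supp_zero [InfiniteDimensional H] (hπ : IsPrincipalBundle (PUGroup H) π)
    (τ : Twist H π f) : (Vectorial.zero hπ τ).supp = ∅ := by
  refine eq_empty_of_forall_notMem fun t => ?_
  obtain ⟨a, ha⟩ := τ.exists_mem t
  refine ((Vectorial.zero hπ τ).notMem_supp_iff ha).2 ?_
  exact ⟨fun ξ η _ => Subsingleton.elim (α := (HFObj.zero (τ.isOpen_U a)).fiber t) _ _,
    fun η => ⟨0, Subsingleton.elim (α := (HFObj.zero (τ.isOpen_U a)).fiber t) _ _⟩⟩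

/-! ### Isomorphisms and refinements -/

theorem TVB.Iso.refl (A : TVB H π f) : A.Iso A := by
  have h : A.IsMorphism A A.twist.g A.vect.φ :=
    ⟨A.twist.g_cont, A.twist.g_lift, fun b a => A.vect.φ_hom b a,
      fun b a a' => A.vect.φ_comp b a a', fun b b' a => A.vect.φ_comp b b' a⟩
  exact ⟨_, _, _, _, h, h, fun a b a' => A.vect.φ_comp a b a', fun a b a' => A.vect.φ_comp a b a'⟩

theorem TVB.Iso.symm {A B : TVB H π f} (h : A.Iso B) : B.Iso A := by
  obtain ⟨k, ψ, k', ψ', h1, h2, h3, h4⟩ := h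
  exact ⟨k', ψ', k, ψ, h2, h1, h4, h3⟩

theorem TVB.IsMorphism.isLift {A B : TVB H π f} {k : B.twist.ι → A.twist.ι → T → UGroup H}
    {ψ : ∀ b a x, ((A.vect.E a).fiber x) →ₗ[ℂ] ((B.vect.E b).fiber x)}
    (h : A.IsMorphism B k ψ) (b : B.twist.ι) (a : A.twist.ι) :
    IsLift (B.twist.U b ∩ A.twist.U a) (B.twist.s b) (A.twist.s a) (k b a) :=
  ⟨h.k_cont b a, h.k_lift b a⟩

/-- A kernel vector of `h` lies in every low space, where an isomorphism followed by its inverse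
acts as a unit scalar after normalising with `φ_self`; so it cannot be killed by passing to a point
where the other `h` is invertible. -/
theorem TVB.Iso.supp_eq {A B : TVB H π f} (h : A.Iso B) : A.supp = B.supp := by
  have key : ∀ {A B : TVB H π f}, A.Iso B → A.supp ⊆ B.supp := by
    rintro A B ⟨k, ψ, k', ψ', h1, h2, h3, h4⟩ t ht
    by_contra htB
    obtain ⟨a, ha⟩ := A.twist.exists_mem t
    obtain ⟨b, hb⟩ := B.twist.exists_mem t
    refine absurd ht ((A.notMem_supp_iff ha).2 ?_)
    have h5 := (h3 a b a).trans ((A.vect.φ_self a).mono inter_subset_right)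
    have hW : A.twist.U a ∩ B.twist.U b ⊆ A.twist.U a ∩ B.twist.U b ∩ A.twist.U a :=
      fun x hx => ⟨hx, hx.1⟩
    obtain ⟨ζ, -, -, he⟩ := h5.mono hW
    exact HFObj.bijective_of_eqv (V := A.twist.U a ∩ B.twist.U b)
      (fun x hx => (h1.ψ_hom b a).comm x ⟨hx.2, hx.1⟩) he ⟨ha, hb⟩ ha
      ((B.notMem_supp_iff hb).1 htB)
  exact (key h).antisymm (key h.symm)

/-- The constant homotopy on `A` works, since the ends of a homotopy only have to be isomorphic to
the given objects. -/
theorem RelTVB.Homotopic.of_iso {S : Set T} {A B : RelTVB H π f S} (h : A.1.Iso B.1) :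
    A.Homotopic B :=
  ⟨RelTVB.pull (f := f) (f' := f.comp ContinuousMap.fst) ContinuousMap.fst (fun _ => rfl)
    (fun _ ht => ht.1) A, TVB.Iso.refl A.1, h⟩

theorem KF.mk_eq_of_iso {S : Set T} {A B : RelTVB H π f S} (h : A.1.Iso B.1) :
    KF.mk A = KF.mk B :=
  Quot.sound (.of_iso h)

/-- A refinement `B` of `A`: every chart of `B` is contained in a chart of `A`, over which the
two objects are identified, compatibly with the transition maps. -/
structure TVB.Refinement (B A : TVB H π f) where
  ρ : B.twist.ι → A.twist.ι
  sub : ∀ i, B.twist.U i ⊆ A.twist.U (ρ i)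
  c : B.twist.ι → T → UGroup H
  lift : ∀ i, IsLift (B.twist.U i) (A.twist.s (ρ i)) (B.twist.s i) (c i)
  θ : ∀ i x, (B.vect.E i).fiber x →ₗ[ℂ] (A.vect.E (ρ i)).fiber x
  θ' : ∀ i x, (A.vect.E (ρ i)).fiber x →ₗ[ℂ] (B.vect.E i).fiber x
  θ_hom : ∀ i, (B.vect.E i).IsHom (A.vect.E (ρ i)) (B.twist.U i) (θ i)
  θ'_hom : ∀ i, (A.vect.E (ρ i)).IsHom (B.vect.E i) (B.twist.U i) (θ' i)
  θ'_θ : ∀ i, (B.vect.E i).Eqv (B.vect.E i) (B.twist.U i) (fun x => θ' i x ∘ₗ θ i x)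
    fun _ => LinearMap.id
  θ_θ' : ∀ i, (A.vect.E (ρ i)).Eqv (A.vect.E (ρ i)) (B.twist.U i) (fun x => θ i x ∘ₗ θ' i x)
    fun _ => LinearMap.id
  compat : ∀ i j, PairEqv (B.vect.E j) (A.vect.E (ρ i)) (B.twist.U i ∩ B.twist.U j)
    (fun x => c i x * B.twist.g i j x) (fun x => θ i x ∘ₗ B.vect.φ i j x)
    (fun x => A.twist.g (ρ i) (ρ j) x * c j x) (fun x => A.vect.φ (ρ i) (ρ j) x ∘ₗ θ j x)

end Lift

theorem PairEqv.of_eqv {H : Type w} [NormedAddCommGroup H] [InnerProductSpace ℂ H]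
    {T : Type u} [TopologicalSpace T] {U U' : Set T} {A : HFObj U} {B : HFObj U'}
    {V : Set T} {g g' : T → UGroup H} {φ φ' : ∀ x, A.fiber x →ₗ[ℂ] B.fiber x}
    (hg : ∀ x ∈ V, g x = g' x) (h : A.Eqv B V φ φ') : PairEqv A B V g φ g' φ' :=
  ⟨fun _ => 1, continuousOn_const, fun x hx ξ => by rw [hg x hx, Circle.coe_one, one_smul],
    h.symm.trans (.of_eqOn fun x _ => by rw [Circle.coe_one, one_smul])⟩

theorem PairEqv.on {H : Type w} [NormedAddCommGroup H] [InnerProductSpace ℂ H]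
    {T : Type u} [TopologicalSpace T] {U U' : Set T} {A : HFObj U} {B : HFObj U'}
    {V : Set T} {g g' : T → UGroup H} {φ φ' : ∀ x, A.fiber x →ₗ[ℂ] B.fiber x}
    (h : PairEqv A B V g φ g' φ') {W : Set T} (hW : W ⊆ V) : PairEqv A B W g φ g' φ' :=
  h.mono hW

theorem HFObj.Eqv.on {T : Type u} [TopologicalSpace T] {U U' : Set T} {A : HFObj U}
    {B : HFObj U'} {V : Set T} {φ φ' : ∀ x, A.fiber x →ₗ[ℂ] B.fiber x}
    (h : A.Eqv B V φ φ') {W : Set T} (hW : W ⊆ V) : A.Eqv B W φ φ' :=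
  h.mono hW

/-! ### Isomorphisms along refinements, and common refinements of twisting parts. -/

section Refinement

variable {H : Type w} [NormedAddCommGroup H] [InnerProductSpace ℂ H]
variable {X : Type u} [TopologicalSpace X] {P : Type v} [TopologicalSpace P]
  [MulAction (PUGroup H)ᵐᵒᵖ P] {T : Type u} [TopologicalSpace T] {π : P → X} {f : C(T, X)}

/-- The square `compat`, composed with `θ'` on both sides and simplified by `θ' θ ≑ 1` and `θ θ' ≑
1`, is the corresponding square for the inverse maps. -/
theorem TVB.Refinement.compat' {A B : TVB H π f} (r : B.Refinement A) (i j : B.twist.ι) :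
    PairEqv (A.vect.E (r.ρ j)) (B.vect.E i) (B.twist.U i ∩ B.twist.U j)
      (fun x => B.twist.g i j x * (r.c j x)⁻¹) (fun x => B.vect.φ i j x ∘ₗ r.θ' j x)
      (fun x => (r.c i x)⁻¹ * A.twist.g (r.ρ i) (r.ρ j) x)
      (fun x => r.θ' i x ∘ₗ A.vect.φ (r.ρ i) (r.ρ j) x) := by
  have hθ' : (A.vect.E (r.ρ j)).IsHom (B.vect.E j) (B.twist.U i ∩ B.twist.U j) (r.θ' j) :=
    (r.θ'_hom j).mono inter_subset_right
  have h1 := ((r.compat i j).comp_left (fun x => (r.c i x)⁻¹) (r.θ' i)).comp_right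
    (fun x => (r.c j x)⁻¹) hθ'.comm
  have hφθ : (A.vect.E (r.ρ j)).IsHom (B.vect.E i) (B.twist.U i ∩ B.twist.U j)
      (fun x => B.vect.φ i j x ∘ₗ r.θ' j x) :=
    (B.vect.φ_hom i j).comp inter_subset_right hθ'
  refine PairEqv.trans (PairEqv.of_eqv (fun x _ => ?_) ?_) (h1.trans
    (PairEqv.of_eqv (fun x _ => ?_) ?_))
  · simp only [inv_mul_cancel_left]
  · exact (((r.θ'_θ i).mono inter_subset_left).comp_right hφθ.comm).symm
  · simp only [mul_assoc, mul_inv_cancel, mul_one]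
  · exact ((r.θ_θ' j).mono inter_subset_right).comp_left
      (fun x => r.θ' i x ∘ₗ A.vect.φ (r.ρ i) (r.ρ j) x)

/-- An isomorphism from `A` restricts to every refinement of `A`. -/
theorem TVB.Iso.of_refinement {A B C : TVB H π f} (r : B.Refinement A) (h : A.Iso C) :
    B.Iso C := by
  obtain ⟨k, ψ, k', ψ', h1, h2, h3, h4⟩ := h
  refine ⟨fun c i x => k c (r.ρ i) x * r.c i x, fun c i x => ψ c (r.ρ i) x ∘ₗ r.θ i x,
    fun i c x => (r.c i x)⁻¹ * k' (r.ρ i) c x, fun i c x => r.θ' i x ∘ₗ ψ' (r.ρ i) c x,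
    ?_, ?_, ?_, ?_⟩
  · have hl : ∀ c i, IsLift (C.twist.U c ∩ B.twist.U i) (C.twist.s c) (B.twist.s i)
        fun x => k c (r.ρ i) x * r.c i x := fun c i =>
      ((h1.isLift c (r.ρ i)).mono (inter_subset_inter_right _ (r.sub i))).mul
        ((r.lift i).mono inter_subset_right)
    refine ⟨fun c i => (hl c i).cont, fun c i => (hl c i).act, fun c i => ?_, fun c i j => ?_,
      fun c c' i => ?_⟩
    · exact ((h1.ψ_hom c (r.ρ i)).mono (inter_subset_inter_right _ (r.sub i))).comp
        (fun x hx => r.sub i hx.2) ((r.θ_hom i).mono inter_subset_right)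
    · have e1 := ((r.compat i j).on (W := C.twist.U c ∩ B.twist.U i ∩ B.twist.U j)
        fun x hx => ⟨hx.1.2, hx.2⟩).comp_left (k c (r.ρ i)) (ψ c (r.ρ i))
      have e2 := ((h1.comp_source c (r.ρ i) (r.ρ j)).on
        (W := C.twist.U c ∩ B.twist.U i ∩ B.twist.U j)
        fun x hx => ⟨⟨hx.1.1, r.sub i hx.1.2⟩, r.sub j hx.2⟩).comp_right (r.c j) (χ := r.θ j)
          fun x hx => (r.θ_hom j).comm x hx.2
      simp only [mul_assoc] at e1 e2 ⊢
      exact e1.trans e2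
    · have e2 := ((h1.comp_target c c' (r.ρ i)).on
        (W := C.twist.U c ∩ C.twist.U c' ∩ B.twist.U i)
        fun x hx => ⟨hx.1, r.sub i hx.2⟩).comp_right (r.c i) (χ := r.θ i)
          fun x hx => (r.θ_hom i).comm x hx.2
      simp only [mul_assoc] at e2 ⊢
      exact e2
  · have hl : ∀ i c, IsLift (B.twist.U i ∩ C.twist.U c) (B.twist.s i) (C.twist.s c)
        fun x => (r.c i x)⁻¹ * k' (r.ρ i) c x := fun i c =>
      ((r.lift i).inv.mono inter_subset_left).mul
        ((h2.isLift (r.ρ i) c).mono (inter_subset_inter_left _ (r.sub i)))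
    refine ⟨fun i c => (hl i c).cont, fun i c => (hl i c).act, fun i c => ?_, fun i c c' => ?_,
      fun i j c => ?_⟩
    · exact ((r.θ'_hom i).mono inter_subset_left).comp
        (fun x hx => r.sub i hx.1) ((h2.ψ_hom (r.ρ i) c).mono
          (inter_subset_inter_left _ (r.sub i)))
    · have e1 := ((h2.comp_source (r.ρ i) c c').on
        (W := B.twist.U i ∩ C.twist.U c ∩ C.twist.U c')
        fun x hx => ⟨⟨r.sub i hx.1.1, hx.1.2⟩, hx.2⟩).comp_left (fun x => (r.c i x)⁻¹) (r.θ' i)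
      simp only [mul_assoc] at e1 ⊢
      exact e1
    · have e1 := ((r.compat' i j).on (W := B.twist.U i ∩ B.twist.U j ∩ C.twist.U c)
        fun x hx => hx.1).comp_right (k' (r.ρ j) c) (χ := ψ' (r.ρ j) c)
          fun x hx => (h2.ψ_hom (r.ρ j) c).comm x ⟨r.sub j hx.1.2, hx.2⟩
      have e2 := ((h2.comp_target (r.ρ i) (r.ρ j) c).on
        (W := B.twist.U i ∩ B.twist.U j ∩ C.twist.U c)
        fun x hx => ⟨⟨r.sub i hx.1.1, r.sub j hx.1.2⟩, hx.2⟩).comp_left (fun x => (r.c i x)⁻¹)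
          (r.θ' i)
      simp only [mul_assoc] at e1 e2 ⊢
      exact e1.trans e2
  · intro i c j
    have e1 := (((h3 (r.ρ i) c (r.ρ j)).on (W := B.twist.U i ∩ C.twist.U c ∩ B.twist.U j)
      fun x hx => ⟨⟨r.sub i hx.1.1, hx.1.2⟩, r.sub j hx.2⟩).comp_left (fun x => (r.c i x)⁻¹)
        (r.θ' i)).comp_right (r.c j) (χ := r.θ j) fun x hx => (r.θ_hom j).comm x hx.2
    have e2 := (((r.compat i j).on (W := B.twist.U i ∩ C.twist.U c ∩ B.twist.U j)
      fun x hx => ⟨hx.1.1, hx.2⟩).comp_left (fun x => (r.c i x)⁻¹) (r.θ' i)).symm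
    have e3 : (B.vect.E j).Eqv (B.vect.E i) (B.twist.U i ∩ C.twist.U c ∩ B.twist.U j)
        (fun x => (r.θ' i x ∘ₗ r.θ i x) ∘ₗ B.vect.φ i j x) (B.vect.φ i j) :=
      ((r.θ'_θ i).on fun x hx => hx.1.1).comp_right
        fun x hx => (B.vect.φ_hom i j).comm x ⟨hx.1.1, hx.2⟩
    have e4 := PairEqv.of_eqv (H := H) (g := B.twist.g i j) (g' := B.twist.g i j)
      (fun _ _ => rfl) e3
    simp only [mul_assoc, inv_mul_cancel_left] at e1 e2 e4 ⊢
    exact e1.trans (e2.trans e4)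
  · intro c i c'
    have e1 := (h4 c (r.ρ i) c').on (W := C.twist.U c ∩ B.twist.U i ∩ C.twist.U c')
      fun x hx => ⟨⟨hx.1.1, r.sub i hx.1.2⟩, hx.2⟩
    have e2 : (C.vect.E c').Eqv (A.vect.E (r.ρ i)) (C.twist.U c ∩ B.twist.U i ∩ C.twist.U c')
        (fun x => (r.θ i x ∘ₗ r.θ' i x) ∘ₗ ψ' (r.ρ i) c' x) (ψ' (r.ρ i) c') :=
      ((r.θ_θ' i).on fun x hx => hx.1.2).comp_right
        fun x hx => (h2.ψ_hom (r.ρ i) c').comm x ⟨r.sub i hx.1.2, hx.2⟩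
    have e3 := PairEqv.of_eqv (H := H) (g := fun x => k c (r.ρ i) x * k' (r.ρ i) c' x)
      (fun _ _ => rfl) (e2.comp_left (ψ c (r.ρ i)))
    simp only [mul_assoc, mul_inv_cancel_left] at e1 e3 ⊢
    exact e3.trans e1

theorem TVB.Refinement.iso {A B : TVB H π f} (r : B.Refinement A) : B.Iso A :=
  (TVB.Iso.refl A).of_refinement r

/-- A refinement of the twisting part. -/
structure Twist.Ref (τ₁ τ : Twist H π f) where
  ρ : τ₁.ι → τ.ι
  sub : ∀ i, τ₁.U i ⊆ τ.U (ρ i)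
  c : τ₁.ι → T → UGroup H
  lift : ∀ i, IsLift (τ₁.U i) (τ.s (ρ i)) (τ₁.s i) (c i)

variable [InfiniteDimensional H]

/-- The lifts of the transition functions transported along a refinement. -/
def Twist.Ref.g' {τ₁ τ : Twist H π f} (r : τ₁.Ref τ) (i j : τ₁.ι) (x : T) : UGroup H :=
  (r.c i x)⁻¹ * τ.g (r.ρ i) (r.ρ j) x * r.c j x

theorem Twist.Ref.isLift {τ₁ τ : Twist H π f} (r : τ₁.Ref τ) (i j : τ₁.ι) :
    IsLift (τ₁.U i ∩ τ₁.U j) (τ₁.s i) (τ₁.s j) (r.g' i j) :=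
  (((r.lift i).inv.mono inter_subset_left).mul ((τ.isLift (r.ρ i) (r.ρ j)).mono
    (inter_subset_inter (r.sub i) (r.sub j)))).mul ((r.lift j).mono inter_subset_right)

/-- The transition maps transported along a refinement of the twisting part. -/
def Vectorial.refineφ {τ₁ τ : Twist H π f} (r : τ₁.Ref τ) (A : Vectorial τ) (i j : τ₁.ι) (x : T) :
    (A.E (r.ρ j)).fiber x →ₗ[ℂ] (A.E (r.ρ i)).fiber x :=
  (UGroup.ratio (r.g' i j x) (τ₁.g i j x) : ℂ) • A.φ (r.ρ i) (r.ρ j) x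

/-- The refined cover comes with its own lifts `τ₁.g`, which differ from the transported ones `r.g'`
by a scalar. Rescaling `φ` by that scalar keeps the class of the pair. -/
theorem Vectorial.refineφ_pairEqv (hπ : IsPrincipalBundle (PUGroup H) π) {τ₁ τ : Twist H π f}
    (r : τ₁.Ref τ) (A : Vectorial τ) (i j : τ₁.ι) :
    PairEqv (A.E (r.ρ j)) (A.E (r.ρ i)) (τ₁.U i ∩ τ₁.U j) (r.g' i j) (A.φ (r.ρ i) (r.ρ j))
      (τ₁.g i j) (A.refineφ r i j) :=
  (r.isLift i j).pairEqv hπ (τ₁.isLift i j) (.of_eqOn fun _ _ => rfl)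

theorem Vectorial.refineφ_hom (hπ : IsPrincipalBundle (PUGroup H) π) {τ₁ τ : Twist H π f}
    (r : τ₁.Ref τ) (A : Vectorial τ) (i j : τ₁.ι) :
    (A.E (r.ρ j)).IsHom (A.E (r.ρ i)) (τ₁.U i ∩ τ₁.U j) (A.refineφ r i j) :=
  ((A.φ_hom (r.ρ i) (r.ρ j)).mono (inter_subset_inter (r.sub i) (r.sub j))).smul
    (continuous_induced_dom.comp_continuousOn (UGroup.continuousOn_ratio (r.isLift i j).cont
      (τ₁.isLift i j).cont fun x hx => (r.isLift i j).mk_eq hπ (τ₁.isLift i j) hx))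

/-- The object obtained from `A` along a refinement of its twisting part. -/
def Vectorial.refine (hπ : IsPrincipalBundle (PUGroup H) π) {τ₁ τ : Twist H π f} (r : τ₁.Ref τ)
    (A : Vectorial τ) : Vectorial τ₁ where
  E i := (A.E (r.ρ i)).restr (τ₁.isOpen_U i) (r.sub i)
  φ i j x := A.refineφ r i j x
  φ_hom i j := by
    have h := A.refineφ_hom hπ r i j
    exact ⟨(HermBundle.ContOn.pullOn (q := id) (V' := τ₁.U i ∩ τ₁.U j) (hW := τ₁.isOpen_U j)
      (hq := continuousOn_id) (hWU := r.sub j) (hW' := τ₁.isOpen_U i) (hq' := continuousOn_id)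
      (hWU' := r.sub i) (fun _ hx => hx) h.cont),
      h.even, h.comm⟩
  φ_inv i j := by
    have e1 := (A.refineφ_pairEqv hπ r i j).symm.comp
      ((A.refineφ_pairEqv hπ r j i).symm.on (W := τ₁.U i ∩ τ₁.U j) fun x hx => ⟨hx.2, hx.1⟩)
      fun x hx => (A.φ_hom (r.ρ j) (r.ρ i)).comm x ⟨r.sub j hx.2, r.sub i hx.1⟩
    have e2 := (((A.φ_inv (r.ρ i) (r.ρ j)).on (W := τ₁.U i ∩ τ₁.U j)
      (inter_subset_inter (r.sub i) (r.sub j))).comp_left (C := A.E (r.ρ i))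
        (fun x => (r.c i x)⁻¹) fun _ => LinearMap.id).comp_right (A := A.E (r.ρ i)) (r.c i)
        (χ := fun _ => LinearMap.id) fun _ _ _ => rfl
    simp only [Twist.Ref.g', mul_assoc, mul_inv_cancel_left, Pi.one_apply, one_mul,
      inv_mul_cancel] at e1 e2 ⊢
    exact e1.trans e2
  φ_comp i j k := by
    have e1 := ((A.refineφ_pairEqv hπ r i j).symm.on (W := τ₁.U i ∩ τ₁.U j ∩ τ₁.U k)
      fun x hx => hx.1).comp ((A.refineφ_pairEqv hπ r j k).symm.on
        (W := τ₁.U i ∩ τ₁.U j ∩ τ₁.U k) fun x hx => ⟨hx.1.2, hx.2⟩)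
      fun x hx => (A.φ_hom (r.ρ j) (r.ρ k)).comm x ⟨r.sub j hx.1.2, r.sub k hx.2⟩
    have e2 := (((A.φ_comp (r.ρ i) (r.ρ j) (r.ρ k)).on (W := τ₁.U i ∩ τ₁.U j ∩ τ₁.U k)
      fun x hx => ⟨⟨r.sub i hx.1.1, r.sub j hx.1.2⟩, r.sub k hx.2⟩).comp_left
        (C := A.E (r.ρ i)) (fun x => (r.c i x)⁻¹) fun _ => LinearMap.id).comp_right
        (A := A.E (r.ρ k)) (r.c k) (χ := fun _ => LinearMap.id) fun _ _ _ => rfl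
    have e3 := (A.refineφ_pairEqv hπ r i k).on (W := τ₁.U i ∩ τ₁.U j ∩ τ₁.U k)
      fun x hx => ⟨hx.1.1, hx.2⟩
    simp only [Twist.Ref.g', mul_assoc, mul_inv_cancel_left] at e1 e2 e3 ⊢
    exact e1.trans (e2.trans e3)

/-- The refined object is a refinement of the given one. -/
def Vectorial.refineRefinement (hπ : IsPrincipalBundle (PUGroup H) π) {τ₁ τ : Twist H π f}
    (r : τ₁.Ref τ) (A : Vectorial τ) :
    TVB.Refinement (⟨τ₁, A.refine hπ r⟩ : TVB H π f) ⟨τ, A⟩ where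
  ρ := r.ρ
  sub := r.sub
  c := r.c
  lift := r.lift
  θ _ _ := LinearMap.id
  θ' _ _ := LinearMap.id
  θ_hom i := ⟨fun a κ b κ' => ((A.E (r.ρ i)).transition b a κ' κ).mono
    fun x hx => ⟨hx.2, hx.1.2.2⟩, fun _ _ _ => rfl, fun _ _ _ => rfl⟩
  θ'_hom i := ⟨fun a κ b κ' => ((A.E (r.ρ i)).transition b a κ' κ).mono
    fun x hx => ⟨hx.2.2, hx.1.2⟩, fun _ _ _ => rfl, fun _ _ _ => rfl⟩
  θ'_θ _ := .of_eqOn fun _ _ => rfl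
  θ_θ' _ := .of_eqOn fun _ _ => rfl
  compat i j := by
    have e1 := (A.refineφ_pairEqv hπ r i j).symm.comp_left (C := A.E (r.ρ i)) (r.c i)
      fun _ => LinearMap.id
    simp only [Twist.Ref.g', mul_assoc, mul_inv_cancel_left] at e1
    exact e1

/-- Two twisting parts over the same space have a common refinement. -/
theorem Twist.exists_common_ref (hπ : IsPrincipalBundle (PUGroup H) π) (τ τ' : Twist H π f) :
    ∃ τ₁ : Twist H π f, Nonempty (τ₁.Ref τ) ∧ Nonempty (τ₁.Ref τ') := by
  have key : ∀ t : T, ∃ (a : τ.ι) (b : τ'.ι) (W : Set T) (k : T → UGroup H), IsOpen W ∧ t ∈ W ∧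
      W ⊆ τ.U a ∧ W ⊆ τ'.U b ∧ IsLift W (τ'.s b) (τ.s a) k := by
    intro t
    obtain ⟨a, ha⟩ := τ.exists_mem t
    obtain ⟨b, hb⟩ := τ'.exists_mem t
    have hproj : ∀ x ∈ τ.U a ∩ τ'.U b, π (τ'.s b x) = π (τ.s a x) := fun x hx =>
      (τ'.proj_s b x hx.2).trans (τ.proj_s a x hx.1).symm
    have hγ : ContinuousOn (fun x => transl (PUGroup H) (τ'.s b x) (τ.s a x))
        (τ.U a ∩ τ'.U b) :=
      hπ.continuousOn_transl.comp (((τ'.s_cont b).mono inter_subset_right).prodMk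
        ((τ.s_cont a).mono inter_subset_left)) hproj
    obtain ⟨W, hW, htW, k, hk, hkγ⟩ := PUGroup.exists_lift hγ ⟨ha, hb⟩
    refine ⟨a, b, W ∩ (τ.U a ∩ τ'.U b), k, hW.inter ((τ.isOpen_U a).inter (τ'.isOpen_U b)),
      ⟨htW, ha, hb⟩, fun x hx => hx.2.1, fun x hx => hx.2.2, hk, fun x hx => ?_⟩
    rw [hkγ x hx]
    exact hπ.transl_act (hproj x hx.2)
  choose a b W k hW hmem hWa hWb hk using key
  -- The charts are small neighbourhoods of the points, with sections and lifts taken from `τ`. The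
  -- refinement of `τ` therefore has trivial change of section, and only the one of `τ'` uses the
  -- local lifts `k`.
  refine ⟨{
    ι := T
    U := W
    isOpen_U := hW
    iUnion_U := eq_univ_of_forall fun t => mem_iUnion.2 ⟨t, hmem t⟩
    s := fun t => τ.s (a t)
    s_cont := fun t => (τ.s_cont (a t)).mono (hWa t)
    proj_s := fun t x hx => τ.proj_s (a t) x (hWa t hx)
    g := fun t t' => τ.g (a t) (a t')
    g_cont := fun t t' => (τ.g_cont (a t) (a t')).mono (inter_subset_inter (hWa t) (hWa t'))
    g_lift := fun t t' x hx => τ.g_lift (a t) (a t') x ⟨hWa t hx.1, hWa t' hx.2⟩ },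
    ⟨⟨a, hWa, fun _ _ => 1, fun t => .one _ _⟩⟩, ⟨⟨b, hWb, k, hk⟩⟩⟩

end Refinement

/-! ### Direct sums: inclusions and projections -/

section SumMaps

variable {E F : Type} [NormedAddCommGroup E] [InnerProductSpace ℂ E] [NormedAddCommGroup F]
  [InnerProductSpace ℂ F]

/-- The first projection of an orthogonal direct sum. -/
def sumFst (E F : Type) [NormedAddCommGroup E] [InnerProductSpace ℂ E] [NormedAddCommGroup F]
    [InnerProductSpace ℂ F] : WithLp 2 (E × F) →ₗ[ℂ] E :=
  LinearMap.fst ℂ E F ∘ₗ (WithLp.linearEquiv 2 ℂ (E × F)).toLinearMap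

/-- The second projection of an orthogonal direct sum. -/
def sumSnd (E F : Type) [NormedAddCommGroup E] [InnerProductSpace ℂ E] [NormedAddCommGroup F]
    [InnerProductSpace ℂ F] : WithLp 2 (E × F) →ₗ[ℂ] F :=
  LinearMap.snd ℂ E F ∘ₗ (WithLp.linearEquiv 2 ℂ (E × F)).toLinearMap

/-- The first inclusion into an orthogonal direct sum. -/
def sumInl (E F : Type) [NormedAddCommGroup E] [InnerProductSpace ℂ E] [NormedAddCommGroup F]
    [InnerProductSpace ℂ F] : E →ₗ[ℂ] WithLp 2 (E × F) :=
  (WithLp.linearEquiv 2 ℂ (E × F)).symm.toLinearMap ∘ₗ LinearMap.inl ℂ E F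

/-- The second inclusion into an orthogonal direct sum. -/
def sumInr (E F : Type) [NormedAddCommGroup E] [InnerProductSpace ℂ E] [NormedAddCommGroup F]
    [InnerProductSpace ℂ F] : F →ₗ[ℂ] WithLp 2 (E × F) :=
  (WithLp.linearEquiv 2 ℂ (E × F)).symm.toLinearMap ∘ₗ LinearMap.inr ℂ E F

theorem sum_ext {ξ η : WithLp 2 (E × F)} (h1 : ξ.fst = η.fst) (h2 : ξ.snd = η.snd) : ξ = η :=
  (WithLp.linearEquiv 2 ℂ (E × F)).injective (Prod.ext h1 h2)

variable {T : Type u} [TopologicalSpace T] {U U' V : Set T}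

theorem HermBundle.ContOn.add {E : HermBundle U} {E' : HermBundle U'}
    {φ φ' : ∀ x, E.fiber x →ₗ[ℂ] E'.fiber x} (hφ : E.ContOn E' V φ) (hφ' : E.ContOn E' V φ') :
    E.ContOn E' V fun x => φ x + φ' x := by
  intro i κ j κ'
  simp only [LinearMap.add_apply, inner_add_right]
  exact (hφ i κ j κ').add (hφ' i κ j κ')

theorem HermBundle.ContOn.neg {E : HermBundle U} {E' : HermBundle U'}
    {φ : ∀ x, E.fiber x →ₗ[ℂ] E'.fiber x} (hφ : E.ContOn E' V φ) :
    E.ContOn E' V fun x => -φ x := by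
  intro i κ j κ'
  simp only [LinearMap.neg_apply, inner_neg_right]
  exact (hφ i κ j κ').neg

theorem HermBundle.ContOn.sumFst (E E' : HermBundle U) :
    (E.sum E').ContOn E V fun x => sumFst (E.fiber x) (E'.fiber x) := by
  rintro i (κ | κ) j κ'
  · exact (E.transition j i.1 κ' κ).mono fun x hx => ⟨hx.2, hx.1.2.1⟩
  · refine (continuousOn_const (c := (0 : ℂ))).congr fun x _ => ?_
    exact inner_zero_right _

theorem HermBundle.ContOn.sumSnd (E E' : HermBundle U) :
    (E.sum E').ContOn E' V fun x => sumSnd (E.fiber x) (E'.fiber x) := by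
  rintro i (κ | κ) j κ'
  · refine (continuousOn_const (c := (0 : ℂ))).congr fun x _ => ?_
    exact inner_zero_right _
  · exact (E'.transition j i.2 κ' κ).mono fun x hx => ⟨hx.2, hx.1.2.2⟩

theorem HermBundle.ContOn.sumInl (E E' : HermBundle U) :
    E.ContOn (E.sum E') V fun x => sumInl (E.fiber x) (E'.fiber x) := by
  rintro i κ j (κ' | κ')
  · refine ((E.transition j.1 i κ' κ).mono (t := V ∩ E.base i ∩ (E.sum E').base j)
      fun x hx => ⟨hx.2.1, hx.1.2⟩).congr fun x _ => ?_
    exact (congrArg (_ + ·) (inner_zero_left (𝕜 := ℂ) _)).trans (add_zero _)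
  · refine (continuousOn_const (c := (0 : ℂ))).congr fun x _ => ?_
    exact (congrArg₂ (· + ·) (inner_zero_left (𝕜 := ℂ) _) (inner_zero_right (𝕜 := ℂ) _)).trans
      (add_zero _)

theorem HermBundle.ContOn.sumInr (E E' : HermBundle U) :
    E'.ContOn (E.sum E') V fun x => sumInr (E.fiber x) (E'.fiber x) := by
  rintro i κ j (κ' | κ')
  · refine (continuousOn_const (c := (0 : ℂ))).congr fun x _ => ?_
    exact (congrArg₂ (· + ·) (inner_zero_right (𝕜 := ℂ) _) (inner_zero_left (𝕜 := ℂ) _)).trans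
      (add_zero _)
  · refine ((E'.transition j.2 i κ' κ).mono (t := V ∩ E'.base i ∩ (E.sum E').base j)
      fun x hx => ⟨hx.2.2, hx.1.2⟩).congr fun x _ => ?_
    exact (congrArg (· + _) (inner_zero_left (𝕜 := ℂ) _)).trans (zero_add _)

theorem HFObj.IsHom.add {A : HFObj U} {B : HFObj U'} {φ φ' : ∀ x, A.fiber x →ₗ[ℂ] B.fiber x}
    (hφ : A.IsHom B V φ) (hφ' : A.IsHom B V φ') : A.IsHom B V fun x => φ x + φ' x where
  cont := hφ.cont.add hφ'.cont
  even x hx ξ := by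
    rw [LinearMap.add_apply, LinearMap.add_apply, hφ.even x hx, hφ'.even x hx, map_add]
  comm x hx ξ := by
    rw [LinearMap.add_apply, LinearMap.add_apply, hφ.comm x hx, hφ'.comm x hx, map_add]

theorem HFObj.IsHom.sumFst (A B : HFObj U) :
    (A.sum B).IsHom A V fun x => sumFst (A.fiber x) (B.fiber x) :=
  ⟨.sumFst _ _, fun _ _ _ => rfl, fun _ _ _ => rfl⟩

theorem HFObj.IsHom.sumSnd (A B : HFObj U) :
    (A.sum B).IsHom B V fun x => sumSnd (A.fiber x) (B.fiber x) :=
  ⟨.sumSnd _ _, fun _ _ _ => rfl, fun _ _ _ => rfl⟩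

theorem HFObj.IsHom.sumInl (A B : HFObj U) :
    A.IsHom (A.sum B) V fun x => sumInl (A.fiber x) (B.fiber x) :=
  ⟨.sumInl _ _, fun x _ _ => congrArg (WithLp.toLp 2) (Prod.ext rfl (map_zero (B.gr x)).symm),
    fun x _ _ => congrArg (WithLp.toLp 2) (Prod.ext rfl (map_zero (B.h x)).symm)⟩

theorem HFObj.IsHom.sumInr (A B : HFObj U) :
    B.IsHom (A.sum B) V fun x => sumInr (A.fiber x) (B.fiber x) :=
  ⟨.sumInr _ _, fun x _ _ => congrArg (WithLp.toLp 2) (Prod.ext (map_zero (A.gr x)).symm rfl),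
    fun x _ _ => congrArg (WithLp.toLp 2) (Prod.ext (map_zero (A.h x)).symm rfl)⟩

/-- The map `[[h, c], [c, -h]]`. -/
def rotMap (h : E →ₗ[ℂ] E) (c : ℝ) : WithLp 2 (E × E) →ₗ[ℂ] WithLp 2 (E × E) :=
  sumMap h (-h) + (c : ℂ) • (TwistedKF.sumInl E E ∘ₗ TwistedKF.sumSnd E E +
    TwistedKF.sumInr E E ∘ₗ TwistedKF.sumFst E E)

theorem rotMap_apply (h : E →ₗ[ℂ] E) (c : ℝ) (ξ : WithLp 2 (E × E)) : rotMap h c ξ =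
    WithLp.toLp 2 (h ξ.fst + (c : ℂ) • ξ.snd, -h ξ.snd + (c : ℂ) • ξ.fst) := by
  refine sum_ext ?_ ?_
  · change h ξ.fst + (c : ℂ) • (ξ.snd + 0) = h ξ.fst + (c : ℂ) • ξ.snd
    rw [add_zero]
  · change -h ξ.snd + (c : ℂ) • (0 + ξ.fst) = -h ξ.snd + (c : ℂ) • ξ.fst
    rw [zero_add]

/-- The off-diagonal terms `h c` and `c (-h)` cancel, so the square acts diagonally as `h² + c²`. -/
theorem rotMap_rotMap_fst (h : E →ₗ[ℂ] E) (c : ℝ) (ξ : WithLp 2 (E × E)) :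
    (rotMap h c (rotMap h c ξ)).fst = h (h ξ.fst) + ((c ^ 2 : ℝ) : ℂ) • ξ.fst := by
  rw [rotMap_apply, rotMap_apply]
  change h (h ξ.fst + (c : ℂ) • ξ.snd) + (c : ℂ) • (-h ξ.snd + (c : ℂ) • ξ.fst) = _
  simp only [map_add, map_smul, smul_add, smul_neg, smul_smul]
  push_cast
  rw [pow_two]
  abel

theorem rotMap_rotMap_snd (h : E →ₗ[ℂ] E) (c : ℝ) (ξ : WithLp 2 (E × E)) :
    (rotMap h c (rotMap h c ξ)).snd = h (h ξ.snd) + ((c ^ 2 : ℝ) : ℂ) • ξ.snd := by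
  rw [rotMap_apply, rotMap_apply]
  change -h (-h ξ.snd + (c : ℂ) • ξ.fst) + (c : ℂ) • (h ξ.fst + (c : ℂ) • ξ.snd) = _
  simp only [map_add, map_smul, map_neg, smul_add, smul_smul]
  push_cast
  rw [pow_two]
  abel

/-- Adding `c²` only raises eigenvalues: an eigenvector of the square with eigenvalue `l` has
components that are eigenvectors of `h²` with eigenvalue `l - c² ≤ l`. Hence transition maps related
by `≑` for `h` remain so after the perturbation. -/
theorem rotMap_lowSpace (h : E →ₗ[ℂ] E) (c μ : ℝ) {ξ : WithLp 2 (E × E)}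
    (hξ : ξ ∈ lowSpace (rotMap h c) μ) : ξ.fst ∈ lowSpace h μ ∧ ξ.snd ∈ lowSpace h μ := by
  have key : lowSpace (rotMap h c) μ ≤ ((lowSpace h μ).comap (TwistedKF.sumFst E E)) ⊓
      ((lowSpace h μ).comap (TwistedKF.sumSnd E E)) := by
    refine lowSpace_le fun l hl η hη => ?_
    have h1 := rotMap_rotMap_fst h c η
    have h2 := rotMap_rotMap_snd h c η
    rw [hη] at h1 h2
    have hl' : l - c ^ 2 < μ := by nlinarith [sq_nonneg c]
    refine ⟨mem_lowSpace hl' ?_, mem_lowSpace hl' ?_⟩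
    · change h (h η.fst) = _ • η.fst
      rw [eq_sub_of_add_eq h1.symm, Complex.ofReal_sub, sub_smul]
      rfl
    · change h (h η.snd) = _ • η.snd
      rw [eq_sub_of_add_eq h2.symm, Complex.ofReal_sub, sub_smul]
      rfl
  exact key hξ

theorem rotMap_symm {h : E →ₗ[ℂ] E} (hh : ∀ ξ η, inner ℂ (h ξ) η = inner ℂ ξ (h η)) (c : ℝ)
    (ξ η : WithLp 2 (E × E)) : inner ℂ (rotMap h c ξ) η = inner ℂ ξ (rotMap h c η) := by
  rw [rotMap_apply, rotMap_apply]
  change inner ℂ (h ξ.fst + (c : ℂ) • ξ.snd) η.fst + inner ℂ (-h ξ.snd + (c : ℂ) • ξ.fst) η.snd =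
    inner ℂ ξ.fst (h η.fst + (c : ℂ) • η.snd) + inner ℂ ξ.snd (-h η.snd + (c : ℂ) • η.fst)
  simp only [inner_add_left, inner_add_right, inner_smul_left, inner_smul_right,
    inner_neg_left, inner_neg_right, hh, Complex.conj_ofReal]
  ring

theorem rotMap_odd {h gr : E →ₗ[ℂ] E} (hh : ∀ ξ, h (gr ξ) = -gr (h ξ)) (c : ℝ)
    (ξ : WithLp 2 (E × E)) :
    rotMap h c (sumMap gr (-gr) ξ) = -sumMap gr (-gr) (rotMap h c ξ) := by
  rw [rotMap_apply, rotMap_apply]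
  refine sum_ext ?_ ?_
  · change h (gr ξ.fst) + (c : ℂ) • (-gr ξ.snd) = -gr (h ξ.fst + (c : ℂ) • ξ.snd)
    rw [hh, map_add, map_smul, smul_neg, neg_add]
  · change -h (-gr ξ.snd) + (c : ℂ) • (gr ξ.fst) = - -gr (-h ξ.snd + (c : ℂ) • ξ.fst)
    rw [map_neg, hh, map_add, map_smul, map_neg, neg_neg, neg_neg]

/-- The degree one perturbation `[[h, c], [c, -h]]` of `(E, h) ⊕ (E, -h)`, the second summand
having the opposite grading. -/
def HFObj.rot (A : HFObj U) (c : T → ℝ) (hc : Continuous c) : HFObj U where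
  toHermBundle := A.toHermBundle.sum A.toHermBundle
  gr x := sumMap (A.gr x) (-A.gr x)
  gr_cont := A.gr_cont.sum A.gr_cont.neg
  gr_gr x hx ξ := sum_ext (A.gr_gr x hx ξ.fst) (by
    change -A.gr x (-A.gr x ξ.snd) = ξ.snd
    rw [map_neg, neg_neg, A.gr_gr x hx])
  gr_symm x hx ξ η := congrArg₂ (· + ·) (A.gr_symm x hx ξ.fst η.fst) (by
    change inner ℂ (-A.gr x ξ.snd) η.snd = inner ℂ ξ.snd (-A.gr x η.snd)
    rw [inner_neg_left, inner_neg_right, A.gr_symm x hx])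
  h x := rotMap (A.h x) (c x)
  h_cont := (A.h_cont.sum A.h_cont.neg).add (((HermBundle.ContOn.comp Subset.rfl (.sumInl _ _)
    (.sumSnd _ _)).add (HermBundle.ContOn.comp Subset.rfl (.sumInr _ _) (.sumFst _ _))).smul
      (Complex.continuous_ofReal.comp hc).continuousOn)
  h_symm x hx := rotMap_symm (A.h_symm x hx) (c x)
  h_odd x hx := rotMap_odd (A.h_odd x hx) (c x)

/-- If `h²η + c²η = 0`, pairing with `η` gives `‖hη‖² + c²‖η‖² = 0`. -/
theorem HFObj.rot_bijective (A : HFObj U) (c : T → ℝ) (hc : Continuous c) {x : T} (hx : x ∈ U)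
    (h : c x ≠ 0 ∨ Function.Bijective (A.h x)) : Function.Bijective ((A.rot c hc).h x) := by
  refine ((A.rot c hc).bijective_h_iff hx).2 fun ξ hξ => ?_
  change rotMap (A.h x) (c x) ξ = 0 at hξ
  have e1 := rotMap_rotMap_fst (A.h x) (c x) ξ
  have e2 := rotMap_rotMap_snd (A.h x) (c x) ξ
  rw [hξ, map_zero] at e1 e2
  have key : ∀ η : A.fiber x, 0 = A.h x (A.h x η) + ((c x ^ 2 : ℝ) : ℂ) • η → η = 0 := by
    intro η hη
    have h1 : (0 : ℂ) = inner ℂ (A.h x η) (A.h x η) + ((c x ^ 2 : ℝ) : ℂ) * inner ℂ η η := by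
      rw [A.h_symm x hx, ← inner_smul_right, ← inner_add_right, ← hη, inner_zero_right]
    rw [inner_self_eq_norm_sq_to_K, inner_self_eq_norm_sq_to_K] at h1
    have h2 : 0 = ‖A.h x η‖ ^ 2 + c x ^ 2 * ‖η‖ ^ 2 :=
      Complex.ofReal_injective (by push_cast; push_cast at h1; exact h1)
    rcases h with h | h
    · have h3 : c x ^ 2 * ‖η‖ ^ 2 = 0 := by nlinarith [sq_nonneg ‖A.h x η‖, sq_nonneg (c x * ‖η‖)]
      simpa [h] using h3
    · have h3 : ‖A.h x η‖ ^ 2 = 0 := by nlinarith [sq_nonneg ‖A.h x η‖, sq_nonneg (c x * ‖η‖)]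
      exact (A.bijective_h_iff hx).1 h η (by simpa using h3)
  exact sum_ext (key ξ.fst e1) (key ξ.snd e2)

/-- The object with the opposite grading and the opposite map. -/
def HFObj.neg (A : HFObj U) : HFObj U where
  toHermBundle := A.toHermBundle
  gr x := -A.gr x
  gr_cont := A.gr_cont.neg
  gr_gr x hx ξ := by
    rw [LinearMap.neg_apply, LinearMap.neg_apply, map_neg, neg_neg, A.gr_gr x hx]
  gr_symm x hx ξ η := by
    rw [LinearMap.neg_apply, LinearMap.neg_apply, inner_neg_left, inner_neg_right,
      A.gr_symm x hx]
  h x := -A.h x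
  h_cont := A.h_cont.neg
  h_symm x hx ξ η := by
    rw [LinearMap.neg_apply, LinearMap.neg_apply, inner_neg_left, inner_neg_right,
      A.h_symm x hx]
  h_odd x hx ξ := by simp [A.h_odd x hx]

theorem HFObj.lowSpace_neg (A : HFObj U) (x : T) (μ : ℝ) :
    lowSpace (A.neg.h x) μ = lowSpace (A.h x) μ := by
  have h : (A.neg.h x) ∘ₗ (A.neg.h x) = A.h x ∘ₗ A.h x := LinearMap.ext fun ξ => by
    change -A.h x (-A.h x ξ) = A.h x (A.h x ξ)
    rw [map_neg, neg_neg]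
  rw [lowSpace, h]
  rfl

end SumMaps

/-! ### Sums of isomorphisms -/

section SumIso

variable {H : Type w} [NormedAddCommGroup H] [InnerProductSpace ℂ H]
variable {X : Type u} [TopologicalSpace X] {P : Type v} [TopologicalSpace P]
  [MulAction (PUGroup H)ᵐᵒᵖ P] {T : Type u} [TopologicalSpace T] {π : P → X} {f : C(T, X)}

/-- Fibrewise maps commuting with the transition maps identify two objects with the same
twisting part. -/
def Vectorial.refinementOfMaps {τ : Twist H π f} {A B : Vectorial τ}
    (θ : ∀ a x, (A.E a).fiber x →ₗ[ℂ] (B.E a).fiber x)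
    (θ' : ∀ a x, (B.E a).fiber x →ₗ[ℂ] (A.E a).fiber x)
    (hθ : ∀ a, (A.E a).IsHom (B.E a) (τ.U a) (θ a))
    (hθ' : ∀ a, (B.E a).IsHom (A.E a) (τ.U a) (θ' a))
    (h : ∀ a, (A.E a).Eqv (A.E a) (τ.U a) (fun x => θ' a x ∘ₗ θ a x) fun _ => LinearMap.id)
    (h' : ∀ a, (B.E a).Eqv (B.E a) (τ.U a) (fun x => θ a x ∘ₗ θ' a x) fun _ => LinearMap.id)
    (hφ : ∀ a b x, θ a x ∘ₗ A.φ a b x = B.φ a b x ∘ₗ θ b x) :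
    TVB.Refinement (⟨τ, A⟩ : TVB H π f) ⟨τ, B⟩ where
  ρ := id
  sub _ := Subset.rfl
  c _ _ := 1
  lift i := .one _ _
  θ := θ
  θ' := θ'
  θ_hom := hθ
  θ'_hom := hθ'
  θ'_θ := h
  θ_θ' := h'
  compat i j := .of_eqOn (fun x _ => (one_mul _).trans (mul_one _).symm) fun x _ => hφ i j x

/-- The relations for a morphism involve only the classes of the pairs `(k, ψ)`, so representatives
may be changed. -/
theorem TVB.IsMorphism.congr {A B : TVB H π f} {k k' : B.twist.ι → A.twist.ι → T → UGroup H}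
    {ψ ψ' : ∀ b a x, ((A.vect.E a).fiber x) →ₗ[ℂ] ((B.vect.E b).fiber x)}
    (h : A.IsMorphism B k ψ)
    (hk : ∀ b a, IsLift (B.twist.U b ∩ A.twist.U a) (B.twist.s b) (A.twist.s a) (k' b a))
    (hψ : ∀ b a, (A.vect.E a).IsHom (B.vect.E b) (B.twist.U b ∩ A.twist.U a) (ψ' b a))
    (he : ∀ b a, PairEqv (A.vect.E a) (B.vect.E b) (B.twist.U b ∩ A.twist.U a) (k b a) (ψ b a)
      (k' b a) (ψ' b a)) : A.IsMorphism B k' ψ' where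
  k_cont b a := (hk b a).cont
  k_lift b a := (hk b a).act
  ψ_hom := hψ
  comp_source b a a' := by
    have e1 := ((he b a).symm.on (W := B.twist.U b ∩ A.twist.U a ∩ A.twist.U a')
      fun x hx => hx.1).comp_right (A.twist.g a a') (χ := A.vect.φ a a')
        fun x hx => (A.vect.φ_hom a a').comm x ⟨hx.1.2, hx.2⟩
    exact e1.trans ((h.comp_source b a a').trans ((he b a').on fun x hx => ⟨hx.1.1, hx.2⟩))
  comp_target b b' a := by
    have e1 := ((he b' a).symm.on (W := B.twist.U b ∩ B.twist.U b' ∩ A.twist.U a)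
      fun x hx => ⟨hx.1.2, hx.2⟩).comp_left (B.twist.g b b') (B.vect.φ b b')
    exact e1.trans ((h.comp_target b b' a).trans ((he b a).on fun x hx => ⟨hx.1.1, hx.2⟩))

theorem TVB.IsLeftInverse.congr {A B : TVB H π f} {k k₁ : B.twist.ι → A.twist.ι → T → UGroup H}
    {ψ ψ₁ : ∀ b a x, ((A.vect.E a).fiber x) →ₗ[ℂ] ((B.vect.E b).fiber x)}
    {k' k'₁ : A.twist.ι → B.twist.ι → T → UGroup H}
    {ψ' ψ'₁ : ∀ a b x, ((B.vect.E b).fiber x) →ₗ[ℂ] ((A.vect.E a).fiber x)}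
    (h : A.IsLeftInverse B k ψ k' ψ')
    (hψ : ∀ b a, (A.vect.E a).IsHom (B.vect.E b) (B.twist.U b ∩ A.twist.U a) (ψ b a))
    (he : ∀ b a, PairEqv (A.vect.E a) (B.vect.E b) (B.twist.U b ∩ A.twist.U a) (k b a) (ψ b a)
      (k₁ b a) (ψ₁ b a))
    (he' : ∀ a b, PairEqv (B.vect.E b) (A.vect.E a) (A.twist.U a ∩ B.twist.U b) (k' a b) (ψ' a b)
      (k'₁ a b) (ψ'₁ a b)) : A.IsLeftInverse B k₁ ψ₁ k'₁ ψ'₁ := fun a b a' => by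
  have e1 := ((he' a b).symm.on (W := A.twist.U a ∩ B.twist.U b ∩ A.twist.U a')
    fun x hx => hx.1).comp ((he b a').symm.on (W := A.twist.U a ∩ B.twist.U b ∩ A.twist.U a')
      fun x hx => ⟨hx.1.2, hx.2⟩) fun x hx => (hψ b a').comm x ⟨hx.1.2, hx.2⟩
  exact e1.trans (h a b a')

variable [InfiniteDimensional H]

theorem TVB.IsMorphism.sum {τ τ' : Twist H π f} {A B : Vectorial τ} {A' B' : Vectorial τ'}
    {k : τ'.ι → τ.ι → T → UGroup H} {ψ : ∀ b a x, ((A.E a).fiber x) →ₗ[ℂ] ((A'.E b).fiber x)}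
    {χ : ∀ b a x, ((B.E a).fiber x) →ₗ[ℂ] ((B'.E b).fiber x)}
    (h : TVB.IsMorphism (⟨τ, A⟩ : TVB H π f) ⟨τ', A'⟩ k ψ)
    (h' : TVB.IsMorphism (⟨τ, B⟩ : TVB H π f) ⟨τ', B'⟩ k χ) :
    TVB.IsMorphism (⟨τ, A.sum B⟩ : TVB H π f) ⟨τ', A'.sum B'⟩ k
      (fun b a x => sumMap (ψ b a x) (χ b a x)) where
  k_cont := h.k_cont
  k_lift := h.k_lift
  ψ_hom b a := (h.ψ_hom b a).sum (h'.ψ_hom b a)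
  comp_source b a a' := by
    have e := (h.comp_source b a a').sum (h'.comp_source b a a')
    simp only [← sumMap_comp] at e
    exact e
  comp_target b b' a := by
    have e := (h.comp_target b b' a).sum (h'.comp_target b b' a)
    simp only [← sumMap_comp] at e
    exact e

theorem TVB.IsLeftInverse.sum {τ τ' : Twist H π f} {A B : Vectorial τ} {A' B' : Vectorial τ'}
    {k : τ'.ι → τ.ι → T → UGroup H} {ψ : ∀ b a x, ((A.E a).fiber x) →ₗ[ℂ] ((A'.E b).fiber x)}
    {χ : ∀ b a x, ((B.E a).fiber x) →ₗ[ℂ] ((B'.E b).fiber x)}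
    {k' : τ.ι → τ'.ι → T → UGroup H} {ψ' : ∀ a b x, ((A'.E b).fiber x) →ₗ[ℂ] ((A.E a).fiber x)}
    {χ' : ∀ a b x, ((B'.E b).fiber x) →ₗ[ℂ] ((B.E a).fiber x)}
    (h : TVB.IsLeftInverse (⟨τ, A⟩ : TVB H π f) ⟨τ', A'⟩ k ψ k' ψ')
    (h' : TVB.IsLeftInverse (⟨τ, B⟩ : TVB H π f) ⟨τ', B'⟩ k χ k' χ') :
    TVB.IsLeftInverse (⟨τ, A.sum B⟩ : TVB H π f) ⟨τ', A'.sum B'⟩ k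
      (fun b a x => sumMap (ψ b a x) (χ b a x)) k' (fun a b x => sumMap (ψ' a b x) (χ' a b x)) :=
  fun a b a' => by
    have e := (h a b a').sum (h' a b a')
    simp only [← sumMap_comp] at e
    exact e

/-- Isomorphic summands have isomorphic direct sums. -/
theorem TVB.Iso.sum (hπ : IsPrincipalBundle (PUGroup H) π) {τ τ' : Twist H π f}
    {A B : Vectorial τ} {A' B' : Vectorial τ'}
    (hA : TVB.Iso (⟨τ, A⟩ : TVB H π f) ⟨τ', A'⟩) (hB : TVB.Iso (⟨τ, B⟩ : TVB H π f) ⟨τ', B'⟩) :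
    TVB.Iso (⟨τ, A.sum B⟩ : TVB H π f) ⟨τ', A'.sum B'⟩ := by
  obtain ⟨k, ψ, k', ψ', h1, h2, h3, h4⟩ := hA
  obtain ⟨l, χ, l', χ', m1, m2, m3, m4⟩ := hB
  -- The two isomorphisms may use different lifts `k` and `l` of the same function to `PU(H)`.
  -- Rescaling `χ` by their ratio moves it over `k`, so that the sum of the maps can be formed over
  -- one lift.
  have key : ∀ {τ τ' : Twist H π f} {A B : Vectorial τ} {A' B' : Vectorial τ'} {k l ψ χ},
      TVB.IsMorphism (⟨τ, A⟩ : TVB H π f) ⟨τ', A'⟩ k ψ →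
      TVB.IsMorphism (⟨τ, B⟩ : TVB H π f) ⟨τ', B'⟩ l χ →
      (∀ b a, PairEqv (B.E a) (B'.E b) (τ'.U b ∩ τ.U a) (l b a) (χ b a) (k b a)
        (fun x => (UGroup.ratio (l b a x) (k b a x) : ℂ) • χ b a x)) ∧
      (∀ b a, (B.E a).IsHom (B'.E b) (τ'.U b ∩ τ.U a)
        (fun x => (UGroup.ratio (l b a x) (k b a x) : ℂ) • χ b a x)) := by
    intro τ τ' A B A' B' k l ψ χ h m
    exact ⟨fun b a => (m.isLift b a).pairEqv hπ (h.isLift b a) (.of_eqOn fun _ _ => rfl),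
      fun b a => (m.ψ_hom b a).smul (continuous_induced_dom.comp_continuousOn
        (UGroup.continuousOn_ratio (m.isLift b a).cont (h.isLift b a).cont
          fun x hx => (m.isLift b a).mk_eq hπ (h.isLift b a) hx))⟩
  obtain ⟨e1, e2⟩ := key h1 m1
  obtain ⟨e1', e2'⟩ := key h2 m2
  refine ⟨k, _, k', _, h1.sum (m1.congr h1.isLift e2 e1), h2.sum (m2.congr h2.isLift e2' e1'),
    ?_, ?_⟩
  · have e3 := m3.congr m1.ψ_hom e1 e1'
    exact TVB.IsLeftInverse.sum h3 e3
  · have e3 := m4.congr m2.ψ_hom e1' e1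
    exact TVB.IsLeftInverse.sum h4 e3

theorem Vectorial.supp_refine (hπ : IsPrincipalBundle (PUGroup H) π) {τ₁ τ : Twist H π f}
    (r : τ₁.Ref τ) (A : Vectorial τ) : (A.refine hπ r).supp = A.supp :=
  (A.refineRefinement hπ r).iso.supp_eq

/-- The pull-back of a refinement. -/
def TVB.Refinement.pull {T' : Type u} [TopologicalSpace T'] {f' : C(T', X)} (q : C(T', T))
    (hq : ∀ t, f' t = f (q t)) {A B : TVB H π f} (r : B.Refinement A) :
    (B.pull q hq).Refinement (A.pull q hq) where
  ρ := r.ρ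
  sub i _ ht := r.sub i ht
  c i t := r.c i (q t)
  lift i := ⟨(r.lift i).cont.comp q.continuous.continuousOn fun _ ht => ht,
    fun t ht => (r.lift i).act (q t) ht⟩
  θ i t := r.θ i (q t)
  θ' i t := r.θ' i (q t)
  θ_hom i := (r.θ_hom i).pull q
  θ'_hom i := (r.θ'_hom i).pull q
  θ'_θ i := (r.θ'_θ i).pull q
  θ_θ' i := (r.θ_θ' i).pull q
  compat i j := (r.compat i j).pull q

/-- Direct sum of two relative objects whose twisting parts may differ. -/
def RelTVB.add (hπ : IsPrincipalBundle (PUGroup H) π) {S : Set T} (A B : RelTVB H π f S) :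
    RelTVB H π f S :=
  RelTVB.sum (Twist.exists_common_ref hπ A.1.twist B.1.twist).choose
    (A.1.vect.refine hπ (Twist.exists_common_ref hπ A.1.twist B.1.twist).choose_spec.1.some)
    (B.1.vect.refine hπ (Twist.exists_common_ref hπ A.1.twist B.1.twist).choose_spec.2.some)
    (by rw [Vectorial.supp_refine]; exact A.2) (by rw [Vectorial.supp_refine]; exact B.2)

theorem RelTVB.Homotopic.add (hπ : IsPrincipalBundle (PUGroup H) π) {S : Set T}
    {A₀ A₁ B₀ B₁ : RelTVB H π f S} (hA : A₀.Homotopic A₁) (hB : B₀.Homotopic B₁) :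
    (A₀.add hπ B₀).Homotopic (A₁.add hπ B₁) := by
  obtain ⟨C, hC0, hC1⟩ := hA
  obtain ⟨D, hD0, hD1⟩ := hB
  have key : ∀ (i : unitInterval) (A B : RelTVB H π f S),
      (C.1.pull (f' := f) (slice T i) fun _ => rfl).Iso A.1 →
      (D.1.pull (f' := f) (slice T i) fun _ => rfl).Iso B.1 →
      ((C.add hπ D).1.pull (f' := f) (slice T i) fun _ => rfl).Iso (A.add hπ B).1 := by
    intro i A B hA hB
    refine TVB.Iso.sum hπ (A := (C.1.vect.refine hπ _).pull _ _)
      (B := (D.1.vect.refine hπ _).pull _ _) ?_ ?_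
    · exact ((hA.of_refinement ((C.1.vect.refineRefinement hπ _).pull (slice T i)
        fun _ => rfl)).symm.of_refinement (A.1.vect.refineRefinement hπ _)).symm
    · exact ((hB.of_refinement ((D.1.vect.refineRefinement hπ _).pull (slice T i)
        fun _ => rfl)).symm.of_refinement (B.1.vect.refineRefinement hπ _)).symm
  exact ⟨C.add hπ D, key 0 _ _ hC0 hD0, key 1 _ _ hC1 hD1⟩

/-- The direct sum of classes. -/
def KF.add (hπ : IsPrincipalBundle (PUGroup H) π) {S : Set T} :
    KF H π f S → KF H π f S → KF H π f S :=
  Quot.map₂ (RelTVB.add hπ) (fun _ _ _ h => RelTVB.Homotopic.add hπ (.of_iso (.refl _)) h)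
    fun _ _ _ h => RelTVB.Homotopic.add hπ h (.of_iso (.refl _))

/-- The common refinement chosen in `RelTVB.add` is immaterial, because a refined object is
isomorphic to the original one. -/
theorem KF.add_mk_mk (hπ : IsPrincipalBundle (PUGroup H) π) {S : Set T} {τ : Twist H π f}
    (A B : Vectorial τ) (hA : Disjoint A.supp S) (hB : Disjoint B.supp S) :
    KF.add hπ (KF.mk ⟨⟨τ, A⟩, hA⟩) (KF.mk ⟨⟨τ, B⟩, hB⟩) = KF.mk (RelTVB.sum τ A B hA hB) := by
  refine KF.mk_eq_of_iso (TVB.Iso.sum hπ ?_ ?_)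
  · exact (A.refineRefinement hπ _).iso
  · exact (B.refineRefinement hπ _).iso

/-- Representing a class over a refinement of a prescribed `τ'` is what allows several classes to be
represented over one twisting part. -/
theorem KF.exists_rep (hπ : IsPrincipalBundle (PUGroup H) π) {S : Set T} (x : KF H π f S)
    (τ' : Twist H π f) : ∃ (τ : Twist H π f) (A : Vectorial τ) (hA : Disjoint A.supp S)
      (r : τ.Ref τ'), x = KF.mk ⟨⟨τ, A⟩, hA⟩ := by
  obtain ⟨⟨⟨τ, A⟩, hA⟩, rfl⟩ := Quot.exists_rep x
  obtain ⟨τ₁, ⟨r⟩, ⟨r'⟩⟩ := Twist.exists_common_ref hπ τ τ'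
  exact ⟨τ₁, A.refine hπ r, by rw [Vectorial.supp_refine]; exact hA, r',
    (KF.mk_eq_of_iso (A := ⟨⟨τ₁, A.refine hπ r⟩, _⟩) (A.refineRefinement hπ r).iso).symm⟩

theorem KF.mk_refine (hπ : IsPrincipalBundle (PUGroup H) π) {S : Set T} {τ₁ τ : Twist H π f}
    (r : τ₁.Ref τ) (A : Vectorial τ) (hA : Disjoint A.supp S)
    (hA' : Disjoint (A.refine hπ r).supp S) :
    KF.mk (⟨⟨τ₁, A.refine hπ r⟩, hA'⟩ : RelTVB H π f S) = KF.mk ⟨⟨τ, A⟩, hA⟩ :=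
  KF.mk_eq_of_iso (A := ⟨⟨τ₁, A.refine hπ r⟩, hA'⟩) (A.refineRefinement hπ r).iso

theorem KF.exists_rep₂ (hπ : IsPrincipalBundle (PUGroup H) π) {S : Set T} (x y : KF H π f S) :
    ∃ (τ : Twist H π f) (A B : Vectorial τ) (hA : Disjoint A.supp S) (hB : Disjoint B.supp S),
      x = KF.mk ⟨⟨τ, A⟩, hA⟩ ∧ y = KF.mk ⟨⟨τ, B⟩, hB⟩ := by
  obtain ⟨⟨⟨τ', B⟩, hB⟩, rfl⟩ := Quot.exists_rep y
  obtain ⟨τ, A, hA, r, rfl⟩ := x.exists_rep hπ τ'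
  have hB' : Disjoint (B.refine hπ r).supp S := by rw [Vectorial.supp_refine]; exact hB
  exact ⟨τ, A, B.refine hπ r, hA, hB', rfl, (KF.mk_refine hπ r B hB hB').symm⟩

theorem KF.exists_rep₃ (hπ : IsPrincipalBundle (PUGroup H) π) {S : Set T} (x y z : KF H π f S) :
    ∃ (τ : Twist H π f) (A B C : Vectorial τ) (hA : Disjoint A.supp S) (hB : Disjoint B.supp S)
      (hC : Disjoint C.supp S),
      x = KF.mk ⟨⟨τ, A⟩, hA⟩ ∧ y = KF.mk ⟨⟨τ, B⟩, hB⟩ ∧ z = KF.mk ⟨⟨τ, C⟩, hC⟩ := by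
  obtain ⟨τ', B, C, hB, hC, rfl, rfl⟩ := KF.exists_rep₂ hπ y z
  obtain ⟨τ, A, hA, r, rfl⟩ := x.exists_rep hπ τ'
  have hB' : Disjoint (B.refine hπ r).supp S := by rw [Vectorial.supp_refine]; exact hB
  have hC' : Disjoint (C.refine hπ r).supp S := by rw [Vectorial.supp_refine]; exact hC
  exact ⟨τ, A, B.refine hπ r, C.refine hπ r, hA, hB', hC', rfl,
    (KF.mk_refine hπ r B hB hB').symm, (KF.mk_refine hπ r C hC hC').symm⟩

theorem KF.add_eq_iff (hπ : IsPrincipalBundle (PUGroup H) π) {S : Set T} (x y z : KF H π f S) :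
    KF.add hπ x y = z ↔ KF.IsDirectSum x y z := by
  constructor
  · rintro rfl
    obtain ⟨τ, A, B, hA, hB, rfl, rfl⟩ := KF.exists_rep₂ hπ x y
    exact ⟨τ, A, B, hA, hB, rfl, rfl, KF.add_mk_mk hπ A B hA hB⟩
  · rintro ⟨τ, A, B, hA, hB, rfl, rfl, rfl⟩
    exact KF.add_mk_mk hπ A B hA hB

theorem KF.add_comm (hπ : IsPrincipalBundle (PUGroup H) π) {S : Set T} (x y : KF H π f S) :
    KF.add hπ x y = KF.add hπ y x := by
  obtain ⟨τ, A, B, hA, hB, rfl, rfl⟩ := KF.exists_rep₂ hπ x y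
  rw [KF.add_mk_mk, KF.add_mk_mk]
  have hh : ∀ (A B : Vectorial τ) (a : τ.ι), ((A.sum B).E a).IsHom ((B.sum A).E a) (τ.U a)
      fun x => sumInl _ _ ∘ₗ sumSnd ((A.E a).fiber x) ((B.E a).fiber x) +
        sumInr _ _ ∘ₗ sumFst ((A.E a).fiber x) ((B.E a).fiber x) := fun A B a =>
    (HFObj.IsHom.comp Subset.rfl (.sumInl _ _) (.sumSnd _ _)).add
      (HFObj.IsHom.comp Subset.rfl (.sumInr _ _) (.sumFst _ _))
  have hinv : ∀ {E F : Type} [NormedAddCommGroup E] [InnerProductSpace ℂ E]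
      [NormedAddCommGroup F] [InnerProductSpace ℂ F],
      (sumInl E F ∘ₗ sumSnd F E + sumInr E F ∘ₗ sumFst F E) ∘ₗ
        (sumInl F E ∘ₗ sumSnd E F + sumInr F E ∘ₗ sumFst E F) = LinearMap.id := by
    intro E F _ _ _ _
    refine LinearMap.ext fun ξ => sum_ext ?_ ?_
    · change 0 + ξ.fst + 0 = ξ.fst
      rw [zero_add, add_zero]
    · change 0 + (ξ.snd + 0) = ξ.snd
      rw [zero_add, add_zero]
  refine KF.mk_eq_of_iso (TVB.Refinement.iso (Vectorial.refinementOfMaps (A := A.sum B)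
    (B := B.sum A) _ _ (hh A B) (hh B A) (fun a => .of_eqOn fun x _ => hinv)
    (fun a => .of_eqOn fun x _ => hinv) fun a b x => LinearMap.ext fun ξ => ?_))
  refine sum_ext ?_ ?_
  · change B.φ a b x ξ.snd + 0 = B.φ a b x (ξ.snd + 0)
    rw [add_zero, add_zero]
  · change 0 + A.φ a b x ξ.fst = A.φ a b x (0 + ξ.fst)
    rw [zero_add, zero_add]

theorem KF.add_assoc (hπ : IsPrincipalBundle (PUGroup H) π) {S : Set T} (x y z : KF H π f S) :
    KF.add hπ (KF.add hπ x y) z = KF.add hπ x (KF.add hπ y z) := by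
  obtain ⟨τ, A, B, C, hA, hB, hC, rfl, rfl, rfl⟩ := KF.exists_rep₃ hπ x y z
  have hAB := (RelTVB.sum τ A B hA hB).2
  have hBC := (RelTVB.sum τ B C hB hC).2
  rw [KF.add_mk_mk, KF.add_mk_mk]
  refine (KF.add_mk_mk hπ (A.sum B) C hAB hC).trans
    (Eq.trans ?_ (KF.add_mk_mk hπ A (B.sum C) hA hBC).symm)
  refine KF.mk_eq_of_iso (TVB.Refinement.iso (Vectorial.refinementOfMaps
    (A := (A.sum B).sum C) (B := A.sum (B.sum C))
    (fun a x => sumInl _ _ ∘ₗ (sumFst _ _ ∘ₗ sumFst _ _) + sumInr _ _ ∘ₗ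
      (sumInl _ _ ∘ₗ (sumSnd _ _ ∘ₗ sumFst _ _) + sumInr _ _ ∘ₗ sumSnd _ _))
    (fun a x => sumInl _ _ ∘ₗ (sumInl _ _ ∘ₗ sumFst _ _ + sumInr _ _ ∘ₗ
      (sumFst _ _ ∘ₗ sumSnd _ _)) + sumInr _ _ ∘ₗ (sumSnd _ _ ∘ₗ sumSnd _ _))
    (fun a => ?_) (fun a => ?_) (fun a => .of_eqOn fun x _ => LinearMap.ext fun ξ => ?_)
    (fun a => .of_eqOn fun x _ => LinearMap.ext fun ξ => ?_) fun a b x => LinearMap.ext fun ξ => ?_))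
  · exact (HFObj.IsHom.comp Subset.rfl (.sumInl _ _) (.comp Subset.rfl (.sumFst _ _)
      (.sumFst _ _))).add (.comp Subset.rfl (.sumInr _ _) ((HFObj.IsHom.comp Subset.rfl
        (.sumInl _ _) (.comp Subset.rfl (.sumSnd _ _) (.sumFst _ _))).add
          (.comp Subset.rfl (.sumInr _ _) (.sumSnd _ _))))
  · exact (HFObj.IsHom.comp Subset.rfl (.sumInl _ _) ((HFObj.IsHom.comp Subset.rfl (.sumInl _ _)
      (.sumFst _ _)).add (.comp Subset.rfl (.sumInr _ _) (.comp Subset.rfl (.sumFst _ _)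
        (.sumSnd _ _))))).add (.comp Subset.rfl (.sumInr _ _) (.comp Subset.rfl (.sumSnd _ _)
          (.sumSnd _ _)))
  · refine sum_ext (sum_ext ?_ ?_) ?_
    · change ξ.fst.fst + 0 + 0 + 0 = ξ.fst.fst
      simp only [add_zero]
    · change 0 + (0 + (ξ.fst.snd + 0)) + 0 = ξ.fst.snd
      simp only [add_zero, zero_add]
    · change 0 + (0 + (0 + ξ.snd)) = ξ.snd
      simp only [zero_add]
  · refine sum_ext ?_ (sum_ext ?_ ?_)
    · change ξ.fst + 0 + 0 + 0 = ξ.fst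
      simp only [add_zero]
    · change 0 + (0 + ξ.snd.fst + 0 + 0) = ξ.snd.fst
      simp only [add_zero, zero_add]
    · change 0 + (0 + (0 + ξ.snd.snd)) = ξ.snd.snd
      simp only [zero_add]
  · refine sum_ext ?_ (sum_ext ?_ ?_)
    · change A.φ a b x ξ.fst.fst + 0 = A.φ a b x (ξ.fst.fst + 0)
      simp only [add_zero]
    · change 0 + (B.φ a b x ξ.fst.snd + 0) = B.φ a b x (0 + (ξ.fst.snd + 0))
      simp only [add_zero, zero_add]
    · change 0 + (0 + C.φ a b x ξ.snd) = C.φ a b x (0 + (0 + ξ.snd))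
      simp only [zero_add]

/-- A summand without support may be dropped. -/
theorem KF.add_mk_of_supp_eq_empty (hπ : IsPrincipalBundle (PUGroup H) π) {S : Set T}
    (x : KF H π f S) (Z : RelTVB H π f S) (hZ : Z.1.supp = ∅) : KF.add hπ x (KF.mk Z) = x := by
  obtain ⟨⟨τ', Z⟩, hZS⟩ := Z
  obtain ⟨τ, A, hA, r, rfl⟩ := x.exists_rep hπ τ'
  have hZ' : Disjoint (Z.refine hπ r).supp S := by rw [Vectorial.supp_refine]; exact hZS
  have hZe : (Z.refine hπ r).supp = ∅ := by rw [Vectorial.supp_refine]; exact hZ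
  rw [← KF.mk_refine hπ r Z hZS hZ', KF.add_mk_mk]
  generalize Z.refine hπ r = Z at hZ' hZe
  -- The projection to `A` is inverse to the inclusion up to `≑`: `Z` has no low eigenvectors, so a
  -- low vector of the sum has zero component in `Z`.
  refine KF.mk_eq_of_iso (TVB.Refinement.iso (Vectorial.refinementOfMaps (A := A.sum Z) (B := A)
    (fun a x => sumFst _ _) (fun a x => sumInl _ _) (fun a => .sumFst _ _) (fun a => .sumInl _ _)
    (fun a x hx => ?_) (fun a => .of_eqOn fun x _ => rfl) fun a b x => rfl))
  obtain ⟨μ, hμ, hev⟩ := (Z.E a).eventually_lowSpace_eq_bot hx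
    ((Z.notMem_supp_iff hx).1 (by rw [hZe]; exact notMem_empty x))
  refine ⟨μ, hμ, (hev.filter_mono nhdsWithin_le_nhds).mono fun y hy ξ hξ => ?_⟩
  have h2 := (lowSpace_sum _ _ le_rfl le_rfl hξ).2
  rw [hy, Submodule.mem_bot] at h2
  exact sum_ext rfl h2.symm

end SumIso

/-! ### Inverses and the group structure -/

section Inverse

variable {H : Type w} [NormedAddCommGroup H] [InnerProductSpace ℂ H]
variable {X : Type u} [TopologicalSpace X] {P : Type v} [TopologicalSpace P]
  [MulAction (PUGroup H)ᵐᵒᵖ P] {T : Type u} [TopologicalSpace T] {π : P → X} {f : C(T, X)}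

theorem HFObj.IsHom.neg {U U' V : Set T} {A : HFObj U} {B : HFObj U'}
    {φ : ∀ x, A.fiber x →ₗ[ℂ] B.fiber x} (h : A.IsHom B V φ) : A.neg.IsHom B.neg V φ where
  cont := h.cont
  even x hx ξ := (map_neg (φ x) _).trans (congrArg Neg.neg (h.even x hx ξ))
  comm x hx ξ := (map_neg (φ x) _).trans (congrArg Neg.neg (h.comm x hx ξ))

theorem PairEqv.neg {U U' V : Set T} {A : HFObj U} {B : HFObj U'} {g g' : T → UGroup H}
    {φ φ' : ∀ x, A.fiber x →ₗ[ℂ] B.fiber x} (h : PairEqv A B V g φ g' φ') :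
    PairEqv A.neg B.neg V g φ g' φ' := by
  obtain ⟨ζ, hζ, hg, he⟩ := h
  refine ⟨ζ, hζ, hg, fun x hx => ?_⟩
  obtain ⟨μ, hμ, hev⟩ := he x hx
  exact ⟨μ, hμ, hev.mono fun y hy ξ hξ => hy ξ (by rwa [A.lowSpace_neg] at hξ)⟩

theorem sumMap_rotMap {E F : Type} [NormedAddCommGroup E] [InnerProductSpace ℂ E]
    [NormedAddCommGroup F] [InnerProductSpace ℂ F] {φ : E →ₗ[ℂ] F} {h : E →ₗ[ℂ] E}
    {h' : F →ₗ[ℂ] F} (hc : ∀ ξ, φ (h ξ) = h' (φ ξ)) (c : ℝ) (ξ : WithLp 2 (E × E)) :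
    sumMap φ φ (rotMap h c ξ) = rotMap h' c (sumMap φ φ ξ) := by
  rw [rotMap_apply, rotMap_apply]
  refine sum_ext ?_ ?_
  · change φ (h ξ.fst + (c : ℂ) • ξ.snd) = h' (φ ξ.fst) + (c : ℂ) • φ ξ.snd
    rw [map_add, map_smul, hc]
  · change φ (-h ξ.snd + (c : ℂ) • ξ.fst) = -h' (φ ξ.snd) + (c : ℂ) • φ ξ.fst
    rw [map_add, map_smul, map_neg, hc]

theorem HFObj.IsHom.rot {U U' V : Set T} {A : HFObj U} {B : HFObj U'}
    {φ : ∀ x, A.fiber x →ₗ[ℂ] B.fiber x} (h : A.IsHom B V φ) (c : T → ℝ) (hc : Continuous c) :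
    (A.rot c hc).IsHom (B.rot c hc) V fun x => sumMap (φ x) (φ x) where
  cont := h.cont.sum h.cont
  even x hx ξ := sum_ext (h.even x hx ξ.fst) (h.neg.even x hx ξ.snd)
  comm x hx ξ := sumMap_rotMap (h.comm x hx) (c x) ξ

theorem PairEqv.rot {U U' V : Set T} {A : HFObj U} {B : HFObj U'} {g g' : T → UGroup H}
    {φ φ' : ∀ x, A.fiber x →ₗ[ℂ] B.fiber x} (h : PairEqv A B V g φ g' φ') (c : T → ℝ)
    (hc : Continuous c) :
    PairEqv (A.rot c hc) (B.rot c hc) V g (fun x => sumMap (φ x) (φ x)) g'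
      (fun x => sumMap (φ' x) (φ' x)) := by
  obtain ⟨ζ, hζ, hg, he⟩ := h
  refine ⟨ζ, hζ, hg, fun x hx => ?_⟩
  obtain ⟨μ, hμ, hev⟩ := he x hx
  refine ⟨μ, hμ, hev.mono fun y hy ξ hξ => ?_⟩
  obtain ⟨h1, h2⟩ := rotMap_lowSpace (A.h y) (c y) μ hξ
  exact sum_ext (hy _ h1) (hy _ h2)

/-- The object with the opposite grading and the opposite maps. -/
def Vectorial.neg {τ : Twist H π f} (A : Vectorial τ) : Vectorial τ where
  E a := (A.E a).neg
  φ := A.φ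
  φ_hom a b := (A.φ_hom a b).neg
  φ_inv a b := (A.φ_inv a b).neg
  φ_comp a b c := (A.φ_comp a b c).neg

/-- The perturbation of `A ⊕ (-A)` by a function. -/
def Vectorial.rot {τ : Twist H π f} (A : Vectorial τ) (c : T → ℝ) (hc : Continuous c) :
    Vectorial τ where
  E a := (A.E a).rot c hc
  φ a b x := sumMap (A.φ a b x) (A.φ a b x)
  φ_hom a b := (A.φ_hom a b).rot c hc
  φ_inv a b := by
    have h := (A.φ_inv a b).rot c hc
    simp only [← sumMap_comp, sumMap_id] at h
    exact h
  φ_comp a b d := by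
    have h := (A.φ_comp a b d).rot c hc
    simp only [← sumMap_comp] at h
    exact h

theorem Vectorial.supp_rot_subset {τ : Twist H π f} (A : Vectorial τ) (c : T → ℝ)
    (hc : Continuous c) : (A.rot c hc).supp ⊆ A.supp ∩ {x | c x = 0} := by
  intro t ht
  obtain ⟨a, ha⟩ := τ.exists_mem t
  by_contra hcon
  refine ((A.rot c hc).notMem_supp_iff ha).2 ((A.E a).rot_bijective c hc ha ?_) ht
  by_cases h0 : c t = 0
  · exact Or.inr ((A.notMem_supp_iff ha).1 fun h => hcon ⟨h, h0⟩)
  · exact Or.inl h0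

theorem Vectorial.supp_neg {τ : Twist H π f} (A : Vectorial τ) : A.neg.supp = A.supp := by
  have h : ∀ a t, Function.Bijective ((A.neg.E a).h t) ↔ Function.Bijective ((A.E a).h t) := by
    intro a t
    exact Equiv.comp_bijective ((A.E a).h t) (Equiv.neg ((A.E a).fiber t))
  ext t
  obtain ⟨a, ha⟩ := τ.exists_mem t
  exact not_iff_not.1 ((A.neg.notMem_supp_iff ha).trans ((h a t).trans
    (A.notMem_supp_iff ha).symm))

variable [InfiniteDimensional H]

/-- The homotopy is `Vectorial.rot` with `c` equal to the time. It is `A ⊕ (-A)` at time `0` and is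
invertible at all positive times; its support stays over that of `A`, so it is a homotopy relative
to `S`. -/
theorem KF.exists_add_neg (hπ : IsPrincipalBundle (PUGroup H) π) {S : Set T} {τ : Twist H π f}
    (A : Vectorial τ) (hA : Disjoint A.supp S) (hA' : Disjoint A.neg.supp S) :
    ∃ Z : RelTVB H π f S, Z.1.supp = ∅ ∧
      KF.add hπ (KF.mk ⟨⟨τ, A⟩, hA⟩) (KF.mk ⟨⟨τ, A.neg⟩, hA'⟩) = KF.mk Z := by
  have hc : Continuous fun q : T × unitInterval => (q.2 : ℝ) :=
    continuous_subtype_val.comp continuous_snd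
  set B : TVB H π (f.comp ContinuousMap.fst : C(T × unitInterval, X)) :=
    ⟨_, (A.pull (f' := f.comp ContinuousMap.fst) (ContinuousMap.fst : C(T × unitInterval, T))
      fun _ => rfl).rot _ hc⟩ with hB
  have hBs : B.supp ⊆ (Prod.fst ⁻¹' A.supp) ∩ {q | (q.2 : ℝ) = 0} :=
    (Vectorial.supp_rot_subset _ _ hc).trans (inter_subset_inter_left _
      (TVB.supp_pull (f' := f.comp ContinuousMap.fst) (ContinuousMap.fst : C(T × unitInterval, T))
        (fun _ => rfl) ⟨τ, A⟩))
  have hBS : Disjoint B.supp (S ×ˢ univ) := disjoint_left.2 fun q hq hqS =>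
    disjoint_left.1 hA (hBs hq).1 hqS.1
  have hS : ∀ i : unitInterval, MapsTo (slice T i) S (S ×ˢ univ) := fun i t ht => ⟨ht, trivial⟩
  let R : RelTVB H π (f.comp ContinuousMap.fst : C(T × unitInterval, X)) (S ×ˢ univ) := ⟨B, hBS⟩
  let Z : unitInterval → RelTVB H π f S := fun i => RelTVB.pull (slice T i) (fun _ => rfl) (hS i) R
  refine ⟨Z 1, ?_, ?_⟩
  · refine eq_empty_of_forall_notMem fun t ht => ?_
    have h1 := (hBs (TVB.supp_pull (f' := f) (slice T 1) (fun _ => rfl) B ht)).2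
    exact one_ne_zero h1
  · rw [KF.add_mk_mk]
    refine Eq.trans ?_ (Quot.sound (r := RelTVB.Homotopic) (a := Z 0) (b := Z 1)
      ⟨R, TVB.Iso.refl _, TVB.Iso.refl _⟩)
    refine KF.mk_eq_of_iso (TVB.Refinement.iso ?_)
    have e : ∀ {E : Type} [NormedAddCommGroup E] [InnerProductSpace ℂ E] (h : E →ₗ[ℂ] E)
        (ξ : WithLp 2 (E × E)), sumMap h (-h) ξ = rotMap h ((0 : unitInterval) : ℝ) ξ := by
      intro E _ _ h ξ
      rw [rotMap_apply, Icc.coe_zero, Complex.ofReal_zero, zero_smul, zero_smul, add_zero,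
        add_zero]
      rfl
    exact Vectorial.refinementOfMaps (A := A.sum A.neg)
      (B := ((A.pull (f' := f.comp ContinuousMap.fst)
        (ContinuousMap.fst : C(T × unitInterval, T)) fun _ => rfl).rot _ hc).pull (slice T 0)
          fun _ => rfl)
      (fun a x => LinearMap.id (M := WithLp 2 ((A.E a).fiber x × (A.E a).fiber x)))
      (fun a x => LinearMap.id (M := WithLp 2 ((A.E a).fiber x × (A.E a).fiber x)))
      (fun a => ⟨HermBundle.ContOn.id ((A.E a).toHermBundle.sum (A.E a).toHermBundle),
        fun _ _ _ => rfl, fun x hx ξ => e ((A.E a).h x) ξ⟩)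
      (fun a => ⟨HermBundle.ContOn.id ((A.E a).toHermBundle.sum (A.E a).toHermBundle),
        fun _ _ _ => rfl, fun x hx ξ => (e ((A.E a).h x) ξ).symm⟩)
      (fun a => .of_eqOn fun _ _ => rfl) (fun a => .of_eqOn fun _ _ => rfl) fun a b x => rfl

theorem KF.pull_add (hπ : IsPrincipalBundle (PUGroup H) π) {T' : Type u} [TopologicalSpace T']
    {f' : C(T', X)} (q : C(T', T)) (hq : ∀ t, f' t = f (q t)) {S : Set T} {S' : Set T'}
    (hS : MapsTo q S' S) (x y : KF H π f S) :
    KF.pull q hq hS (KF.add hπ x y) = KF.add hπ (KF.pull q hq hS x) (KF.pull q hq hS y) := by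
  obtain ⟨τ, A, B, hA, hB, rfl, rfl⟩ := KF.exists_rep₂ hπ x y
  rw [KF.add_mk_mk]
  exact (KF.add_mk_mk hπ (A.pull q hq) (B.pull q hq)
    (RelTVB.pull q hq hS (⟨⟨τ, A⟩, hA⟩ : RelTVB H π f S)).2
    (RelTVB.pull q hq hS (⟨⟨τ, B⟩, hB⟩ : RelTVB H π f S)).2).symm

/-- The class of the zero object with the twisting part induced from the base. -/
def KF.zero (hπ : IsPrincipalBundle (PUGroup H) π) (τ₀ : Twist H π (ContinuousMap.id X))
    (f : C(T, X)) (S : Set T) : KF H π f S :=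
  KF.mk ⟨⟨τ₀.pull f fun _ => rfl, .zero hπ _⟩, by
    rw [TVB.supp, Vectorial.supp_zero]; exact disjoint_bot_left⟩

theorem KF.add_zero (hπ : IsPrincipalBundle (PUGroup H) π) (τ₀ : Twist H π (ContinuousMap.id X))
    {S : Set T} (x : KF H π f S) : KF.add hπ x (KF.zero hπ τ₀ f S) = x :=
  x.add_mk_of_supp_eq_empty hπ _ (Vectorial.supp_zero hπ _)

/-- `Z` and the zero object are both neutral, hence each equals their sum. -/
theorem KF.mk_eq_zero (hπ : IsPrincipalBundle (PUGroup H) π) (τ₀ : Twist H π (ContinuousMap.id X))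
    {S : Set T} (Z : RelTVB H π f S) (hZ : Z.1.supp = ∅) : KF.mk Z = KF.zero hπ τ₀ f S := by
  rw [← KF.add_mk_of_supp_eq_empty hπ (KF.zero hπ τ₀ f S) Z hZ, KF.add_comm, KF.add_zero]

theorem KF.exists_neg (hπ : IsPrincipalBundle (PUGroup H) π) (τ₀ : Twist H π (ContinuousMap.id X))
    {S : Set T} (x : KF H π f S) : ∃ y, KF.add hπ y x = KF.zero hπ τ₀ f S := by
  obtain ⟨⟨⟨τ, A⟩, hA⟩, rfl⟩ := Quot.exists_rep x
  have hA' : Disjoint A.neg.supp S := by rw [A.supp_neg]; exact hA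
  obtain ⟨Z, hZ, h⟩ := KF.exists_add_neg hπ A hA hA'
  refine ⟨KF.mk ⟨⟨τ, A.neg⟩, hA'⟩, ?_⟩
  exact (KF.add_comm hπ _ _).trans (h.trans (KF.mk_eq_zero hπ τ₀ Z hZ))

/-- The group structure on `KF`. -/
@[reducible]
def KF.addCommGroup (hπ : IsPrincipalBundle (PUGroup H) π) (τ₀ : Twist H π (ContinuousMap.id X))
    (f : C(T, X)) (S : Set T) : AddCommGroup (KF H π f S) where
  toAdd := ⟨KF.add hπ⟩
  toZero := ⟨KF.zero hπ τ₀ f S⟩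
  toNeg := ⟨fun x => (x.exists_neg hπ τ₀).choose⟩
  add_assoc := KF.add_assoc hπ
  add_comm := KF.add_comm hπ
  zero_add x := (KF.add_comm hπ _ x).trans (x.add_zero hπ τ₀)
  add_zero x := x.add_zero hπ τ₀
  neg_add_cancel x := (x.exists_neg hπ τ₀).choose_spec
  nsmul := @nsmulRec _ ⟨KF.zero hπ τ₀ f S⟩ ⟨KF.add hπ⟩
  zsmul := @zsmulRec _ ⟨KF.zero hπ τ₀ f S⟩ ⟨KF.add hπ⟩ ⟨fun x => (x.exists_neg hπ τ₀).choose⟩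
    (@nsmulRec _ ⟨KF.zero hπ τ₀ f S⟩ ⟨KF.add hπ⟩)

end Inverse

/-! ### Gluing -/

section OfSubtype

variable {T T' T₁ T₂ : Type u} [TopologicalSpace T] [TopologicalSpace T'] [TopologicalSpace T₁]
  [TopologicalSpace T₂] {O : Set T'}

/-- Isomorphisms between restrictions live over a subspace `O`, while the glued object lives over
the whole space. This comparison of neighbourhood filters moves continuity and `≑` from the first to
the second. -/
theorem map_nhdsWithin_subtypeVal {W : Set T'} (hW : W ⊆ O) (t : O) :
    map Subtype.val (𝓝[Subtype.val ⁻¹' W] t) = 𝓝[W] (t : T') := by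
  rw [Topology.IsEmbedding.subtypeVal.map_nhdsWithin_eq, image_preimage_eq_of_subset]
  rwa [Subtype.range_coe]

theorem continuousOn_of_subtype {Z : Type*} [TopologicalSpace Z] {F : T' → Z} {F₀ : O → Z}
    {W : Set T'} {W₀ : Set O} (hW : W ⊆ O) (hW₀ : ∀ t : O, (t : T') ∈ W → t ∈ W₀)
    (hF : ∀ t : O, (t : T') ∈ W → F t = F₀ t) (h : ContinuousOn F₀ W₀) : ContinuousOn F W := by
  intro t ht
  have h1 := (h.mono hW₀) ⟨t, hW ht⟩ ht
  rw [ContinuousWithinAt, ← map_nhdsWithin_subtypeVal hW ⟨t, hW ht⟩, tendsto_map'_iff]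
  rw [hF ⟨t, hW ht⟩ ht]
  refine h1.congr' ?_
  filter_upwards [self_mem_nhdsWithin] with y hy using (hF y hy).symm

variable {q₁ : T' → T₁} {q₂ : T' → T₂} {c₁ : C(O, T₁)} {c₂ : C(O, T₂)} {U₁ : Set T₁} {U₂ : Set T₂}
  {W₁ W₂ W : Set T'} {W₀ : Set O} {A₁ : HFObj U₁} {A₂ : HFObj U₂}
  {h₁ : IsOpen W₁} {h₁' : ContinuousOn q₁ W₁} {h₁'' : MapsTo q₁ W₁ U₁}
  {h₂ : IsOpen W₂} {h₂' : ContinuousOn q₂ W₂} {h₂'' : MapsTo q₂ W₂ U₂}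

theorem HFObj.IsHom.of_subtype (hq₁ : ContinuousOn q₁ O) (hq₂ : ContinuousOn q₂ O) (hW : W ⊆ O)
    (hW₀ : ∀ t : O, (t : T') ∈ W → t ∈ W₀)
    {φ : ∀ t : O, A₁.fiber (q₁ t) →ₗ[ℂ] A₂.fiber (q₂ t)}
    (h : (A₁.pull ⟨fun t : O => q₁ t, hq₁.domRestrict⟩).IsHom (A₂.pull ⟨fun t : O => q₂ t, hq₂.domRestrict⟩)
      W₀ φ)
    {Φ : ∀ t, A₁.fiber (q₁ t) →ₗ[ℂ] A₂.fiber (q₂ t)} (hΦ : ∀ t : O, (t : T') ∈ W → Φ t = φ t) :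
    (A₁.pullOn q₁ h₁ h₁' h₁'').IsHom (A₂.pullOn q₂ h₂ h₂' h₂'') W Φ where
  cont i κ j κ' := by
    refine continuousOn_of_subtype (fun t ht => hW ht.1.1) (fun t ht => ?_) (fun t ht => ?_)
      (h.cont i κ j κ')
    · exact ⟨⟨hW₀ t ht.1.1, ht.1.2.2⟩, ht.2.2⟩
    · rw [hΦ t ht.1.1]
      rfl
  even t ht ξ := by
    rw [hΦ ⟨t, hW ht⟩ ht]
    exact h.even ⟨t, hW ht⟩ (hW₀ _ ht) ξ
  comm t ht ξ := by
    rw [hΦ ⟨t, hW ht⟩ ht]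
    exact h.comm ⟨t, hW ht⟩ (hW₀ _ ht) ξ

theorem PairEqv.of_subtype {H : Type w} [NormedAddCommGroup H] [InnerProductSpace ℂ H]
    (hq₁ : ContinuousOn q₁ O) (hq₂ : ContinuousOn q₂ O) (hW : W ⊆ O)
    (hW₀ : ∀ t : O, (t : T') ∈ W → t ∈ W₀) {g g' : O → UGroup H}
    {φ φ' : ∀ t : O, A₁.fiber (q₁ t) →ₗ[ℂ] A₂.fiber (q₂ t)}
    (h : PairEqv (A₁.pull ⟨fun t : O => q₁ t, hq₁.domRestrict⟩)
      (A₂.pull ⟨fun t : O => q₂ t, hq₂.domRestrict⟩) W₀ g φ g' φ')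
    {G G' : T' → UGroup H} (hG : ∀ t : O, (t : T') ∈ W → G t = g t)
    (hG' : ∀ t : O, (t : T') ∈ W → G' t = g' t)
    {Φ Φ' : ∀ t, A₁.fiber (q₁ t) →ₗ[ℂ] A₂.fiber (q₂ t)} (hΦ : ∀ t : O, (t : T') ∈ W → Φ t = φ t)
    (hΦ' : ∀ t : O, (t : T') ∈ W → Φ' t = φ' t) :
    PairEqv (A₁.pullOn q₁ h₁ h₁' h₁'') (A₂.pullOn q₂ h₂ h₂' h₂'') W G Φ G' Φ' := by
  classical
  obtain ⟨ζ, hζ, hg, he⟩ := h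
  refine ⟨fun t => if ht : t ∈ O then ζ ⟨t, ht⟩ else 1, ?_, fun t ht ξ => ?_, fun t ht => ?_⟩
  · exact continuousOn_of_subtype hW hW₀ (fun t _ => dif_pos t.2) hζ
  · beta_reduce
    rw [dif_pos (hW ht), hG ⟨t, hW ht⟩ ht, hG' ⟨t, hW ht⟩ ht]
    exact hg ⟨t, hW ht⟩ (hW₀ _ ht) ξ
  · obtain ⟨μ, hμ, hev⟩ := he ⟨t, hW ht⟩ (hW₀ _ ht)
    refine ⟨μ, hμ, ?_⟩
    rw [← map_nhdsWithin_subtypeVal hW ⟨t, hW ht⟩, eventually_map]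
    filter_upwards [hev.filter_mono (nhdsWithin_mono _ fun y hy => hW₀ y hy),
      self_mem_nhdsWithin] with y hy hyW ξ hξ
    rw [hΦ y hyW, hΦ' y hyW, dif_pos y.2]
    exact hy ξ hξ

end OfSubtype

section Glue

variable {H : Type w} [NormedAddCommGroup H] [InnerProductSpace ℂ H]
variable {X : Type u} [TopologicalSpace X] {P : Type v} [TopologicalSpace P]
  [MulAction (PUGroup H)ᵐᵒᵖ P] {π : P → X} {T' T₁ T₂ : Type u} [TopologicalSpace T']
  [TopologicalSpace T₁] [TopologicalSpace T₂] {f' : C(T', X)} {f₁ : C(T₁, X)} {f₂ : C(T₂, X)}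

/-- The restriction of a map continuous on a set. -/
def restrOf {q : T' → T₁} {O : Set T'} (hq : ContinuousOn q O) : C(O, T₁) :=
  ⟨fun t => q t, hq.domRestrict⟩

/-- The inclusion of a subspace. -/
def subtypeIncl (O : Set T') : C(O, T') := ⟨Subtype.val, continuous_subtype_val⟩

/-- Extension by `1` of a function to `U(H)`. -/
def extOne {O : Set T'} (g : O → UGroup H) (t : T') : UGroup H :=
  open Classical in if h : t ∈ O then g ⟨t, h⟩ else 1

theorem extOne_coe {O : Set T'} (g : O → UGroup H) (t : O) : extOne g (t : T') = g t :=
  dif_pos t.2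

/-- Extension by `0` of a family of linear maps. -/
def extZero {O : Set T'} {E F : T' → Type} [∀ t, NormedAddCommGroup (E t)]
    [∀ t, InnerProductSpace ℂ (E t)] [∀ t, NormedAddCommGroup (F t)]
    [∀ t, InnerProductSpace ℂ (F t)] (φ : ∀ t : O, E t →ₗ[ℂ] F t) (t : T') : E t →ₗ[ℂ] F t :=
  open Classical in if h : t ∈ O then φ ⟨t, h⟩ else 0

/-- Data for gluing two twisted vectorial bundles, defined over open sets covering `T'` by
pull-back along `q₁` and `q₂`, and identified on the intersection. -/
structure GlueData (A₁ : TVB H π f₁) (A₂ : TVB H π f₂) (f' : C(T', X)) where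
  V₁ : Set T'
  V₂ : Set T'
  open₁ : IsOpen V₁
  open₂ : IsOpen V₂
  cover : V₁ ∪ V₂ = univ
  q₁ : T' → T₁
  q₂ : T' → T₂
  cont₁ : ContinuousOn q₁ V₁
  cont₂ : ContinuousOn q₂ V₂
  hf₁ : ∀ t ∈ V₁, f' t = f₁ (q₁ t)
  hf₂ : ∀ t ∈ V₂, f' t = f₂ (q₂ t)

namespace GlueData

variable {A₁ : TVB H π f₁} {A₂ : TVB H π f₂} (D : GlueData A₁ A₂ f')

/-- The restriction of the first object to the intersection. -/
def res₁ : TVB H π (f'.comp (subtypeIncl (D.V₁ ∩ D.V₂))) :=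
  A₁.pull (restrOf (D.cont₁.mono inter_subset_left)) fun t => D.hf₁ t t.2.1

/-- The restriction of the second object to the intersection. -/
def res₂ : TVB H π (f'.comp (subtypeIncl (D.V₁ ∩ D.V₂))) :=
  A₂.pull (restrOf (D.cont₂.mono inter_subset_right)) fun t => D.hf₂ t t.2.2

/-- The open sets of the glued object. -/
def U : A₁.twist.ι ⊕ A₂.twist.ι → Set T'
  | .inl a => D.V₁ ∩ D.q₁ ⁻¹' A₁.twist.U a
  | .inr b => D.V₂ ∩ D.q₂ ⁻¹' A₂.twist.U b

theorem isOpen_U : ∀ a, IsOpen (D.U a)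
  | .inl a => D.cont₁.isOpen_inter_preimage D.open₁ (A₁.twist.isOpen_U a)
  | .inr b => D.cont₂.isOpen_inter_preimage D.open₂ (A₂.twist.isOpen_U b)

variable (k : A₂.twist.ι → A₁.twist.ι → ↥(D.V₁ ∩ D.V₂) → UGroup H)
  (ψ : ∀ b a x, ((D.res₁.vect.E a).fiber x) →ₗ[ℂ] ((D.res₂.vect.E b).fiber x))
  (k' : A₁.twist.ι → A₂.twist.ι → ↥(D.V₁ ∩ D.V₂) → UGroup H)
  (ψ' : ∀ a b x, ((D.res₂.vect.E b).fiber x) →ₗ[ℂ] ((D.res₁.vect.E a).fiber x))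

/-- The lifted transition functions of the glued object. -/
def g : A₁.twist.ι ⊕ A₂.twist.ι → A₁.twist.ι ⊕ A₂.twist.ι → T' → UGroup H
  | .inl a, .inl a', t => A₁.twist.g a a' (D.q₁ t)
  | .inl a, .inr b, t => extOne (k' a b) t
  | .inr b, .inl a, t => extOne (k b a) t
  | .inr b, .inr b', t => A₂.twist.g b b' (D.q₂ t)

/-- The local sections of the glued object. -/
def s : A₁.twist.ι ⊕ A₂.twist.ι → T' → P
  | .inl a, t => A₁.twist.s a (D.q₁ t)
  | .inr b, t => A₂.twist.s b (D.q₂ t)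

/-- The local objects of the glued object. -/
def E : ∀ a, HFObj (D.U a)
  | .inl a => (A₁.vect.E a).pullOn D.q₁ (D.isOpen_U (.inl a)) (D.cont₁.mono inter_subset_left)
      fun _ ht => ht.2
  | .inr b => (A₂.vect.E b).pullOn D.q₂ (D.isOpen_U (.inr b)) (D.cont₂.mono inter_subset_left)
      fun _ ht => ht.2

/-- The transition maps of the glued object. -/
def φ : ∀ a b x, (D.E b).fiber x →ₗ[ℂ] (D.E a).fiber x
  | .inl a, .inl a', t => A₁.vect.φ a a' (D.q₁ t)
  | .inl a, .inr b, t => extZero (E := fun t => (A₂.vect.E b).fiber (D.q₂ t))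
      (F := fun t => (A₁.vect.E a).fiber (D.q₁ t)) (ψ' a b) t
  | .inr b, .inl a, t => extZero (E := fun t => (A₁.vect.E a).fiber (D.q₁ t))
      (F := fun t => (A₂.vect.E b).fiber (D.q₂ t)) (ψ b a) t
  | .inr b, .inr b', t => A₂.vect.φ b b' (D.q₂ t)

variable {k ψ k' ψ'}

/-- The twisting part of the glued object. -/
def twist (h1 : D.res₁.IsMorphism D.res₂ k ψ) (h2 : D.res₂.IsMorphism D.res₁ k' ψ') :
    Twist H π f' where
  ι := A₁.twist.ι ⊕ A₂.twist.ι
  U := D.U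
  isOpen_U := D.isOpen_U
  iUnion_U := by
    refine eq_univ_of_forall fun t => mem_iUnion.2 ?_
    rcases D.cover.ge (mem_univ t) with ht | ht
    · obtain ⟨a, ha⟩ := A₁.twist.exists_mem (D.q₁ t)
      exact ⟨.inl a, ht, ha⟩
    · obtain ⟨a, ha⟩ := A₂.twist.exists_mem (D.q₂ t)
      exact ⟨.inr a, ht, ha⟩
  s := D.s
  s_cont := by
    rintro (a | b)
    · exact (A₁.twist.s_cont a).comp (D.cont₁.mono inter_subset_left) fun _ ht => ht.2
    · exact (A₂.twist.s_cont b).comp (D.cont₂.mono inter_subset_left) fun _ ht => ht.2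
  proj_s := by
    rintro (a | b) t ht
    · exact (A₁.twist.proj_s a _ ht.2).trans (D.hf₁ t ht.1).symm
    · exact (A₂.twist.proj_s b _ ht.2).trans (D.hf₂ t ht.1).symm
  g := D.g k k'
  g_cont := by
    rintro (a | a) (b | b)
    · exact (A₁.twist.g_cont a b).comp (D.cont₁.mono fun t ht => ht.1.1)
        fun _ ht => by exact ⟨ht.1.2, ht.2.2⟩
    · exact continuousOn_of_subtype (fun t ht => by exact ⟨ht.1.1, ht.2.1⟩)
        (fun t ht => by exact ⟨ht.1.2, ht.2.2⟩) (fun t _ => extOne_coe _ t) (h2.k_cont a b)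
    · exact continuousOn_of_subtype (fun t ht => by exact ⟨ht.2.1, ht.1.1⟩)
        (fun t ht => by exact ⟨ht.1.2, ht.2.2⟩) (fun t _ => extOne_coe _ t) (h1.k_cont a b)
    · exact (A₂.twist.g_cont a b).comp (D.cont₂.mono fun t ht => ht.1.1)
        fun _ ht => by exact ⟨ht.1.2, ht.2.2⟩
  g_lift := by
    rintro (a | a) (b | b) t ht
    · exact A₁.twist.g_lift a b _ ⟨ht.1.2, ht.2.2⟩
    · have e := extOne_coe (k' a b) ⟨t, ht.1.1, ht.2.1⟩
      change MulOpposite.op (extOne (k' a b) t : PUGroup H) • _ = _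
      rw [e]
      exact h2.k_lift a b ⟨t, ht.1.1, ht.2.1⟩ ⟨ht.1.2, ht.2.2⟩
    · have e := extOne_coe (k a b) ⟨t, ht.2.1, ht.1.1⟩
      change MulOpposite.op (extOne (k a b) t : PUGroup H) • _ = _
      rw [e]
      exact h1.k_lift a b ⟨t, ht.2.1, ht.1.1⟩ ⟨ht.1.2, ht.2.2⟩
    · exact A₂.twist.g_lift a b _ ⟨ht.1.2, ht.2.2⟩

/-- The vectorial part of the glued object. -/
def vect (h1 : D.res₁.IsMorphism D.res₂ k ψ) (h2 : D.res₂.IsMorphism D.res₁ k' ψ')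
    (h3 : D.res₁.IsLeftInverse D.res₂ k ψ k' ψ') (h4 : D.res₂.IsLeftInverse D.res₁ k' ψ' k ψ) :
    Vectorial (D.twist h1 h2) where
  E := D.E
  φ := D.φ ψ ψ'
  φ_hom := by
    rintro (a | a) (b | b)
    · exact HFObj.IsHom.pullOn (fun t ht => by exact ⟨ht.1.2, ht.2.2⟩) (A₁.vect.φ_hom a b)
    · exact (h2.ψ_hom a b).of_subtype (D.cont₂.mono inter_subset_right)
        (D.cont₁.mono inter_subset_left) (fun t ht => by exact ⟨ht.1.1, ht.2.1⟩)
        (fun t ht => by exact ⟨ht.1.2, ht.2.2⟩) fun t _ => dif_pos t.2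
    · exact (h1.ψ_hom a b).of_subtype (D.cont₁.mono inter_subset_left)
        (D.cont₂.mono inter_subset_right) (fun t ht => by exact ⟨ht.2.1, ht.1.1⟩)
        (fun t ht => by exact ⟨ht.1.2, ht.2.2⟩) fun t _ => dif_pos t.2
    · exact HFObj.IsHom.pullOn (fun t ht => by exact ⟨ht.1.2, ht.2.2⟩) (A₂.vect.φ_hom a b)
  φ_inv := by
    rintro (a | a) (b | b)
    · exact PairEqv.pullOn (D.cont₁.mono fun t ht => ht.1.1) (fun t ht => by exact ⟨ht.1.2, ht.2.2⟩)
        (A₁.vect.φ_inv a b)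
    · refine PairEqv.of_subtype (D.cont₁.mono inter_subset_left) (D.cont₁.mono inter_subset_left)
        (fun t ht => by exact ⟨ht.1.1, ht.2.1⟩) (fun t ht => by exact ⟨ht.1.2, ht.2.2⟩)
        (((h3 a b a).on fun t ht => by exact ⟨ht, ht.1⟩).trans ((D.res₁.vect.φ_self a).on inter_subset_left))
        (fun t _ => ?_) (fun t _ => rfl) (fun t _ => ?_) (fun t _ => rfl)
      · exact congrArg₂ (· * ·) (extOne_coe _ t) (extOne_coe _ t)
      · exact congrArg₂ LinearMap.comp (dif_pos t.2) (dif_pos t.2)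
    · refine PairEqv.of_subtype (D.cont₂.mono inter_subset_right) (D.cont₂.mono inter_subset_right)
        (fun t ht => by exact ⟨ht.2.1, ht.1.1⟩) (fun t ht => by exact ⟨ht.1.2, ht.2.2⟩)
        (((h4 a b a).on fun t ht => by exact ⟨ht, ht.1⟩).trans ((D.res₂.vect.φ_self a).on inter_subset_left))
        (fun t _ => ?_) (fun t _ => rfl) (fun t _ => ?_) (fun t _ => rfl)
      · exact congrArg₂ (· * ·) (extOne_coe _ t) (extOne_coe _ t)
      · exact congrArg₂ LinearMap.comp (dif_pos t.2) (dif_pos t.2)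
    · exact PairEqv.pullOn (D.cont₂.mono fun t ht => ht.1.1) (fun t ht => by exact ⟨ht.1.2, ht.2.2⟩)
        (A₂.vect.φ_inv a b)
  -- Among the six mixed cases, those whose middle index is on the opposite side to both outer ones
  -- are the inverse relations; the others express compatibility of the isomorphism with the
  -- transition maps of its source or of its target.
  φ_comp := by
    rintro (a | a) (b | b) (c | c)
    · exact PairEqv.pullOn (D.cont₁.mono fun t ht => ht.1.1.1)
        (fun t ht => by exact ⟨⟨ht.1.1.2, ht.1.2.2⟩, ht.2.2⟩) (A₁.vect.φ_comp a b c)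
    · refine PairEqv.of_subtype (D.cont₂.mono inter_subset_right) (D.cont₁.mono inter_subset_left)
        (fun t ht => by exact ⟨ht.1.1.1, ht.2.1⟩) (fun t ht => by exact ⟨⟨ht.1.1.2, ht.1.2.2⟩, ht.2.2⟩)
        (h2.comp_target a b c) (fun t _ => ?_) (fun t _ => extOne_coe _ t) (fun t _ => ?_)
        (fun t _ => dif_pos t.2)
      · exact congrArg (A₁.twist.g a b (D.q₁ t) * ·) (extOne_coe _ t)
      · exact congrArg (LinearMap.comp (A₁.vect.φ a b (D.q₁ t))) (dif_pos t.2)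
    · refine PairEqv.of_subtype (D.cont₁.mono inter_subset_left) (D.cont₁.mono inter_subset_left)
        (fun t ht => by exact ⟨ht.1.1.1, ht.1.2.1⟩) (fun t ht => by exact ⟨⟨ht.1.1.2, ht.1.2.2⟩, ht.2.2⟩)
        (h3 a b c) (fun t _ => ?_) (fun t _ => rfl) (fun t _ => ?_) (fun t _ => rfl)
      · exact congrArg₂ (· * ·) (extOne_coe _ t) (extOne_coe _ t)
      · exact congrArg₂ LinearMap.comp (dif_pos t.2) (dif_pos t.2)
    · refine PairEqv.of_subtype (D.cont₂.mono inter_subset_right) (D.cont₁.mono inter_subset_left)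
        (fun t ht => by exact ⟨ht.1.1.1, ht.2.1⟩) (fun t ht => by exact ⟨⟨ht.1.1.2, ht.1.2.2⟩, ht.2.2⟩)
        (h2.comp_source a b c) (fun t _ => ?_) (fun t _ => extOne_coe _ t) (fun t _ => ?_)
        (fun t _ => dif_pos t.2)
      · exact congrArg (· * A₂.twist.g b c (D.q₂ t)) (extOne_coe _ t)
      · exact congrArg (fun l => LinearMap.comp l (A₂.vect.φ b c (D.q₂ t))) (dif_pos t.2)
    · refine PairEqv.of_subtype (D.cont₁.mono inter_subset_left) (D.cont₂.mono inter_subset_right)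
        (fun t ht => by exact ⟨ht.2.1, ht.1.1.1⟩) (fun t ht => by exact ⟨⟨ht.1.1.2, ht.1.2.2⟩, ht.2.2⟩)
        (h1.comp_source a b c) (fun t _ => ?_) (fun t _ => extOne_coe _ t) (fun t _ => ?_)
        (fun t _ => dif_pos t.2)
      · exact congrArg (· * A₁.twist.g b c (D.q₁ t)) (extOne_coe _ t)
      · exact congrArg (fun l => LinearMap.comp l (A₁.vect.φ b c (D.q₁ t))) (dif_pos t.2)
    · refine PairEqv.of_subtype (D.cont₂.mono inter_subset_right) (D.cont₂.mono inter_subset_right)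
        (fun t ht => by exact ⟨ht.1.2.1, ht.1.1.1⟩) (fun t ht => by exact ⟨⟨ht.1.1.2, ht.1.2.2⟩, ht.2.2⟩)
        (h4 a b c) (fun t _ => ?_) (fun t _ => rfl) (fun t _ => ?_) (fun t _ => rfl)
      · exact congrArg₂ (· * ·) (extOne_coe _ t) (extOne_coe _ t)
      · exact congrArg₂ LinearMap.comp (dif_pos t.2) (dif_pos t.2)
    · refine PairEqv.of_subtype (D.cont₁.mono inter_subset_left) (D.cont₂.mono inter_subset_right)
        (fun t ht => by exact ⟨ht.2.1, ht.1.1.1⟩) (fun t ht => by exact ⟨⟨ht.1.1.2, ht.1.2.2⟩, ht.2.2⟩)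
        (h1.comp_target a b c) (fun t _ => ?_) (fun t _ => extOne_coe _ t) (fun t _ => ?_)
        (fun t _ => dif_pos t.2)
      · exact congrArg (A₂.twist.g a b (D.q₂ t) * ·) (extOne_coe _ t)
      · exact congrArg (LinearMap.comp (A₂.vect.φ a b (D.q₂ t))) (dif_pos t.2)
    · exact PairEqv.pullOn (D.cont₂.mono fun t ht => ht.1.1.1)
        (fun t ht => by exact ⟨⟨ht.1.1.2, ht.1.2.2⟩, ht.2.2⟩) (A₂.vect.φ_comp a b c)

end GlueData

end Glue

/-! ### Conditions over the empty set. -/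

section EmptySet

variable {T : Type u} [TopologicalSpace T] {U U' V : Set T} {A : HFObj U} {B : HFObj U'}

theorem HFObj.Eqv.of_empty (hV : ∀ x, x ∉ V) (φ φ' : ∀ x, A.fiber x →ₗ[ℂ] B.fiber x) :
    A.Eqv B V φ φ' := fun x hx => (hV x hx).elim

theorem HFObj.IsHom.of_empty (hV : ∀ x, x ∉ V) (φ : ∀ x, A.fiber x →ₗ[ℂ] B.fiber x) :
    A.IsHom B V φ :=
  ⟨fun _ _ _ _ x hx => (hV x hx.1.1).elim, fun x hx => (hV x hx).elim,
    fun x hx => (hV x hx).elim⟩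

theorem PairEqv.of_empty {H : Type w} [NormedAddCommGroup H] [InnerProductSpace ℂ H]
    (hV : ∀ x, x ∉ V) (g g' : T → UGroup H) (φ φ' : ∀ x, A.fiber x →ₗ[ℂ] B.fiber x) :
    PairEqv A B V g φ g' φ' :=
  ⟨fun _ => 1, continuousOn_const, fun x hx => (hV x hx).elim, .of_empty hV _ _⟩

end EmptySet

/-! ### The glued object and its restrictions. -/

section GlueIso

variable {H : Type w} [NormedAddCommGroup H] [InnerProductSpace ℂ H]
variable {X : Type u} [TopologicalSpace X] {P : Type v} [TopologicalSpace P]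
  [MulAction (PUGroup H)ᵐᵒᵖ P] {π : P → X} {T' T'' T₁ T₂ : Type u} [TopologicalSpace T']
  [TopologicalSpace T''] [TopologicalSpace T₁] [TopologicalSpace T₂] {f' : C(T', X)}
  {f'' : C(T'', X)} {f₁ : C(T₁, X)} {f₂ : C(T₂, X)}

/-- Every condition is vacuous. The case is treated apart because the comparison of a glued object
with one of its pieces needs a chart, which is chosen at a point. -/
theorem TVB.iso_of_isEmpty [IsEmpty T'] (A B : TVB H π f') : A.Iso B := by
  have h : ∀ A B : TVB H π f', A.IsMorphism B (fun _ _ _ => 1) (fun _ _ _ => 0) := fun A B =>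
    ⟨fun _ _ t => isEmptyElim t, fun _ _ t => isEmptyElim t, fun _ _ => .of_empty isEmptyElim _,
      fun _ _ _ => .of_empty isEmptyElim _ _ _ _, fun _ _ _ => .of_empty isEmptyElim _ _ _ _⟩
  exact ⟨_, _, _, _, h A B, h B A, fun _ _ _ => .of_empty isEmptyElim _ _ _ _,
    fun _ _ _ => .of_empty isEmptyElim _ _ _ _⟩

namespace GlueData

variable {A₁ : TVB H π f₁} {A₂ : TVB H π f₂} (D : GlueData A₁ A₂ f')
  {k : A₂.twist.ι → A₁.twist.ι → ↥(D.V₁ ∩ D.V₂) → UGroup H}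
  {ψ : ∀ b a x, ((D.res₁.vect.E a).fiber x) →ₗ[ℂ] ((D.res₂.vect.E b).fiber x)}
  {k' : A₁.twist.ι → A₂.twist.ι → ↥(D.V₁ ∩ D.V₂) → UGroup H}
  {ψ' : ∀ a b x, ((D.res₂.vect.E b).fiber x) →ₗ[ℂ] ((D.res₁.vect.E a).fiber x)}

section
variable (h1 : D.res₁.IsMorphism D.res₂ k ψ) (h2 : D.res₂.IsMorphism D.res₁ k' ψ')
  (h3 : D.res₁.IsLeftInverse D.res₂ k ψ k' ψ') (h4 : D.res₂.IsLeftInverse D.res₁ k' ψ' k ψ)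

/-- The glued object. -/
def glue : TVB H π f' := ⟨D.twist h1 h2, D.vect h1 h2 h3 h4⟩

theorem mem_supp_glue_left {t : T'} (ht : t ∈ D.V₁) :
    t ∈ (D.glue h1 h2 h3 h4).supp ↔ D.q₁ t ∈ A₁.supp := by
  obtain ⟨a, ha⟩ := A₁.twist.exists_mem (D.q₁ t)
  exact not_iff_not.1 (((D.glue h1 h2 h3 h4).notMem_supp_iff (a := .inl a) ⟨ht, ha⟩).trans
    (A₁.notMem_supp_iff ha).symm)

theorem mem_supp_glue_right {t : T'} (ht : t ∈ D.V₂) :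
    t ∈ (D.glue h1 h2 h3 h4).supp ↔ D.q₂ t ∈ A₂.supp := by
  obtain ⟨a, ha⟩ := A₂.twist.exists_mem (D.q₂ t)
  exact not_iff_not.1 (((D.glue h1 h2 h3 h4).notMem_supp_iff (a := .inr a) ⟨ht, ha⟩).trans
    (A₂.notMem_supp_iff ha).symm)

/-- Away from `V₂`, the glued object is the pull-back of the first one. -/
def refinementLeft (s : C(T'', T')) (hf : ∀ t, f'' t = f' (s t)) (hs : ∀ t, s t ∈ D.V₁)
    (hs' : ∀ t, s t ∉ D.V₂) (hc : Continuous fun t => D.q₁ (s t)) (a₀ : A₁.twist.ι) :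
    ((D.glue h1 h2 h3 h4).pull s hf).Refinement
      (A₁.pull ⟨fun t => D.q₁ (s t), hc⟩ fun t => (hf t).trans (D.hf₁ _ (hs t))) where
  ρ := Sum.elim id fun _ => a₀
  sub
    | .inl a => fun t ht => ht.2
    | .inr b => fun t ht => (hs' t ht.1).elim
  c _ _ := 1
  lift
    | .inl a => .one _ _
    | .inr b => ⟨continuousOn_const, fun t ht => (hs' t ht.1).elim⟩
  θ
    | .inl a => fun t => LinearMap.id (M := (A₁.vect.E a).fiber (D.q₁ (s t)))
    | .inr b => fun t => 0
  θ'
    | .inl a => fun t => LinearMap.id (M := (A₁.vect.E a).fiber (D.q₁ (s t)))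
    | .inr b => fun t => 0
  θ_hom
    | .inl a => ⟨fun i κ j κ' => (((A₁.vect.E a).pull ⟨fun t => D.q₁ (s t), hc⟩).transition
        j i κ' κ).mono fun t ht => ⟨ht.2, ht.1.2.2⟩, fun _ _ _ => rfl, fun _ _ _ => rfl⟩
    | .inr b => .of_empty (fun t ht => hs' t ht.1) _
  θ'_hom
    | .inl a => ⟨fun i κ j κ' => (((A₁.vect.E a).pull ⟨fun t => D.q₁ (s t), hc⟩).transition
        j i κ' κ).mono fun t ht => ⟨ht.2.2, ht.1.2⟩, fun _ _ _ => rfl, fun _ _ _ => rfl⟩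
    | .inr b => .of_empty (fun t ht => hs' t ht.1) _
  θ'_θ
    | .inl a => .of_eqOn fun _ _ => rfl
    | .inr b => .of_empty (fun t ht => hs' t ht.1) _ _
  θ_θ'
    | .inl a => .of_eqOn fun _ _ => rfl
    | .inr b => .of_empty (fun t ht => hs' t ht.1) _ _
  compat
    | .inl a, .inl a' => .of_eqOn (fun t _ => (one_mul _).trans (mul_one _).symm) fun _ _ => rfl
    | .inr b, _ => .of_empty (fun t ht => hs' t ht.1.1) _ _ _ _
    | .inl a, .inr b => .of_empty (fun t ht => hs' t ht.2.1) _ _ _ _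

/-- Away from `V₁`, the glued object is the pull-back of the second one. -/
def refinementRight (s : C(T'', T')) (hf : ∀ t, f'' t = f' (s t)) (hs : ∀ t, s t ∈ D.V₂)
    (hs' : ∀ t, s t ∉ D.V₁) (hc : Continuous fun t => D.q₂ (s t)) (a₀ : A₂.twist.ι) :
    ((D.glue h1 h2 h3 h4).pull s hf).Refinement
      (A₂.pull ⟨fun t => D.q₂ (s t), hc⟩ fun t => (hf t).trans (D.hf₂ _ (hs t))) where
  ρ := Sum.elim (fun _ => a₀) id
  sub
    | .inr a => fun t ht => ht.2
    | .inl b => fun t ht => (hs' t ht.1).elim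
  c _ _ := 1
  lift
    | .inr a => .one _ _
    | .inl b => ⟨continuousOn_const, fun t ht => (hs' t ht.1).elim⟩
  θ
    | .inr a => fun t => LinearMap.id (M := (A₂.vect.E a).fiber (D.q₂ (s t)))
    | .inl b => fun t => 0
  θ'
    | .inr a => fun t => LinearMap.id (M := (A₂.vect.E a).fiber (D.q₂ (s t)))
    | .inl b => fun t => 0
  θ_hom
    | .inr a => ⟨fun i κ j κ' => (((A₂.vect.E a).pull ⟨fun t => D.q₂ (s t), hc⟩).transition
        j i κ' κ).mono fun t ht => ⟨ht.2, ht.1.2.2⟩, fun _ _ _ => rfl, fun _ _ _ => rfl⟩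
    | .inl b => .of_empty (fun t ht => hs' t ht.1) _
  θ'_hom
    | .inr a => ⟨fun i κ j κ' => (((A₂.vect.E a).pull ⟨fun t => D.q₂ (s t), hc⟩).transition
        j i κ' κ).mono fun t ht => ⟨ht.2.2, ht.1.2⟩, fun _ _ _ => rfl, fun _ _ _ => rfl⟩
    | .inl b => .of_empty (fun t ht => hs' t ht.1) _
  θ'_θ
    | .inr a => .of_eqOn fun _ _ => rfl
    | .inl b => .of_empty (fun t ht => hs' t ht.1) _ _
  θ_θ'
    | .inr a => .of_eqOn fun _ _ => rfl
    | .inl b => .of_empty (fun t ht => hs' t ht.1) _ _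
  compat
    | .inr a, .inr a' => .of_eqOn (fun t _ => (one_mul _).trans (mul_one _).symm) fun _ _ => rfl
    | .inl b, _ => .of_empty (fun t ht => hs' t ht.1.1) _ _ _ _
    | .inr a, .inl b => .of_empty (fun t ht => hs' t ht.2.1) _ _ _ _

end

/-- Two objects over open sets that cover the space, isomorphic over the intersection, can be
glued. -/
theorem exists_glue (h : D.res₁.Iso D.res₂) : ∃ G : TVB H π f',
    (∀ t ∈ D.V₁, t ∈ G.supp ↔ D.q₁ t ∈ A₁.supp) ∧ (∀ t ∈ D.V₂, t ∈ G.supp ↔ D.q₂ t ∈ A₂.supp) ∧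
    (∀ (T'' : Type u) [TopologicalSpace T''] (f'' : C(T'', X)) (s : C(T'', T'))
      (hf : ∀ t, f'' t = f' (s t)), (∀ t, s t ∈ D.V₁) → (∀ t, s t ∉ D.V₂) →
      ∀ (c : C(T'', T₁)) (hfc : ∀ t, f'' t = f₁ (c t)), (∀ t, c t = D.q₁ (s t)) →
      ∀ Z, (A₁.pull c hfc).Iso Z → (G.pull s hf).Iso Z) ∧
    (∀ (T'' : Type u) [TopologicalSpace T''] (f'' : C(T'', X)) (s : C(T'', T'))
      (hf : ∀ t, f'' t = f' (s t)), (∀ t, s t ∈ D.V₂) → (∀ t, s t ∉ D.V₁) →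
      ∀ (c : C(T'', T₂)) (hfc : ∀ t, f'' t = f₂ (c t)), (∀ t, c t = D.q₂ (s t)) →
      ∀ Z, (A₂.pull c hfc).Iso Z → (G.pull s hf).Iso Z) := by
  obtain ⟨k, ψ, k', ψ', h1, h2, h3, h4⟩ := h
  refine ⟨D.glue h1 h2 h3 h4, fun t ht => D.mem_supp_glue_left h1 h2 h3 h4 ht,
    fun t ht => D.mem_supp_glue_right h1 h2 h3 h4 ht, ?_, ?_⟩
  · intro T'' _ f'' s hf hs hs' c hfc hc Z hZ
    have hcont : Continuous fun t => D.q₁ (s t) := by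
      simpa only [← hc] using c.continuous
    obtain rfl : c = ⟨fun t => D.q₁ (s t), hcont⟩ := ContinuousMap.ext hc
    rcases isEmpty_or_nonempty T'' with hT | ⟨⟨t⟩⟩
    · exact TVB.iso_of_isEmpty _ _
    · exact hZ.of_refinement (D.refinementLeft h1 h2 h3 h4 s hf hs hs' hcont
        (A₁.twist.exists_mem (D.q₁ (s t))).choose)
  · intro T'' _ f'' s hf hs hs' c hfc hc Z hZ
    have hcont : Continuous fun t => D.q₂ (s t) := by
      simpa only [← hc] using c.continuous
    obtain rfl : c = ⟨fun t => D.q₂ (s t), hcont⟩ := ContinuousMap.ext hc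
    rcases isEmpty_or_nonempty T'' with hT | ⟨⟨t⟩⟩
    · exact TVB.iso_of_isEmpty _ _
    · exact hZ.of_refinement (D.refinementRight h1 h2 h3 h4 s hf hs hs' hcont
        (A₂.twist.exists_mem (D.q₂ (s t))).choose)

end GlueData

end GlueIso

/-! ### Homotopy as an equivalence relation, and mapping cylinders. -/

section Homotopy

variable {H : Type w} [NormedAddCommGroup H] [InnerProductSpace ℂ H]
variable {X : Type u} [TopologicalSpace X] {P : Type v} [TopologicalSpace P]
  [MulAction (PUGroup H)ᵐᵒᵖ P] {π : P → X} {T T' : Type u} [TopologicalSpace T]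
  [TopologicalSpace T'] {f : C(T, X)} {f' : C(T', X)}

/-- The nearest point of the unit interval. -/
abbrev clamp (x : ℝ) : unitInterval := projIcc 0 1 zero_le_one x

theorem clamp_of_le {x : ℝ} (h : x ≤ 0) : clamp x = 0 := projIcc_of_le_left _ h

theorem clamp_of_ge {x : ℝ} (h : 1 ≤ x) : clamp x = 1 := projIcc_of_right_le _ h

theorem clamp_coe (x : unitInterval) : clamp (x : ℝ) = x := projIcc_val _ x

theorem coe_clamp {x : ℝ} (h : 0 ≤ x) (h' : x ≤ 1) : (clamp x : ℝ) = x :=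
  congrArg Subtype.val (projIcc_of_mem zero_le_one ⟨h, h'⟩)

theorem continuous_clamp : Continuous clamp := continuous_projIcc

theorem TVB.pull_congr (A : TVB H π f) {q q' : C(T', T)} {hq : ∀ t, f' t = f (q t)}
    {hq' : ∀ t, f' t = f (q' t)} (h : ∀ t, q t = q' t) : A.pull q hq = A.pull q' hq' := by
  obtain rfl : q = q' := ContinuousMap.ext h
  rfl

theorem RelTVB.Homotopic.symm {S : Set T} {A B : RelTVB H π f S} (h : A.Homotopic B) :
    B.Homotopic A := by
  obtain ⟨C, h0, h1⟩ := h
  let q : C(T × unitInterval, T × unitInterval) :=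
    (ContinuousMap.id T).prodMap ⟨unitInterval.symm, unitInterval.continuous_symm⟩
  have hq : MapsTo q (S ×ˢ univ) (S ×ˢ univ) := fun t ht => ⟨ht.1, trivial⟩
  refine ⟨C.pull q (fun _ => rfl) hq, ?_, ?_⟩
  · rwa [show ((C.pull q (fun _ => rfl) hq).1.pull (f' := f) (slice T 0)
      fun _ => rfl) = C.1.pull (slice T 1) fun _ => rfl from
      TVB.pull_congr (q := q.comp (slice T 0)) (q' := slice T 1) (hq := fun _ => rfl)
        (hq' := fun _ => rfl) C.1 fun t => Prod.ext rfl unitInterval.symm_zero]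
  · rwa [show ((C.pull q (fun _ => rfl) hq).1.pull (f' := f) (slice T 1)
      fun _ => rfl) = C.1.pull (slice T 0) fun _ => rfl from
      TVB.pull_congr (q := q.comp (slice T 1)) (q' := slice T 0) (hq := fun _ => rfl)
        (hq' := fun _ => rfl) C.1 fun t => Prod.ext rfl unitInterval.symm_one]

/-- Two homotopies, the first of which ends where the second one begins, can be composed. -/
theorem TVB.exists_concat (C C' : TVB H π (f.comp ContinuousMap.fst : C(T × unitInterval, X)))
    (h : (C.pull (f' := f) (slice T 1) fun _ => rfl).Iso (C'.pull (slice T 0) fun _ => rfl)) :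
    ∃ G : TVB H π (f.comp ContinuousMap.fst : C(T × unitInterval, X)),
      (∀ S : Set T, Disjoint C.supp (S ×ˢ univ) → Disjoint C'.supp (S ×ˢ univ) →
        Disjoint G.supp (S ×ˢ univ)) ∧
      (∀ Z : TVB H π f, (C.pull (f' := f) (slice T 0) fun _ => rfl).Iso Z →
        (G.pull (f' := f) (slice T 0) fun _ => rfl).Iso Z) ∧
      (∀ Z : TVB H π f, (C'.pull (f' := f) (slice T 1) fun _ => rfl).Iso Z →
        (G.pull (f' := f) (slice T 1) fun _ => rfl).Iso Z) := by
  -- `C` runs during the first third of the time and `C'` during the last third. The clamps hold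
  -- both constant on the overlap `1/3 < t < 2/3`, where `C` is at its end and `C'` at its
  -- beginning, so the given isomorphism identifies them.
  let D : GlueData C C' (f.comp ContinuousMap.fst : C(T × unitInterval, X)) :=
    { V₁ := {p | (p.2 : ℝ) < 2 / 3}
      V₂ := {p | 1 / 3 < (p.2 : ℝ)}
      open₁ := isOpen_lt (by fun_prop) continuous_const
      open₂ := isOpen_lt continuous_const (by fun_prop)
      cover := eq_univ_of_forall fun p => by
        by_cases hp : (p.2 : ℝ) < 2 / 3
        · exact Or.inl hp
        · exact Or.inr (by change 1 / 3 < (p.2 : ℝ); linarith)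
      q₁ := fun p => (p.1, clamp (3 * p.2))
      q₂ := fun p => (p.1, clamp (3 * p.2 - 2))
      cont₁ := (continuous_fst.prodMk (continuous_clamp.comp (by fun_prop))).continuousOn
      cont₂ := (continuous_fst.prodMk (continuous_clamp.comp (by fun_prop))).continuousOn
      hf₁ := fun _ _ => rfl
      hf₂ := fun _ _ => rfl }
  have hD : D.res₁.Iso D.res₂ := by
    let q₀ : C(↥(D.V₁ ∩ D.V₂), T) := ⟨fun p => p.1.1, by fun_prop⟩
    have h' := h.pull (f' := (f.comp ContinuousMap.fst).comp (subtypeIncl (D.V₁ ∩ D.V₂))) q₀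
      fun _ => rfl
    have e1 : (C.pull (f' := f) (slice T 1) fun _ => rfl).pull
        (f' := (f.comp ContinuousMap.fst).comp (subtypeIncl (D.V₁ ∩ D.V₂))) q₀ (fun _ => rfl) =
        D.res₁ := TVB.pull_congr (q := (slice T 1).comp q₀) (hq := fun _ => rfl) C fun p => Prod.ext rfl
      (clamp_of_ge (by have : 1 / 3 < (p.1.2 : ℝ) := p.2.2; linarith)).symm
    have e2 : (C'.pull (f' := f) (slice T 0) fun _ => rfl).pull
        (f' := (f.comp ContinuousMap.fst).comp (subtypeIncl (D.V₁ ∩ D.V₂))) q₀ (fun _ => rfl) =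
        D.res₂ := TVB.pull_congr (q := (slice T 0).comp q₀) (hq := fun _ => rfl) C' fun p => Prod.ext rfl
      (clamp_of_le (by have : (p.1.2 : ℝ) < 2 / 3 := p.2.1; linarith)).symm
    rwa [e1, e2] at h'
  obtain ⟨G, hG1, hG2, hl, hr⟩ := D.exists_glue hD
  refine ⟨G, fun S hS hS' => disjoint_left.2 fun p hp hpS => ?_, fun Z hZ => ?_, fun Z hZ => ?_⟩
  · rcases D.cover.ge (mem_univ p) with ht | ht
    · exact disjoint_left.1 hS ((hG1 p ht).1 hp) ⟨hpS.1, trivial⟩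
    · exact disjoint_left.1 hS' ((hG2 p ht).1 hp) ⟨hpS.1, trivial⟩
  · refine hl T f (slice T 0) (fun _ => rfl) (fun t => ?_) (fun t => ?_) (slice T 0)
      (fun _ => rfl) (fun t => Prod.ext rfl (clamp_of_le ?_).symm) Z hZ
    · change ((0 : unitInterval) : ℝ) < 2 / 3
      norm_num
    · change ¬ 1 / 3 < ((0 : unitInterval) : ℝ)
      norm_num
    · change 3 * ((0 : unitInterval) : ℝ) ≤ 0
      norm_num
  · refine hr T f (slice T 1) (fun _ => rfl) (fun t => ?_) (fun t => ?_) (slice T 1)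
      (fun _ => rfl) (fun t => Prod.ext rfl (clamp_of_ge ?_).symm) Z hZ
    · change 1 / 3 < ((1 : unitInterval) : ℝ)
      norm_num
    · change ¬ ((1 : unitInterval) : ℝ) < 2 / 3
      norm_num
    · change 1 ≤ 3 * ((1 : unitInterval) : ℝ) - 2
      norm_num

/-- The constant homotopy on `B` is inserted between the two: at each junction a single given
isomorphism, or its inverse, then suffices and isomorphisms need not be composed. -/
theorem RelTVB.Homotopic.trans {S : Set T} {A B C : RelTVB H π f S} (h : A.Homotopic B)
    (h' : B.Homotopic C) : A.Homotopic C := by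
  obtain ⟨K, h0, h1⟩ := h
  obtain ⟨L, m0, m1⟩ := h'
  let M : RelTVB H π (f.comp ContinuousMap.fst : C(T × unitInterval, X)) (S ×ˢ univ) :=
    RelTVB.pull ContinuousMap.fst (fun _ => rfl) (fun _ ht => ht.1) B
  obtain ⟨G, hGS, hG0, hG1⟩ := TVB.exists_concat K.1 M.1 h1
  obtain ⟨G', hGS', hG0', hG1'⟩ := TVB.exists_concat G L.1 (hG1 _ m0.symm)
  exact ⟨⟨G', hGS' S (hGS S K.2 M.2) L.2⟩, hG0' _ (hG0 _ h0), hG1' _ m1⟩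

/-- Objects represent the same class if and only if they are joined by a homotopy. -/
theorem KF.mk_eq_iff {S : Set T} {A B : RelTVB H π f S} :
    KF.mk A = KF.mk B ↔ A.Homotopic B := by
  have e : Equivalence (RelTVB.Homotopic (H := H) (π := π) (f := f) (S := S)) :=
    ⟨fun A => .of_iso (.refl _), .symm, .trans⟩
  exact ⟨fun h => e.eqvGen_iff.1 (Quot.eqvGen_exact h), fun h => Quot.sound h⟩

/-- Homotopic maps of pairs over `X` induce the same map. -/
theorem KF.mk_pull_eq_of_homotopy {S : Set T} {S' : Set T'} (A : RelTVB H π f S)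
    (h : C(T' × unitInterval, T)) (hf : ∀ p, f' p.1 = f (h p)) (hS : ∀ t ∈ S', ∀ i, h (t, i) ∈ S)
    {q₀ q₁ : C(T', T)} {hq₀ : ∀ t, f' t = f (q₀ t)} {hq₁ : ∀ t, f' t = f (q₁ t)}
    {hS₀ : MapsTo q₀ S' S} {hS₁ : MapsTo q₁ S' S} (h₀ : ∀ t, h (t, 0) = q₀ t)
    (h₁ : ∀ t, h (t, 1) = q₁ t) : KF.mk (A.pull q₀ hq₀ hS₀) = KF.mk (A.pull q₁ hq₁ hS₁) := by
  refine KF.mk_eq_iff.2 ⟨RelTVB.pull (f' := f'.comp ContinuousMap.fst) h hf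
    (fun p hp => hS p.1 hp.1 p.2) A, ?_, ?_⟩
  · rw [show A.pull q₀ hq₀ hS₀ = RelTVB.pull (h.comp (slice T' 0)) (fun t => hf (t, 0))
      (fun t ht => hS t ht 0) A from Subtype.ext (TVB.pull_congr _ fun t => (h₀ t).symm)]
    exact .refl _
  · rw [show A.pull q₁ hq₁ hS₁ = RelTVB.pull (h.comp (slice T' 1)) (fun t => hf (t, 1))
      (fun t ht => hS t ht 1) A from Subtype.ext (TVB.pull_congr _ fun t => (h₁ t).symm)]
    exact .refl _

/-- The mapping cylinder of the inclusion of `D` in `T`. -/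
abbrev Cyl (T : Type u) [TopologicalSpace T] (D : Set T) : Type u :=
  {p : T × unitInterval // p.2 = 0 ∨ p.1 ∈ D}

/-- The projection of the mapping cylinder. -/
def cylFst (T : Type u) [TopologicalSpace T] (D : Set T) : C(Cyl T D, T) :=
  ⟨fun p => p.1.1, by fun_prop⟩

/-- `A` is used at heights below `2/3` and `C`, started at height `2/3`, at heights above `1/3`. A
positive height forces the point to lie over `D`; on the overlap `C` is still at time `0`, where it
is `A` restricted to `D`. The clauses describe the support and the base of the result, and the
absence of support at the top when `C` ends without support. -/
theorem TVB.exists_cylinder (D : Set T) (A : TVB H π f)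
    (C : TVB H π ((f.comp (subtypeIncl D)).comp ContinuousMap.fst : C(D × unitInterval, X)))
    (h : (C.pull (f' := f.comp (subtypeIncl D)) (slice D 0) fun _ => rfl).Iso
      (A.pull (subtypeIncl D) fun _ => rfl)) :
    ∃ G : TVB H π (f.comp (cylFst T D)),
      (∀ S : Set T, Disjoint A.supp S → Disjoint C.supp ((Subtype.val ⁻¹' S) ×ˢ univ) →
        Disjoint G.supp (cylFst T D ⁻¹' S)) ∧
      (∀ (T'' : Type u) [TopologicalSpace T''] (f'' : C(T'', X)) (s : C(T'', Cyl T D))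
        (hf : ∀ t, f'' t = f (cylFst T D (s t))), (∀ t, (s t).1.2 = 0) →
        ∀ (c : C(T'', T)) (hfc : ∀ t, f'' t = f (c t)), (∀ t, c t = (s t).1.1) →
        ∀ Z, (A.pull c hfc).Iso Z → (G.pull s hf).Iso Z) ∧
      (∀ p : Cyl T D, p.1.2 = 1 → p ∈ G.supp → ∃ d : D, (d, 1) ∈ C.supp) := by
  -- The map `q₂` must be defined on all of the cylinder, so a point of `D` is needed as a value off
  -- `D`. If `D` is empty the cylinder is its base.
  rcases D.eq_empty_or_nonempty with hD | ⟨d₀, hd₀⟩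
  · refine ⟨A.pull (cylFst T D) fun _ => rfl, fun S hS _ => disjoint_left.2 fun p hp hpS =>
      disjoint_left.1 hS (TVB.supp_pull _ _ _ hp) hpS, fun T'' _ f'' s hf hs c hfc hc Z hZ => ?_,
      fun p hp _ => ?_⟩
    · rwa [TVB.pull_congr (q' := (cylFst T D).comp s) (hq' := hf) A hc] at hZ
    · exfalso
      rcases p.2 with h0 | h0
      · exact zero_ne_one (h0.symm.trans hp)
      · exact eq_empty_iff_forall_notMem.1 hD _ h0
  classical
  have hmem : ∀ p : Cyl T D, 1 / 3 < (p.1.2 : ℝ) → p.1.1 ∈ D := fun p hp =>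
    p.2.resolve_left fun h0 => by
      rw [h0, Icc.coe_zero] at hp
      norm_num at hp
  let q₂ : Cyl T D → D × unitInterval := fun p =>
    (if hp : p.1.1 ∈ D then ⟨p.1.1, hp⟩ else ⟨d₀, hd₀⟩, clamp (3 * p.1.2 - 2))
  have hq₂ : ∀ p : Cyl T D, ∀ hp : p.1.1 ∈ D, q₂ p = (⟨p.1.1, hp⟩, clamp (3 * p.1.2 - 2)) :=
    fun p hp => Prod.ext (dif_pos hp) rfl
  let Γ : GlueData A C (f.comp (cylFst T D)) :=
    { V₁ := {p | (p.1.2 : ℝ) < 2 / 3}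
      V₂ := {p | 1 / 3 < (p.1.2 : ℝ)}
      open₁ := isOpen_lt (by fun_prop) continuous_const
      open₂ := isOpen_lt continuous_const (by fun_prop)
      cover := eq_univ_of_forall fun p => by
        by_cases hp : (p.1.2 : ℝ) < 2 / 3
        · exact Or.inl hp
        · exact Or.inr (by change 1 / 3 < (p.1.2 : ℝ); linarith)
      q₁ := fun p => p.1.1
      q₂ := q₂
      cont₁ := (by fun_prop : Continuous fun p : Cyl T D => p.1.1).continuousOn
      cont₂ := by
        rw [continuousOn_iff_continuous_domRestrict]
        have e : domRestrict {p : Cyl T D | 1 / 3 < (p.1.2 : ℝ)} q₂ =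
            fun p => (⟨p.1.1.1, hmem p.1 p.2⟩, clamp (3 * p.1.1.2 - 2)) :=
          funext fun p => hq₂ p.1 (hmem p.1 p.2)
        rw [e]
        exact (by fun_prop : Continuous fun p : {p : Cyl T D | 1 / 3 < (p.1.2 : ℝ)} =>
          (⟨p.1.1.1, hmem p.1 p.2⟩ : D)).prodMk (continuous_clamp.comp (by fun_prop))
      hf₁ := fun _ _ => rfl
      hf₂ := fun p hp => by rw [hq₂ p (hmem p hp)]; rfl }
  have hΓ : Γ.res₁.Iso Γ.res₂ := by
    let q₀ : C(↥(Γ.V₁ ∩ Γ.V₂), D) := ⟨fun p => ⟨p.1.1.1, hmem p.1 p.2.2⟩, by fun_prop⟩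
    have h' := h.symm.pull (f' := (f.comp (cylFst T D)).comp (subtypeIncl (Γ.V₁ ∩ Γ.V₂))) q₀
      fun _ => rfl
    have e2 : (C.pull (f' := f.comp (subtypeIncl D)) (slice D 0) fun _ => rfl).pull
        (f' := (f.comp (cylFst T D)).comp (subtypeIncl (Γ.V₁ ∩ Γ.V₂))) q₀ (fun _ => rfl) =
        Γ.res₂ := TVB.pull_congr (q := (slice D 0).comp q₀) (hq := fun _ => rfl) C fun p => by
      change ((⟨p.1.1.1, hmem p.1 p.2.2⟩ : D), (0 : unitInterval)) = q₂ p.1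
      rw [hq₂ p.1 (hmem p.1 p.2.2)]
      refine Prod.ext rfl ?_
      exact (clamp_of_le (by have : (p.1.1.2 : ℝ) < 2 / 3 := p.2.1; linarith)).symm
    rwa [e2] at h'
  obtain ⟨G, hG1, hG2, hl, -⟩ := Γ.exists_glue hΓ
  refine ⟨G, fun S hS hS' => disjoint_left.2 fun p hp hpS => ?_,
    fun T'' _ f'' s hf hs c hfc hc Z hZ => ?_, fun p hp hps => ?_⟩
  · rcases Γ.cover.ge (mem_univ p) with ht | ht
    · exact disjoint_left.1 hS ((hG1 p ht).1 hp) hpS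
    · have h1 := (hG2 p ht).1 hp
      change q₂ p ∈ _ at h1
      rw [hq₂ p (hmem p ht)] at h1
      exact disjoint_left.1 hS' h1 ⟨hpS, trivial⟩
  · refine hl T'' f'' s hf (fun t => ?_) (fun t => ?_) c hfc hc Z hZ
    · change ((s t).1.2 : ℝ) < 2 / 3
      rw [hs t]
      norm_num
    · change ¬ 1 / 3 < ((s t).1.2 : ℝ)
      rw [hs t]
      norm_num
  · have ht : p ∈ Γ.V₂ := by
      change 1 / 3 < (p.1.2 : ℝ)
      rw [hp]
      norm_num
    have h1 := (hG2 p ht).1 hps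
    change q₂ p ∈ _ at h1
    rw [hq₂ p (hmem p ht), hp, clamp_of_ge (by norm_num)] at h1
    exact ⟨_, h1⟩

end Homotopy

/-! ### Pull-backs along bundle maps -/

section BundleMap

variable {H : Type w} [NormedAddCommGroup H] [InnerProductSpace ℂ H]
variable {X : Type u} [TopologicalSpace X] {P : Type v} [TopologicalSpace P]
  [MulAction (PUGroup H)ᵐᵒᵖ P] {π : P → X} {T T' T'' : Type u} [TopologicalSpace T]
  [TopologicalSpace T'] [TopologicalSpace T''] {f : C(T, X)} {f' : C(T', X)} {f'' : C(T'', X)}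

variable (H π f f') in
/-- `Q` is a continuous family of equivariant maps from the fibre of `P` over `f (q t)` to the fibre
over `f' t`. -/
structure IsBundleMap (q : T' → T) (Q : T' → P → P) : Prop where
  proj : ∀ t p, π p = f (q t) → π (Q t p) = f' t
  act : ∀ t p, π p = f (q t) → ∀ g : PUGroup H,
    Q t (MulOpposite.op g • p) = MulOpposite.op g • Q t p
  cont : ContinuousOn (fun z : T' × P => Q z.1 z.2) {z | π z.2 = f (q z.1)}

theorem IsBundleMap.comp {q : T' → T} {Q : T' → P → P} (h : IsBundleMap H π f f' q Q)
    {s : T'' → T'} (hs : Continuous s) (hf : ∀ t, f'' t = f' (s t)) :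
    IsBundleMap H π f f'' (fun t => q (s t)) fun t => Q (s t) where
  proj t p hp := (h.proj (s t) p hp).trans (hf t).symm
  act t p hp g := h.act (s t) p hp g
  cont := h.cont.comp (f := fun z : T'' × P => (s z.1, z.2)) (by fun_prop) fun z hz => hz

/-- Pull-back of the twisting part along a bundle map. -/
def Twist.bpull (q : C(T', T)) {Q : T' → P → P} (h : IsBundleMap H π f f' q Q)
    (τ : Twist H π f) : Twist H π f' where
  ι := τ.ι
  U a := q ⁻¹' τ.U a
  isOpen_U a := (τ.isOpen_U a).preimage q.continuous
  iUnion_U := by rw [← preimage_iUnion, τ.iUnion_U, preimage_univ]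
  s a t := Q t (τ.s a (q t))
  s_cont a := h.cont.comp (f := fun t => (t, τ.s a (q t)))
    (continuousOn_id.prodMk ((τ.s_cont a).comp q.continuous.continuousOn fun _ ht => ht))
    fun t ht => τ.proj_s a (q t) ht
  proj_s a t ht := h.proj t _ (τ.proj_s a (q t) ht)
  g a b t := τ.g a b (q t)
  g_cont a b := (τ.g_cont a b).comp q.continuous.continuousOn fun _ ht => ht
  g_lift a b t ht := by
    rw [← h.act t _ (τ.proj_s a (q t) ht.1), τ.g_lift a b (q t) ht]

/-- Pull-back along a bundle map. -/
def TVB.bpull (q : C(T', T)) {Q : T' → P → P} (h : IsBundleMap H π f f' q Q)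
    (A : TVB H π f) : TVB H π f' where
  twist := A.twist.bpull q h
  vect :=
    { E := fun a => (A.vect.E a).pull q
      φ := fun a b t => A.vect.φ a b (q t)
      φ_hom := fun a b => (A.vect.φ_hom a b).pull q
      φ_inv := fun a b => (A.vect.φ_inv a b).pull q
      φ_comp := fun a b c => (A.vect.φ_comp a b c).pull q }

theorem TVB.supp_bpull (q : C(T', T)) {Q : T' → P → P} (h : IsBundleMap H π f f' q Q)
    (A : TVB H π f) : (A.bpull q h).supp = q ⁻¹' A.supp := by
  ext t
  obtain ⟨a, ha⟩ := A.twist.exists_mem (q t)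
  exact not_iff_not.1 (((A.bpull q h).notMem_supp_iff (a := a) ha).trans
    (A.notMem_supp_iff ha).symm)

theorem TVB.Iso.bpull (q : C(T', T)) {Q : T' → P → P} (hQ : IsBundleMap H π f f' q Q)
    {A B : TVB H π f} (h : A.Iso B) : (A.bpull q hQ).Iso (B.bpull q hQ) := by
  have key : ∀ {A B : TVB H π f} {k : B.twist.ι → A.twist.ι → T → UGroup H}
      {ψ : ∀ b a x, ((A.vect.E a).fiber x) →ₗ[ℂ] ((B.vect.E b).fiber x)},
      A.IsMorphism B k ψ → (A.bpull q hQ).IsMorphism (B.bpull q hQ)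
        (fun b a t => k b a (q t)) (fun b a t => ψ b a (q t)) := by
    intro A B k ψ h
    exact
      { k_cont := fun b a => (h.k_cont b a).comp q.continuous.continuousOn fun _ ht => ht
        k_lift := fun b a t ht =>
          (hQ.act t _ (B.twist.proj_s b (q t) ht.1) _).symm.trans
            (congrArg (Q t) (h.k_lift b a (q t) ht))
        ψ_hom := fun b a => (h.ψ_hom b a).pull q
        comp_source := fun b a a' => (h.comp_source b a a').pull q
        comp_target := fun b b' a => (h.comp_target b b' a).pull q }
  obtain ⟨k, ψ, k', ψ', h1, h2, h3, h4⟩ := h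
  exact ⟨_, _, _, _, key h1, key h2, fun a b a' => (h3 a b a').pull q,
    fun a b a' => (h4 a b a').pull q⟩

/-- The pull-back along a bundle map that is the identity on fibres. -/
theorem TVB.bpull_iso_pull {q q' : C(T', T)} {Q : T' → P → P} (h : IsBundleMap H π f f' q Q)
    (hq' : ∀ t, f' t = f (q' t)) (hqq : ∀ t, q t = q' t) (hQ : ∀ t p, π p = f' t → Q t p = p)
    (A : TVB H π f) : (A.bpull q h).Iso (A.pull q' hq') := by
  obtain rfl : q = q' := ContinuousMap.ext hqq
  refine TVB.Refinement.iso
    { ρ := id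
      sub := fun i => Subset.rfl
      c := fun _ _ => 1
      lift := fun i => ⟨continuousOn_const, fun t ht => ?_⟩
      θ := fun i t => LinearMap.id (M := (A.vect.E i).fiber (q t))
      θ' := fun i t => LinearMap.id (M := (A.vect.E i).fiber (q t))
      θ_hom := fun i => .id ((A.vect.E i).pull q)
      θ'_hom := fun i => .id ((A.vect.E i).pull q)
      θ'_θ := fun i => .of_eqOn fun _ _ => rfl
      θ_θ' := fun i => .of_eqOn fun _ _ => rfl
      compat := fun i j => .of_eqOn (fun t _ => (one_mul _).trans (mul_one _).symm)
        fun _ _ => rfl }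
  exact (one_smul _ _).trans (hQ t _ ((A.twist.proj_s i (q t) ht).trans (hq' t).symm)).symm

/-- Pull-back of relative objects along a bundle map. -/
def RelTVB.bpull (q : C(T', T)) {Q : T' → P → P} (h : IsBundleMap H π f f' q Q) {S : Set T}
    {S' : Set T'} (hS : MapsTo q S' S) (A : RelTVB H π f S) : RelTVB H π f' S' :=
  ⟨A.1.bpull q h, disjoint_left.2 fun t ht hts => disjoint_left.1 A.2
    (by rw [TVB.supp_bpull] at ht; exact ht) (hS hts)⟩

theorem RelTVB.Homotopic.bpull (q : C(T', T)) {Q : T' → P → P} (h : IsBundleMap H π f f' q Q)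
    {S : Set T} {S' : Set T'} (hS : MapsTo q S' S) {A B : RelTVB H π f S} (hAB : A.Homotopic B) :
    (A.bpull q h hS).Homotopic (B.bpull q h hS) := by
  obtain ⟨C, h0, h1⟩ := hAB
  have hQ : IsBundleMap H π (f.comp ContinuousMap.fst : C(T × unitInterval, X))
      (f'.comp ContinuousMap.fst : C(T' × unitInterval, X))
      (q.prodMap (ContinuousMap.id unitInterval)) fun t => Q t.1 :=
    ⟨fun t => h.proj t.1, fun t => h.act t.1,
      h.cont.comp (f := fun z : (T' × unitInterval) × P => (z.1.1, z.2)) (by fun_prop)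
        fun z hz => hz⟩
  have hq : MapsTo (q.prodMap (ContinuousMap.id unitInterval)) (S' ×ˢ univ) (S ×ˢ univ) :=
    fun t ht => ⟨hS ht.1, trivial⟩
  exact ⟨C.bpull _ hQ hq, h0.bpull q h, h1.bpull q h⟩

/-- Homotopic bundle maps induce the same map. -/
theorem KF.mk_bpull_eq_of_homotopy {S : Set T} {S' : Set T'} (A : RelTVB H π f S)
    (q : C(T' × unitInterval, T)) {Q : T' × unitInterval → P → P}
    (h : IsBundleMap H π f (f'.comp ContinuousMap.fst : C(T' × unitInterval, X)) q Q)
    (hS : ∀ t ∈ S', ∀ i, q (t, i) ∈ S) {A₀ A₁ : RelTVB H π f' S'}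
    (h₀ : TVB.Iso ((A.1.bpull q h).pull (f' := f') (slice T' 0) fun _ => rfl) A₀.1)
    (h₁ : TVB.Iso ((A.1.bpull q h).pull (f' := f') (slice T' 1) fun _ => rfl) A₁.1) :
    KF.mk A₀ = KF.mk A₁ :=
  Quot.sound ⟨A.bpull q h (S' := S' ×ˢ univ) fun p hp => hS p.1 hp.1 p.2, h₀, h₁⟩

end BundleMap

/-! ### CW complexes -/

section CW

open Topology.RelCWComplex (cell map openCell closedCell cellFrontier)

variable {X : Type u} [TopologicalSpace X] [T2Space X] [CWComplex (univ : Set X)]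

/-- The characteristic map of a cell, as a map onto the closed cell. -/
def charMap (n : ℕ) (e : cell (univ : Set X) n) :
    Metric.closedBall (0 : Fin n → ℝ) 1 → closedCell n e :=
  fun y => ⟨map n e y, mem_image_of_mem _ y.2⟩

theorem continuous_charMap (n : ℕ) (e : cell (univ : Set X) n) : Continuous (charMap n e) :=
  (continuousOn_iff_continuous_domRestrict.1 (RelCWComplex.continuousOn n e)).subtype_mk _

/-- A continuous surjection from a compact space to a Hausdorff space is closed, hence a quotient
map. -/
theorem isQuotientMap_charMap (n : ℕ) (e : cell (univ : Set X) n) :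
    IsQuotientMap (charMap n e) := by
  have : CompactSpace (Metric.closedBall (0 : Fin n → ℝ) 1) :=
    isCompact_iff_compactSpace.1 (isCompact_closedBall _ _)
  refine (continuous_charMap n e).isClosedMap.isQuotientMap (continuous_charMap n e) ?_
  rintro ⟨_, y, hy, rfl⟩
  exact ⟨⟨y, hy⟩, rfl⟩

/-- All characteristic maps together. -/
def charMaps : (Σ c : Σ n, cell (univ : Set X) n, Metric.closedBall (0 : Fin c.1 → ℝ) 1) →
    (univ : Set X) :=
  fun z => ⟨charMap z.1.1 z.1.2 z.2, trivial⟩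

theorem exists_mem_openCell (x : X) : ∃ n, ∃ e : cell (univ : Set X) n, x ∈ openCell n e := by
  have h := mem_univ x
  rw [← CWComplex.iUnion_openCell_eq_complex (C := (univ : Set X))] at h
  simpa only [mem_iUnion] using h

/-- A set is closed when its intersections with the closed cells are, and these intersections are
images of the compact preimages under the characteristic maps. -/
theorem isQuotientMap_charMaps : IsQuotientMap (charMaps (X := X)) := by
  have hc : Continuous (charMaps (X := X)) :=
    (continuous_sigma fun c => continuous_subtype_val.comp (continuous_charMap c.1 c.2)).subtype_mk _
  refine isQuotientMap_iff_isClosed.2 ⟨?_, fun A => ⟨fun h => h.preimage hc, fun h => ?_⟩⟩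
  · rintro ⟨x, -⟩
    obtain ⟨n, e, y, hy, rfl⟩ := exists_mem_openCell x
    exact ⟨⟨⟨n, e⟩, ⟨y, Metric.ball_subset_closedBall hy⟩⟩, rfl⟩
  · have h1 : IsClosed (Subtype.val '' A) := by
      refine (CWComplex.closed univ _ (subset_univ _)).2 fun n e => ?_
      have h2 : IsClosed (Sigma.mk (⟨n, e⟩ : Σ n, cell (univ : Set X) n) ⁻¹' (charMaps ⁻¹' A)) :=
        h.preimage continuous_sigmaMk
      have : CompactSpace (Metric.closedBall (0 : Fin n → ℝ) 1) :=
        isCompact_iff_compactSpace.1 (isCompact_closedBall _ _)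
      have h3 := h2.isCompact.image (continuous_subtype_val.comp (continuous_charMap n e))
      convert h3.isClosed using 1
      ext x
      constructor
      · rintro ⟨⟨x, hx, rfl⟩, y, hy, hyx⟩
        refine ⟨⟨y, hy⟩, ?_, hyx⟩
        change (⟨map n e y, trivial⟩ : (univ : Set X)) ∈ A
        have e1 : (⟨map n e y, trivial⟩ : (univ : Set X)) = x := Subtype.ext hyx
        rwa [e1]
      · rintro ⟨y, hy, rfl⟩
        exact ⟨⟨_, hy, rfl⟩, (charMap n e y).2⟩
    have h2 := h1.preimage (continuous_subtype_val (p := (· ∈ (univ : Set X))))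
    rwa [preimage_image_eq _ Subtype.val_injective] at h2

theorem exists_finset_cellFrontier_subset (n : ℕ) (e : cell (univ : Set X) n) :
    ∃ s : Finset (Σ m, cell (univ : Set X) m), (∀ c ∈ s, c.1 < n) ∧
      cellFrontier n e ⊆ ⋃ c : s, closedCell c.1.1 c.1.2 := by
  obtain ⟨I, hI⟩ := CWComplex.cellFrontier_subset_finite_closedCell (C := (univ : Set X)) n e
  refine ⟨(Finset.range n).sigma I, fun c hc => Finset.mem_range.1 (Finset.mem_sigma.1 hc).1, ?_⟩
  intro x hx
  have h := hI hx
  simp only [mem_iUnion] at h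
  obtain ⟨m, hm, j, hj, hx⟩ := h
  exact mem_iUnion.2 ⟨⟨⟨m, j⟩, Finset.mem_sigma.2 ⟨Finset.mem_range.2 hm, hj⟩⟩, hx⟩

/-- A point of the frontier of an `n`-cell lies in an open cell of smaller dimension. -/
theorem exists_mem_openCell_of_mem_cellFrontier {n : ℕ} {e : cell (univ : Set X) n} {x : X}
    (hx : x ∈ cellFrontier n e) : ∃ m < n, ∃ e' : cell (univ : Set X) m, x ∈ openCell m e' := by
  obtain ⟨I, hI⟩ := CWComplex.cellFrontier_subset_finite_openCell (C := (univ : Set X)) n e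
  have h := hI hx
  simp only [mem_iUnion] at h
  obtain ⟨m, hm, j, hj, hx⟩ := h
  exact ⟨m, hm, j, hx⟩

theorem exists_mem_openCell_of_mem_closedCell {n : ℕ} {e : cell (univ : Set X) n} {x : X}
    (hx : x ∈ closedCell n e) : x ∈ openCell n e ∨
      ∃ m < n, ∃ e' : cell (univ : Set X) m, x ∈ openCell m e' := by
  rw [← RelCWComplex.cellFrontier_union_openCell_eq_closedCell] at hx
  exact hx.symm.imp id exists_mem_openCell_of_mem_cellFrontier

theorem openCell_unique {n m : ℕ} {e : cell (univ : Set X) n} {e' : cell (univ : Set X) m} {x : X}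
    (hx : x ∈ openCell n e) (hx' : x ∈ openCell m e') :
    (⟨n, e⟩ : Σ n, cell (univ : Set X) n) = ⟨m, e'⟩ :=
  RelCWComplex.eq_of_not_disjoint_openCell fun h => disjoint_left.1 h hx hx'

theorem notMem_openCell_of_mem_cellFrontier {n : ℕ} {e e' : cell (univ : Set X) n} {x : X}
    (hx : x ∈ cellFrontier n e) : x ∉ openCell n e' := fun h => by
  obtain ⟨m, hm, e'', h'⟩ := exists_mem_openCell_of_mem_cellFrontier hx
  exact hm.ne (congrArg Sigma.fst (openCell_unique h' h))

/-- A function can be redefined on an open cell. -/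
theorem exists_extend_openCell {Ω : Type*} (n : ℕ) (e : cell (univ : Set X) n) (F : X → Ω)
    (G : (Fin n → ℝ) → Ω) : ∃ F' : X → Ω, (∀ x, x ∉ openCell n e → F' x = F x) ∧
      ∀ y ∈ Metric.ball (0 : Fin n → ℝ) 1, F' (map n e y) = G y := by
  classical
  refine ⟨fun x => if x ∈ openCell n e then G ((map n e).symm x) else F x,
    fun x hx => if_neg hx, fun y hy => ?_⟩
  refine (if_pos (show map n e y ∈ openCell n e from mem_image_of_mem _ hy)).trans ?_
  rw [(map n e).left_inv (by rwa [RelCWComplex.source_eq])]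

/-- Construction of a function on a CW complex, one cell after the other. -/
theorem exists_cell_extension {Ω : Type*} (S : Set X)
    (Good : ∀ n, cell (univ : Set X) n → (X → Ω) → Prop)
    (hlocal : ∀ n e F F', EqOn F F' (closedCell n e) → Good n e F → Good n e F')
    (hS : ∀ n (e : cell (univ : Set X) n), closedCell n e ⊆ S ∨ Disjoint (openCell n e) S)
    (F₀ : X → Ω) (hbase : ∀ n e, closedCell n e ⊆ S → Good n e F₀)
    (hstep : ∀ n e F, (∀ m < n, ∀ e', Good m e' F) → Disjoint (openCell n e) S →
      ∃ F', (∀ x, x ∉ openCell n e → F' x = F x) ∧ Good n e F') :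
    ∃ F, EqOn F F₀ S ∧ ∀ n e, Good n e F := by
  classical
  -- All `n`-cells that do not lie in `S` are treated at once. Their open cells are disjoint from
  -- each other and from the lower cells, so the modifications do not interfere and `hlocal`
  -- preserves what is already good.
  have key : ∀ n (F : X → Ω), EqOn F F₀ S → (∀ m < n, ∀ e, Good m e F) →
      ∃ F', EqOn F' F₀ S ∧ (∀ m < n + 1, ∀ e, Good m e F') ∧
        ∀ x, (∀ e : cell (univ : Set X) n, x ∉ openCell n e) → F' x = F x := by
    intro n F hF hg
    have hst : ∀ e : cell (univ : Set X) n, ∃ F' : X → Ω, Disjoint (openCell n e) S →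
        (∀ x, x ∉ openCell n e → F' x = F x) ∧ Good n e F' := fun e => by
      by_cases he : Disjoint (openCell n e) S
      · obtain ⟨F', h⟩ := hstep n e F hg he
        exact ⟨F', fun _ => h⟩
      · exact ⟨F, fun h => absurd h he⟩
    choose K hK using hst
    let F' : X → Ω := fun x => if h : ∃ e : cell (univ : Set X) n, x ∈ openCell n e ∧
      Disjoint (openCell n e) S then K h.choose x else F x
    have h1 : ∀ (e : cell (univ : Set X) n) x, x ∈ openCell n e → Disjoint (openCell n e) S →
        F' x = K e x := by
      intro e x hx he
      have h : ∃ e : cell (univ : Set X) n, x ∈ openCell n e ∧ Disjoint (openCell n e) S :=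
        ⟨e, hx, he⟩
      have h2 : h.choose = e := eq_of_heq (Sigma.mk.inj (openCell_unique h.choose_spec.1 hx)).2
      change dite _ _ _ = _
      rw [dif_pos h, h2]
    have h2 : ∀ x, (¬ ∃ e : cell (univ : Set X) n, x ∈ openCell n e ∧ Disjoint (openCell n e) S) →
        F' x = F x := fun x hx => dif_neg hx
    have hFS : EqOn F' F S := fun x hx => h2 x fun ⟨e, he, hd⟩ => disjoint_left.1 hd he hx
    refine ⟨F', hFS.trans hF, fun m hm e => ?_, fun x hx => h2 x fun ⟨e, he, _⟩ => hx e he⟩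
    rcases Nat.lt_succ_iff_lt_or_eq.1 hm with hm | rfl
    · refine hlocal m e F F' (fun x hx => (h2 x ?_).symm) (hg m hm e)
      rintro ⟨e', he', -⟩
      rcases exists_mem_openCell_of_mem_closedCell hx with h | ⟨k, hk, e'', h⟩
      · exact hm.ne (congrArg Sigma.fst (openCell_unique h he'))
      · exact (hk.trans hm).ne (congrArg Sigma.fst (openCell_unique h he'))
    · rcases hS m e with he | he
      · exact hlocal m e F₀ F' (fun x hx => ((hFS.trans hF) (he hx)).symm) (hbase m e he)
      · refine hlocal m e (K e) F' (fun x hx => ?_) (hK e he).2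
        by_cases hxe : x ∈ openCell m e
        · exact (h1 e x hxe he).symm
        · rw [(hK e he).1 x hxe, h2]
          rintro ⟨e', he', -⟩
          rw [← RelCWComplex.cellFrontier_union_openCell_eq_closedCell] at hx
          exact notMem_openCell_of_mem_cellFrontier (hx.resolve_right hxe) he'
  let St : ℕ → Type _ := fun n => {F : X → Ω // EqOn F F₀ S ∧ ∀ m < n, ∀ e, Good m e F}
  let seq : ∀ n, St n := fun n => Nat.rec (motive := St)
    ⟨F₀, fun _ _ => rfl, fun m hm => absurd hm (Nat.not_lt_zero m)⟩
    (fun n F => ⟨(key n F.1 F.2.1 F.2.2).choose, (key n F.1 F.2.1 F.2.2).choose_spec.1,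
      (key n F.1 F.2.1 F.2.2).choose_spec.2.1⟩) n
  have hseq : ∀ n x, (∀ e : cell (univ : Set X) n, x ∉ openCell n e) →
      (seq (n + 1)).1 x = (seq n).1 x := fun n =>
    (key n (seq n).1 (seq n).2.1 (seq n).2.2).choose_spec.2.2
  have hstab : ∀ {m : ℕ} {e : cell (univ : Set X) m} {x}, x ∈ openCell m e → ∀ k,
      (seq (m + 1 + k)).1 x = (seq (m + 1)).1 x := by
    intro m e x hx k
    induction k with
    | zero => rfl
    | succ k ih =>
      refine (hseq _ x fun e' he' => ?_).trans ih
      have := congrArg Sigma.fst (openCell_unique hx he')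
      change m = m + 1 + k at this
      omega
  choose d c hc using exists_mem_openCell (X := X)
  have hlim : ∀ {m : ℕ} {e : cell (univ : Set X) m} {x}, x ∈ openCell m e → ∀ k, m < k →
      (seq (d x + 1)).1 x = (seq k).1 x := by
    intro m e x hx k hk
    have : d x = m := congrArg Sigma.fst (openCell_unique (hc x) hx)
    obtain ⟨j, rfl⟩ := Nat.exists_eq_add_of_lt hk
    rw [this, ← hstab hx j, Nat.add_right_comm]
  -- The value at `x` is final once the cells of the dimension of its open cell have been treated.
  refine ⟨fun x => (seq (d x + 1)).1 x, fun x hx => (seq (d x + 1)).2.1 hx, fun n e => ?_⟩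
  refine hlocal n e (seq (n + 1)).1 _ (fun x hx => ?_) ((seq (n + 1)).2.2 n n.lt_succ_self e)
  rcases exists_mem_openCell_of_mem_closedCell hx with h | ⟨m, hm, e', h⟩
  · exact (hlim h _ n.lt_succ_self).symm
  · exact (hlim h _ (hm.trans n.lt_succ_self)).symm

theorem continuousOn_cellFrontier {Z : Type*} [TopologicalSpace Z] {T : Type*} [TopologicalSpace T]
    {n : ℕ} (e : cell (univ : Set X) n) {p : T → X} (hp : Continuous p) {F : T → Z}
    (h : ∀ m < n, ∀ e' : cell (univ : Set X) m, ContinuousOn F (p ⁻¹' closedCell m e')) :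
    ContinuousOn F (p ⁻¹' cellFrontier n e) := by
  obtain ⟨s, hs, hsub⟩ := exists_finset_cellFrontier_subset n e
  have h1 : ContinuousOn F (⋃ c : s, p ⁻¹' closedCell c.1.1 c.1.2) :=
    (locallyFinite_of_finite _).continuousOn_iUnion
      (fun c => RelCWComplex.isClosed_closedCell.preimage hp) fun c => h _ (hs _ c.2) _
  rw [← preimage_iUnion] at h1
  exact h1.mono (preimage_mono hsub)

theorem continuousOn_closedCell {Z : Type*} [TopologicalSpace Z] {n : ℕ}
    (e : cell (univ : Set X) n) {F : X → Z}
    (h : ContinuousOn (fun y => F (map n e y)) (Metric.closedBall 0 1)) :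
    ContinuousOn F (closedCell n e) := by
  rw [continuousOn_iff_continuous_domRestrict] at h ⊢
  exact (isQuotientMap_charMap n e).continuous_iff.2 h

theorem continuous_of_continuousOn_closedCell {Z : Type*} [TopologicalSpace Z] {F : X → Z}
    (h : ∀ n (e : cell (univ : Set X) n), ContinuousOn F (closedCell n e)) : Continuous F := by
  have h1 : Continuous fun x : (univ : Set X) => F x :=
    isQuotientMap_charMaps.continuous_iff.2 (continuous_sigma fun c =>
      (continuousOn_iff_continuous_domRestrict.1 (h c.1 c.2)).comp (continuous_charMap c.1 c.2))
  exact h1.comp (g := fun x : (univ : Set X) => F x) (f := fun x : X => ⟨x, trivial⟩)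
    (by fun_prop)

end CW

/-! ### Partitions subordinate to a cover of a CW complex, and the existence of a twisting part. -/

section Cover

open Topology.RelCWComplex (cell map openCell closedCell cellFrontier)

theorem exists_continuous_eq_zero_iff {E : Type*} [PseudoMetricSpace E] {C : Set E}
    (hC : IsClosed C) : ∃ c : E → ℝ, Continuous c ∧ (∀ y, 0 ≤ c y) ∧ ∀ y, c y = 0 ↔ y ∈ C := by
  rcases C.eq_empty_or_nonempty with rfl | hne
  · exact ⟨fun _ => 1, continuous_const, fun _ => zero_le_one, fun y => by simp⟩
  · exact ⟨fun y => Metric.infDist y C, Metric.continuous_infDist_pt C,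
      fun y => Metric.infDist_nonneg, fun y => (hC.mem_iff_infDist_zero hne).symm⟩

variable {X : Type u} [TopologicalSpace X] [T2Space X] [CWComplex (univ : Set X)]

/-- A bounded function with finitely many nonzero values. -/
theorem lp_sum_single_apply {ι : Type*} [DecidableEq ι] (s : Finset ι) (c : ι → ℝ) (i : ι) :
    (∑ j ∈ s, c j • lp.single (E := fun _ : ι => ℝ) ⊤ j (1 : ℝ) : lp (fun _ : ι => ℝ) ⊤) i =
      if i ∈ s then c i else 0 := by
  rw [lp.coeFn_sum, Finset.sum_apply]
  simp only [lp.coeFn_smul, Pi.smul_apply, lp.single_apply, smul_eq_mul, Pi.single_apply,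
    mul_ite, mul_one, mul_zero, Finset.sum_ite_eq]

/-- The coordinates of `F` play the part of an unnormalised partition of unity. They are extended
over one cell at a time; over each closed cell only finitely many are nonzero, so continuity into
`ℓ^∞` is continuity of a finite sum. The sup norm later provides local finiteness. -/
theorem exists_partition {ι : Type u} (V : ι → Set X) (hV : ∀ i, IsOpen (V i))
    (hcov : ∀ x, ∃ i, x ∈ V i) :
    ∃ F : X → lp (fun _ : ι => ℝ) ⊤, Continuous F ∧ (∀ x, F x ≠ 0) ∧
      (∀ x, {i | F x i ≠ 0}.Finite) ∧ ∀ x i, 0 ≤ F x i ∧ (F x i ≠ 0 → x ∈ V i) := by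
  classical
  let Good : ∀ n, cell (univ : Set X) n → (X → lp (fun _ : ι => ℝ) ⊤) → Prop := fun n e F =>
    ContinuousOn F (closedCell n e) ∧ {i | ∃ x ∈ closedCell n e, F x i ≠ 0}.Finite ∧
      ∀ x ∈ closedCell n e, F x ≠ 0 ∧ ∀ i, 0 ≤ F x i ∧ (F x i ≠ 0 → x ∈ V i)
  suffices h : ∃ F, ∀ n e, Good n e F by
    obtain ⟨F, hF⟩ := h
    refine ⟨F, continuous_of_continuousOn_closedCell fun n e => (hF n e).1, fun x => ?_,
      fun x => ?_, fun x => ?_⟩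
    all_goals obtain ⟨n, e, hx⟩ := exists_mem_openCell x
    all_goals have hx' := RelCWComplex.openCell_subset_closedCell n e hx
    · exact ((hF n e).2.2 x hx').1
    · exact (hF n e).2.1.subset fun i hi => ⟨x, hx', hi⟩
    · exact ((hF n e).2.2 x hx').2
  suffices h : ∃ F, EqOn F (fun _ => 0) ∅ ∧ ∀ n e, Good n e F from h.imp fun F h => h.2
  refine exists_cell_extension ∅ Good ?_ (fun _ _ => Or.inr (disjoint_empty _)) (fun _ => 0) ?_ ?_
  · rintro n e F F' h ⟨h1, h2, h3⟩
    refine ⟨h1.congr fun x hx => (h hx).symm, ?_, fun x hx => h hx ▸ h3 x hx⟩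
    convert h2 using 5 with i x
    constructor
    · rintro ⟨hx, hi⟩
      exact ⟨hx, by rwa [h hx]⟩
    · rintro ⟨hx, hi⟩
      exact ⟨hx, by rwa [← h hx]⟩
  · intro n e he
    have := RelCWComplex.map_zero_mem_closedCell n e
    exact absurd (he this) (notMem_empty _)
  · intro n e F hF _
    obtain ⟨s, hs, hsub⟩ := exists_finset_cellFrontier_subset n e
    have hfr : ∀ x ∈ cellFrontier n e, ∃ c ∈ s, x ∈ closedCell c.1 c.2 := fun x hx => by
      obtain ⟨c, hc⟩ := mem_iUnion.1 (hsub hx)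
      exact ⟨c.1, c.2, hc⟩
    have hFfr : ∀ x ∈ cellFrontier n e, F x ≠ 0 ∧ ∀ i, 0 ≤ F x i ∧ (F x i ≠ 0 → x ∈ V i) :=
      fun x hx => by
        obtain ⟨c, hc, hxc⟩ := hfr x hx
        exact (hF c.1 (hs c hc) c.2).2.2 x hxc
    have hA₀ : {i | ∃ x ∈ cellFrontier n e, F x i ≠ 0}.Finite := by
      refine (s.finite_toSet.biUnion (t := fun c => {i | ∃ x ∈ closedCell c.1 c.2, F x i ≠ 0})
        fun c hc => (hF c.1 (hs c hc) c.2).2.1).subset ?_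
      rintro i ⟨x, hx, hi⟩
      obtain ⟨c, hc, hxc⟩ := hfr x hx
      exact mem_biUnion hc ⟨x, hxc, hi⟩
    have hFc : ContinuousOn F (cellFrontier n e) :=
      continuousOn_cellFrontier e continuous_id fun m hm e' => (hF m hm e').1
    have hΦ : ContinuousOn (map n e) (Metric.closedBall 0 1) := RelCWComplex.continuousOn n e
    have hΦs : ContinuousOn (map n e) (Metric.sphere 0 1) :=
      hΦ.mono Metric.sphere_subset_closedBall
    let N : ι → Set (Fin n → ℝ) := fun i => Metric.closedBall 0 1 ∩ map n e ⁻¹' (V i)ᶜ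
    have hN : ∀ i, IsClosed (N i) := fun i =>
      hΦ.preimage_isClosed_of_isClosed Metric.isClosed_closedBall (hV i).isClosed_compl
    have hK : ∀ i, IsClosed (Metric.sphere (0 : Fin n → ℝ) 1 ∪ N i) := fun i =>
      Metric.isClosed_sphere.union (hN i)
    -- `b i` vanishes exactly on the sphere and outside `V i`. Adding it leaves the boundary values
    -- and the supports unchanged, and makes the coordinate positive at interior points that lie in
    -- `V i`.
    choose b hbc hb0 hb using fun i => exists_continuous_eq_zero_iff (hK i)
    have hg : ∀ i, ∃ g : C(Fin n → ℝ, ℝ), (∀ y ∈ Metric.sphere (0 : Fin n → ℝ) 1,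
        g y = F (map n e y) i) ∧ ∀ y ∈ N i, g y = 0 := by
      intro i
      let f : (Fin n → ℝ) → ℝ := fun y =>
        if y ∈ Metric.sphere (0 : Fin n → ℝ) 1 then F (map n e y) i else 0
      have hf0 : ∀ y ∈ N i, f y = 0 := by
        intro y hy
        by_cases hys : y ∈ Metric.sphere (0 : Fin n → ℝ) 1
        · refine (if_pos hys).trans (by_contra fun h => ?_)
          exact hy.2 (((hFfr _ (mem_image_of_mem _ hys)).2 i).2 h)
        · exact if_neg hys
      have hf : ContinuousOn f (Metric.sphere (0 : Fin n → ℝ) 1 ∪ N i) := by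
        refine ContinuousOn.union_of_isClosed ?_ ?_ Metric.isClosed_sphere (hN i)
        · have h1 : ContinuousOn (fun y => F (map n e y)) (Metric.sphere (0 : Fin n → ℝ) 1) :=
            hFc.comp hΦs fun y hy => mem_image_of_mem _ hy
          have h2 : Continuous fun v : lp (fun _ : ι => ℝ) ⊤ => v i :=
            (continuous_apply i).comp lp.uniformContinuous_coe.continuous
          exact (h2.comp_continuousOn h1).congr fun y hy => if_pos hy
        · exact continuousOn_const.congr hf0
      -- Tietze extension of the boundary values, together with the value `0` outside `V i`.
      obtain ⟨g, hg⟩ := ContinuousMap.exists_restrict_eq (hK i)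
        ⟨_, continuousOn_iff_continuous_domRestrict.1 hf⟩
      have hg' : ∀ y (hy : y ∈ Metric.sphere (0 : Fin n → ℝ) 1 ∪ N i), g y = f y := fun y hy =>
        DFunLike.congr_fun hg ⟨y, hy⟩
      exact ⟨g, fun y hy => (hg' y (Or.inl hy)).trans (if_pos hy),
        fun y hy => (hg' y (Or.inr hy)).trans (hf0 y hy)⟩
    choose g hgs hgN using hg
    obtain ⟨I₀, hI₀⟩ : ∃ I₀ : Finset ι, closedCell n e ⊆ ⋃ i ∈ I₀, V i :=
      RelCWComplex.isCompact_closedCell.elim_finite_subcover V hV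
        fun x _ => mem_iUnion.2 (hcov x)
    let A := hA₀.toFinset ∪ I₀
    -- `A` contains the indices nonzero on the frontier, so the boundary values are reproduced, and
    -- enough indices to cover the compact closed cell, so some `b j` makes the sum nonzero in the
    -- interior. The absolute value keeps the coordinates nonnegative.
    let G : (Fin n → ℝ) → lp (fun _ : ι => ℝ) ⊤ := fun y =>
      ∑ j ∈ A, (|g j y| + b j y) • lp.single (E := fun _ : ι => ℝ) ⊤ j (1 : ℝ)
    have hG : ∀ y i, G y i = if i ∈ A then |g i y| + b i y else 0 := fun y i =>
      lp_sum_single_apply A (fun i => |g i y| + b i y) i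
    have hGc : Continuous G := continuous_finsetSum _ fun j _ =>
      (((g j).continuous.abs).add (hbc j)).smul continuous_const
    have hGs : ∀ y ∈ Metric.sphere (0 : Fin n → ℝ) 1, G y = F (map n e y) := by
      intro y hy
      have hy' : map n e y ∈ cellFrontier n e := mem_image_of_mem _ hy
      refine lp.ext (funext fun i => (hG y i).trans ?_)
      split_ifs with hi
      · rw [hgs i y hy, (hb i y).2 (Or.inl hy), add_zero, abs_of_nonneg ((hFfr _ hy').2 i).1]
      · by_contra h
        exact hi (Finset.mem_union_left _ (hA₀.mem_toFinset.2 ⟨_, hy', fun h0 => h h0.symm⟩))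
    obtain ⟨F', hF', hF'G⟩ := exists_extend_openCell n e F G
    have hFG : ∀ y ∈ Metric.closedBall (0 : Fin n → ℝ) 1, F' (map n e y) = G y := by
      intro y hy
      rw [← Metric.ball_union_sphere] at hy
      rcases hy with hy | hy
      · exact hF'G y hy
      · rw [hGs y hy]
        exact hF' _ (notMem_openCell_of_mem_cellFrontier (mem_image_of_mem _ hy))
    refine ⟨F', hF', ?_, ?_, ?_⟩
    · exact continuousOn_closedCell e (hGc.continuousOn.congr hFG)
    · refine A.finite_toSet.subset ?_
      rintro i ⟨_, ⟨y, hy, rfl⟩, hi⟩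
      rw [hFG y hy, hG] at hi
      by_contra h
      exact hi (if_neg h)
    · rintro _ ⟨y, hy, rfl⟩
      rw [hFG y hy]
      refine ⟨?_, fun i => ⟨?_, fun h => ?_⟩⟩
      · rw [← Metric.ball_union_sphere] at hy
        rcases hy with hy | hy
        · have hy' := Metric.ball_subset_closedBall hy
          obtain ⟨i, hi, hyi⟩ := mem_iUnion₂.1 (hI₀ (mem_image_of_mem (map n e) hy'))
          intro h
          have h1 := hG y i
          rw [h, if_pos (Finset.mem_union_right _ hi)] at h1
          have h2 : b i y ≠ 0 := fun h0 => by
            rcases (hb i y).1 h0 with h0 | h0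
            · exact (Metric.mem_ball.1 hy).ne (Metric.mem_sphere.1 h0)
            · exact h0.2 hyi
          have h3 : 0 < b i y := lt_of_le_of_ne (hb0 i y) h2.symm
          have h4 : (0 : ℝ) = |g i y| + b i y := h1
          have := abs_nonneg (g i y)
          linarith
        · rw [hGs y hy]
          exact (hFfr _ (mem_image_of_mem _ hy)).1
      · rw [hG]
        split_ifs
        · exact add_nonneg (abs_nonneg _) (hb0 i y)
        · exact le_rfl
      · by_contra hyi
        have hyN : y ∈ N i := ⟨hy, hyi⟩
        rw [hG, hgN i y hyN, (hb i y).2 (Or.inr hyN), abs_zero, add_zero, ite_self] at h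
        exact h rfl

/-- An open cover of a CW complex has a locally finite closed refinement whose interiors cover. -/
theorem exists_locallyFinite_refinement {ι : Type u} (V : ι → Set X) (hV : ∀ i, IsOpen (V i))
    (hcov : ∀ x, ∃ i, x ∈ V i) :
    ∃ C O : ι → Set X, LocallyFinite C ∧ (∀ i, IsClosed (C i)) ∧ (∀ i, IsOpen (O i)) ∧
      (∀ i, O i ⊆ C i) ∧ (∀ i, C i ⊆ V i) ∧ ∀ x, ∃ i, x ∈ O i := by
  obtain ⟨F, hF, h0, hfin, hFi⟩ := exists_partition V hV hcov
  have hc : ∀ i, Continuous fun x => F x i := fun i =>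
    ((continuous_apply i).comp lp.uniformContinuous_coe.continuous).comp hF
  have hpos : ∀ x, 0 < ‖F x‖ := fun x => norm_pos_iff.2 (h0 x)
  -- `C i` consists of the points where the coordinate is nearly maximal. If `‖F y - F x‖ < ‖F x‖ /
  -- 4` and `F x i = 0`, then `F y i < ‖F x‖ / 4`, which is less than `3/4 * ‖F y‖`. So only the
  -- finitely many indices with `F x i ≠ 0` can occur near `x`.
  refine ⟨fun i => {x | 3 / 4 * ‖F x‖ ≤ F x i}, fun i => {x | 3 / 4 * ‖F x‖ < F x i}, ?_,
    fun i => isClosed_le (by fun_prop) (hc i), fun i => isOpen_lt (by fun_prop) (hc i),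
    fun i x hx => le_of_lt (mem_ofPred.1 hx), fun i x hx => ?_, fun x => ?_⟩
  · intro x
    refine ⟨{y | ‖F y - F x‖ < ‖F x‖ / 4},
      (isOpen_lt (by fun_prop) continuous_const).mem_nhds (by
        change ‖F x - F x‖ < _
        rw [sub_self, norm_zero]
        linarith [hpos x]), (hfin x).subset ?_⟩
    rintro i ⟨y, hy1, hy2⟩
    have hy1 : 3 / 4 * ‖F y‖ ≤ F y i := hy1
    have hy2 : ‖F y - F x‖ < ‖F x‖ / 4 := hy2
    have h1 := norm_sub_norm_le (F x) (F y)
    rw [norm_sub_rev] at h1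
    have h2 := lp.norm_apply_le_norm ENNReal.top_ne_zero (F y - F x) i
    rw [lp.coeFn_sub, Pi.sub_apply, Real.norm_eq_abs] at h2
    have h3 := le_abs_self (F y i - F x i)
    have h4 := hpos x
    intro h5
    rw [h5] at h3 h2
    linarith
  · refine (hFi x i).2 (ne_of_gt ?_)
    have h1 : 3 / 4 * ‖F x‖ ≤ F x i := hx
    linarith [hpos x]
  · obtain ⟨i₀, -⟩ := hcov x
    have : Nonempty ι := ⟨i₀⟩
    by_contra! h
    have h1 : ‖F x‖ ≤ 3 / 4 * ‖F x‖ := (lp.isLUB_norm (F x)).2 (by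
      rintro _ ⟨i, rfl⟩
      change ‖F x i‖ ≤ _
      rw [Real.norm_of_nonneg (hFi x i).1]
      exact not_lt.1 (h i))
    linarith [hpos x]

variable {H : Type w} [NormedAddCommGroup H] [InnerProductSpace ℂ H] [InfiniteDimensional H]
  {P : Type v} [TopologicalSpace P] [MulAction (PUGroup H)ᵐᵒᵖ P] {π : P → X}

theorem IsPrincipalBundle.exists_section {G : Type w} [Group G] [TopologicalSpace G]
    {X : Type u} [TopologicalSpace X] {P : Type v} [TopologicalSpace P] [MulAction Gᵐᵒᵖ P]
    {π : P → X} (hπ : IsPrincipalBundle G π) (x : X) :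
    ∃ V : Set X, IsOpen V ∧ x ∈ V ∧ ∃ σ : X → P, ContinuousOn σ V ∧ ∀ y ∈ V, π (σ y) = y := by
  classical
  obtain ⟨V, hV, hx, e, he, -⟩ := hπ.locally_trivial x
  let σ : X → P := fun y => if hy : y ∈ V then (e (⟨y, hy⟩, 1)).1 else (e (⟨x, hx⟩, 1)).1
  have hσ : ∀ y (hy : y ∈ V), σ y = (e (⟨y, hy⟩, 1)).1 := fun y hy => dif_pos hy
  refine ⟨V, hV, hx, σ, ?_, fun y hy => ?_⟩
  · rw [continuousOn_iff_continuous_domRestrict]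
    have h : domRestrict V σ = fun y : V => (e (y, 1)).1 := funext fun y => hσ y.1 y.2
    rw [h]
    fun_prop
  · rw [hσ y hy]
    exact he _

/-- Over a CW complex, the sections of a principal `PU(H)`-bundle admit a twisting part. -/
theorem exists_twist (hπ : IsPrincipalBundle (PUGroup H) π) :
    Nonempty (Twist H π (ContinuousMap.id X)) := by
  choose V hV hxV σ hσ hπσ using hπ.exists_section
  obtain ⟨C, O, hC, hCc, hO, hOC, hCV, hcov⟩ :=
    exists_locallyFinite_refinement V hV fun x => ⟨x, hxV x⟩
  choose a ha using hcov
  have hfin : ∀ x, {b | x ∈ C b}.Finite := fun x => hC.point_finite x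
  -- Transition functions lift to `U(H)` only locally, while a twisting part asks for a lift on the
  -- whole of each double intersection. So lifts are fixed near each `x` for the finitely many `b`
  -- with `x ∈ C b`, and the charts are taken inside their domains.
  have hk : ∀ x b, ∃ W, IsOpen W ∧ x ∈ W ∧ ∃ k : X → UGroup H, x ∈ C b →
      W ⊆ V b ∧ W ⊆ V (a x) ∧ ContinuousOn k W ∧
      ∀ y ∈ W, (k y : PUGroup H) = transl (PUGroup H) (σ (a x) y) (σ b y) := by
    intro x b
    by_cases hxb : x ∈ C b
    · have hγ : ContinuousOn (fun y => transl (PUGroup H) (σ (a x) y) (σ b y))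
          (V (a x) ∩ V b) :=
        hπ.continuousOn_transl.comp (((hσ (a x)).mono inter_subset_left).prodMk
          ((hσ b).mono inter_subset_right)) fun y hy =>
            (hπσ (a x) y hy.1).trans (hπσ b y hy.2).symm
      obtain ⟨W, hW, hxW, g, hg, hgl⟩ := PUGroup.exists_lift hγ
        (t₀ := x) ⟨hCV _ (hOC _ (ha x)), hCV _ hxb⟩
      exact ⟨W ∩ (V (a x) ∩ V b), hW.inter ((hV _).inter (hV _)),
        ⟨hxW, hCV _ (hOC _ (ha x)), hCV _ hxb⟩, g, fun _ =>
        ⟨fun y hy => hy.2.2, fun y hy => hy.2.1, hg, hgl⟩⟩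
    · exact ⟨univ, isOpen_univ, trivial, fun _ => 1, fun h => absurd h hxb⟩
  choose W hWo hxW k hkp using hk
  -- `U x` avoids every `C b` not containing `x`. If `U x` meets `U y` then `x ∈ C (a y)`, so the
  -- lift `k x (a y)` fixed near `x` is available on all of `U x`.
  let U : X → Set X := fun x => interior (⋂ (b) (_ : x ∉ C b), (C b)ᶜ) ∩ O (a x) ∩
    ⋂ b ∈ {b | x ∈ C b}, W x b
  have hUo : ∀ x, IsOpen (U x) := fun x =>
    (isOpen_interior.inter (hO _)).inter ((hfin x).isOpen_biInter fun b _ => hWo x b)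
  have hxU : ∀ x, x ∈ U x := fun x =>
    ⟨⟨mem_interior_iff_mem_nhds.2 (hC.iInter_compl_mem_nhds hCc x), ha x⟩,
      mem_iInter₂.2 fun b _ => hxW x b⟩
  have hmem : ∀ x y z, z ∈ U x ∩ U y → x ∈ C (a y) := by
    intro x y z hz
    by_contra h
    exact mem_iInter₂.1 (interior_subset hz.1.1.1) (a y) h (hOC _ hz.2.1.2)
  have hUW : ∀ x b, x ∈ C b → U x ⊆ W x b := fun x b hb z hz => mem_iInter₂.1 hz.2 b hb
  have hUV : ∀ x, U x ⊆ V (a x) := fun x z hz => hCV _ (hOC _ hz.1.2)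
  exact ⟨{
    ι := X
    U := U
    isOpen_U := hUo
    iUnion_U := eq_univ_of_forall fun x => mem_iUnion.2 ⟨x, hxU x⟩
    s := fun x => σ (a x)
    s_cont := fun x => (hσ _).mono (hUV x)
    proj_s := fun x z hz => hπσ _ z (hUV x hz)
    g := fun x y => k x (a y)
    g_cont := fun x y z hz => by
      have h := hmem x y z hz
      exact ((hkp x (a y) h).2.2.1.mono fun z hz => hUW x (a y) h hz.1) z hz
    g_lift := fun x y z hz => by
      have h := hmem x y z hz
      rw [(hkp x (a y) h).2.2.2 z (hUW x (a y) h hz.1)]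
      exact hπ.transl_act ((hπσ _ z (hUV x hz.1)).trans (hπσ _ z (hUV y hz.2)).symm) }⟩

end Cover

/-! ### Sections of principal bundles over cubes -/

section Cube

variable {G : Type w} [Group G] [TopologicalSpace G] [IsTopologicalGroup G] {X : Type u}
  [TopologicalSpace X] {P : Type v} [TopologicalSpace P] [MulAction Gᵐᵒᵖ P] {π : P → X}

/-- `Φ` lifts to `P` over `s`. -/
def LiftsOn {E : Type*} [TopologicalSpace E] (π : P → X) (Φ : E → X) (s : Set E) : Prop :=
  ∃ L : E → P, ContinuousOn L s ∧ ∀ y ∈ s, π (L y) = Φ y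

theorem LiftsOn.mono {E : Type*} [TopologicalSpace E] {Φ : E → X} {s s' : Set E}
    (h : LiftsOn π Φ s) (hs : s' ⊆ s) : LiftsOn π Φ s' := by
  obtain ⟨L, hL, h⟩ := h
  exact ⟨L, hL.mono hs, fun y hy => h y (hs hy)⟩

/-- On `s₂` the lift `L₂` is corrected by the translation from `L₂` to `L₁` measured at `p y`, where
both lifts are defined. As `p` fixes the intersection, the corrected lift agrees with `L₁` there. -/
theorem LiftsOn.union (hπ : IsPrincipalBundle G π) {E : Type*} [TopologicalSpace E] {Φ : E → X}
    {s₁ s₂ : Set E} (h₁ : LiftsOn π Φ s₁) (h₂ : LiftsOn π Φ s₂) (hs₁ : IsClosed s₁)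
    (hs₂ : IsClosed s₂) {p : E → E} (hp : Continuous p) (hps : MapsTo p s₂ (s₁ ∩ s₂))
    (hpf : ∀ y ∈ s₁ ∩ s₂, p y = y) : LiftsOn π Φ (s₁ ∪ s₂) := by
  classical
  obtain ⟨L₁, hc₁, hL₁⟩ := h₁
  obtain ⟨L₂, hc₂, hL₂⟩ := h₂
  let L' : E → P := fun y => MulOpposite.op (transl G (L₂ (p y)) (L₁ (p y))) • L₂ y
  have hpp : ∀ y ∈ s₂, π (L₂ (p y)) = π (L₁ (p y)) := fun y hy =>
    (hL₂ _ (hps hy).2).trans (hL₁ _ (hps hy).1).symm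
  have hc' : ContinuousOn L' s₂ := by
    have h1 : ContinuousOn (fun y => transl G (L₂ (p y)) (L₁ (p y))) s₂ :=
      hπ.continuousOn_transl.comp
        ((hc₂.comp hp.continuousOn fun y hy => (hps hy).2).prodMk
          (hc₁.comp hp.continuousOn fun y hy => (hps hy).1)) hpp
    exact hπ.continuous_act.comp_continuousOn (hc₂.prodMk h1)
  let L : E → P := fun y => if y ∈ s₁ then L₁ y else L' y
  have e₁ : ∀ y ∈ s₁, L y = L₁ y := fun y hy => if_pos hy
  have e₂ : ∀ y ∈ s₂, L y = L' y := fun y hy => by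
    by_cases h : y ∈ s₁
    · rw [e₁ y h]
      have h2 := hπ.transl_act (hpp y hy)
      rw [hpf y ⟨h, hy⟩] at h2
      change _ = MulOpposite.op (transl G (L₂ (p y)) (L₁ (p y))) • L₂ y
      rw [hpf y ⟨h, hy⟩, h2]
    · exact if_neg h
  refine ⟨L, (hc₁.congr e₁).union_of_isClosed (hc'.congr e₂) hs₁ hs₂, ?_⟩
  rintro y (hy | hy)
  · rw [e₁ y hy, hL₁ y hy]
  · rw [e₂ y hy]
    exact (hπ.proj_act _ _).trans (hL₂ y hy)

/-- Local sections give lifts over small cubes, and these are joined slab by slab along one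
coordinate after the other. With the sup norm the closed ball is a cube, and a slab retracts onto
its face by changing one coordinate. -/
theorem IsPrincipalBundle.liftsOn_cube (hπ : IsPrincipalBundle G π) {n : ℕ}
    {Φ : (Fin n → ℝ) → X} (hΦ : ContinuousOn Φ (Metric.closedBall 0 1)) :
    LiftsOn π Φ (Metric.closedBall 0 1) := by
  have hD : ∀ y : Fin n → ℝ, y ∈ Metric.closedBall (0 : Fin n → ℝ) 1 ↔ ∀ i, |y i| ≤ 1 := fun y => by
    rw [mem_closedBall_zero_iff, pi_norm_le_iff_of_nonneg zero_le_one]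
    rfl
  -- The first `k` coordinates are already unrestricted and the others are confined near those of
  -- `z`; the case `k = n` is the claim.
  have key : ∀ k ≤ n, ∀ z ∈ Metric.closedBall (0 : Fin n → ℝ) 1, ∃ ε > 0,
      LiftsOn π Φ {y | y ∈ Metric.closedBall (0 : Fin n → ℝ) 1 ∧
        ∀ i : Fin n, k ≤ i → |y i - z i| ≤ ε} := by
    intro k
    induction k with
    | zero =>
      intro _ z hz
      obtain ⟨V, hV, hzV, σ, hσ, hπσ⟩ := hπ.exists_section (Φ z)
      obtain ⟨ε, hε, hsub⟩ := Metric.mem_nhdsWithin_iff.1 (hΦ z hz (hV.mem_nhds hzV))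
      refine ⟨ε / 2, half_pos hε, fun y => σ (Φ y), ?_, ?_⟩
      all_goals have h : ∀ y ∈ {y | y ∈ Metric.closedBall (0 : Fin n → ℝ) 1 ∧
        ∀ i : Fin n, 0 ≤ (i : ℕ) → |y i - z i| ≤ ε / 2}, Φ y ∈ V := fun y hy => hsub (by
          refine ⟨?_, hy.1⟩
          rw [Metric.mem_ball]
          exact ((dist_pi_le_iff (half_pos hε).le).2 fun i =>
            hy.2 i (Nat.zero_le _)).trans_lt (half_lt_self hε))
      · exact hσ.comp (hΦ.mono fun y hy => hy.1) h
      · exact fun y hy => hπσ _ (h y hy)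
    | succ k ih =>
      intro hk z hz
      have ih := ih (Nat.le_of_succ_le hk)
      let κ : Fin n := ⟨k, hk⟩
      let zt : Icc (-1 : ℝ) 1 → Fin n → ℝ := fun t => Function.update z κ t
      have hzt : ∀ t, zt t ∈ Metric.closedBall (0 : Fin n → ℝ) 1 := fun t => by
        rw [hD]
        intro i
        rcases eq_or_ne i κ with hi | hi
        · rw [hi, show zt t κ = t from Function.update_self _ _ _, abs_le]
          exact t.2
        · rw [show zt t i = z i from Function.update_of_ne hi _ _]
          exact (hD z).1 hz i
      choose ε hε hlift using fun t => ih (zt t) (hzt t)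
      -- A Lebesgue subdivision of `[-1, 1]`: each slab `t j ≤ y κ ≤ t (j + 1)` lies in one of the
      -- sets on which a lift exists.
      obtain ⟨t, ht0, htm, ⟨m, hm⟩, htc⟩ := exists_monotone_Icc_subset_open_cover_Icc
        (by norm_num : (-1 : ℝ) ≤ 1) (c := fun t : Icc (-1 : ℝ) 1 => {s : Icc (-1 : ℝ) 1 | |(s : ℝ) - t| < ε t})
        (fun t => isOpen_lt (by fun_prop) continuous_const)
        fun t _ => mem_iUnion.2 ⟨t, by
          change |(t : ℝ) - t| < ε t
          rw [sub_self, abs_zero]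
          exact hε t⟩
      have hcl : ∀ δ : ℝ, IsClosed {y | y ∈ Metric.closedBall (0 : Fin n → ℝ) 1 ∧
          ∀ i : Fin n, k + 1 ≤ (i : ℕ) → |y i - z i| ≤ δ} := fun δ => by
        simp only [ofPred_and, ofPred_forall]
        exact Metric.isClosed_closedBall.inter (isClosed_iInter fun i => isClosed_iInter fun _ =>
          isClosed_le (by fun_prop) continuous_const)
      have hstep : ∀ j, ∃ δ > 0, LiftsOn π Φ ({y | y ∈ Metric.closedBall (0 : Fin n → ℝ) 1 ∧
          ∀ i : Fin n, k + 1 ≤ (i : ℕ) → |y i - z i| ≤ δ} ∩ {y | y κ ≤ t j}) := by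
        intro j
        induction j with
        | zero =>
          refine ⟨ε (t 0), hε _, (hlift (t 0)).mono fun y hy => ⟨hy.1.1, fun i hi => ?_⟩⟩
          rcases hi.lt_or_eq with hi | hi
          · rw [show zt (t 0) i = z i from
              Function.update_of_ne (fun h => hi.ne (congrArg Fin.val h).symm) _ _]
            exact hy.1.2 i hi
          · obtain rfl : κ = i := Fin.ext hi
            rw [show zt (t 0) κ = t 0 from Function.update_self _ _ _]
            have h1 : y κ ≤ t 0 := hy.2
            have h2 := (abs_le.1 ((hD y).1 hy.1.1 κ)).1
            rw [ht0] at h1 ⊢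
            rw [le_antisymm h1 h2, sub_self, abs_zero]
            exact (hε _).le
        | succ j ihj =>
          obtain ⟨δ, hδ, hj⟩ := ihj
          obtain ⟨i₀, hi₀⟩ := htc j
          refine ⟨min δ (ε i₀), lt_min hδ (hε i₀), ?_⟩
          set B := {y | y ∈ Metric.closedBall (0 : Fin n → ℝ) 1 ∧
            ∀ i : Fin n, k + 1 ≤ (i : ℕ) → |y i - z i| ≤ min δ (ε i₀)} with hB
          have h₁ : LiftsOn π Φ (B ∩ {y | y κ ≤ t j}) := hj.mono fun y hy =>
            ⟨⟨hy.1.1, fun i hi => (hy.1.2 i hi).trans (min_le_left _ _)⟩, hy.2⟩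
          have h₂ : LiftsOn π Φ (B ∩ {y | (t j : ℝ) ≤ y κ ∧ y κ ≤ t (j + 1)}) := by
            refine (hlift i₀).mono fun y hy => ⟨hy.1.1, fun i hi => ?_⟩
            rcases hi.lt_or_eq with hi | hi
            · rw [show zt i₀ i = z i from
                Function.update_of_ne (fun h => hi.ne (congrArg Fin.val h).symm) _ _]
              exact (hy.1.2 i hi).trans (min_le_right _ _)
            · obtain rfl : κ = i := Fin.ext hi
              rw [show zt i₀ κ = i₀ from Function.update_self _ _ _]
              have h3 : (⟨y κ, abs_le.1 ((hD y).1 hy.1.1 κ)⟩ : Icc (-1 : ℝ) 1) ∈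
                  Icc (t j) (t (j + 1)) := hy.2
              exact (hi₀ h3).le
          have hle : ∀ c : ℝ, IsClosed {y : Fin n → ℝ | y κ ≤ c} := fun c =>
            isClosed_le (by fun_prop) continuous_const
          have hge : IsClosed {y : Fin n → ℝ | (t j : ℝ) ≤ y κ} :=
            isClosed_le continuous_const (by fun_prop)
          have h := h₁.union hπ h₂ ((hcl _).inter (hle _)) ((hcl _).inter (hge.inter (hle _)))
            (p := fun y => Function.update y κ (t j : ℝ)) (by fun_prop) (fun y hy => ?_)
            fun y hy => ?_
          · refine h.mono fun y hy => ?_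
            rcases le_total (y κ) (t j) with h4 | h4
            · exact Or.inl ⟨hy.1, h4⟩
            · exact Or.inr ⟨hy.1, h4, hy.2⟩
          · have h5 : Function.update y κ (t j : ℝ) ∈ B := by
              refine ⟨(hD _).2 fun i => ?_, fun i hi => ?_⟩
              · rcases eq_or_ne i κ with hi | hi
                · rw [hi, Function.update_self, abs_le]
                  exact (t j).2
                · rw [Function.update_of_ne hi]
                  exact (hD y).1 hy.1.1 i
              · rw [Function.update_of_ne fun h => by
                  rw [h] at hi
                  exact absurd hi (Nat.not_succ_le_self k)]
                exact hy.1.2 i hi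
            have h6 : Function.update y κ (t j : ℝ) κ = t j := Function.update_self _ _ _
            exact ⟨⟨h5, h6.le⟩, h5, h6.ge, h6.le.trans (htm j.le_succ)⟩
          · have h7 : y κ = t j := le_antisymm hy.1.2 hy.2.2.1
            change Function.update y κ (t j : ℝ) = y
            rw [← h7, Function.update_eq_self]
      obtain ⟨δ, hδ, h⟩ := hstep m
      refine ⟨δ, hδ, h.mono fun y hy => ⟨hy, ?_⟩⟩
      change y κ ≤ t m
      rw [hm m le_rfl]
      exact (abs_le.1 ((hD y).1 hy.1 κ)).2
  obtain ⟨ε, -, h⟩ := key n le_rfl 0 (Metric.mem_closedBall_self zero_le_one)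
  exact h.mono fun y hy => ⟨hy, fun i hi => absurd i.2 (not_lt.2 hi)⟩

end Cube

/-! ### The equivariant retraction -/

section Retraction

open Topology.RelCWComplex (cell map openCell closedCell cellFrontier)

variable {G : Type w} [Group G] [TopologicalSpace G] [IsTopologicalGroup G] {X : Type u}
  [TopologicalSpace X] {P : Type v} [TopologicalSpace P] [MulAction Gᵐᵒᵖ P] {π : P → X}

theorem IsPrincipalBundle.transl_self (hπ : IsPrincipalBundle G π) (p : P) : transl G p p = 1 :=
  hπ.transl_eq (one_smul _ p)

theorem IsPrincipalBundle.transl_smul (hπ : IsPrincipalBundle G π) {p p' : P} (h : π p = π p')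
    (g : G) : transl G p (MulOpposite.op g • p') = transl G p p' * g :=
  hπ.transl_eq (by rw [MulOpposite.op_mul, mul_smul, hπ.transl_act h])

/-- By equivariance `R` is determined by its values on the single lift `L`. Comparing `L` with a
local section descends continuity from `Z × I` to `A × I`, since a quotient map stays a quotient map
after multiplication by the locally compact `I`; the group action then spreads it over the fibres.
-/
theorem IsPrincipalBundle.continuousOn_of_lift (hπ : IsPrincipalBundle G π) {A : Set X}
    {Z : Type*} [TopologicalSpace Z] {q : Z → A} (hq : IsQuotientMap q) {L : Z → P}
    (hL : Continuous L) (hπL : ∀ z, π (L z) = q z) {R : P → unitInterval → P × unitInterval}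
    (hR : ∀ p, π p ∈ A → ∀ (g : G) t,
      R (MulOpposite.op g • p) t = (MulOpposite.op g • (R p t).1, (R p t).2))
    (hc : Continuous fun z : Z × unitInterval => R (L z.1) z.2) :
    ContinuousOn (fun z : P × unitInterval => R z.1 z.2) {z | π z.1 ∈ A} := by
  have hact : Continuous fun w : (P × unitInterval) × G =>
      (MulOpposite.op w.2 • w.1.1, w.1.2) :=
    (hπ.continuous_act.comp (f := fun w : (P × unitInterval) × G => (w.1.1, w.2))
      (by fun_prop)).prodMk (by fun_prop)
  rintro ⟨p₀, t₀⟩ hp₀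
  obtain ⟨V, hV, hxV, σ, hσ, hπσ⟩ := hπ.exists_section (π p₀)
  let A' : Set A := Subtype.val ⁻¹' V
  have hq' := hq.restrictPreimage_isOpen (s := A') (hV.preimage continuous_subtype_val)
  have hg : Continuous fun w : A' × unitInterval => R (σ w.1.1.1) w.2 := by
    refine hq'.continuous_lift_prod_left ?_
    have e : (fun z : (q ⁻¹' A') × unitInterval =>
        R (σ ((A'.restrictPreimage q z.1).1.1)) z.2) = fun z =>
        (MulOpposite.op (transl G (L z.1.1) (σ (q z.1.1))) • (R (L z.1.1) z.2).1,
          (R (L z.1.1) z.2).2) := by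
      funext z
      have h1 : π (L z.1.1) = π (σ (q z.1.1)) := (hπL _).trans (hπσ _ z.1.2).symm
      rw [← hR _ (by rw [hπL]; exact (q z.1.1).2), hπ.transl_act h1]
      rfl
    rw [e]
    refine hact.comp (f := fun z : (q ⁻¹' A') × unitInterval =>
      (R (L z.1.1) z.2, transl G (L z.1.1) (σ (q z.1.1)))) (Continuous.prodMk ?_ ?_)
    · exact hc.comp (f := fun z : (q ⁻¹' A') × unitInterval => (z.1.1, z.2)) (by fun_prop)
    · have h2 : Continuous fun z : (q ⁻¹' A') × unitInterval => σ (q z.1.1) :=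
        hσ.comp_continuous (continuous_subtype_val.comp
          (hq.continuous.comp (by fun_prop))) fun z => z.1.2
      exact hπ.continuousOn_transl.comp_continuous
        ((hL.comp (by fun_prop)).prodMk h2) fun z => (hπL _).trans (hπσ _ z.1.2).symm
  have hS : ContinuousOn (fun z : P × unitInterval => R z.1 z.2) {z | π z.1 ∈ A ∧ π z.1 ∈ V} := by
    rw [continuousOn_iff_continuous_domRestrict]
    have e : domRestrict {z : P × unitInterval | π z.1 ∈ A ∧ π z.1 ∈ V} (fun z => R z.1 z.2) =
        fun z => (MulOpposite.op (transl G (σ (π z.1.1)) z.1.1) • (R (σ (π z.1.1)) z.1.2).1,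
          (R (σ (π z.1.1)) z.1.2).2) := by
      funext z
      have h1 := hπσ _ z.2.2
      rw [← hR _ (by rw [h1]; exact z.2.1), hπ.transl_act h1]
      rfl
    rw [e]
    have hp : Continuous fun z : {z : P × unitInterval | π z.1 ∈ A ∧ π z.1 ∈ V} => π z.1.1 :=
      hπ.continuous_proj.comp (by fun_prop)
    refine hact.comp (f := fun z : {z : P × unitInterval | π z.1 ∈ A ∧ π z.1 ∈ V} =>
      (R (σ (π z.1.1)) z.1.2, transl G (σ (π z.1.1)) z.1.1)) (Continuous.prodMk ?_ ?_)
    · exact hg.comp (f := fun z : {z : P × unitInterval | π z.1 ∈ A ∧ π z.1 ∈ V} =>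
        ((⟨⟨π z.1.1, z.2.1⟩, z.2.2⟩ : A'), z.1.2))
        (((hp.subtype_mk _).subtype_mk _).prodMk (by fun_prop))
    · exact hπ.continuousOn_transl.comp_continuous
        ((hσ.comp_continuous hp fun z => z.2.2).prodMk (by fun_prop)) fun z => hπσ _ z.2.2
  refine (hS _ ⟨hp₀, hxV⟩).mono_of_mem_nhdsWithin ?_
  have : {z : P × unitInterval | π z.1 ∈ V} ∈ 𝓝 (p₀, t₀) :=
    (hV.preimage (hπ.continuous_proj.comp continuous_fst)).mem_nhds hxV
  exact inter_mem self_mem_nhdsWithin (mem_nhdsWithin_of_mem_nhds this)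

variable [T2Space X] [CWComplex (univ : Set X)]

/-- The retraction of `D × I` onto `∂D × I ∪ D × {0}`. -/
def ballRetr {E : Type*} [NormedAddCommGroup E] [NormedSpace ℝ E] (y : E) (t : unitInterval) :
    E × unitInterval :=
  -- Central projection from the point `(0, 2)`. The maximum is the factor that decides whether the
  -- ray leaves through the side `‖y‖ = 1` or through the bottom `t = 0`.
  ((max ‖y‖ ((2 - t) / 2))⁻¹ • y, clamp (2 - (2 - t) / max ‖y‖ ((2 - t) / 2)))

section BallRetr

variable {E : Type*} [NormedAddCommGroup E] [NormedSpace ℝ E]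

theorem ballRetr_max_pos (y : E) (t : unitInterval) : 0 < max ‖y‖ ((2 - (t : ℝ)) / 2) :=
  lt_max_of_lt_right (by have := t.2.2; linarith)

theorem continuous_ballRetr : Continuous fun z : E × unitInterval => ballRetr z.1 z.2 := by
  have h0 : ∀ z : E × unitInterval, max ‖z.1‖ ((2 - (z.2 : ℝ)) / 2) ≠ 0 := fun z =>
    (ballRetr_max_pos z.1 z.2).ne'
  have h1 : Continuous fun z : E × unitInterval => max ‖z.1‖ ((2 - (z.2 : ℝ)) / 2) := by fun_prop
  exact ((h1.inv₀ h0).smul continuous_fst).prodMk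
    (continuous_clamp.comp (continuous_const.sub ((by fun_prop :
      Continuous fun z : E × unitInterval => 2 - (z.2 : ℝ)).div h1 h0)))

theorem ballRetr_of_norm_eq_one {y : E} (hy : ‖y‖ = 1) (t : unitInterval) :
    ballRetr y t = (y, t) := by
  have h : max ‖y‖ ((2 - (t : ℝ)) / 2) = 1 := by
    rw [hy]
    exact max_eq_left (by have := t.2.1; linarith)
  rw [ballRetr, h, inv_one, one_smul, div_one, sub_sub_cancel, clamp_coe]

theorem ballRetr_zero {y : E} (hy : ‖y‖ ≤ 1) : ballRetr y 0 = (y, 0) := by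
  have h : max ‖y‖ ((2 - ((0 : unitInterval) : ℝ)) / 2) = 1 := by
    rw [Icc.coe_zero, sub_zero, div_self two_ne_zero]
    exact max_eq_right hy
  rw [ballRetr, h, inv_one, one_smul, div_one, sub_sub_cancel, clamp_coe]

theorem ballRetr_mem {y : E} (t : unitInterval) :
    ‖(ballRetr y t).1‖ = 1 ∨ ‖(ballRetr y t).1‖ ≤ 1 ∧ (ballRetr y t).2 = 0 := by
  have h0 := ballRetr_max_pos y t
  have h1 : ‖(ballRetr y t).1‖ = (max ‖y‖ ((2 - (t : ℝ)) / 2))⁻¹ * ‖y‖ := by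
    rw [ballRetr, norm_smul, Real.norm_of_nonneg (inv_pos.2 h0).le]
  rcases le_total ((2 - (t : ℝ)) / 2) ‖y‖ with h | h
  · left
    rw [h1]
    rw [max_eq_left h] at h0 ⊢
    exact inv_mul_cancel₀ h0.ne'
  · right
    rw [h1]
    refine ⟨?_, ?_⟩
    · rw [inv_mul_le_iff₀ h0, mul_one]
      exact le_max_left _ _
    · rw [ballRetr]
      refine clamp_of_le ?_
      rw [max_eq_right h] at h0 ⊢
      rw [div_div_eq_mul_div, mul_comm, mul_div_assoc, div_self (by linarith), mul_one, sub_self]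

end BallRetr

/-- This is the homotopy extension property of the CW pair `(X, Y)`, made equivariant. Over a cell
the bundle has a section along the characteristic map, so there the extension problem is the
retraction of `D × I` onto `∂D × I ∪ D × {0}`, spread over the fibres by the group. -/
theorem IsPrincipalBundle.exists_equivariant_retraction (hπ : IsPrincipalBundle G π)
    (Y : RelCWComplex.Subcomplex (univ : Set X)) :
    ∃ R : P → unitInterval → P × unitInterval,
      (Continuous fun z : P × unitInterval => R z.1 z.2) ∧
      (∀ p (g : G) t, R (MulOpposite.op g • p) t = (MulOpposite.op g • (R p t).1, (R p t).2)) ∧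
      (∀ p, R p 0 = (p, 0)) ∧ (∀ p t, π p ∈ Y → R p t = (p, t)) ∧
      ∀ p t, (R p t).2 = 0 ∨ π (R p t).1 ∈ Y := by
  let Good : ∀ n, cell (univ : Set X) n → (X → P → unitInterval → P × unitInterval) → Prop :=
    fun n e F =>
      ContinuousOn (fun z : P × unitInterval => F (π z.1) z.1 z.2) {z | π z.1 ∈ closedCell n e} ∧
      ∀ p, π p ∈ closedCell n e →
        (∀ (g : G) t, F (π p) (MulOpposite.op g • p) t =
          (MulOpposite.op g • (F (π p) p t).1, (F (π p) p t).2)) ∧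
        F (π p) p 0 = (p, 0) ∧ ∀ t, (F (π p) p t).2 = 0 ∨ π (F (π p) p t).1 ∈ Y
  have hS : ∀ n (e : cell (univ : Set X) n),
      closedCell n e ⊆ (Y : Set X) ∨ Disjoint (openCell n e) (Y : Set X) := fun n e => by
    by_cases he : e ∈ Y.I n
    · exact Or.inl (Y.closedCell_subset_of_mem he)
    · exact Or.inr (Y.disjoint_openCell_subcomplex_of_not_mem he)
  have hex : ∃ F : X → P → unitInterval → P × unitInterval,
      EqOn F (fun _ p t => (p, t)) Y ∧ ∀ n e, Good n e F := by
    refine exists_cell_extension (Y : Set X) Good ?_ hS _ ?_ ?_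
    · rintro n e F F' h ⟨h1, h2⟩
      refine ⟨h1.congr fun z hz => ?_, fun p hp => ?_⟩
      · change F' (π z.1) z.1 z.2 = F (π z.1) z.1 z.2
        rw [h hz]
      · rw [← h hp]
        exact h2 p hp
    · intro n e he
      exact ⟨continuousOn_id, fun p hp => ⟨fun _ _ => rfl, rfl, fun t => Or.inr (he hp)⟩⟩
    · intro n e F hF _
      have hΦ : ContinuousOn (map n e) (Metric.closedBall 0 1) := RelCWComplex.continuousOn n e
      -- `L` trivialises the pull-back of `P` to the closed ball; an equivariant map over the cell
      -- is given by its values on `L`.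
      obtain ⟨L, hL, hπL⟩ := hπ.liftsOn_cube hΦ
      have hfr : ∀ p, π p ∈ cellFrontier n e →
          (∀ (g : G) t, F (π p) (MulOpposite.op g • p) t =
            (MulOpposite.op g • (F (π p) p t).1, (F (π p) p t).2)) ∧
          F (π p) p 0 = (p, 0) ∧ ∀ t, (F (π p) p t).2 = 0 ∨ π (F (π p) p t).1 ∈ Y :=
        fun p hp => by
          obtain ⟨m, hm, e', h⟩ := exists_mem_openCell_of_mem_cellFrontier hp
          exact (hF m hm e').2 p (RelCWComplex.openCell_subset_closedCell m e' h)
      have hFc : ContinuousOn (fun z : P × unitInterval => F (π z.1) z.1 z.2)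
          {z | π z.1 ∈ cellFrontier n e} :=
        continuousOn_cellFrontier e (hπ.continuous_proj.comp continuous_fst)
          fun m hm e' => (hF m hm e').1
      have hsph : ∀ y ∈ Metric.sphere (0 : Fin n → ℝ) 1, π (L y) ∈ cellFrontier n e := fun y hy => by
        rw [hπL y (Metric.sphere_subset_closedBall hy)]
        exact mem_image_of_mem _ hy
      classical
      -- The data to be extended: the map of the previous stage over the sphere, the identity at
      -- time `0`. They agree on the sphere at time `0` because the previous stage is the identity
      -- there.
      let k : (Fin n → ℝ) × unitInterval → P × unitInterval := fun z =>
        if z.1 ∈ Metric.sphere (0 : Fin n → ℝ) 1 then F (π (L z.1)) (L z.1) z.2 else (L z.1, z.2)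
      have hk1 : ∀ y ∈ Metric.sphere (0 : Fin n → ℝ) 1, ∀ t,
          k (y, t) = F (π (L y)) (L y) t := fun y hy t => if_pos hy
      have hk0 : ∀ y, k (y, 0) = (L y, 0) := fun y => by
        by_cases hy : y ∈ Metric.sphere (0 : Fin n → ℝ) 1
        · rw [hk1 y hy]
          exact (hfr _ (hsph y hy)).2.1
        · exact if_neg hy
      have hkc : ContinuousOn k ({z | z.1 ∈ Metric.sphere (0 : Fin n → ℝ) 1} ∪
          {z | z.1 ∈ Metric.closedBall (0 : Fin n → ℝ) 1 ∧ z.2 = 0}) := by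
        refine ContinuousOn.union_of_isClosed ?_ ?_
          (Metric.isClosed_sphere.preimage continuous_fst)
          ((Metric.isClosed_closedBall.preimage continuous_fst).inter
            (isClosed_singleton.preimage continuous_snd))
        · refine (hFc.comp (f := fun z : (Fin n → ℝ) × unitInterval => (L z.1, z.2))
            (((hL.mono Metric.sphere_subset_closedBall).comp continuousOn_fst
              fun z hz => hz).prodMk continuousOn_snd)
            (s := {z | z.1 ∈ Metric.sphere (0 : Fin n → ℝ) 1}) fun z hz => hsph _ hz).congr ?_
          exact fun z hz => hk1 z.1 hz z.2
        · refine ((hL.comp continuousOn_fst fun z hz => hz.1).prodMk continuousOn_snd).congr ?_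
          rintro ⟨y, t⟩ ⟨hy, rfl⟩
          exact hk0 y
      have hM : ∀ y t, ballRetr y t ∈ {z | z.1 ∈ Metric.sphere (0 : Fin n → ℝ) 1} ∪
          {z | z.1 ∈ Metric.closedBall (0 : Fin n → ℝ) 1 ∧ z.2 = 0} := fun y t =>
        (ballRetr_mem t).imp (fun h => mem_sphere_zero_iff_norm.2 h)
          fun h => ⟨mem_closedBall_zero_iff.2 h.1, h.2⟩
      -- On `L y` the new map is `k ∘ ballRetr`, and translation by the group defines it on the rest
      -- of the fibre.
      obtain ⟨F', hF', hF'G⟩ := exists_extend_openCell n e F fun y p t =>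
        (MulOpposite.op (transl G (L y) p) • (k (ballRetr y t)).1, (k (ballRetr y t)).2)
      have hfr' : ∀ p, π p ∈ cellFrontier n e → F' (π p) = F (π p) := fun p hp =>
        hF' _ (notMem_openCell_of_mem_cellFrontier hp)
      have hL' : ∀ y ∈ Metric.closedBall (0 : Fin n → ℝ) 1, ∀ t,
          F' (π (L y)) (L y) t = k (ballRetr y t) := by
        intro y hy t
        have hy' := hy
        rw [← Metric.ball_union_sphere] at hy'
        rcases hy' with hy' | hy'
        · rw [hπL y hy, hF'G y hy']
          dsimp only
          rw [hπ.transl_self, MulOpposite.op_one, one_smul]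
        · rw [hfr' _ (hsph y hy'), ballRetr_of_norm_eq_one (mem_sphere_zero_iff_norm.1 hy'),
            hk1 y hy']
      have hprop : ∀ p, π p ∈ closedCell n e →
          (∀ (g : G) t, F' (π p) (MulOpposite.op g • p) t =
            (MulOpposite.op g • (F' (π p) p t).1, (F' (π p) p t).2)) ∧
          F' (π p) p 0 = (p, 0) ∧ ∀ t, (F' (π p) p t).2 = 0 ∨ π (F' (π p) p t).1 ∈ Y := by
        rintro p ⟨y, hy, hyp⟩
        have hy' := hy
        rw [← Metric.ball_union_sphere] at hy'
        rcases hy' with hy' | hy'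
        · have hLp : π (L y) = π p := (hπL y hy).trans hyp
          rw [← hyp, hF'G y hy']
          dsimp only
          refine ⟨fun g t => ?_, ?_, fun t => ?_⟩
          · rw [hπ.transl_smul hLp, MulOpposite.op_mul, mul_smul]
          · rw [ballRetr_zero (mem_closedBall_zero_iff.1 hy), hk0, hπ.transl_act hLp]
          · rw [hπ.proj_act]
            have hb := hM y t
            generalize ballRetr y t = b at hb
            obtain ⟨y', s⟩ := b
            rcases hb with hb | hb
            · rw [hk1 y' hb]
              exact (hfr _ (hsph y' hb)).2.2 s
            · obtain rfl : s = 0 := hb.2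
              left
              rw [hk0]
        · have hp : π p ∈ cellFrontier n e := hyp ▸ mem_image_of_mem _ hy'
          rw [hfr' p hp]
          exact hfr p hp
      refine ⟨F', hF', ?_, hprop⟩
      refine hπ.continuousOn_of_lift (R := fun p t => F' (π p) p t) (isQuotientMap_charMap n e)
        (L := fun z => L z) (continuousOn_iff_continuous_domRestrict.1 hL) (fun z => hπL z.1 z.2)
        (fun p hp g t => ?_) ?_
      · rw [hπ.proj_act]
        exact (hprop p hp).1 g t
      · have e1 : (fun z : Metric.closedBall (0 : Fin n → ℝ) 1 × unitInterval =>
            F' (π (L z.1)) (L z.1) z.2) = fun z => k (ballRetr z.1.1 z.2) :=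
          funext fun z => hL' z.1.1 z.1.2 z.2
        rw [e1]
        exact hkc.comp_continuous (continuous_ballRetr.comp (f := fun z :
          Metric.closedBall (0 : Fin n → ℝ) 1 × unitInterval => (z.1.1, z.2)) (by fun_prop))
          fun z => hM _ _
  obtain ⟨F, hFY, hF⟩ := hex
  have hprop : ∀ p, (∀ (g : G) t, F (π p) (MulOpposite.op g • p) t =
      (MulOpposite.op g • (F (π p) p t).1, (F (π p) p t).2)) ∧
      F (π p) p 0 = (p, 0) ∧ ∀ t, (F (π p) p t).2 = 0 ∨ π (F (π p) p t).1 ∈ Y := fun p => by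
    obtain ⟨n, e, h⟩ := exists_mem_openCell (π p)
    exact (hF n e).2 p (RelCWComplex.openCell_subset_closedCell n e h)
  refine ⟨fun p t => F (π p) p t, ?_, fun p g t => ?_, fun p => (hprop p).2.1, fun p t hp => ?_,
    fun p => (hprop p).2.2⟩
  · choose L hL hπL using fun c : Σ n, cell (univ : Set X) n =>
      hπ.liftsOn_cube (RelCWComplex.continuousOn c.1 c.2)
    have h := hπ.continuousOn_of_lift (R := fun p t => F (π p) p t) isQuotientMap_charMaps
      (L := fun z => L z.1 z.2.1)
      (continuous_sigma fun c => continuousOn_iff_continuous_domRestrict.1 (hL c))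
      (fun z => hπL z.1 z.2.1 z.2.2) (fun p _ g t => by
        rw [hπ.proj_act]
        exact (hprop p).1 g t) (by
        refine Homeomorph.sigmaProdDistrib.symm.comp_continuous_iff'.1 (continuous_sigma fun c => ?_)
        have hc : Continuous fun z : Metric.closedBall (0 : Fin c.1 → ℝ) 1 × unitInterval =>
            (L c z.1.1, z.2) :=
          ((continuousOn_iff_continuous_domRestrict.1 (hL c)).comp continuous_fst).prodMk
            continuous_snd
        refine (hF c.1 c.2).1.comp_continuous hc fun z => ?_
        change π (L c z.1.1) ∈ closedCell c.1 c.2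
        rw [hπL c z.1.1 z.1.2]
        exact mem_image_of_mem _ z.1.2)
    exact continuousOn_univ.1 (h.mono fun z _ => mem_univ (π z.1))
  · dsimp only
    rw [hπ.proj_act]
    exact (hprop p).1 g t
  · exact congrFun (congrFun (hFY hp) p) t

end Retraction

/-! ### The retraction of `X × I` covered by a bundle map. -/

section BundleRetraction

variable {H : Type w} [NormedAddCommGroup H] [InnerProductSpace ℂ H]
variable {X : Type u} [TopologicalSpace X] [T2Space X] [CWComplex (univ : Set X)]
  {P : Type v} [TopologicalSpace P] [MulAction (PUGroup H)ᵐᵒᵖ P] {π : P → X}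

/-- The retraction of `X × I` onto `X × {0} ∪ Y × I`, covered by a bundle map. -/
theorem exists_bundle_retraction (hπ : IsPrincipalBundle (PUGroup H) π)
    (Y : RelCWComplex.Subcomplex (univ : Set X)) :
    ∃ (r : C(X × unitInterval, X × unitInterval)) (Q : X × unitInterval → P → P),
      IsBundleMap H π (ContinuousMap.id X) (ContinuousMap.fst : C(X × unitInterval, X))
        (fun z => (r z).1) Q ∧
      (∀ x, r (x, 0) = (x, 0)) ∧ (∀ x t, x ∈ Y → r (x, t) = (x, t)) ∧
      (∀ z, (r z).2 = 0 ∨ (r z).1 ∈ Y) ∧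
      ∀ z p, z.2 = 0 ∨ z.1 ∈ Y → π p = z.1 → Q z p = p := by
  obtain ⟨R, hRc, hRg, hR0, hRY, hR⟩ := hπ.exists_equivariant_retraction Y
  choose V hV hxV σ hσ hπσ using hπ.exists_section
  -- An arbitrary point in each fibre, chosen without continuity. What is defined from it is
  -- independent of the choice by equivariance, so continuity is checked with local sections
  -- instead.
  let p₀ : X → P := fun x => σ x x
  have hp₀ : ∀ x, π (p₀ x) = x := fun x => hπσ x x (hxV x)
  have hrp : ∀ p p' t, π p = π p' → π (R p t).1 = π (R p' t).1 ∧ (R p t).2 = (R p' t).2 := by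
    intro p p' t h
    obtain ⟨g, rfl⟩ := hπ.exists_act h
    rw [hRg]
    exact ⟨(hπ.proj_act _ _).symm, rfl⟩
  let r : X × unitInterval → X × unitInterval := fun z =>
    (π (R (p₀ z.1) z.2).1, (R (p₀ z.1) z.2).2)
  have hrσ : ∀ p t, r (π p, t) = (π (R p t).1, (R p t).2) := fun p t =>
    Prod.ext (hrp _ _ t (hp₀ _)).1 (hrp _ _ t (hp₀ _)).2
  have hσV : ∀ x, ContinuousOn (fun z : X × unitInterval => σ x z.1) {z | z.1 ∈ V x} := fun x =>
    (hσ x).comp continuousOn_fst fun z hz => hz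
  have hRσ : ∀ x, ContinuousOn (fun z : X × unitInterval => R (σ x z.1) z.2) {z | z.1 ∈ V x} :=
    fun x => hRc.comp_continuousOn ((hσV x).prodMk continuousOn_snd)
  have hr : Continuous r := by
    rw [continuous_iff_continuousAt]
    rintro ⟨x, t⟩
    have h1 : ContinuousOn r {z | z.1 ∈ V x} := by
      refine ((hπ.continuous_proj.comp_continuousOn (hRσ x).fst).prodMk (hRσ x).snd).congr ?_
      rintro ⟨y, s⟩ hy
      have h := hrσ (σ x y) s
      rwa [hπσ x y hy] at h
    exact h1.continuousAt (((hV x).preimage continuous_fst).mem_nhds (hxV x))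
  -- `Q z` is the equivariant map from the fibre over `(r z).1` to the fibre over `z.1` that undoes
  -- `R` at the time `z.2`: it sends `(R p₀).1` back to `p₀`.
  let Q : X × unitInterval → P → P := fun z p =>
    MulOpposite.op (transl (PUGroup H) (R (p₀ z.1) z.2).1 p) • p₀ z.1
  have hQ : ∀ (z : X × unitInterval) p p', π p' = z.1 → π p = (r z).1 →
      Q z p = MulOpposite.op (transl (PUGroup H) (R p' z.2).1 p) • p' := by
    intro z p p' hp' hp
    obtain ⟨g, hg⟩ := hπ.exists_act (p := p₀ z.1) (p' := p') ((hp₀ _).trans hp'.symm)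
    have h1 := hRg (p₀ z.1) g z.2
    have h2 : π (R (p₀ z.1) z.2).1 = π p := hp.symm
    rw [hg] at h1
    have h3 : transl (PUGroup H) (R p' z.2).1 p =
        g⁻¹ * transl (PUGroup H) (R (p₀ z.1) z.2).1 p := by
      refine hπ.transl_eq ?_
      rw [h1]
      rw [← mul_smul, ← MulOpposite.op_mul, mul_inv_cancel_left, hπ.transl_act h2]
    rw [h3, ← hg, ← mul_smul, ← MulOpposite.op_mul, mul_inv_cancel_left]
  refine ⟨⟨r, hr⟩, Q, ⟨fun z p hp => ?_, fun z p hp g => ?_, ?_⟩, fun x => ?_, fun x t hx => ?_,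
    fun z => hR _ _, fun z p hz hp => ?_⟩
  · exact (hπ.proj_act _ _).trans (hp₀ _)
  · have h1 : π (R (p₀ z.1) z.2).1 = π p := hp.symm
    change MulOpposite.op (transl (PUGroup H) (R (p₀ z.1) z.2).1 _) • p₀ z.1 = _
    rw [hπ.transl_smul h1, MulOpposite.op_mul, mul_smul]
  · rintro ⟨⟨x, t⟩, p⟩ hp
    have h1 : ContinuousOn (fun w : (X × unitInterval) × P => Q w.1 w.2)
        {w | w.1.1 ∈ V x ∧ π w.2 = (r w.1).1} := by
      have h2 : ContinuousOn (fun w : (X × unitInterval) × P => σ x w.1.1)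
          {w | w.1.1 ∈ V x ∧ π w.2 = (r w.1).1} :=
        (hσV x).comp continuousOn_fst fun w hw => hw.1
      have h3 : ContinuousOn (fun w : (X × unitInterval) × P => (R (σ x w.1.1) w.1.2).1)
          {w | w.1.1 ∈ V x ∧ π w.2 = (r w.1).1} :=
        ((hRσ x).comp continuousOn_fst fun w hw => hw.1).fst
      have h4 : ∀ w ∈ {w : (X × unitInterval) × P | w.1.1 ∈ V x ∧ π w.2 = (r w.1).1},
          π (R (σ x w.1.1) w.1.2).1 = π w.2 := by
        rintro ⟨⟨y, s⟩, p'⟩ ⟨hy, hp'⟩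
        have h := congrArg Prod.fst (hrσ (σ x y) s)
        rw [hπσ x y hy] at h
        exact (hp'.trans h).symm
      refine (hπ.continuous_act.comp_continuousOn
        (h2.prodMk (hπ.continuousOn_transl.comp (h3.prodMk continuousOn_snd) h4))).congr ?_
      rintro ⟨z, p'⟩ ⟨hy, hp'⟩
      exact hQ z p' _ (hπσ x z.1 hy) hp'
    refine (h1 _ ⟨hxV x, hp⟩).mono_of_mem_nhdsWithin ?_
    have : {w : (X × unitInterval) × P | w.1.1 ∈ V x} ∈ 𝓝 ((x, t), p) :=
      ((hV x).preimage (continuous_fst.comp continuous_fst)).mem_nhds (hxV x)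
    exact inter_mem (mem_nhdsWithin_of_mem_nhds this) self_mem_nhdsWithin
  · change (π (R (p₀ x) 0).1, (R (p₀ x) 0).2) = _
    rw [hR0, hp₀]
  · change (π (R (p₀ x) t).1, (R (p₀ x) t).2) = _
    rw [hRY _ _ (by rw [hp₀]; exact hx), hp₀]
  · have h1 : R p z.2 = (p, z.2) := by
      rcases hz with hz | hz
      · rw [hz, hR0]
      · exact hRY _ _ (hp ▸ hz)
    have h2 : π p = (r z).1 := by
      have h := congrArg Prod.fst (hrσ p z.2)
      rw [h1, hp] at h
      exact hp.trans h.symm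
    rw [hQ z p p hp h2, h1, hπ.transl_self, MulOpposite.op_one, one_smul]

end BundleRetraction

/-! ### Vanishing of classes, and cylinders made from null-homotopies. -/

section Tools

variable {H : Type w} [NormedAddCommGroup H] [InnerProductSpace ℂ H]
variable {X : Type u} [TopologicalSpace X] {P : Type v} [TopologicalSpace P]
  [MulAction (PUGroup H)ᵐᵒᵖ P] {π : P → X} {T T' T'' : Type u} [TopologicalSpace T]
  [TopologicalSpace T'] [TopologicalSpace T''] {f : C(T, X)} {f' : C(T', X)} {f'' : C(T'', X)}

/-- Two objects with empty support are isomorphic if their twisting parts are. -/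
theorem TVB.iso_of_supp_eq_empty [InfiniteDimensional H] (hπ : IsPrincipalBundle (PUGroup H) π)
    {M N : TVB H π f} (hM : M.supp = ∅) (hN : N.supp = ∅)
    (k : N.twist.ι → M.twist.ι → T → UGroup H)
    (hk : ∀ b a, IsLift (N.twist.U b ∩ M.twist.U a) (N.twist.s b) (M.twist.s a) (k b a)) :
    M.Iso N := by
  have hb : ∀ {M : TVB H π f}, M.supp = ∅ → ∀ a, ∀ x ∈ M.twist.U a,
      Function.Bijective ((M.vect.E a).h x) := fun hM a x hx =>
    (TVB.notMem_supp_iff _ hx).1 (hM ▸ notMem_empty x)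
  -- Since `h` is invertible everywhere, any two maps are `≑`-equal, so the zero maps over the lifts
  -- `k` are an isomorphism.
  have key : ∀ {M N : TVB H π f}, M.supp = ∅ → N.supp = ∅ →
      ∀ k : N.twist.ι → M.twist.ι → T → UGroup H,
      (∀ b a, IsLift (N.twist.U b ∩ M.twist.U a) (N.twist.s b) (M.twist.s a) (k b a)) →
      M.IsMorphism N k fun _ _ _ => 0 := fun {M N} hM hN k hk =>
    { k_cont := fun b a => (hk b a).cont
      k_lift := fun b a => (hk b a).act
      ψ_hom := fun b a => .zero _ _
      comp_source := fun b a a' =>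
        (((hk b a).mono inter_subset_left).mul ((M.twist.isLift a a').mono
          fun x hx => ⟨hx.1.2, hx.2⟩)).pairEqv hπ ((hk b a').mono fun x hx => ⟨hx.1.1, hx.2⟩)
          (HFObj.eqv_of_bijective _ (fun x hx => hx.2) (fun x hx => hb hM a' x hx.2) _ _)
      comp_target := fun b b' a =>
        (((N.twist.isLift b b').mono inter_subset_left).mul ((hk b' a).mono
          fun x hx => ⟨hx.1.2, hx.2⟩)).pairEqv hπ ((hk b a).mono fun x hx => ⟨hx.1.1, hx.2⟩)
          (HFObj.eqv_of_bijective _ (fun x hx => hx.2) (fun x hx => hb hM a x hx.2) _ _) }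
  have hk' : ∀ a b, IsLift (M.twist.U a ∩ N.twist.U b) (M.twist.s a) (N.twist.s b)
      fun x => (k b a x)⁻¹ := fun a b => (hk b a).inv.mono fun x hx => ⟨hx.2, hx.1⟩
  have inv : ∀ {M N : TVB H π f}, M.supp = ∅ → N.supp = ∅ →
      ∀ (k : N.twist.ι → M.twist.ι → T → UGroup H) (k' : M.twist.ι → N.twist.ι → T → UGroup H),
      (∀ b a, IsLift (N.twist.U b ∩ M.twist.U a) (N.twist.s b) (M.twist.s a) (k b a)) →
      (∀ b a, IsLift (M.twist.U b ∩ N.twist.U a) (M.twist.s b) (N.twist.s a) (k' b a)) →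
      M.IsLeftInverse N k (fun _ _ _ => 0) k' fun _ _ _ => 0 :=
    fun {M N} hM hN k k' hk hk' a b a' =>
      (((hk' a b).mono inter_subset_left).mul ((hk b a').mono
        fun x hx => ⟨hx.1.2, hx.2⟩)).pairEqv hπ ((M.twist.isLift a a').mono
        fun x hx => ⟨hx.1.1, hx.2⟩)
        (HFObj.eqv_of_bijective _ (fun x hx => hx.2) (fun x hx => hb hM a' x hx.2) _ _)
  exact ⟨k, _, _, _, key hM hN k hk, key hN hM _ hk', inv hM hN k _ hk hk', inv hN hM _ k hk' hk⟩

/-- Homotopic bundle maps induce the same map. -/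
theorem KF.mk_bpull_slice {S : Set T} {S' : Set T'} (A : RelTVB H π f S)
    (q : C(T' × unitInterval, T)) {Q : T' × unitInterval → P → P}
    (h : IsBundleMap H π f (f'.comp ContinuousMap.fst : C(T' × unitInterval, X)) q Q)
    (hS : ∀ t ∈ S', ∀ i, q (t, i) ∈ S) {q₀ q₁ : C(T', T)} {Q₀ Q₁ : T' → P → P}
    {h₀ : IsBundleMap H π f f' q₀ Q₀} {h₁ : IsBundleMap H π f f' q₁ Q₁} {hS₀ : MapsTo q₀ S' S}
    {hS₁ : MapsTo q₁ S' S} (hq₀ : ∀ t, q (t, 0) = q₀ t) (hQ₀ : ∀ t, Q (t, 0) = Q₀ t)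
    (hq₁ : ∀ t, q (t, 1) = q₁ t) (hQ₁ : ∀ t, Q (t, 1) = Q₁ t) :
    KF.mk (A.bpull q₀ h₀ hS₀) = KF.mk (A.bpull q₁ h₁ hS₁) := by
  obtain rfl : q.comp (slice T' 0) = q₀ := ContinuousMap.ext hq₀
  obtain rfl : (fun t => Q (t, 0)) = Q₀ := funext hQ₀
  obtain rfl : q.comp (slice T' 1) = q₁ := ContinuousMap.ext hq₁
  obtain rfl : (fun t => Q (t, 1)) = Q₁ := funext hQ₁
  exact KF.mk_bpull_eq_of_homotopy A q h hS (TVB.Iso.refl _) (TVB.Iso.refl _)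

theorem KF.mk_bpull_eq_mk_pull {S : Set T} {S' : Set T'} (A : RelTVB H π f S) {q q' : C(T', T)}
    {Q : T' → P → P} (h : IsBundleMap H π f f' q Q) {hS : MapsTo q S' S}
    (hq' : ∀ t, f' t = f (q' t)) {hS' : MapsTo q' S' S} (hqq : ∀ t, q t = q' t)
    (hQ : ∀ t p, π p = f' t → Q t p = p) :
    KF.mk (A.bpull q h hS) = KF.mk (A.pull q' hq' hS') :=
  KF.mk_eq_of_iso (TVB.bpull_iso_pull h hq' hqq hQ A.1)

/-- The null-homotopy of `j^*A` lives over `T'`. As `e` is a section of `j` over `D`, it can be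
pulled back to `D × I` and glued to `A`. The result records a killing of `A` over `D` without
altering `A` on the base. -/
theorem exists_cylinder_of_homotopic {S : Set T} {S' : Set T'} (A : RelTVB H π f S)
    {j : C(T', T)} {hfj : ∀ t, f' t = f (j t)} {hj : MapsTo j S' S} {N : RelTVB H π f' S'}
    (h : (A.pull j hfj hj).Homotopic N) (hN : N.1.supp = ∅) {D : Set T} (e : C(D, T'))
    (hje : ∀ d, j (e d) = d) (heS : ∀ d : D, (d : T) ∈ S → e d ∈ S') :
    ∃ G : TVB H π (f.comp (cylFst T D)), Disjoint G.supp (cylFst T D ⁻¹' S) ∧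
      (∀ p : Cyl T D, p.1.2 = 1 → p ∉ G.supp) ∧
      ∀ (T'' : Type u) [TopologicalSpace T''] (f'' : C(T'', X)) (s : C(T'', Cyl T D))
        (hf : ∀ t, f'' t = f (cylFst T D (s t))), (∀ t, (s t).1.2 = 0) →
        ∀ (c : C(T'', T)) (hfc : ∀ t, f'' t = f (c t)), (∀ t, c t = (s t).1.1) →
        (G.pull s hf).Iso (A.1.pull c hfc) := by
  obtain ⟨C, h0, h1⟩ := h
  have hfe : ∀ d : D, f.comp (subtypeIncl D) d = f' (e d) := fun d => by
    rw [hfj, hje]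
    rfl
  let C' : TVB H π ((f.comp (subtypeIncl D)).comp ContinuousMap.fst : C(D × unitInterval, X)) :=
    C.1.pull (f := f'.comp ContinuousMap.fst) (e.prodMap (ContinuousMap.id unitInterval)) fun d => hfe d.1
  have hC' : (C'.pull (f' := f.comp (subtypeIncl D)) (slice D 0) fun _ => rfl).Iso
      (A.1.pull (subtypeIncl D) fun _ => rfl) := by
    have h2 := h0.pull (f' := f.comp (subtypeIncl D)) e hfe
    have e1 : (A.pull j hfj hj).1.pull (f' := f.comp (subtypeIncl D)) e hfe =
        A.1.pull (subtypeIncl D) fun _ => rfl :=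
      TVB.pull_congr (q := j.comp e) (hq := fun d => (hfe d).trans (hfj _)) A.1 hje
    rw [e1] at h2
    exact h2
  obtain ⟨G, hG1, hG2, hG3⟩ := TVB.exists_cylinder D A.1 C' hC'
  refine ⟨G, hG1 S A.2 ?_, fun p hp hps => ?_, fun T'' _ f'' s hf hs c hfc hc =>
    hG2 T'' f'' s hf hs c hfc hc _ (.refl _)⟩
  · refine disjoint_left.2 fun d hd hdS => disjoint_left.1 C.2 (TVB.supp_pull _ _ _ hd) ?_
    exact ⟨heS d.1 hdS.1, trivial⟩
  · obtain ⟨d, hd⟩ := hG3 p hp hps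
    have h3 : (e d, (1 : unitInterval)) ∈ C.1.supp := TVB.supp_pull _ _ _ hd
    have h4 : slice T' 1 ⁻¹' C.1.supp = ∅ := (TVB.supp_pull_eq (f' := f') (slice T' 1)
      (fun _ => rfl) C.1).symm.trans (h1.supp_eq.trans hN)
    exact eq_empty_iff_forall_notMem.1 h4 (e d) h3

variable [InfiniteDimensional H]

/-- Combines two facts: homotopy is an equivalence relation, and all objects with empty support
represent zero. It turns vanishing of a class into an actual homotopy. -/
theorem KF.mk_eq_zero_iff (hπ : IsPrincipalBundle (PUGroup H) π)
    (τ₀ : Twist H π (ContinuousMap.id X)) {S : Set T} (A : RelTVB H π f S) :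
    KF.mk A = KF.zero hπ τ₀ f S ↔ ∃ N : RelTVB H π f S, N.1.supp = ∅ ∧ A.Homotopic N := by
  constructor
  · intro h
    exact ⟨⟨⟨τ₀.pull f fun _ => rfl, .zero hπ _⟩, by
      rw [TVB.supp, Vectorial.supp_zero]; exact disjoint_bot_left⟩,
      Vectorial.supp_zero hπ _, KF.mk_eq_iff.1 h⟩
  · rintro ⟨N, hN, h⟩
    exact (KF.mk_eq_iff.2 h).trans (KF.mk_eq_zero hπ τ₀ N hN)

end Tools

/-! ### Exactness at `KF^{-n}(X)`, and the kernel of the map that forgets `Y`. -/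

section ExactSequence

variable {H : Type w} [NormedAddCommGroup H] [InnerProductSpace ℂ H]
variable {X : Type u} [TopologicalSpace X] {P : Type v} [TopologicalSpace P]
  [MulAction (PUGroup H)ᵐᵒᵖ P] {π : P → X} {n : ℕ} {Y : Set X}

variable (H π Y) in
/-- A retraction of `X × I` onto `X × {0} ∪ Y × I`, covered by a bundle map. -/
structure BundleRetraction where
  r : C(X × unitInterval, X × unitInterval)
  Q : X × unitInterval → P → P
  isBundleMap : IsBundleMap H π (ContinuousMap.id X)
    (ContinuousMap.fst : C(X × unitInterval, X)) (fun z => (r z).1) Q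
  apply_zero : ∀ x, r (x, 0) = (x, 0)
  apply_mem : ∀ x t, x ∈ Y → r (x, t) = (x, t)
  mem : ∀ z, (r z).2 = 0 ∨ (r z).1 ∈ Y
  eq_self : ∀ z p, z.2 = 0 ∨ z.1 ∈ Y → π p = z.1 → Q z p = p

variable [InfiniteDimensional H]

/-- Exactness at `KF^{-n}(X)`. -/
theorem restrictTo_eq_zero_iff (hπ : IsPrincipalBundle (PUGroup H) π)
    (τ₀ : Twist H π (ContinuousMap.id X)) (R : BundleRetraction H π Y)
    (y : KFn H π n (ContinuousMap.id X) ∅) :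
    restrictTo H π n Y y = KF.zero hπ τ₀ _ _ ↔ y ∈ range (forget H π n Y) := by
  constructor
  · obtain ⟨A, rfl⟩ := Quot.exists_rep y
    intro hy
    obtain ⟨N, hN, hAN⟩ := (KF.mk_eq_zero_iff hπ τ₀ _).1 hy
    let D : Set (X × Cb n) := {z | z.1 ∈ Y}
    -- `G` is `A` on `X × I^n` and the null-homotopy over `Y × I^n`, placed on the mapping cylinder
    -- of the inclusion.
    obtain ⟨G, hG1, hG2, hG3⟩ := exists_cylinder_of_homotopic A hAN hN (D := D)
      ⟨fun d => (⟨d.1.1, d.2⟩, d.1.2), by fun_prop⟩ (fun d => rfl)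
      fun d hd => hd.imp (fun h => h.1.elim) fun h => ⟨trivial, h.2⟩
    let S : Set (X × Cb n) := ∅ ×ˢ univ ∪ univ ×ˢ Cube.boundary (Fin n)
    -- The retraction of `X × I` lands in `X × {0} ∪ Y × I`, which with the factor `I^n` is the
    -- cylinder. It is a homotopy from the inclusion of the base to a map that sends `Y × I^n` to
    -- the top.
    let q : C((X × Cb n) × unitInterval, Cyl (X × Cb n) D) :=
      ⟨fun z => ⟨(((R.r (z.1.1, z.2)).1, z.1.2), (R.r (z.1.1, z.2)).2), R.mem _⟩, by fun_prop⟩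
    have hq : IsBundleMap H π
        ((((ContinuousMap.id X).comp ContinuousMap.fst : C(X × Cb n, X))).comp
          (cylFst (X × Cb n) D))
        ((((ContinuousMap.id X).comp ContinuousMap.fst : C(X × Cb n, X))).comp
          ContinuousMap.fst : C((X × Cb n) × unitInterval, X)) q
        fun z => R.Q (z.1.1, z.2) := by
      have h := R.isBundleMap.comp (s := fun z : (X × Cb n) × unitInterval => (z.1.1, z.2))
        (f'' := ((((ContinuousMap.id X).comp ContinuousMap.fst : C(X × Cb n, X))).comp
          ContinuousMap.fst : C((X × Cb n) × unitInterval, X))) (by fun_prop) fun _ => rfl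
      exact ⟨h.proj, h.act, h.cont⟩
    let G' : RelTVB H π ((((ContinuousMap.id X).comp ContinuousMap.fst : C(X × Cb n, X))).comp
          (cylFst (X × Cb n) D)) (cylFst _ D ⁻¹' S) := ⟨G, hG1⟩
    let q₀ : C(X × Cb n, Cyl (X × Cb n) D) := ⟨fun z => ⟨(z, 0), Or.inl rfl⟩, by fun_prop⟩
    have hq1 := hq.comp (f'' := ((ContinuousMap.id X).comp ContinuousMap.fst : C(X × Cb n, X)))
      (s := fun z => (z, 1)) (by fun_prop) fun _ => rfl
    have hq0 := hq.comp (f'' := ((ContinuousMap.id X).comp ContinuousMap.fst : C(X × Cb n, X)))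
      (s := fun z => (z, 0)) (by fun_prop) fun _ => rfl
    have hq00 : ∀ z : X × Cb n, q (z, 0) = q₀ z := fun z => by
      refine Subtype.ext ?_
      change (((R.r (z.1, 0)).1, z.2), (R.r (z.1, 0)).2) = (z, 0)
      rw [R.apply_zero]
    have hS : ∀ t ∈ S, ∀ i, q (t, i) ∈ cylFst _ D ⁻¹' S := fun t ht i =>
      ht.imp (fun h => h.1.elim) fun h => ⟨trivial, h.2⟩
    -- The required preimage. Over `Y` the map at time `1` lands on the top of the cylinder, where
    -- `G` has no support; over `∂I^n` it stays in the relative part.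
    let B : KFn H π n (ContinuousMap.id X) Y := KF.mk ⟨G.bpull (q.comp (slice _ 1)) hq1, by
      refine disjoint_left.2 fun z hz hzS => ?_
      replace hz : q (z, 1) ∈ G.supp := (TVB.supp_bpull (q.comp (slice _ 1)) hq1 G).le hz
      rcases hzS with hzS | hzS
      · refine hG2 _ ?_ hz
        change (R.r (z.1, 1)).2 = 1
        rw [R.apply_mem _ _ hzS.1]
      · exact disjoint_left.1 hG1 hz (Or.inr ⟨trivial, hzS.2⟩)⟩
    refine ⟨B, ?_⟩
    have e1 : KF.mk (G'.bpull (q.comp (slice _ 0)) hq0 (S' := S) fun t ht => hS t ht 0) =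
        KF.mk (G'.bpull (q.comp (slice _ 1)) hq1 fun t ht => hS t ht 1) :=
      KF.mk_bpull_slice G' q hq hS (fun _ => rfl) (fun _ => rfl) (fun _ => rfl) fun _ => rfl
    have e2 : KF.mk (G'.bpull (q.comp (slice _ 0)) hq0 (S' := S) fun t ht => hS t ht 0) =
        KF.mk (G'.pull q₀ (fun _ => rfl) fun t ht => by
          rw [← hq00]
          exact hS t ht 0) :=
      KF.mk_bpull_eq_mk_pull G' hq0 _ hq00 fun z p hp => R.eq_self _ _ (Or.inl rfl) hp
    have e3 : KF.mk (G'.pull q₀ (fun _ => rfl) fun t ht => by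
          rw [← hq00]
          exact hS t ht 0) = KF.mk (A.pull (f' := (ContinuousMap.id X).comp ContinuousMap.fst)
            (ContinuousMap.id _) (fun _ => rfl) fun t ht => ht) :=
      KF.mk_eq_of_iso (hG3 _ _ q₀ (fun _ => rfl) (fun _ => rfl) (ContinuousMap.id _)
        (fun _ => rfl) fun _ => rfl)
    exact e1.symm.trans (e2.trans e3)
  · rintro ⟨z, rfl⟩
    obtain ⟨A, rfl⟩ := Quot.exists_rep z
    refine KF.mk_eq_zero hπ τ₀ _ (eq_empty_of_forall_notMem fun t ht => ?_)
    have h := TVB.supp_pull _ _ _ (TVB.supp_pull _ _ _ ht)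
    exact disjoint_left.1 A.2 h (Or.inl ⟨t.1.2, trivial⟩)

/-- The inclusion of `X × I^n × {0}`. -/
def hatZero (n : ℕ) (Y : Set X) : C(X × Cb n, Hat n Y) :=
  ⟨fun z => ⟨(z, 0), Or.inl rfl⟩, by fun_prop⟩

theorem mapsTo_hatZero : MapsTo (hatZero n Y) (∅ ×ˢ univ ∪ univ ×ˢ Cube.boundary (Fin n))
    (hatSmall n Y) := fun z hz => Or.inr (hz.resolve_left fun h => h.1.elim).2

/-- The homotopy over the mapping cylinder of `X × I^n × {0}` in `Hat n Y`. -/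
def hatPush (n : ℕ) (Y : Set X) :
    C(Hat n Y × unitInterval, Cyl (Hat n Y) {h | h.1.2 = 0}) :=
  -- With `s` the height and `u = s - τ (1 - s)`, the positive part of `u` is the new height and the
  -- negative part is the depth in the cylinder attached below the bottom. At `τ = 0` nothing moves;
  -- at `τ = 1`, `u = 2 s - 1` stretches `[0, 1]` over `[-1, 1]`. The top `s = 1` is fixed
  -- throughout.
  ⟨fun z => ⟨(⟨(z.1.1.1, clamp (z.1.1.2 - z.2 * (1 - z.1.1.2))), by
      rcases z.1.2 with h | h
      · refine Or.inl (clamp_of_le ?_)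
        rw [h, Icc.coe_zero, sub_zero, mul_one, zero_sub]
        exact neg_nonpos.2 z.2.2.1
      · exact Or.inr h⟩, clamp (-(z.1.1.2 - z.2 * (1 - z.1.1.2)))), by
      rcases le_total 0 ((z.1.1.2 : ℝ) - z.2 * (1 - z.1.1.2)) with h | h
      · exact Or.inl (clamp_of_le (neg_nonpos.2 h))
      · exact Or.inr (clamp_of_le h)⟩, by
    have h1 : Continuous fun z : Hat n Y × unitInterval =>
        clamp (z.1.1.2 - z.2 * (1 - z.1.1.2)) := continuous_clamp.comp (by fun_prop)
    have h2 : Continuous fun z : Hat n Y × unitInterval =>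
        clamp (-(z.1.1.2 - z.2 * (1 - z.1.1.2))) := continuous_clamp.comp (by fun_prop)
    fun_prop⟩

/-- A null-homotopy over `X × I^n` is attached below the bottom of `Hat n Y`, and stretching the
heights over both parts deforms `p^*A` to an object without support on the bottom. Conversely,
restriction to the bottom recovers the class with `Y` forgotten, and it is zero for objects relative
to `hatLarge`. -/
theorem forget_eq_zero_iff (hπ : IsPrincipalBundle (PUGroup H) π)
    (τ₀ : Twist H π (ContinuousMap.id X)) (y : KFn H π n (ContinuousMap.id X) Y) :
    forget H π n Y y = KF.zero hπ τ₀ _ _ ↔ ∃ x, hatForget H π n Y x = hatPull H π n Y y := by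
  constructor
  · obtain ⟨A, rfl⟩ := Quot.exists_rep y
    intro hy
    obtain ⟨N, hN, hAN⟩ := (KF.mk_eq_zero_iff hπ τ₀ _).1 hy
    let A' : RelTVB H π (hatProj n Y) (hatSmall n Y) := A.pull (hatFst n Y) (fun _ => rfl)
      fun t ht => by
        rcases ht with ht | ht
        · exact Or.inl ⟨ht.1, trivial⟩
        · exact Or.inr ⟨trivial, ht⟩
    obtain ⟨G, hG1, hG2, hG3⟩ := exists_cylinder_of_homotopic A' (j := hatZero n Y)
      (hfj := fun _ => rfl) (hj := mapsTo_hatZero) hAN hN (D := {h | h.1.2 = 0})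
      ⟨fun d => d.1.1.1, by fun_prop⟩ (fun d => Subtype.ext (Prod.ext rfl d.2.symm))
      fun d hd => by
        rcases hd with hd | hd
        · exact absurd (d.2.symm.trans hd.2) zero_ne_one
        · exact Or.inr ⟨trivial, hd⟩
    let G' : RelTVB H π ((hatProj n Y).comp (cylFst (Hat n Y) {h | h.1.2 = 0}))
      (cylFst _ _ ⁻¹' hatSmall n Y) := ⟨G, hG1⟩
    have hS : ∀ h ∈ hatSmall n Y, ∀ i, hatPush n Y (h, i) ∈ cylFst _ _ ⁻¹' hatSmall n Y := by
      rintro h hh i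
      rcases hh with hh | hh
      · refine Or.inl ⟨hh.1, ?_⟩
        change clamp _ = 1
        rw [hh.2, Icc.coe_one, sub_self, mul_zero, sub_zero]
        exact clamp_of_ge le_rfl
      · exact Or.inr hh
    let q₁ : C(Hat n Y, Cyl (Hat n Y) {h | h.1.2 = 0}) := (hatPush n Y).comp (slice _ 1)
    let q₀ : C(Hat n Y, Cyl (Hat n Y) {h | h.1.2 = 0}) := (hatPush n Y).comp (slice _ 0)
    have hq₀ : ∀ h, q₀ h = ⟨(h, 0), Or.inl rfl⟩ := fun h => by
      refine Subtype.ext (Prod.ext (Subtype.ext (Prod.ext rfl ?_)) ?_)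
      · change clamp ((h.1.2 : ℝ) - ((0 : unitInterval) : ℝ) * (1 - h.1.2)) = h.1.2
        rw [Icc.coe_zero, zero_mul, sub_zero, clamp_coe]
      · change clamp (-((h.1.2 : ℝ) - ((0 : unitInterval) : ℝ) * (1 - h.1.2))) = 0
        rw [Icc.coe_zero, zero_mul, sub_zero]
        exact clamp_of_le (neg_nonpos.2 h.1.2.2.1)
    refine ⟨KF.mk ⟨G.pull (f' := hatProj n Y) q₁ fun _ => rfl, ?_⟩, ?_⟩
    · refine disjoint_left.2 fun h hh hhS => ?_
      have hh := TVB.supp_pull _ _ _ hh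
      rcases hhS with hhS | hhS
      · refine hG2 (q₁ h) ?_ hh
        have h0 : h.1.2 = 0 := hhS
        change clamp (-((h.1.2 : ℝ) - ((1 : unitInterval) : ℝ) * (1 - h.1.2))) = 1
        rw [h0, Icc.coe_one, Icc.coe_zero]
        exact clamp_of_ge (by norm_num)
      · exact disjoint_left.1 hG1 hh (hS h hhS 1)
    · have e1 : KF.mk (G'.pull (f' := hatProj n Y) q₀ (fun _ => rfl) (S' := hatSmall n Y)
          fun h hh => hS h hh 0) = KF.mk (G'.pull q₁ (fun _ => rfl) fun h hh => hS h hh 1) :=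
        KF.mk_pull_eq_of_homotopy G' (hatPush n Y) (fun _ => rfl) hS (fun _ => rfl) fun _ => rfl
      have e2 : KF.mk (G'.pull (f' := hatProj n Y) q₀ (fun _ => rfl) (S' := hatSmall n Y)
          fun h hh => hS h hh 0) = KF.mk (A'.pull (ContinuousMap.id _) (fun _ => rfl)
            fun h hh => hh) :=
        KF.mk_eq_of_iso (hG3 _ _ q₀ (fun _ => rfl) (fun h => by rw [hq₀]) (ContinuousMap.id _)
          (fun _ => rfl) fun h => by rw [hq₀]; rfl)
      exact e1.symm.trans e2
  · rintro ⟨x, hx⟩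
    obtain ⟨A, rfl⟩ := Quot.exists_rep y
    obtain ⟨B, rfl⟩ := Quot.exists_rep x
    have h := congrArg (KF.pull (f' := (ContinuousMap.id X).comp ContinuousMap.fst)
      (hatZero n Y) (fun _ => rfl) mapsTo_hatZero) hx
    refine Eq.trans (Eq.trans ?_ h.symm) (KF.mk_eq_zero hπ τ₀ (RelTVB.pull (hatZero n Y)
      (fun _ => rfl) mapsTo_hatZero (RelTVB.pull (ContinuousMap.id _) (fun _ => rfl)
        (fun _ ht => Or.inr ht) B)) ?_)
    · rfl
    · refine eq_empty_of_forall_notMem fun t ht => ?_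
      exact disjoint_left.1 B.2 (TVB.supp_pull _ _ _ (TVB.supp_pull _ _ _ ht)) (Or.inl rfl)

end ExactSequence

/-! ### Injectivity of the excision map. -/

section Excision

/-- The point of `I^{n+1}` with the coordinates of `v` and the last coordinate `t`. -/
def cubeSnoc {n : ℕ} (v : Cb n) (t : unitInterval) : Cb (n + 1) :=
  Fin.snoc (α := fun _ => unitInterval) v t

theorem cubeSnoc_castSucc {n : ℕ} (v : Cb n) (t : unitInterval) (i : Fin n) :
    cubeSnoc v t i.castSucc = v i := Fin.snoc_castSucc (α := fun _ => unitInterval) t v i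

theorem cubeSnoc_last {n : ℕ} (v : Cb n) (t : unitInterval) :
    cubeSnoc v t (Fin.last n) = t := Fin.snoc_last (α := fun _ => unitInterval) t v

@[fun_prop]
theorem _root_.Continuous.cubeSnoc {T : Type*} [TopologicalSpace T] {n : ℕ} {v : T → Cb n}
    {t : T → unitInterval} (hv : Continuous v) (ht : Continuous t) :
    Continuous fun x => cubeSnoc (v x) (t x) :=
  Continuous.finSnoc (A := fun _ => unitInterval) hv ht

theorem cubeSnoc_mem_boundary_iff {n : ℕ} {v : Cb n} {t : unitInterval} :
    cubeSnoc v t ∈ Cube.boundary (Fin (n + 1)) ↔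
      (t = 0 ∨ t = 1) ∨ v ∈ Cube.boundary (Fin n) := by
  change (∃ i, _) ↔ _ ∨ ∃ i, _
  rw [Fin.exists_fin_succ']
  simp only [cubeSnoc_castSucc, cubeSnoc_last]
  exact or_comm

/-- The expansion of the unit interval about its midpoint. -/
def spread (s a : unitInterval) : unitInterval := clamp (a + s * (a - 1 / 2))

theorem continuous_spread : Continuous fun z : unitInterval × unitInterval => spread z.1 z.2 :=
  continuous_clamp.comp (by fun_prop)

@[fun_prop]
theorem _root_.Continuous.spread {T : Type*} [TopologicalSpace T] {g g' : T → unitInterval}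
    (hg : Continuous g) (hg' : Continuous g') : Continuous fun t => spread (g t) (g' t) :=
  continuous_spread.comp (hg.prodMk hg')

theorem spread_zero_right (s : unitInterval) : spread s 0 = 0 := clamp_of_le (by
  have := s.2.1
  rw [Icc.coe_zero]
  linarith)

theorem spread_one_right (s : unitInterval) : spread s 1 = 1 := clamp_of_ge (by
  have := s.2.1
  rw [Icc.coe_one]
  linarith)

theorem spread_zero_left (a : unitInterval) : spread 0 a = a := by
  rw [spread, Icc.coe_zero, zero_mul, add_zero, clamp_coe]

theorem spread_one_left_of_le {a : unitInterval} (ha : (a : ℝ) ≤ 1 / 4) : spread 1 a = 0 :=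
  clamp_of_le (by rw [Icc.coe_one]; linarith)

theorem spread_one_left_of_ge {a : unitInterval} (ha : 3 / 4 ≤ (a : ℝ)) : spread 1 a = 1 :=
  clamp_of_ge (by rw [Icc.coe_one]; linarith)

/-- A function on the unit interval that vanishes at the ends. -/
def bump (a : unitInterval) : unitInterval := clamp (4 * min (a : ℝ) (1 - a))

@[fun_prop]
theorem continuous_bump : Continuous bump := continuous_clamp.comp (by fun_prop)

theorem bump_zero : bump 0 = 0 := clamp_of_le (by simp)

theorem bump_one : bump 1 = 0 := clamp_of_le (by simp)

theorem bump_of_mem {a : unitInterval} (h : 1 / 4 ≤ (a : ℝ)) (h' : (a : ℝ) ≤ 3 / 4) :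
    bump a = 1 :=
  clamp_of_ge (by
    have : 1 / 4 ≤ min (a : ℝ) (1 - a) := le_min h (by linarith)
    linarith)

theorem spread_mem_boundary {n : ℕ} (s : unitInterval) {v : Cb n}
    (hv : v ∈ Cube.boundary (Fin n)) : (fun i => spread s (v i)) ∈ Cube.boundary (Fin n) := by
  obtain ⟨i, hi⟩ := hv
  refine ⟨i, hi.imp (fun h => ?_) fun h => ?_⟩
  · change spread s (v i) = 0
    rw [h, spread_zero_right]
  · change spread s (v i) = 1
    rw [h, spread_one_right]

variable {H : Type w} [NormedAddCommGroup H] [InnerProductSpace ℂ H]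
variable {X : Type u} [TopologicalSpace X] {P : Type v} [TopologicalSpace P]
  [MulAction (PUGroup H)ᵐᵒᵖ P] {π : P → X} {n : ℕ} {Y : Set X}

/-- The expansion of the cubes in `Hat n Y`. -/
def hatSpread (n : ℕ) (Y : Set X) : C(Hat n Y × unitInterval, Hat n Y) :=
  ⟨fun z => ⟨((z.1.1.1.1, fun i => spread z.2 (z.1.1.1.2 i)), spread z.2 z.1.1.2), by
    rcases z.1.2 with h | h | h
    · exact Or.inl (by rw [h, spread_zero_right])
    · exact Or.inr (Or.inl h)
    · exact Or.inr (Or.inr (spread_mem_boundary _ h))⟩, by fun_prop⟩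

theorem hatSpread_mem_hatLarge {h : Hat n Y} (hh : h ∈ hatLarge n Y) (s : unitInterval) :
    hatSpread n Y (h, s) ∈ hatLarge n Y := by
  rcases hh with hh | hh | hh
  · have h0 : h.1.2 = 0 := hh
    refine Or.inl ?_
    change spread s h.1.2 = 0
    rw [h0, spread_zero_right]
  · refine Or.inr (Or.inl ⟨hh.1, ?_⟩)
    change spread s h.1.2 = 1
    rw [hh.2, spread_one_right]
  · exact Or.inr (Or.inr (spread_mem_boundary _ hh))

theorem hatSpread_zero (h : Hat n Y) : hatSpread n Y (h, 0) = h :=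
  Subtype.ext (Prod.ext (Prod.ext rfl (funext fun _ => spread_zero_left _)) (spread_zero_left _))

/-- The weight of a point of `Hat n Y`: zero unless the point is interior to the cube over a point
of `Y`. -/
def hatWeight (n : ℕ) (Y : Set X) : C(Hat n Y, unitInterval) :=
  ⟨fun h => bump h.1.2 * ∏ i, bump (h.1.1.2 i), by fun_prop⟩

theorem hatWeight_eq_zero {h : Hat n Y} (hh : h.1.1.1 ∉ Y) : hatWeight n Y h = 0 := by
  change bump h.1.2 * ∏ i, bump (h.1.1.2 i) = 0
  rcases h.2 with h0 | h0 | ⟨i, hi⟩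
  · rw [h0, bump_zero, zero_mul]
  · exact absurd h0 hh
  · rw [Finset.prod_eq_zero (Finset.mem_univ i), mul_zero]
    rcases hi with hi | hi
    · rw [hi, bump_zero]
    · rw [hi, bump_one]

/-- The thresholds match: full expansion sends coordinates outside `[1/4, 3/4]` to an end of the
interval, and the weight is `1` when all coordinates lie in `[1/4, 3/4]`. A point over the
complement of `Y` always lands in `hatLarge`, since its height is `0` or it lies over `∂I^n`. -/
theorem hatSpread_one_mem_or (h : Hat n Y) :
    hatSpread n Y (h, 1) ∈ hatLarge n Y ∨ hatWeight n Y h = 1 := by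
  by_cases hv : ∀ i, 1 / 4 ≤ (h.1.1.2 i : ℝ) ∧ (h.1.1.2 i : ℝ) ≤ 3 / 4
  · rcases le_or_gt (1 / 4) (h.1.2 : ℝ) with ht | ht
    · rcases le_or_gt (h.1.2 : ℝ) (3 / 4) with ht' | ht'
      · refine Or.inr ?_
        change bump h.1.2 * ∏ i, bump (h.1.1.2 i) = 1
        rw [bump_of_mem ht ht', Finset.prod_eq_one fun i _ => bump_of_mem (hv i).1 (hv i).2,
          mul_one]
      · refine Or.inl ?_
        rcases h.2 with h0 | h0 | h0
        · rw [h0, Icc.coe_zero] at ht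
          norm_num at ht
        · exact Or.inr (Or.inl ⟨h0, spread_one_left_of_ge ht'.le⟩)
        · exact Or.inr (Or.inr (spread_mem_boundary _ h0))
    · exact Or.inl (Or.inl (spread_one_left_of_le ht.le))
  · push Not at hv
    obtain ⟨i, hi⟩ := hv
    refine Or.inl (Or.inr (Or.inr ⟨i, ?_⟩))
    rcases lt_or_ge (h.1.1.2 i : ℝ) (1 / 4) with h1 | h1
    · exact Or.inl (spread_one_left_of_le h1.le)
    · exact Or.inr (spread_one_left_of_ge (hi h1).le)

variable [InfiniteDimensional H]

/-- The null-homotopy over `Y × I^{n+1}` is attached as a cylinder over the part of `Hat n Y` above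
`Y`. It is entered to a depth given by `hatWeight`, which vanishes away from `Y`, while the cubes
are expanded. In the end each point is in the relative part or at the top of the cylinder, so the
support is empty. -/
theorem excision_eq_zero (hπ : IsPrincipalBundle (PUGroup H) π)
    (τ₀ : Twist H π (ContinuousMap.id X)) (x : KF H π (hatProj n Y) (hatLarge n Y))
    (hx : excision H π n Y x = KF.zero hπ τ₀ _ _) : x = KF.zero hπ τ₀ _ _ := by
  obtain ⟨A, rfl⟩ := Quot.exists_rep x
  obtain ⟨N, hN, hAN⟩ := (KF.mk_eq_zero_iff hπ τ₀ _).1 hx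
  let D : Set (Hat n Y) := {h | h.1.1.1 ∈ Y}
  obtain ⟨G, hG1, hG2, hG3⟩ := exists_cylinder_of_homotopic A hAN hN (D := D)
    ⟨fun d => (⟨d.1.1.1.1, d.2⟩, cubeSnoc d.1.1.1.2 d.1.1.2), by fun_prop⟩
    (fun d => Subtype.ext (Prod.ext (Prod.ext rfl (funext fun i => cubeSnoc_castSucc ..))
      (cubeSnoc_last ..)))
    fun d hd => by
      refine Or.inr ⟨trivial, cubeSnoc_mem_boundary_iff.2 ?_⟩
      rcases hd with hd | hd | hd
      · exact Or.inl (Or.inl hd)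
      · exact Or.inl (Or.inr hd.2)
      · exact Or.inr hd
  let G' : RelTVB H π ((hatProj n Y).comp (cylFst (Hat n Y) D))
    (cylFst _ _ ⁻¹' hatLarge n Y) := ⟨G, hG1⟩
  -- Off `Y` there is no cylinder to enter; the vanishing of the weight there makes the map well
  -- defined.
  let q : C(Hat n Y × unitInterval, Cyl (Hat n Y) D) :=
    ⟨fun z => ⟨(hatSpread n Y z, z.2 * hatWeight n Y z.1), by
      by_cases hz : z.1.1.1.1 ∈ Y
      · exact Or.inr hz
      · exact Or.inl (by change z.2 * hatWeight n Y z.1 = 0; rw [hatWeight_eq_zero hz, mul_zero])⟩,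
      by fun_prop⟩
  have hS : ∀ h ∈ hatLarge n Y, ∀ i, q (h, i) ∈ cylFst _ _ ⁻¹' hatLarge n Y := fun h hh i =>
    hatSpread_mem_hatLarge hh i
  let q₁ : C(Hat n Y, Cyl (Hat n Y) D) := q.comp (slice _ 1)
  let q₀ : C(Hat n Y, Cyl (Hat n Y) D) := q.comp (slice _ 0)
  have hq₀ : ∀ h, q₀ h = ⟨(h, 0), Or.inl rfl⟩ := fun h =>
    Subtype.ext (Prod.ext (hatSpread_zero h) (zero_mul (hatWeight n Y h)))
  have e1 : KF.mk (G'.pull (f' := hatProj n Y) q₀ (fun _ => rfl) (S' := hatLarge n Y)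
      fun h hh => hS h hh 0) = KF.mk (G'.pull q₁ (fun _ => rfl) fun h hh => hS h hh 1) :=
    KF.mk_pull_eq_of_homotopy G' q (fun _ => rfl) hS (fun _ => rfl) fun _ => rfl
  have e2 : KF.mk (G'.pull (f' := hatProj n Y) q₀ (fun _ => rfl) (S' := hatLarge n Y)
      fun h hh => hS h hh 0) = KF.mk A :=
    KF.mk_eq_of_iso (hG3 _ _ q₀ (fun _ => rfl) (fun h => by rw [hq₀]) (ContinuousMap.id _)
      (fun _ => rfl) fun h => by rw [hq₀]; rfl)
  refine e2.symm.trans (e1.trans (KF.mk_eq_zero hπ τ₀ _ (eq_empty_of_forall_notMem fun h hh => ?_)))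
  replace hh : q₁ h ∈ G.supp := TVB.supp_pull _ _ _ hh
  rcases hatSpread_one_mem_or h with h1 | h1
  · exact disjoint_left.1 hG1 hh h1
  · refine hG2 _ ?_ hh
    change 1 * hatWeight n Y h = 1
    rw [h1, one_mul]

end Excision

/-! ### Surjectivity of the excision map. -/

section ExcisionSurjective

variable {H : Type w} [NormedAddCommGroup H] [InnerProductSpace ℂ H]
variable {X : Type u} [TopologicalSpace X] {P : Type v} [TopologicalSpace P]
  [MulAction (PUGroup H)ᵐᵒᵖ P] {π : P → X} {n : ℕ} {Y : Set X}

theorem IsLift.comp {T T' : Type u} [TopologicalSpace T] [TopologicalSpace T'] {V : Set T}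
    {s s' : T → P} {g : T → UGroup H} (h : IsLift V s s' g) {q : T' → T} (hq : Continuous q) :
    IsLift (q ⁻¹' V) (fun t => s (q t)) (fun t => s' (q t)) fun t => g (q t) :=
  ⟨h.cont.comp hq.continuousOn fun _ ht => ht, fun t ht => h.act (q t) ht⟩

/-- The cube coordinates of a point of `Hat n Y`. -/
def hatCoord (h : Hat n Y) : Cb (n + 1) := cubeSnoc h.1.1.2 h.1.2

@[fun_prop]
theorem continuous_hatCoord : Continuous (hatCoord (n := n) (Y := Y)) := by
  unfold hatCoord
  fun_prop

theorem hatCoord_hatIncl (t : Y × Cb (n + 1)) : hatCoord (hatIncl n Y t) = t.2 := by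
  funext i
  induction i using Fin.lastCases with
  | last => exact cubeSnoc_last ..
  | cast i => exact cubeSnoc_castSucc ..

theorem mem_of_hatCoord_notMem {h : Hat n Y} (hh : hatCoord h ∉ Cube.boundary (Fin (n + 1))) :
    h.1.1.1 ∈ Y := by
  rw [hatCoord, cubeSnoc_mem_boundary_iff] at hh
  rcases h.2 with h0 | h0 | h0
  · exact absurd (Or.inl (Or.inl h0)) hh
  · exact h0
  · exact absurd (Or.inr h0) hh

theorem hatCoord_mem_of_mem_hatLarge {h : Hat n Y} (hh : h ∈ hatLarge n Y) :
    hatCoord h ∈ Cube.boundary (Fin (n + 1)) := by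
  refine cubeSnoc_mem_boundary_iff.2 ?_
  rcases hh with hh | hh | hh
  · exact Or.inl (Or.inl hh)
  · exact Or.inl (Or.inr hh.2)
  · exact Or.inr hh

/-- The contraction of the unit interval to its middle fifth. -/
def shrink (s a : unitInterval) : unitInterval :=
  ⟨(1 - s) * a + s * (2 / 5 + 1 / 5 * a), by
    have h1 := s.2.1
    have h2 := s.2.2
    have h3 := a.2.1
    have h4 := a.2.2
    constructor
    · have := mul_nonneg (sub_nonneg.2 h2) h3
      positivity
    · nlinarith⟩

@[fun_prop]
theorem _root_.Continuous.shrink {T : Type*} [TopologicalSpace T] {g g' : T → unitInterval}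
    (hg : Continuous g) (hg' : Continuous g') : Continuous fun t => shrink (g t) (g' t) :=
  Continuous.subtype_mk (by fun_prop) _

theorem shrink_zero_right_le (s : unitInterval) : (shrink s 0 : ℝ) ≤ 2 / 5 := by
  change (1 - (s : ℝ)) * ((0 : unitInterval) : ℝ) + s * (2 / 5 + 1 / 5 * ((0 : unitInterval) : ℝ)) ≤ _
  have := s.2.2
  rw [Icc.coe_zero]
  linarith

theorem le_shrink_one_right (s : unitInterval) : 3 / 5 ≤ (shrink s 1 : ℝ) := by
  change _ ≤ (1 - (s : ℝ)) * ((1 : unitInterval) : ℝ) + s * (2 / 5 + 1 / 5 * ((1 : unitInterval) : ℝ))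
  have := s.2.2
  rw [Icc.coe_one]
  linarith

theorem shrink_zero_left (a : unitInterval) : shrink 0 a = a := Subtype.ext (by
  change (1 - ((0 : unitInterval) : ℝ)) * a + ((0 : unitInterval) : ℝ) * _ = a
  rw [Icc.coe_zero]
  ring)

theorem coe_shrink_one_left (a : unitInterval) : (shrink 1 a : ℝ) = 2 / 5 + 1 / 5 * a := by
  change (1 - ((1 : unitInterval) : ℝ)) * a + ((1 : unitInterval) : ℝ) * _ = _
  rw [Icc.coe_one]
  ring

variable [InfiniteDimensional H]

/-- The object is compressed into the middle fifth of every coordinate. Points with all coordinates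
strictly inside the cube form an open subset of `Hat n Y` lying over `Y`, so the compressed object
lives there and can be glued to the zero object elsewhere. Undoing the compression is a homotopy. -/
theorem excision_surjective (hπ : IsPrincipalBundle (PUGroup H) π)
    (τ₀ : Twist H π (ContinuousMap.id X)) : Function.Surjective (excision H π n Y) := by
  intro y
  let f₂ : C(Y × Cb (n + 1), X) := (incl Y).comp ContinuousMap.fst
  rcases isEmpty_or_nonempty Y with hY | ⟨⟨y₀⟩⟩
  · obtain ⟨B, rfl⟩ := Quot.exists_rep y
    exact ⟨KF.zero hπ τ₀ _ _, KF.mk_eq_of_iso (TVB.iso_of_isEmpty _ _)⟩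
  classical
  -- The twisting part is taken to refine the pull-back of `τ₀`, which carries the zero object; the
  -- refinement supplies the lifts needed for gluing on the overlap.
  obtain ⟨τ, A, hA, r, rfl⟩ := KF.exists_rep hπ y (τ₀.pull f₂ fun _ => rfl)
  let B : TVB H π f₂ := ⟨τ, A⟩
  let Z : TVB H π (hatProj n Y) := ⟨τ₀.pull (hatProj n Y) fun _ => rfl, .zero hπ _⟩
  have hZ : Z.supp = ∅ := Vectorial.supp_zero hπ _
  -- Sends the middle fifth `[2/5, 3/5]` onto the unit interval and collapses the rest to the ends.
  let κ : unitInterval → unitInterval := fun a => clamp (5 * a - 2)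
  have hκ : Continuous κ := continuous_clamp.comp (by fun_prop)
  let q₂ : Hat n Y → Y × Cb (n + 1) := fun h =>
    (if hh : h.1.1.1 ∈ Y then ⟨h.1.1.1, hh⟩ else y₀, fun i => κ (hatCoord h i))
  let V₂ : Set (Hat n Y) := {h | ∀ i, 0 < (hatCoord h i : ℝ) ∧ (hatCoord h i : ℝ) < 1}
  have hV₂ : ∀ h ∈ V₂, h.1.1.1 ∈ Y := fun h hh => mem_of_hatCoord_notMem fun ⟨i, hi⟩ => by
    rcases hi with hi | hi
    · exact (hh i).1.ne' (congrArg Subtype.val hi)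
    · exact (hh i).2.ne (congrArg Subtype.val hi)
  have hq₂ : ∀ h, ∀ hh : h.1.1.1 ∈ Y, q₂ h = (⟨h.1.1.1, hh⟩, fun i => κ (hatCoord h i)) :=
    fun h hh => Prod.ext (dif_pos hh) rfl
  have hcont : ∀ i, Continuous fun h : Hat n Y => (hatCoord h i : ℝ) := fun i => by fun_prop
  let Γ : GlueData Z B (hatProj n Y) :=
    { V₁ := {h | ∃ i, (hatCoord h i : ℝ) < 2 / 5 ∨ 3 / 5 < (hatCoord h i : ℝ)}
      V₂ := V₂
      open₁ := by
        rw [ofPred_exists]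
        exact isOpen_iUnion fun i => (isOpen_lt (hcont i) continuous_const).union
          (isOpen_lt continuous_const (hcont i))
      open₂ := by
        change IsOpen {h : Hat n Y | ∀ i, _}
        rw [ofPred_forall]
        exact isOpen_iInter_of_finite fun i => (isOpen_lt continuous_const (hcont i)).inter
          (isOpen_lt (hcont i) continuous_const)
      cover := by
        refine eq_univ_of_forall fun h => or_iff_not_imp_left.2 fun hh i => ?_
        have h1 : ¬ ∃ i, (hatCoord h i : ℝ) < 2 / 5 ∨ 3 / 5 < (hatCoord h i : ℝ) := hh
        push Not at h1
        exact ⟨by linarith [(h1 i).1], by linarith [(h1 i).2]⟩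
      q₁ := id
      q₂ := q₂
      cont₁ := continuousOn_id
      cont₂ := by
        rw [continuousOn_iff_continuous_domRestrict]
        have e : domRestrict V₂ q₂ = fun h => (⟨h.1.1.1.1, hV₂ h.1 h.2⟩,
            fun i => κ (hatCoord h.1 i)) := funext fun h => hq₂ h.1 (hV₂ h.1 h.2)
        rw [e]
        fun_prop
      hf₁ := fun _ _ => rfl
      hf₂ := fun h hh => by rw [hq₂ h (hV₂ h hh)]; rfl }
  have hB : ∀ h, (∃ i, (hatCoord h i : ℝ) ≤ 2 / 5 ∨ 3 / 5 ≤ (hatCoord h i : ℝ)) →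
      q₂ h ∉ B.supp := fun h ⟨i, hi⟩ hh => disjoint_left.1 hA hh (Or.inr ⟨trivial, i, by
    rcases hi with hi | hi
    · exact Or.inl (clamp_of_le (by linarith))
    · exact Or.inr (clamp_of_ge (by linarith))⟩)
  -- On the overlap some coordinate is outside `[2/5, 3/5]`, so `κ` sends it to an end, where the
  -- given object has no support. Both restrictions have empty support, and comparing their twisting
  -- parts is enough.
  have hΓ : Γ.res₁.Iso Γ.res₂ := by
    have h1 : Γ.res₁.supp = ∅ := eq_empty_of_forall_notMem fun t ht =>
      (hZ.le (TVB.supp_pull _ _ _ ht) :)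
    have h2 : Γ.res₂.supp = ∅ := eq_empty_of_forall_notMem fun t ht => by
      obtain ⟨i, hi⟩ := t.2.1
      exact hB t.1 ⟨i, hi.imp le_of_lt le_of_lt⟩ (TVB.supp_pull _ _ _ ht)
    have hc : Continuous fun t : ↥(Γ.V₁ ∩ Γ.V₂) => q₂ t.1 :=
      (Γ.cont₂.mono inter_subset_right).domRestrict
    have hc' : Continuous fun t : ↥(Γ.V₁ ∩ Γ.V₂) => hatProj n Y t.1 := by fun_prop
    refine TVB.iso_of_supp_eq_empty hπ h1 h2
      (fun b a t => (r.c b (q₂ t.1))⁻¹ * τ₀.g (r.ρ b) a (hatProj n Y t.1)) fun b a => ?_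
    have l1 := ((r.lift b).inv.comp hc).mono
      (W := Γ.res₂.twist.U b ∩ Γ.res₁.twist.U a) fun t ht => ht.1
    have l2 := ((τ₀.isLift (r.ρ b) a).comp hc').mono
      (W := Γ.res₂.twist.U b ∩ Γ.res₁.twist.U a) fun t ht => ⟨by
        have h3 := r.sub b ht.1
        change f₂ (q₂ t.1) ∈ τ₀.U (r.ρ b) at h3
        rwa [← Γ.hf₂ t.1 t.2.2] at h3, ht.2⟩
    refine l1.mul ⟨l2.cont, fun t ht => ?_⟩
    have h3 : τ₀.s (r.ρ b) (hatProj n Y t.1) = τ₀.s (r.ρ b) (f₂ (q₂ t.1)) :=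
      congrArg _ (Γ.hf₂ t.1 t.2.2)
    exact (congrArg _ h3.symm).trans (l2.act t ht)
  obtain ⟨E, hE1, hE2, -, hr⟩ := Γ.exists_glue hΓ
  -- The glued object has no support on this larger set. The homotopy moves the boundary of the cube
  -- inwards, so it would not preserve the boundary, but it keeps the boundary inside `S`.
  let S : Set (Hat n Y) := {h | ∃ i, (hatCoord h i : ℝ) ≤ 2 / 5 ∨ 3 / 5 ≤ (hatCoord h i : ℝ)}
  have hES : Disjoint E.supp S := disjoint_left.2 fun h hh hS => by
    rcases Γ.cover.ge (mem_univ h) with hv | hv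
    · exact hZ.le ((hE1 h hv).1 hh)
    · exact hB h hS ((hE2 h hv).1 hh)
  have hbd : ∀ {h : Hat n Y}, hatCoord h ∈ Cube.boundary (Fin (n + 1)) → h ∈ S := by
    rintro h ⟨i, hi⟩
    refine ⟨i, hi.imp (fun hi => ?_) fun hi => ?_⟩
    · rw [hi, Icc.coe_zero]; norm_num
    · rw [hi, Icc.coe_one]; norm_num
  let q : C((Y × Cb (n + 1)) × unitInterval, Hat n Y) :=
    (hatIncl n Y).comp ⟨fun z => (z.1.1, fun i => shrink z.2 (z.1.2 i)), by fun_prop⟩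
  have hqc : ∀ z i, hatCoord (q z) i = shrink z.2 (z.1.2 i) := fun z i =>
    congrFun (hatCoord_hatIncl _) i
  let S' : Set (Y × Cb (n + 1)) := ∅ ×ˢ univ ∪ univ ×ˢ Cube.boundary (Fin (n + 1))
  have hqS : ∀ t ∈ S', ∀ i, q (t, i) ∈ S := by
    rintro t (ht | ⟨-, j, hj⟩) i
    · exact ht.1.elim
    · refine ⟨j, ?_⟩
      rw [hqc]
      dsimp only
      rcases hj with hj | hj
      · rw [hj]
        exact Or.inl (shrink_zero_right_le i)
      · rw [hj]
        exact Or.inr (le_shrink_one_right i)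
  let E' : RelTVB H π (hatProj n Y) S := ⟨E, hES⟩
  refine ⟨KF.mk ⟨E, hES.mono_right fun h hh => hbd (hatCoord_mem_of_mem_hatLarge hh)⟩, ?_⟩
  let p₁ : C(Y × Cb (n + 1), Hat n Y) := q.comp (slice _ 1)
  have hp₁ : ∀ t i, (hatCoord (p₁ t) i : ℝ) = 2 / 5 + 1 / 5 * (t.2 i : ℝ) := fun t i =>
    (congrArg Subtype.val (hqc (t, 1) i)).trans (coe_shrink_one_left _)
  have e1 : KF.mk (E'.pull (f' := f₂) (hatIncl n Y) (fun _ => rfl) (S' := S') fun t ht =>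
      hbd (by rw [hatCoord_hatIncl]; exact ht.elim (fun h => h.1.elim) fun h => h.2)) =
      KF.mk (E'.pull p₁ (fun _ => rfl) fun t ht => hqS t ht 1) :=
    KF.mk_pull_eq_of_homotopy E' q (fun _ => rfl) hqS
      (fun t => congrArg (hatIncl n Y) (Prod.ext rfl (funext fun i => shrink_zero_left _)))
      fun _ => rfl
  have e2 : KF.mk (E'.pull (f' := f₂) p₁ (fun _ => rfl) (S' := S') fun t ht => hqS t ht 1) =
      KF.mk ⟨B, hA⟩ := by
    refine KF.mk_eq_of_iso (hr _ f₂ p₁ (fun _ => rfl) (fun t i => ?_) (fun t => ?_)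
      (ContinuousMap.id _) (fun _ => rfl) (fun t => ?_) _ (.refl _))
    · rw [hp₁]
      have h3 := (t.2 i).2.1
      have h4 := (t.2 i).2.2
      constructor <;> linarith
    · rintro ⟨i, hi⟩
      rw [hp₁] at hi
      have h3 := (t.2 i).2.1
      have h4 := (t.2 i).2.2
      rcases hi with hi | hi <;> linarith
    · change t = q₂ (p₁ t)
      rw [hq₂ (p₁ t) t.1.2]
      refine Prod.ext rfl (funext fun i => ?_)
      change t.2 i = clamp (5 * (hatCoord (p₁ t) i : ℝ) - 2)
      rw [hp₁, show 5 * (2 / 5 + 1 / 5 * (t.2 i : ℝ)) - 2 = t.2 i by ring, clamp_coe]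
  exact e1.trans e2

end ExcisionSurjective

/-! ### The kernel of the map that forgets the bottom of `Hat n Y`. -/

section Connecting

variable {H : Type w} [NormedAddCommGroup H] [InnerProductSpace ℂ H]
variable {X : Type u} [TopologicalSpace X] {P : Type v} [TopologicalSpace P]
  [MulAction (PUGroup H)ᵐᵒᵖ P] {π : P → X} {n : ℕ} {Y : Set X}

/-- The inclusion of `Hat n Y` in `X × I^{n+1}`. -/
def hatToCube (n : ℕ) (Y : Set X) : C(Hat n Y, X × Cb (n + 1)) :=
  ⟨fun h => (h.1.1.1, hatCoord h), by fun_prop⟩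

/-- The homotopy pushing `Hat n Y` in `X × I^{n+1}` to the top of the cube. -/
def hatLift (n : ℕ) (Y : Set X) : C(Hat n Y × unitInterval, X × Cb (n + 1)) :=
  ⟨fun z => (z.1.1.1.1, cubeSnoc z.1.1.1.2 (clamp (z.1.1.2 + z.2 * (1 - z.1.1.2)))), by
    have h : Continuous fun z : Hat n Y × unitInterval =>
      clamp (z.1.1.2 + z.2 * (1 - z.1.1.2)) := continuous_clamp.comp (by fun_prop)
    fun_prop⟩

/-- `X × I^{n+1}` as the cylinder over the base of `Hat n Y`. -/
def cubeToCylinder (n : ℕ) (Y : Set X) : C(X × Cb (n + 1), Hat n Y × unitInterval) :=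
  ⟨fun z => (⟨((z.1, fun i => z.2 i.castSucc), 0), Or.inl rfl⟩, z.2 (Fin.last n)), by fun_prop⟩

/-- The homotopy between the side and the base of the cylinder over `Hat n Y`. -/
def cylinderTurn (n : ℕ) (Y : Set X) :
    C((Y × Cb (n + 1)) × unitInterval, Hat n Y × unitInterval) :=
  ⟨fun z => (hatIncl n Y (z.1.1, cubeSnoc (fun i => z.1.2 i.castSucc)
      (z.1.2 (Fin.last n) * clamp (2 * (1 - z.2)))),
    z.1.2 (Fin.last n) * clamp (2 * z.2)), by
    have h1 : Continuous fun z : (Y × Cb (n + 1)) × unitInterval =>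
      clamp (2 * (1 - (z.2 : ℝ))) := continuous_clamp.comp (by fun_prop)
    have h2 : Continuous fun z : (Y × Cb (n + 1)) × unitInterval =>
      clamp (2 * (z.2 : ℝ)) := continuous_clamp.comp (by fun_prop)
    fun_prop⟩

theorem cylinderTurn_fst (z : (Y × Cb (n + 1)) × unitInterval) :
    (cylinderTurn n Y z).1.1 = ((z.1.1.1, fun i => z.1.2 i.castSucc),
      z.1.2 (Fin.last n) * clamp (2 * (1 - z.2))) :=
  Prod.ext (Prod.ext rfl (funext fun i => cubeSnoc_castSucc (fun i => z.1.2 i.castSucc)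
    (z.1.2 (Fin.last n) * clamp (2 * (1 - z.2))) i))
    (cubeSnoc_last (fun i => z.1.2 i.castSucc) (z.1.2 (Fin.last n) * clamp (2 * (1 - z.2))))

variable [InfiniteDimensional H]

/-- Forward: a null-homotopy over `Hat n Y`, restricted to the bottom, is an object on `X × I^{n+1}`
with the time as last coordinate. Over `Y`, the height and time coordinates form a square, and
turning from the height edge to the time edge identifies its restriction with `e x`. Backward: when
`e x` extends to `X × I^{n+1}`, injectivity of `e` makes `x` the restriction of that extension to
`Hat n Y`, and raising all heights to `1` moves it off its support. -/
theorem hatForget_eq_zero_iff (hπ : IsPrincipalBundle (PUGroup H) π)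
    (τ₀ : Twist H π (ContinuousMap.id X)) (hinj : Function.Injective (excision H π n Y))
    (x : KF H π (hatProj n Y) (hatLarge n Y)) :
    hatForget H π n Y x = KF.zero hπ τ₀ _ _ ↔
      excision H π n Y x ∈ range (restrictTo H π (n + 1) Y) := by
  constructor
  · obtain ⟨B, rfl⟩ := Quot.exists_rep x
    intro hx
    obtain ⟨N, hN, C, h0, h1⟩ := (KF.mk_eq_zero_iff hπ τ₀ _).1 hx
    have hC0 : ∀ p : Hat n Y × unitInterval, p.1 ∈ hatLarge n Y → p.2 = 0 → p ∉ C.1.supp := by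
      rintro ⟨h, -⟩ hh rfl hC
      have h3 : slice _ 0 ⁻¹' C.1.supp = _ := (TVB.supp_pull_eq (f' := hatProj n Y) (slice _ 0)
        (fun _ => rfl) C.1).symm.trans h0.supp_eq
      exact disjoint_left.1 B.2 (TVB.supp_pull _ _ _ (h3.le hC)) hh
    have hC1 : ∀ p : Hat n Y × unitInterval, p.2 = 1 → p ∉ C.1.supp := by
      rintro ⟨h, -⟩ rfl hC
      have h3 : slice _ 1 ⁻¹' C.1.supp = ∅ := (TVB.supp_pull_eq (f' := hatProj n Y) (slice _ 1)
        (fun _ => rfl) C.1).symm.trans (h1.supp_eq.trans hN)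
      exact h3.le hC
    have hCS : ∀ h ∈ hatSmall n Y, ∀ i, (h, i) ∉ C.1.supp := fun h hh i hC =>
      disjoint_left.1 C.2 hC ⟨hh, trivial⟩
    -- Viewed relative to the complement of its own support, `C` can be pulled back along every map
    -- for which the relative part avoids that support.
    let C' : RelTVB H π ((hatProj n Y).comp ContinuousMap.fst : C(Hat n Y × unitInterval, X))
      C.1.suppᶜ := ⟨C.1, disjoint_compl_right⟩
    have hw : MapsTo (cubeToCylinder n Y)
        (∅ ×ˢ univ ∪ univ ×ˢ Cube.boundary (Fin (n + 1))) C.1.suppᶜ := by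
      rintro z (hz | ⟨-, i, hi⟩)
      · exact hz.1.elim
      · induction i using Fin.lastCases with
        | last =>
          rcases hi with hi | hi
          · exact hC0 _ (Or.inl rfl) hi
          · exact hC1 _ hi
        | cast i => exact hCS _ (Or.inr ⟨i, hi⟩) _
    have hcs : ∀ t ∈ ((∅ ×ˢ univ ∪ univ ×ˢ Cube.boundary (Fin (n + 1)) :
        Set (Y × Cb (n + 1)))), ∀ i, cylinderTurn n Y (t, i) ∈ C.1.suppᶜ := by
      rintro t (ht | ⟨-, j, hj⟩) i
      · exact ht.1.elim
      -- The path goes from `(a, 0)` through the corner `(a, a)` to `(0, a)` in height and time,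
      -- where `a` is the last coordinate. For `a = 0` it stays at the bottom at time `0`. For `a =
      -- 1` it has height `1` in the first half and time `1` in the second; both avoid the support.
      · induction j using Fin.lastCases with
        | last =>
          have e1 := congrArg Prod.snd (cylinderTurn_fst (t, i))
          rcases hj with hj | hj
          · refine hC0 _ (Or.inl (e1.trans ?_)) ?_
            · dsimp only
              rw [hj, zero_mul]
            · change t.2 (Fin.last n) * _ = 0
              rw [hj, zero_mul]
          · rcases le_total (i : ℝ) (1 / 2) with h2 | h2
            · refine hCS _ (Or.inl ⟨t.1.2, e1.trans ?_⟩) _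
              dsimp only
              rw [hj, one_mul]
              exact clamp_of_ge (by linarith)
            · refine hC1 _ ?_
              change t.2 (Fin.last n) * clamp (2 * (i : ℝ)) = 1
              rw [hj, one_mul]
              exact clamp_of_ge (by linarith)
        | cast j =>
          refine hCS _ (Or.inr ?_) _
          exact (congrArg (fun p => p.1.2 ∈ Cube.boundary (Fin n)) (cylinderTurn_fst (t, i))).mpr
            ⟨j, hj⟩
    let w : KFn H π (n + 1) (ContinuousMap.id X) ∅ :=
      KF.mk (C'.pull (cubeToCylinder n Y) (fun _ => rfl) hw)
    let g₀ : C(Y × Cb (n + 1), Hat n Y × unitInterval) := (slice _ 0).comp (hatIncl n Y)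
    let g₁ : C(Y × Cb (n + 1), Hat n Y × unitInterval) :=
      (cubeToCylinder n Y).comp ((incl Y).prodMap (ContinuousMap.id (Cb (n + 1))))
    have hg₀ : ∀ t, cylinderTurn n Y (t, 0) = g₀ t := fun t => by
      refine Prod.ext (Subtype.ext ((cylinderTurn_fst _).trans (Prod.ext rfl ?_))) ?_
      · change t.2 (Fin.last n) * clamp (2 * (1 - ((0 : unitInterval) : ℝ))) = t.2 (Fin.last n)
        rw [clamp_of_ge (by rw [Icc.coe_zero]; norm_num), mul_one]
      · change t.2 (Fin.last n) * clamp (2 * ((0 : unitInterval) : ℝ)) = 0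
        rw [clamp_of_le (by rw [Icc.coe_zero]; norm_num), mul_zero]
    have hg₁ : ∀ t, cylinderTurn n Y (t, 1) = g₁ t := fun t => by
      refine Prod.ext (Subtype.ext ((cylinderTurn_fst _).trans (Prod.ext rfl ?_))) ?_
      · change t.2 (Fin.last n) * clamp (2 * (1 - ((1 : unitInterval) : ℝ))) = 0
        rw [clamp_of_le (by rw [Icc.coe_one]; norm_num), mul_zero]
      · change t.2 (Fin.last n) * clamp (2 * ((1 : unitInterval) : ℝ)) = t.2 (Fin.last n)
        rw [clamp_of_ge (by rw [Icc.coe_one]; norm_num), mul_one]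
    have e1 : KF.mk (C'.pull (f' := (incl Y).comp ContinuousMap.fst) g₀ (fun _ => rfl)
        (S' := ∅ ×ˢ univ ∪ univ ×ˢ Cube.boundary (Fin (n + 1)))
        fun t ht => hg₀ t ▸ hcs t ht 0) = KF.mk (C'.pull g₁ (fun _ => rfl)
          fun t ht => hg₁ t ▸ hcs t ht 1) :=
      KF.mk_pull_eq_of_homotopy C' (cylinderTurn n Y) (fun _ => rfl) hcs hg₀ hg₁
    have e2 : KF.mk (C'.pull (f' := (incl Y).comp ContinuousMap.fst) g₀ (fun _ => rfl)
        (S' := ∅ ×ˢ univ ∪ univ ×ˢ Cube.boundary (Fin (n + 1)))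
        fun t ht => hg₀ t ▸ hcs t ht 0) = excision H π n Y (KF.mk B) :=
      KF.mk_eq_of_iso (h0.pull (f' := (incl Y).comp ContinuousMap.fst) (hatIncl n Y) fun _ => rfl)
    exact ⟨w, e1.symm.trans e2⟩
  · rintro ⟨w, hw⟩
    obtain ⟨W, rfl⟩ := Quot.exists_rep w
    have hS : MapsTo (hatToCube n Y) (hatLarge n Y)
        (∅ ×ˢ univ ∪ univ ×ˢ Cube.boundary (Fin (n + 1))) := fun h hh =>
      Or.inr ⟨trivial, hatCoord_mem_of_mem_hatLarge hh⟩
    -- The pull-back of `W` to `Hat n Y` has the same image under `e` as `x`.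
    obtain rfl : x = KF.mk (W.pull (f' := hatProj n Y) (hatToCube n Y) (fun _ => rfl) hS) := by
      refine hinj (hw.symm.trans (congrArg KF.mk (Subtype.ext ?_)))
      exact TVB.pull_congr (q := (incl Y).prodMap (ContinuousMap.id (Cb (n + 1))))
        (q' := (hatToCube n Y).comp (hatIncl n Y)) (hq := fun _ => rfl) (hq' := fun _ => rfl) W.1
        fun t => Prod.ext rfl (hatCoord_hatIncl t).symm
    have hlift : ∀ h ∈ hatSmall n Y, ∀ i, hatLift n Y (h, i) ∈
        (∅ ×ˢ univ ∪ univ ×ˢ Cube.boundary (Fin (n + 1)) : Set (X × Cb (n + 1))) := by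
      rintro h hh i
      refine Or.inr ⟨trivial, cubeSnoc_mem_boundary_iff.2 ?_⟩
      rcases hh with hh | hh
      · refine Or.inl (Or.inr ?_)
        dsimp only
        rw [hh.2]
        exact clamp_of_ge (by rw [Icc.coe_one]; norm_num)
      · exact Or.inr hh
    let q₁ : C(Hat n Y, X × Cb (n + 1)) := (hatLift n Y).comp (slice _ 1)
    have e1 : KF.mk (W.pull (f' := hatProj n Y) (hatToCube n Y) (fun _ => rfl)
        (S' := hatSmall n Y) fun h hh => hS (Or.inr hh)) =
        KF.mk (W.pull q₁ (fun _ => rfl) fun h hh => hlift h hh 1) :=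
      KF.mk_pull_eq_of_homotopy W (hatLift n Y) (fun _ => rfl) hlift (fun h => by
        refine Prod.ext rfl ?_
        change cubeSnoc _ (clamp (h.1.2 + ((0 : unitInterval) : ℝ) * (1 - h.1.2))) = cubeSnoc _ _
        rw [Icc.coe_zero, zero_mul, add_zero, clamp_coe]) fun _ => rfl
    refine e1.trans (KF.mk_eq_zero hπ τ₀ _ (eq_empty_of_forall_notMem fun h hh => ?_))
    refine disjoint_left.1 W.2 (TVB.supp_pull _ _ _ hh)
      (Or.inr ⟨trivial, cubeSnoc_mem_boundary_iff.2 (Or.inl (Or.inr ?_))⟩)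
    change clamp (h.1.2 + ((1 : unitInterval) : ℝ) * (1 - h.1.2)) = 1
    exact clamp_of_ge (by rw [Icc.coe_one]; linarith)

end Connecting

/-! ### The central projection of the box `I^n × I` onto its bottom and sides. -/

section Box

variable {n : ℕ}

/-- The gauge of `I^n × I` about the point `(1/2, …, 1/2, 2)`, equal to `1` on the bottom and on
the sides of the box. -/
def boxGauge (c : Cb n × unitInterval) : ℝ :=
  max (2 * ‖fun i => (c.1 i : ℝ) - 1 / 2‖) ((2 - c.2) / 2)

theorem norm_cube_sub_le (v : Cb n) : ‖fun i => (v i : ℝ) - 1 / 2‖ ≤ 1 / 2 := by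
  refine (pi_norm_le_iff_of_nonneg (by norm_num)).2 fun i => ?_
  rw [Real.norm_eq_abs, abs_le]
  have h1 := (v i).2.1
  have h2 := (v i).2.2
  constructor <;> linarith

theorem half_le_boxGauge (c : Cb n × unitInterval) : 1 / 2 ≤ boxGauge c :=
  le_max_of_le_right (by have := c.2.2.2; linarith)

theorem boxGauge_pos (c : Cb n × unitInterval) : 0 < boxGauge c :=
  one_half_pos.trans_le (half_le_boxGauge c)

theorem boxGauge_le_one (c : Cb n × unitInterval) : boxGauge c ≤ 1 :=
  max_le (by linarith [norm_cube_sub_le c.1]) (by linarith [c.2.2.1])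

theorem boxGauge_eq_one {c : Cb n × unitInterval}
    (hc : c.2 = 0 ∨ c.1 ∈ Cube.boundary (Fin n)) : boxGauge c = 1 := by
  refine (boxGauge_le_one c).antisymm ?_
  rcases hc with hc | ⟨i, hi⟩
  · refine le_max_of_le_right ?_
    rw [hc, Icc.coe_zero]
    norm_num
  · refine le_max_of_le_left ?_
    have h := norm_le_pi_norm (fun i => (c.1 i : ℝ) - 1 / 2) i
    have h' : ‖(c.1 i : ℝ) - 1 / 2‖ = 1 / 2 := by
      rcases hi with hi | hi
      · rw [hi, Icc.coe_zero]; norm_num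
      · rw [hi, Icc.coe_one]; norm_num
    linarith

@[fun_prop]
theorem continuous_boxGauge : Continuous (boxGauge (n := n)) := by
  unfold boxGauge
  fun_prop

/-- The time at which the flow from the centre of the box through `c` reaches `c`. -/
def boxTime (c : Cb n × unitInterval) : unitInterval := clamp (1 - boxGauge c)

@[fun_prop]
theorem continuous_boxTime : Continuous (boxTime (n := n)) := continuous_clamp.comp (by fun_prop)

theorem boxTime_eq_zero {c : Cb n × unitInterval}
    (hc : c.2 = 0 ∨ c.1 ∈ Cube.boundary (Fin n)) : boxTime c = 0 :=
  clamp_of_le (by rw [boxGauge_eq_one hc, sub_self])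

/-- The point of the ray from the centre of the box through `c` at the time `s`. -/
def boxMap (c : Cb n × unitInterval) (s : unitInterval) : Cb n × unitInterval :=
  (fun i => clamp (1 / 2 + (1 - s) / boxGauge c * (c.1 i - 1 / 2)),
    clamp (2 - (1 - s) / boxGauge c * (2 - c.2)))

@[fun_prop]
theorem _root_.Continuous.boxMap {T : Type*} [TopologicalSpace T] {c : T → Cb n × unitInterval}
    {s : T → unitInterval} (hc : Continuous c) (hs : Continuous s) :
    Continuous fun x => boxMap (c x) (s x) := by
  have h : Continuous fun x => (1 - (s x : ℝ)) / boxGauge (c x) :=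
    (by fun_prop : Continuous fun x => 1 - (s x : ℝ)).div (by fun_prop) fun x =>
      (boxGauge_pos _).ne'
  exact (continuous_pi fun i => continuous_clamp.comp (by fun_prop)).prodMk
    (continuous_clamp.comp (by fun_prop))

/-- The point at time `s` on the ray has gauge `1 - s`, before clamping; so `c` itself is reached at
the time `1 - boxGauge c`. -/
theorem boxMap_boxTime (c : Cb n × unitInterval) : boxMap c (boxTime c) = c := by
  have h : (1 - (boxTime c : ℝ)) / boxGauge c = 1 := by
    rw [boxTime, coe_clamp (by linarith [boxGauge_le_one c]) (by linarith [boxGauge_pos c]),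
      sub_sub_cancel, div_self (boxGauge_pos c).ne']
  refine Prod.ext (funext fun i => ?_) ?_
  · change clamp (1 / 2 + _ * _) = _
    rw [h, one_mul, add_sub_cancel, clamp_coe]
  · change clamp (2 - _ * _) = _
    rw [h, one_mul, sub_sub_cancel, clamp_coe]

/-- At time `0` the gauge is `1`. If the maximum is attained by the cube coordinates, one of them
has reached an end of its interval; otherwise the height is `0`. -/
theorem boxMap_zero_mem (c : Cb n × unitInterval) :
    (boxMap c 0).2 = 0 ∨ (boxMap c 0).1 ∈ Cube.boundary (Fin n) := by
  have hpos := boxGauge_pos c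
  rcases max_choice (2 * ‖fun i => (c.1 i : ℝ) - 1 / 2‖) ((2 - c.2) / 2) with h | h
  · change boxGauge c = _ at h
    refine Or.inr ?_
    obtain ⟨i, hi⟩ : ∃ i, ‖fun i => (c.1 i : ℝ) - 1 / 2‖ ≤ ‖(c.1 i : ℝ) - 1 / 2‖ := by
      by_contra! hcon
      exact lt_irrefl _ ((pi_norm_lt_iff (by linarith)).2 hcon)
    have hi' : boxGauge c / 2 ≤ |(c.1 i : ℝ) - 1 / 2| := by
      rw [Real.norm_eq_abs] at hi
      linarith
    refine ⟨i, ?_⟩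
    change clamp (1 / 2 + (1 - ((0 : unitInterval) : ℝ)) / boxGauge c * (c.1 i - 1 / 2)) = 0 ∨
      clamp (1 / 2 + (1 - ((0 : unitInterval) : ℝ)) / boxGauge c * (c.1 i - 1 / 2)) = 1
    rw [Icc.coe_zero, sub_zero, one_div_mul_eq_div]
    rcases le_abs.1 hi' with h1 | h1
    · refine Or.inr (clamp_of_ge ?_)
      have : 1 / 2 ≤ ((c.1 i : ℝ) - 1 / 2) / boxGauge c := by
        rw [le_div_iff₀ hpos]
        linarith
      linarith
    · refine Or.inl (clamp_of_le ?_)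
      have : ((c.1 i : ℝ) - 1 / 2) / boxGauge c ≤ -(1 / 2) := by
        rw [div_le_iff₀ hpos]
        linarith
      linarith
  · change boxGauge c = _ at h
    refine Or.inl ?_
    change clamp (2 - (1 - ((0 : unitInterval) : ℝ)) / boxGauge c * (2 - c.2)) = 0
    refine clamp_of_le (le_of_eq ?_)
    rw [Icc.coe_zero, sub_zero, one_div_mul_eq_div, show (2 - (c.2 : ℝ)) = 2 * boxGauge c by
      linarith, mul_div_cancel_right₀ _ hpos.ne', sub_self]

end Box

/-! ### The covered retraction onto `Hat n Y`, and bijectivity of `p^*`. -/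

section HatPull

variable {H : Type w} [NormedAddCommGroup H] [InnerProductSpace ℂ H]
variable {X : Type u} [TopologicalSpace X] {P : Type v} [TopologicalSpace P]
  [MulAction (PUGroup H)ᵐᵒᵖ P] {π : P → X} {Y : Set X}

namespace BundleRetraction

variable (R : BundleRetraction H π Y) (n : ℕ)

/-- The retraction of `X × I^n × I` onto `Hat n Y`. -/
def hatRetr : C((X × Cb n) × unitInterval, Hat n Y) :=
  -- The box time of the point is used as the time of the retraction `r`, and the point then moves
  -- along its ray to the new time. If that time is `0` it lands on the bottom or the sides;
  -- otherwise the new base point is in `Y`.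
  ⟨fun z => ⟨(((R.r (z.1.1, boxTime (z.1.2, z.2))).1,
      (boxMap (z.1.2, z.2) (R.r (z.1.1, boxTime (z.1.2, z.2))).2).1),
      (boxMap (z.1.2, z.2) (R.r (z.1.1, boxTime (z.1.2, z.2))).2).2), by
    rcases R.mem (z.1.1, boxTime (z.1.2, z.2)) with h | h
    · rw [h]
      exact (boxMap_zero_mem _).imp id Or.inr
    · exact Or.inr (Or.inl h)⟩, by
    have h1 : Continuous fun z : (X × Cb n) × unitInterval =>
      R.r (z.1.1, boxTime (z.1.2, z.2)) := R.r.continuous.comp (by fun_prop)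
    have h2 := Continuous.boxMap (by fun_prop : Continuous fun z : (X × Cb n) × unitInterval =>
      (z.1.2, z.2)) h1.snd
    exact ((h1.fst.prodMk h2.fst).prodMk h2.snd).subtype_mk _⟩

/-- The bundle map that covers the retraction onto `Hat n Y`. -/
def hatFibre (z : (X × Cb n) × unitInterval) : P → P :=
  R.Q (z.1.1, boxTime (z.1.2, z.2))

theorem isBundleMap_hatRetr : IsBundleMap H π (hatProj n Y)
    (ContinuousMap.fst.comp ContinuousMap.fst : C((X × Cb n) × unitInterval, X))
    (R.hatRetr n) (R.hatFibre n) := by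
  have h := R.isBundleMap.comp
    (s := fun z : (X × Cb n) × unitInterval => (z.1.1, boxTime (z.1.2, z.2)))
    (f'' := (ContinuousMap.fst.comp ContinuousMap.fst : C((X × Cb n) × unitInterval, X)))
    (by fun_prop) fun _ => rfl
  exact ⟨h.proj, h.act, h.cont⟩

variable {n}

/-- Points on the bottom or over `∂I^n` have box time `0`, and `r` fixes both time `0` and `Y`; with
the time unchanged, the ray returns the point itself. -/
theorem hatRetr_eq {z : (X × Cb n) × unitInterval}
    (hz : z.2 = 0 ∨ z.1.1 ∈ Y ∨ z.1.2 ∈ Cube.boundary (Fin n)) :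
    ((R.hatRetr n z).1 = z) := by
  have h : R.r (z.1.1, boxTime (z.1.2, z.2)) = (z.1.1, boxTime (z.1.2, z.2)) := by
    rcases hz with hz | hz | hz
    · rw [boxTime_eq_zero (Or.inl hz), R.apply_zero]
    · exact R.apply_mem _ _ hz
    · rw [boxTime_eq_zero (Or.inr hz), R.apply_zero]
  change (((R.r (z.1.1, boxTime (z.1.2, z.2))).1, _), _) = _
  rw [h]
  dsimp only
  rw [boxMap_boxTime]

theorem hatFibre_eq {z : (X × Cb n) × unitInterval}
    (hz : z.2 = 0 ∨ z.1.1 ∈ Y ∨ z.1.2 ∈ Cube.boundary (Fin n)) {p : P} (hp : π p = z.1.1) :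
    R.hatFibre n z p = p := by
  refine R.eq_self _ _ ?_ hp
  rcases hz with hz | hz | hz
  · exact Or.inl (boxTime_eq_zero (Or.inl hz))
  · exact Or.inr hz
  · exact Or.inl (boxTime_eq_zero (Or.inr hz))

end BundleRetraction

variable {n : ℕ}

/-- The homotopy raising `Hat n Y` in `X × I^n × I` to the top. -/
def hatRaise (n : ℕ) (Y : Set X) : C(Hat n Y × unitInterval, (X × Cb n) × unitInterval) :=
  ⟨fun z => (z.1.1.1, clamp (z.1.1.2 + z.2 * (1 - z.1.1.2))), by
    have h : Continuous fun z : Hat n Y × unitInterval =>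
      clamp (z.1.1.2 + z.2 * (1 - z.1.1.2)) := continuous_clamp.comp (by fun_prop)
    fun_prop⟩

/-- Raising `Hat n Y` to the top of `X × I^n × I` and retracting back is a homotopy of bundle maps
from the identity to `j ∘ p`, with `j` the retraction of the top slice. So `B` is homotopic to `p^*
j^* B`, and the relative part is preserved throughout. -/
theorem hatPull_surjective (R : BundleRetraction H π Y) :
    Function.Surjective (hatPull H π n Y) := by
  intro y
  obtain ⟨B, rfl⟩ := Quot.exists_rep y
  let j : C(X × Cb n, Hat n Y) := (R.hatRetr n).comp (slice _ 1)
  have hj := (R.isBundleMap_hatRetr n).comp (s := fun z : X × Cb n => (z, 1))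
    (f'' := (ContinuousMap.id X).comp ContinuousMap.fst) (by fun_prop) fun _ => rfl
  have hjS : MapsTo j (Y ×ˢ univ ∪ univ ×ˢ Cube.boundary (Fin n)) (hatSmall n Y) := by
    rintro z (hz | hz)
    · have e := R.hatRetr_eq (z := (z, 1)) (Or.inr (Or.inl hz.1))
      refine Or.inl ?_
      change (R.hatRetr n (z, 1)).1.1.1 ∈ Y ∧ (R.hatRetr n (z, 1)).1.2 = 1
      rw [e]
      exact ⟨hz.1, rfl⟩
    · have e := R.hatRetr_eq (z := (z, 1)) (Or.inr (Or.inr hz.2))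
      refine Or.inr ?_
      change (R.hatRetr n (z, 1)).1.1.2 ∈ _
      rw [e]
      exact hz.2
  let q : C(Hat n Y × unitInterval, Hat n Y) := (R.hatRetr n).comp (hatRaise n Y)
  have hq : IsBundleMap H π (hatProj n Y)
      ((hatProj n Y).comp ContinuousMap.fst : C(Hat n Y × unitInterval, X)) q
      fun z => R.hatFibre n (hatRaise n Y z) :=
    (R.isBundleMap_hatRetr n).comp (hatRaise n Y).continuous fun _ => rfl
  have hqS : ∀ h ∈ hatSmall n Y, ∀ i, q (h, i) ∈ hatSmall n Y := by
    rintro h hh i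
    rcases hh with hh | hh
    · have e := R.hatRetr_eq (z := hatRaise n Y (h, i)) (Or.inr (Or.inl hh.1))
      refine Or.inl ?_
      change (R.hatRetr n (hatRaise n Y (h, i))).1.1.1 ∈ Y ∧
        (R.hatRetr n (hatRaise n Y (h, i))).1.2 = 1
      rw [e]
      refine ⟨hh.1, ?_⟩
      change clamp (h.1.2 + i * (1 - h.1.2)) = 1
      rw [hh.2]
      exact clamp_of_ge (by rw [Icc.coe_one]; norm_num)
    · have e := R.hatRetr_eq (z := hatRaise n Y (h, i)) (Or.inr (Or.inr hh))
      refine Or.inr ?_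
      change (R.hatRetr n (hatRaise n Y (h, i))).1.1.2 ∈ _
      rw [e]
      exact hh
  have hr0 : ∀ h : Hat n Y, hatRaise n Y (h, 0) = h.1 := fun h => Prod.ext rfl (by
    change clamp (h.1.2 + ((0 : unitInterval) : ℝ) * (1 - h.1.2)) = _
    rw [Icc.coe_zero, zero_mul, add_zero, clamp_coe])
  have hr1 : ∀ h : Hat n Y, hatRaise n Y (h, 1) = (h.1.1, 1) := fun h => Prod.ext rfl (by
    change clamp (h.1.2 + ((1 : unitInterval) : ℝ) * (1 - h.1.2)) = _
    exact clamp_of_ge (by rw [Icc.coe_one]; linarith))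
  have hq0 := hq.comp (s := fun h : Hat n Y => (h, 0)) (f'' := hatProj n Y) (by fun_prop)
    fun _ => rfl
  have hq1 : IsBundleMap H π (hatProj n Y) (hatProj n Y) (j.comp (hatFst n Y))
      fun h => R.hatFibre n (h.1.1, 1) :=
    hj.comp (s := hatFst n Y) (f'' := hatProj n Y) (hatFst n Y).continuous fun _ => rfl
  have e1 : KF.mk (B.bpull (q.comp (slice _ 0)) hq0 (S' := hatSmall n Y)
      fun t ht => hqS t ht 0) = KF.mk (B.bpull (j.comp (hatFst n Y)) hq1 fun t ht => by
        have h := hqS t ht 1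
        change R.hatRetr n (hatRaise n Y (t, 1)) ∈ _ at h
        rw [hr1] at h
        exact h) :=
    KF.mk_bpull_slice B q hq hqS (fun _ => rfl) (fun _ => rfl)
      (fun h => congrArg (R.hatRetr n) (hr1 h)) fun h => congrArg (R.hatFibre n) (hr1 h)
  have e2 : KF.mk (B.bpull (q.comp (slice _ 0)) hq0 (S' := hatSmall n Y)
      fun t ht => hqS t ht 0) = KF.mk (B.pull (f' := hatProj n Y) (ContinuousMap.id _)
        (fun _ => rfl) fun t ht => ht) :=
    KF.mk_bpull_eq_mk_pull B hq0 _
      (fun h => (congrArg (R.hatRetr n) (hr0 h)).trans (Subtype.ext (R.hatRetr_eq h.2)))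
      fun h p hp => (congrFun (congrArg (R.hatFibre n) (hr0 h)) p).trans (R.hatFibre_eq h.2 hp)
  exact ⟨KF.mk (B.bpull j hj hjS), e1.symm.trans e2⟩

/-- `j^*` is a left inverse of `p^*`: the map `p ∘ j` is the end of a homotopy of bundle maps that
starts at the identity, obtained by retracting all slices of `X × I^n × I` and projecting. -/
theorem hatPull_injective (R : BundleRetraction H π Y) :
    Function.Injective (hatPull H π n Y) := by
  let S : Set (X × Cb n) := Y ×ˢ univ ∪ univ ×ˢ Cube.boundary (Fin n)
  let fX : C(X × Cb n, X) := (ContinuousMap.id X).comp ContinuousMap.fst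
  let j : C(X × Cb n, Hat n Y) := (R.hatRetr n).comp (slice _ 1)
  have hj : IsBundleMap H π (hatProj n Y) fX j fun z => R.hatFibre n (z, 1) :=
    (R.isBundleMap_hatRetr n).comp (s := fun z : X × Cb n => (z, 1)) (by fun_prop) fun _ => rfl
  have hret : ∀ t ∈ S, ∀ i, (R.hatRetr n (t, i)).1 = (t, i) := fun t ht i =>
    R.hatRetr_eq (z := (t, i)) (Or.inr (ht.imp (fun h => h.1) fun h => h.2))
  have hjS : MapsTo j S (hatSmall n Y) := by
    intro z hz
    have e := hret z hz 1
    change ((R.hatRetr n (z, 1)).1.1.1 ∈ Y ∧ (R.hatRetr n (z, 1)).1.2 = 1) ∨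
      (R.hatRetr n (z, 1)).1.1.2 ∈ _
    rw [e]
    exact hz.imp (fun h => ⟨h.1, rfl⟩) fun h => h.2
  let q : C((X × Cb n) × unitInterval, X × Cb n) := (hatFst n Y).comp (R.hatRetr n)
  have hb := R.isBundleMap_hatRetr n
  have hq : IsBundleMap H π fX (fX.comp ContinuousMap.fst : C((X × Cb n) × unitInterval, X)) q
      (R.hatFibre n) := ⟨hb.proj, hb.act, hb.cont⟩
  have hqS : ∀ t ∈ S, ∀ i, q (t, i) ∈ S := fun t ht i => by
    change (R.hatRetr n (t, i)).1.1 ∈ S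
    rw [hret t ht i]
    exact ht
  have hq0 := hq.comp (s := fun t : X × Cb n => (t, 0)) (f'' := fX) (by fun_prop) fun _ => rfl
  have hq1 : IsBundleMap H π fX fX ((hatFst n Y).comp j) fun t => R.hatFibre n (t, 1) :=
    hq.comp (s := fun t : X × Cb n => (t, 1)) (f'' := fX) (by fun_prop) fun _ => rfl
  have key : ∀ A : RelTVB H π fX S,
      KF.mk (A.bpull ((hatFst n Y).comp j) hq1 fun t ht => hqS t ht 1) = KF.mk A := fun A => by
    have e1 : KF.mk (A.bpull (q.comp (slice _ 0)) hq0 (S' := S) fun t ht => hqS t ht 0) =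
        KF.mk (A.bpull ((hatFst n Y).comp j) hq1 fun t ht => hqS t ht 1) :=
      KF.mk_bpull_slice A q hq hqS (fun _ => rfl) (fun _ => rfl) (fun _ => rfl) fun _ => rfl
    have e2 : KF.mk (A.bpull (q.comp (slice _ 0)) hq0 (S' := S) fun t ht => hqS t ht 0) =
        KF.mk (A.pull (f' := fX) (ContinuousMap.id _) (fun _ => rfl) fun t ht => ht) :=
      KF.mk_bpull_eq_mk_pull A hq0 _
        (fun t => congrArg Prod.fst (R.hatRetr_eq (z := (t, 0)) (Or.inl rfl)))
        fun t p hp => R.hatFibre_eq (z := (t, 0)) (Or.inl rfl) hp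
    exact e1.symm.trans e2
  intro x y hxy
  obtain ⟨A, rfl⟩ := Quot.exists_rep x
  obtain ⟨B, rfl⟩ := Quot.exists_rep y
  have h : RelTVB.Homotopic _ _ := (KF.mk_eq_iff.1 hxy).bpull j hj hjS
  exact (key A).symm.trans ((KF.mk_eq_iff.2 h).trans (key B))

end HatPull

/-! ### Induced homomorphisms and the connecting map. -/

section Delta

variable {H : Type w} [NormedAddCommGroup H] [InnerProductSpace ℂ H] [InfiniteDimensional H]
variable {X : Type u} [TopologicalSpace X] {P : Type v} [TopologicalSpace P]
  [MulAction (PUGroup H)ᵐᵒᵖ P] {π : P → X} {T T' : Type u} [TopologicalSpace T]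
  [TopologicalSpace T'] {f : C(T, X)} {f' : C(T', X)}

/-- The homomorphism induced by a map of pairs. -/
def KF.pullHom (hπ : IsPrincipalBundle (PUGroup H) π) (τ₀ : Twist H π (ContinuousMap.id X))
    (q : C(T', T)) (hq : ∀ t, f' t = f (q t)) {S : Set T} {S' : Set T'} (hS : MapsTo q S' S) :
    letI := KF.addCommGroup hπ τ₀ f S
    letI := KF.addCommGroup hπ τ₀ f' S'
    KF H π f S →+ KF H π f' S' :=
  letI := KF.addCommGroup hπ τ₀ f S
  letI := KF.addCommGroup hπ τ₀ f' S'
  AddMonoidHom.mk' (KF.pull q hq hS) (KF.pull_add hπ q hq hS)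

theorem KF.pull_zero (hπ : IsPrincipalBundle (PUGroup H) π)
    (τ₀ : Twist H π (ContinuousMap.id X)) (q : C(T', T)) (hq : ∀ t, f' t = f (q t)) {S : Set T}
    {S' : Set T'} (hS : MapsTo q S' S) :
    KF.pull q hq hS (KF.zero hπ τ₀ f S) = KF.zero hπ τ₀ f' S' :=
  KF.mk_eq_zero hπ τ₀ (RelTVB.pull q hq hS ⟨⟨τ₀.pull f fun _ => rfl, .zero hπ _⟩, by
      rw [TVB.supp, Vectorial.supp_zero]; exact disjoint_bot_left⟩)
    (subset_empty_iff.1 ((TVB.supp_pull q hq _).trans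
      (preimage_mono (t := ∅) (Vectorial.supp_zero hπ _).subset)))

/-- For a homomorphism, triviality of the kernel suffices. -/
theorem excision_injective {n : ℕ} {Y : Set X} (hπ : IsPrincipalBundle (PUGroup H) π)
    (τ₀ : Twist H π (ContinuousMap.id X)) : Function.Injective (excision H π n Y) :=
  let := KF.addCommGroup hπ τ₀ (hatProj n Y) (hatLarge n Y)
  let := KF.addCommGroup hπ τ₀ ((incl Y).comp ContinuousMap.fst : C(Y × Cb (n + 1), X))
    (∅ ×ˢ univ ∪ univ ×ˢ Cube.boundary (Fin (n + 1)))
  (injective_iff_map_eq_zero (KF.pullHom hπ τ₀ (f := hatProj n Y)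
    (f' := (incl Y).comp ContinuousMap.fst) (S := hatLarge n Y)
    (S' := ∅ ×ˢ univ ∪ univ ×ˢ Cube.boundary (Fin (n + 1)))
    (hatIncl n Y) (fun _ => rfl) _)).2 (excision_eq_zero hπ τ₀)

/-- The composite through the two bijections is additive because all three pull-backs are. -/
theorem exists_connecting {n : ℕ} {Y : Set X} (hπ : IsPrincipalBundle (PUGroup H) π)
    (τ₀ : Twist H π (ContinuousMap.id X)) (he : Function.Bijective (excision H π n Y))
    (hp : Function.Bijective (hatPull H π n Y)) :
    letI := KF.addCommGroup hπ τ₀ ((incl Y).comp ContinuousMap.fst : C(Y × Cb (n + 1), X))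
      (∅ ×ˢ univ ∪ univ ×ˢ Cube.boundary (Fin (n + 1)))
    letI := KF.addCommGroup hπ τ₀ ((ContinuousMap.id X).comp ContinuousMap.fst : C(X × Cb n, X))
      (Y ×ˢ univ ∪ univ ×ˢ Cube.boundary (Fin n))
    ∃ δ : KFn H π (n + 1) (incl Y) ∅ →+ KFn H π n (ContinuousMap.id X) Y,
      ∀ x, hatPull H π n Y (δ (excision H π n Y x)) = hatForget H π n Y x := by
  let e := Equiv.ofBijective _ he
  let p := Equiv.ofBijective _ hp
  let := KF.addCommGroup hπ τ₀ ((incl Y).comp ContinuousMap.fst : C(Y × Cb (n + 1), X))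
    (∅ ×ˢ univ ∪ univ ×ˢ Cube.boundary (Fin (n + 1)))
  let := KF.addCommGroup hπ τ₀ ((ContinuousMap.id X).comp ContinuousMap.fst : C(X × Cb n, X))
    (Y ×ˢ univ ∪ univ ×ˢ Cube.boundary (Fin n))
  refine ⟨AddMonoidHom.mk' (fun y => p.symm (hatForget H π n Y (e.symm y))) fun a b => ?_,
    fun x => (p.apply_symm_apply _).trans (congrArg (hatForget H π n Y) (e.symm_apply_apply x))⟩
  obtain ⟨a, rfl⟩ := e.surjective a
  obtain ⟨b, rfl⟩ := e.surjective b
  have h1 : e a + e b = e (KF.add hπ a b) := (KF.pull_add hπ _ _ _ a b).symm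
  refine p.injective ?_
  rw [h1, e.symm_apply_apply, e.symm_apply_apply, e.symm_apply_apply, p.apply_symm_apply]
  refine (KF.pull_add hπ _ _ _ a b).trans ?_
  refine Eq.trans ?_ (KF.pull_add hπ _ _ _ _ _).symm
  exact congrArg₂ (KF.add hπ) (p.apply_symm_apply _).symm (p.apply_symm_apply _).symm

end Delta

end TwistedKF

end

/-! ### Assembly of the exact sequences. -/

theorem mainTheorem7 {X : Type u} [TopologicalSpace X] [T2Space X]
    [CWComplex (univ : Set X)] (Y : RelCWComplex.Subcomplex (univ : Set X))
    {H : Type w} [NormedAddCommGroup H] [InnerProductSpace ℂ H] [CompleteSpace H]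
    [TopologicalSpace.SeparableSpace H] [InfiniteDimensional H]
    {P : Type v} [TopologicalSpace P] [MulAction (PUGroup H)ᵐᵒᵖ P] (π : P → X)
    (hπ : IsPrincipalBundle (PUGroup H) π) :
    ∃ grp : ∀ (T : Type u) [TopologicalSpace T] (f : C(T, X)) (S : Set T),
        AddCommGroup (KF H π f S),
      (∀ (T : Type u) [TopologicalSpace T] (f : C(T, X)) (S : Set T) (x y z : KF H π f S),
        x + y = z ↔ KF.IsDirectSum x y z) ∧
      (∀ (T T' : Type u) [TopologicalSpace T] [TopologicalSpace T'] (f : C(T, X)) (f' : C(T', X))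
        (q : C(T', T)) (hq : ∀ t, f' t = f (q t)) (S : Set T) (S' : Set T')
        (hS : MapsTo q S' S) (x y : KF H π f S),
        KF.pull (H := H) (π := π) q hq hS (x + y) = KF.pull q hq hS x + KF.pull q hq hS y) ∧
      ∀ n : ℕ,
        Function.Exact (forget H π n (Y : Set X)) (restrictTo H π n (Y : Set X)) ∧
        Function.Bijective (excision H π n (Y : Set X)) ∧
        Function.Bijective (hatPull H π n (Y : Set X)) ∧
        ∃ δ : KFn H π (n + 1) (incl (Y : Set X)) ∅ →+ KFn H π n (ContinuousMap.id X) (Y : Set X),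
          (∀ x, hatPull H π n (Y : Set X) (δ (excision H π n (Y : Set X) x)) =
            hatForget H π n (Y : Set X) x) ∧
          Function.Exact δ (forget H π n (Y : Set X)) ∧
          Function.Exact (restrictTo H π (n + 1) (Y : Set X)) δ := by
  -- The pull-backs of this one twisting part provide the zero element of every group; addition
  -- itself does not depend on it.
  obtain ⟨τ₀⟩ := exists_twist hπ
  obtain ⟨r, Q, hQ, h0, hY, hm, hs⟩ := exists_bundle_retraction hπ Y
  let R : BundleRetraction H π (Y : Set X) := ⟨r, Q, hQ, h0, hY, hm, hs⟩
  refine ⟨fun T _ f S => KF.addCommGroup hπ τ₀ f S,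
    fun T _ f S x y z => KF.add_eq_iff hπ x y z,
    fun T T' _ _ f f' q hq S S' hS x y => KF.pull_add hπ q hq hS x y, fun n => ?_⟩
  have he : Function.Bijective (excision H π n (Y : Set X)) :=
    ⟨excision_injective hπ τ₀, excision_surjective hπ τ₀⟩
  have hp : Function.Bijective (hatPull H π n (Y : Set X)) :=
    ⟨hatPull_injective R, hatPull_surjective R⟩
  obtain ⟨δ, hδ⟩ := exists_connecting hπ τ₀ he hp
  refine ⟨restrictTo_eq_zero_iff hπ τ₀ R, he, hp, δ, hδ, fun y => ?_, fun y => ?_⟩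
  -- Exactness (b): since `e` is onto and `p^*` is injective, `y` is a value of `δ` exactly when
  -- `p^* y` is a value of `hatForget`.
  · refine (forget_eq_zero_iff hπ τ₀ y).trans ⟨?_, ?_⟩
    · rintro ⟨x, hx⟩
      exact ⟨_, hp.1 ((hδ x).trans hx)⟩
    · rintro ⟨z, rfl⟩
      obtain ⟨x, rfl⟩ := he.2 z
      exact ⟨x, (hδ x).symm⟩
  -- Exactness (c): with `y = e x`, `δ y = 0` means `hatForget x = 0`, because `p^*` is injective
  -- and preserves zero.
  · obtain ⟨x, rfl⟩ := he.2 y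
    refine Iff.trans ?_ (hatForget_eq_zero_iff hπ τ₀ he.1 x)
    have h : hatPull H π n (Y : Set X) (KF.zero hπ τ₀ _ _) = KF.zero hπ τ₀ _ _ :=
      KF.pull_zero hπ τ₀ _ _ _
    rw [← hδ x]
    exact ⟨fun h1 => (congrArg _ h1).trans h, fun h1 => hp.1 (h1.trans h.symm)⟩
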